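/- **Setting.** Let $k$ be a field with $\mathrm{char}\,k\neq 2$ (and $\mathrm{char}\,k\ne 2,3$ for $G_2$), $\mathcal O=k[[\varpi]]$, $F=k((\varpi))$. Let $G$ be one of $\mathrm{Sp}_{2n}$, $\mathrm{SO}_{2n+1}$ ($n\ge 0$), $\mathrm{SO}_{2n}$ ($n\ge1$), $G_2$, realised as the stabilizer in $\mathrm{SL}_d$ ($d=2n,2n+1,2n,7$) of a standard tensor $T$ on $k^d=\langle e_0,\dots,e_{d-1}\rangle$: * $\mathrm{Sp}_{2n}$: $T(e_i,e_j)=(-1)^j$ if $i+j=2n-1$, and $0$ otherwise; * $\mathrm{SO}_{2n+1}$: $T(e_i,e_j)=(-1)^j$ if $i+j=2n$, and $0$ otherwise; * $\mathrm{SO}_{2n}$: $T(e_i,e_j)=(-1)^j$ if $i+j=2n-2$, $T(e_{2n-1},e_{2n-1})=1$, and $0$ otherwise; * $G_2$: $T=-e^*_{036}+2e^*_{045}+e^*_{126}-e^*_{135}+e^*_{234}$, where $e^*_{ijl}=e_i^*\wedge e_j^*\wedge e_l^*$. Let $\mathfrak g$ be the Lie algebra of $G$ and $\chi:\mathfrak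 g\to\mathfrak c=\mathfrak g/\!/G$ the Chevalley map. In coordinates, $\mathfrak c$ has coordinates $(a_2,a_4,\dots,a_{2n})$ for $\mathrm{Sp}_{2n}$ and $\mathrm{SO}_{2n+1}$, $(a_2,\dots,a_{2n-2},p)$ for $\mathrm{SO}_{2n}$, $(e,q)$ for $G_2$, and $\chi(\gamma)=a$ means that the characteristic polynomial of $\gamma$ is $f_a$ (and moreover, for $\mathrm{SO}_{2n}$, that the Pfaffian of $S\gamma$ is $p$, $S$ being the Gram matrix of $T$), where $$f_a=x^{2n}+a_2x^{2n-2}+\dots+a_{2n},\quad x(x^{2n}+a_2x^{2n-2}+\dots+a_{2n}),\quad x^2g+p^2,\quad x\big(x^6-ex^4+\tfrac{e^2}{4}x^2+q\big)$$ respectively, with $g=x^{2n-2}+a_2x^{2n-4}+\dots+a_{2n-2}$. Let $a\in\mathfrak c(\mathcal O)\cap\mathfrak c^{rs}(F)$, where $\mathfrak c^{rs}$ is the image of the points of a Cartan subalgebra at which no root vanishes. Put $B_a=\mathcal O[x]/(f_a)$, $L_0=B_a$ and $V_a=B_a\otimes_{\mathcal O}F$, except that for $\mathrm{SO}_{2n}$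 we put $L_0=\tilde B_a=\mathcal O[x,y]/(xy-p,\;g(x)+y^2)$ and $V_a=\tilde B_a\otimes_{\mathcal O}F$ (which equals $B_a\otimes_{\mathcal O} F$ if $p\ne0$). Let $\tau$ be the involution $x\mapsto-x$, $y\mapsto -y$. The form $\omega_a$ on $V_a$ is * $\mathrm{Sp}_{2n}$, $\mathrm{SO}_{2n+1}$: $\omega_a(b_1,b_2)=\beta^*(b_1\tau(b_2))$, with $\beta^*$ the coefficient of $x^{d-1}$ in the basis $1,x,\dots,x^{d-1}$, that is, $\mathrm{tr}(b_1\tau(b_2)/f_a')$; * $\mathrm{SO}_{2n}$: $\omega_a(b_1,b_2)=\mathrm{tr}_{V_a/F}(\mathfrak D^{-1}b_1\tau(b_2))$ with $\mathfrak D=xg'(x)-2y^2$; * $G_2$: the alternating trilinear form $\omega_a=\delta_1\wedge\delta_2\wedge\eta_3+\delta_1\wedge\eta_2\wedge\delta_3+\eta_1\wedge\delta_2\wedge\delta_3-q\,\eta_1\wedge\eta_2\wedge\eta_3+\varepsilon\wedge\mathrm{tr}_z$, where $z=x(x^2-\frac e2)$, $f_0=f_a/x$, $(\varepsilon,\delta_1,\delta_2,\delta_3,\eta_1,\eta_2,\eta_3)$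 is the basis dual to $(f_0,x,x^2,x^3,xz,x^2z,x^3z)$, and $\mathrm{tr}_z(g,h)=\mathrm{tr}(g\,\tau(h)\,z/f_a')$. For $\gamma\in\mathfrak g(F)$ let $\mathcal M_\gamma(k)=\{g\in G(F)/G(\mathcal O)\mid \mathrm{ad}(g)^{-1}\gamma\in\mathfrak g(\mathcal O)\}$. By a *framing* of $\gamma$ we mean an $F$-linear isomorphism $h:F^d\to V_a$ carrying $T$ to $\omega_a$ and $\gamma$ to multiplication by $x$. For lattices $L,L'$ put $\deg(L:L')=\mathrm{length}(L/L\cap L')-\mathrm{length}(L'/L\cap L')$. **Theorem.** 1. There are $\gamma_a\in\mathfrak g(\mathcal O)$ with $\chi(\gamma_a)=a$ (the value at $a$ of the companion section) and a framing $h$ of $\gamma_a$ with $h(\mathcal O^d)=L_0$. By definition $\mathcal M_a(k)=\mathcal M_{\gamma_a}(k)$. 2. For every $\gamma\in\mathfrak g(F)$ with $\chi(\gamma)=a$ and every framing $h$ of $\gamma$, the map $g\mapsto h(g\mathcal O^d)$ is a well-defined bijection from $\mathcal M_\gamma(k)$ onto the set of $\mathcal O$-lattices $\mathcal V\subset V_a$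 which are $B_a$-submodules, on which $\omega_a$ takes values in $\mathcal O$, and which satisfy $\deg(\mathcal V:B_a)=0$ (for $\mathrm{SO}_{2n}$: $\deg(\mathcal V:\tilde B_a)=0$). In particular this describes $\mathcal M_a(k)$. 3. If $k$ is algebraically closed, every $\gamma\in\mathfrak g(F)$ with $\chi(\gamma)=a$ has a framing, so that (2) describes $\mathcal M_\gamma(k)$ for all such $\gamma$. -/

import Mathlib

open scoped TensorProduct Polynomial

noncomputable section

namespace Springer

/-- The ring of integers `𝒪 = k⟦ϖ⟧`. -/
abbrev OO (k : Type*) [Field k] := PowerSeries k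

/-- The field `F = k((ϖ))`. -/
abbrev FF (k : Type*) [Field k] := LaurentSeries k

/-! ### Groups and Lie algebras defined by a tensor

An array `T : (Fin m → ι) → ℤ` is an `m`-linear form on `R ^ ι` for every commutative ring `R`.
The groups are `G = Stab(T) ∩ SL`. -/

section Tensor

variable {m : ℕ} {ι : Type} [Fintype ι] [DecidableEq ι]

/-- The `m`-linear form on `R ^ ι` with coefficients `T`. -/
def tensorForm (T : (Fin m → ι) → ℤ) (R : Type*) [CommRing R] (v : Fin m → ι → R) : R :=
  ∑ s : Fin m → ι, (T s : R) * ∏ j, v j (s j)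

/-- `G(R)`: the elements of `SL_ι(R)` fixing the tensor `T`. -/
def tensorGroup (T : (Fin m → ι) → ℤ) (R : Type*) [CommRing R] :
    Subgroup (Matrix.GeneralLinearGroup ι R) where
  carrier := {g | (g : Matrix ι ι R).det = 1 ∧
    ∀ v : Fin m → ι → R,
      tensorForm T R (fun j => (g : Matrix ι ι R).mulVec (v j)) = tensorForm T R v}
  one_mem' := by simp
  mul_mem' := by
    rintro g h ⟨hg, hg'⟩ ⟨hh, hh'⟩
    refine ⟨by simp [Matrix.det_mul, hg, hh], fun v => ?_⟩
    have := hg' (fun j => (h : Matrix ι ι R).mulVec (v j))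
    simp only [Matrix.mulVec_mulVec] at this
    rw [Units.val_mul, this, hh' v]
  inv_mem' := by
    rintro g ⟨hg, hg'⟩
    have hgi : (g : Matrix ι ι R) * ((g⁻¹ : Matrix.GeneralLinearGroup ι R) : Matrix ι ι R) = 1 := by
      rw [← Units.val_mul, mul_inv_cancel, Units.val_one]
    refine ⟨?_, fun v => ?_⟩
    · have := congrArg Matrix.det hgi
      rwa [Matrix.det_mul, hg, one_mul, Matrix.det_one] at this
    · have := hg' (fun j => ((g⁻¹ : Matrix.GeneralLinearGroup ι R) : Matrix ι ι R).mulVec (v j))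
      simp only [Matrix.mulVec_mulVec, hgi, Matrix.one_mulVec] at this
      exact this.symm

/-- `𝔤(R)`: the traceless matrices annihilating the tensor `T`. -/
def tensorLie (T : (Fin m → ι) → ℤ) (R : Type*) [CommRing R] : Set (Matrix ι ι R) :=
  {γ | γ.trace = 0 ∧
    ∀ v : Fin m → ι → R, ∑ j, tensorForm T R (Function.update v j (γ.mulVec (v j))) = 0}

variable (k : Type*) [Field k]

/-- `G(𝒪)` as a subgroup of `GL_ι(F)`. -/
def integralGroup (T : (Fin m → ι) → ℤ) : Subgroup (Matrix.GeneralLinearGroup ι (FF k)) :=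
  (tensorGroup T (OO k)).map (Matrix.GeneralLinearGroup.map (algebraMap (OO k) (FF k)))

/-- `𝔤(𝒪)` as a subset of the matrices over `F`. -/
def integralLie (T : (Fin m → ι) → ℤ) : Set (Matrix ι ι (FF k)) :=
  (fun γ : Matrix ι ι (OO k) => γ.map (algebraMap (OO k) (FF k))) '' tensorLie T (OO k)

/-- The quotient `G(F) / G(𝒪)`. -/
abbrev Grassmannian (T : (Fin m → ι) → ℤ) :=
  tensorGroup T (FF k) ⧸ (integralGroup k T).subgroupOf (tensorGroup T (FF k))

variable {k}

/-- The `k`-points of the affine Springer fiber of `γ`: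
`{g ∈ G(F) / G(𝒪) | ad(g)⁻¹ γ ∈ 𝔤(𝒪)}`. -/
def affineSpringerFiber (T : (Fin m → ι) → ℤ) (γ : Matrix ι ι (FF k)) :
    Set (Grassmannian k T) :=
  {y | ∃ g : tensorGroup T (FF k), (QuotientGroup.mk g : Grassmannian k T) = y ∧
    ((g⁻¹ : Matrix.GeneralLinearGroup ι (FF k)) : Matrix ι ι (FF k)) * γ *
      ((g : Matrix.GeneralLinearGroup ι (FF k)) : Matrix ι ι (FF k)) ∈ integralLie k T}

end Tensor

/-! ### Lattices -/

section Lattices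

variable {k : Type*} [Field k] {V : Type*} [CommRing V] [Algebra (FF k) V] [Algebra (OO k) V]
  [IsScalarTower (OO k) (FF k) V]

/-- The relative degree `deg(L : M) = length(L / L ∩ M) - length(M / L ∩ M)`. -/
def relDegree (L M : Submodule (OO k) V) : ℤ :=
  ((Module.length (OO k) (L ⧸ M.submoduleOf L)).toNat : ℤ) -
    ((Module.length (OO k) (M ⧸ L.submoduleOf M)).toNat : ℤ)

/-- The lattices of the theorem: `act : B → V` gives the `B`-module structure on `V`, `L₀` is the
lattice that the degree is taken with respect to, `Ω` is the form on `V`. -/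
structure IsSpringerLattice {m : ℕ} {B : Type*} [CommRing B] [Algebra (OO k) B]
    (act : B →ₐ[OO k] V) (L₀ : Submodule (OO k) V) (Ω : (Fin m → V) → FF k)
    (L : Submodule (OO k) V) : Prop where
  isLattice : Submodule.IsLattice (FF k) L
  module : ∀ b : B, ∀ v ∈ L, act b * v ∈ L
  integral : ∀ v : Fin m → V, (∀ j, v j ∈ L) → Ω v ∈ Set.range (algebraMap (OO k) (FF k))
  degree : relDegree L L₀ = 0

variable {m : ℕ} {ι : Type} [Fintype ι] [DecidableEq ι]

/-- An `F`-basis of `V` which identifies `(F ^ ι, T, γ)` with `(V, Ω, multiplication by x)`. -/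
def IsFraming (T : (Fin m → ι) → ℤ) (x : V) (Ω : (Fin m → V) → FF k)
    (γ : Matrix ι ι (FF k)) (b : Module.Basis ι (FF k) V) : Prop :=
  (∀ s : Fin m → ι, Ω (fun j => b (s j)) = (T s : FF k)) ∧
    LinearMap.toMatrix b b (LinearMap.mulLeft (FF k) x) = γ

/-- The lattice `h (g 𝒪 ^ ι)`, where `h : F ^ ι ≃ V` is given by the basis `b`. -/
def frameLattice (b : Module.Basis ι (FF k) V) (g : Matrix ι ι (FF k)) : Submodule (OO k) V :=
  Submodule.span (OO k) (Set.range fun j => ∑ i, g i j • b i)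

/-- The lattice description of the affine Springer fiber over `a`. Here `χ γ` says that `γ` lies
over `a`, and `x` is the canonical generator.

* The triple `(L₀, Ω, x)` is isomorphic over `𝒪` to `(𝒪 ^ ι, T, γ)` for some `γ ∈ 𝔤(𝒪)` over `a`
  (a value of the companion section at `a`).
* For each `γ ∈ 𝔤(F)` over `a` and each isomorphism `h` over `F` of `(F ^ ι, T, γ)` with
  `(V, Ω, x)`, the map `g ↦ h (g 𝒪 ^ ι)` is a bijection from the `k`-points of the affine Springer
  fiber of `γ` to the set of lattices.
* If `k` is algebraically closed, every `γ ∈ 𝔤(F)` over `a` admits such an `h`. -/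
def LatticeDescription (T : (Fin m → ι) → ℤ) (χ : Matrix ι ι (FF k) → Prop)
    {B : Type*} [CommRing B] [Algebra (OO k) B] (act : B →ₐ[OO k] V) (x : B)
    (L₀ : Submodule (OO k) V) (Ω : (Fin m → V) → FF k) : Prop :=
  (∃ γ ∈ integralLie k T, χ γ ∧ ∃ b : Module.Basis ι (FF k) V,
    IsFraming T (act x) Ω γ b ∧ Submodule.span (OO k) (Set.range b) = L₀) ∧
  (∀ γ ∈ tensorLie T (FF k), χ γ → ∀ b : Module.Basis ι (FF k) V,
    IsFraming T (act x) Ω γ b →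
      ∃ Φ : affineSpringerFiber T γ ≃ {L : Submodule (OO k) V // IsSpringerLattice act L₀ Ω L},
        ∀ (g : tensorGroup T (FF k))
          (hg : (QuotientGroup.mk g : Grassmannian k T) ∈ affineSpringerFiber T γ),
          (Φ ⟨QuotientGroup.mk g, hg⟩ : Submodule (OO k) V) =
            frameLattice b ((g : Matrix.GeneralLinearGroup ι (FF k)) : Matrix ι ι (FF k))) ∧
  (IsAlgClosed k → ∀ γ ∈ tensorLie T (FF k), χ γ →
    ∃ b : Module.Basis ι (FF k) V, IsFraming T (act x) Ω γ b)

end Lattices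

/-! ### Spectral covers over an arbitrary base ring -/

section Spectral

variable {R : Type*} [CommRing R]

/-- `x ^ (2n) + a₂ x ^ (2n-2) + ⋯ + a₂ₙ`, where `a i` is the coefficient `a₂₍ᵢ₊₁₎`. -/
def evenPoly {n : ℕ} (a : Fin n → R) : R[X] :=
  Polynomial.X ^ (2 * n) +
    ∑ i : Fin n, Polynomial.C (a i) * Polynomial.X ^ (2 * (n - 1 - (i : ℕ)))

theorem evenPoly_monic {n : ℕ} (a : Fin n → R) : (evenPoly a).Monic := by
  refine Polynomial.monic_X_pow_add ?_
  refine (Polynomial.degree_sum_le _ _).trans_lt ?_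
  rw [Finset.sup_lt_iff (WithBot.bot_lt_coe _)]
  intro i _
  refine (Polynomial.degree_C_mul_X_pow_le _ _).trans_lt ?_
  have := i.2
  exact_mod_cast (by omega : 2 * (n - 1 - (i : ℕ)) < 2 * n)

theorem evenPoly_degree [Nontrivial R] {n : ℕ} (a : Fin n → R) :
    (evenPoly a).degree = ((2 * n : ℕ) : WithBot ℕ) := by
  rw [evenPoly, Polynomial.degree_add_eq_left_of_degree_lt, Polynomial.degree_X_pow]
  rw [Polynomial.degree_X_pow]
  refine (Polynomial.degree_sum_le _ _).trans_lt ?_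
  rw [Finset.sup_lt_iff (WithBot.bot_lt_coe _)]
  intro i _
  refine (Polynomial.degree_C_mul_X_pow_le _ _).trans_lt ?_
  have := i.2
  exact_mod_cast (by omega : 2 * (n - 1 - (i : ℕ)) < 2 * n)

theorem aeval_neg_evenPoly {n : ℕ} (a : Fin n → R) {S : Type*} [CommRing S] [Algebra R S] (r : S) :
    Polynomial.aeval (-r) (evenPoly a) = Polynomial.aeval r (evenPoly a) := by
  simp [evenPoly, Even.neg_pow]

/-- The coefficient of `x ^ i` on `R[x] / (f)`. -/
def coeffFun {f : R[X]} (hf : f.Monic) (i : ℕ) : AdjoinRoot f →ₗ[R] R :=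
  Polynomial.lcoeff R i ∘ₗ AdjoinRoot.modByMonicHom hf

/-- The involution `x ↦ -x` of `R[x] / (f)`. -/
def involution {f : R[X]} (hf : Polynomial.aeval (-AdjoinRoot.root f) f = 0) :
    AdjoinRoot f →ₐ[R] AdjoinRoot f :=
  AdjoinRoot.liftAlgHom f (Algebra.ofId R (AdjoinRoot f)) (-AdjoinRoot.root f) hf

/-! The symplectic case. -/

/-- The spectral algebra `B = R[x] / (x ^ (2n) + a₂ x ^ (2n-2) + ⋯ + a₂ₙ)`. -/
abbrev SpAlg {n : ℕ} (a : Fin n → R) := AdjoinRoot (evenPoly a)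

/-- The involution of `B` with `x ↦ -x`. -/
def spInvolution {n : ℕ} (a : Fin n → R) : SpAlg a →ₐ[R] SpAlg a :=
  involution (by rw [aeval_neg_evenPoly]; simp)

/-! The odd orthogonal case. -/

/-- `x f₀` with `f₀ = x ^ (2n) + a₂ x ^ (2n-2) + ⋯ + a₂ₙ`. -/
def oddPoly {n : ℕ} (a : Fin n → R) : R[X] := Polynomial.X * evenPoly a

theorem oddPoly_monic {n : ℕ} (a : Fin n → R) : (oddPoly a).Monic :=
  Polynomial.monic_X.mul (evenPoly_monic a)

/-- The spectral algebra `B = R[x] / (x f₀)`. -/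
abbrev SOOddAlg {n : ℕ} (a : Fin n → R) := AdjoinRoot (oddPoly a)

/-- The involution of `B` with `x ↦ -x`. -/
def soOddInvolution {n : ℕ} (a : Fin n → R) : SOOddAlg a →ₐ[R] SOOddAlg a :=
  involution (by
    have h : Polynomial.aeval (AdjoinRoot.root (oddPoly a)) (oddPoly a) = 0 := by simp
    rw [oddPoly, map_mul, Polynomial.aeval_X] at h ⊢
    rw [aeval_neg_evenPoly, neg_mul, neg_eq_zero]
    exact h)

/-! The even orthogonal case, for `SO` of rank `n = m + 1`; the coordinates are
`a₂, …, a₂ₘ` and the Pfaffian `p`. -/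

/-- `f = x² g + p²`, where `g = x ^ (2m) + a₂ x ^ (2m-2) + ⋯ + a₂ₘ`. -/
def soEvenPoly {m : ℕ} (a : Fin m → R) (p : R) : R[X] :=
  Polynomial.X ^ 2 * evenPoly a + Polynomial.C (p ^ 2)

/-- The spectral algebra `B = R[x] / (f)`. -/
abbrev SOEvenAlg {m : ℕ} (a : Fin m → R) (p : R) := AdjoinRoot (soEvenPoly a p)

/-- The ideal `(x y - p, g(x) + y²)` of `R[x, y]`. -/
def soEvenIdeal {m : ℕ} (a : Fin m → R) (p : R) : Ideal (MvPolynomial (Fin 2) R) :=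
  Ideal.span {MvPolynomial.X 0 * MvPolynomial.X 1 - MvPolynomial.C p,
    Polynomial.aeval (MvPolynomial.X 0) (evenPoly a) + MvPolynomial.X 1 ^ 2}

/-- The normalized spectral algebra `B̃ = R[x, y] / (x y - p, g(x) + y²)`. -/
abbrev SOEvenNormAlg {m : ℕ} (a : Fin m → R) (p : R) :=
  MvPolynomial (Fin 2) R ⧸ soEvenIdeal a p

/-- The element `x` of `B̃`. -/
def soEvenX {m : ℕ} (a : Fin m → R) (p : R) : SOEvenNormAlg a p :=
  Ideal.Quotient.mk _ (MvPolynomial.X 0)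

/-- The element `y` of `B̃` (called `p_{n-1}` in the classical notation). -/
def soEvenY {m : ℕ} (a : Fin m → R) (p : R) : SOEvenNormAlg a p :=
  Ideal.Quotient.mk _ (MvPolynomial.X 1)

theorem soEvenX_mul_soEvenY {m : ℕ} (a : Fin m → R) (p : R) :
    soEvenX a p * soEvenY a p = algebraMap R _ p := by
  have h : (Ideal.Quotient.mk (soEvenIdeal a p))
      (MvPolynomial.X 0 * MvPolynomial.X 1 - MvPolynomial.C p) = 0 :=
    Ideal.Quotient.eq_zero_iff_mem.2 (Ideal.subset_span (by simp))
  rw [map_sub, map_mul, sub_eq_zero] at h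
  exact h

theorem aeval_soEvenX_add {m : ℕ} (a : Fin m → R) (p : R) :
    Polynomial.aeval (soEvenX a p) (evenPoly a) + soEvenY a p ^ 2 = 0 := by
  have h : (Ideal.Quotient.mkₐ R (soEvenIdeal a p))
      (Polynomial.aeval (MvPolynomial.X 0) (evenPoly a) + MvPolynomial.X 1 ^ 2) = 0 :=
    Ideal.Quotient.eq_zero_iff_mem.2 (Ideal.subset_span (by simp))
  rw [map_add, map_pow, ← Polynomial.aeval_algHom_apply] at h
  exact h

/-- The canonical homomorphism `B → B̃`, `x ↦ x`. -/
def soEvenToNorm {m : ℕ} (a : Fin m → R) (p : R) : SOEvenAlg a p →ₐ[R] SOEvenNormAlg a p :=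
  AdjoinRoot.liftAlgHom _ (Algebra.ofId R _) (soEvenX a p) (by
    change Polynomial.aeval (soEvenX a p) (soEvenPoly a p) = 0
    rw [soEvenPoly, map_add, map_mul, map_pow, Polynomial.aeval_X, Polynomial.aeval_C, map_pow,
      ← soEvenX_mul_soEvenY, eq_neg_of_add_eq_zero_left (aeval_soEvenX_add a p)]
    ring)

theorem soEvenIdeal_le_ker {m : ℕ} (a : Fin m → R) (p : R) {S : Type*} [CommRing S] [Algebra R S]
    (x y : S) (h₁ : x * y = algebraMap R S p)
    (h₂ : Polynomial.aeval x (evenPoly a) + y ^ 2 = 0) (z : MvPolynomial (Fin 2) R)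
    (hz : z ∈ soEvenIdeal a p) : MvPolynomial.aeval ![-x, -y] z = 0 := by
  rw [← RingHom.mem_ker]
  revert z
  change Ideal.span _ ≤ RingHom.ker _
  rw [Ideal.span_le]
  rintro z (rfl | rfl)
  · simp [RingHom.mem_ker, h₁]
  · simp [RingHom.mem_ker, ← Polynomial.aeval_algHom_apply, aeval_neg_evenPoly, h₂]

/-- The involution of `B̃` with `x ↦ -x` and `y ↦ -y`. -/
def soEvenInvolution {m : ℕ} (a : Fin m → R) (p : R) :
    SOEvenNormAlg a p →ₐ[R] SOEvenNormAlg a p :=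
  Ideal.Quotient.liftₐ (soEvenIdeal a p)
    (MvPolynomial.aeval ![-soEvenX a p, -soEvenY a p])
    (soEvenIdeal_le_ker a p _ _ (soEvenX_mul_soEvenY a p) (aeval_soEvenX_add a p))

/-- The generator `𝔇 = x g'(x) - 2 y²` of the different of `B̃` over `R`, that is, the determinant of
`(-y, g'; -x, 2y)`. -/
def soEvenDifferent {m : ℕ} (a : Fin m → R) (p : R) : SOEvenNormAlg a p :=
  Matrix.det !![-soEvenY a p, Polynomial.aeval (soEvenX a p) (Polynomial.derivative (evenPoly a));
    -soEvenX a p, 2 * soEvenY a p]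

end Spectral

/-! ### Forms on `V = B ⊗ F` -/

section Forms

variable {k : Type*} [Field k]

/-- The `F`-linear extension of a linear form on `B`. -/
def extendScalars {B : Type*} [CommRing B] [Algebra (OO k) B] (φ : B →ₗ[OO k] OO k) :
    FF k ⊗[OO k] B →ₗ[FF k] FF k :=
  (TensorProduct.AlgebraTensorModule.rid (OO k) (FF k) (FF k)).toLinearMap ∘ₗ φ.baseChange (FF k)

/-- The `F`-linear extension of an involution of `B`. -/
def extendInvolution {B : Type*} [CommRing B] [Algebra (OO k) B] (τ : B →ₐ[OO k] B) :
    FF k ⊗[OO k] B →ₐ[FF k] FF k ⊗[OO k] B :=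
  Algebra.TensorProduct.map (AlgHom.id (FF k) (FF k)) τ

/-- The canonical homomorphism `B → B ⊗ F`. -/
def toGeneric (B : Type*) [CommRing B] [Algebra (OO k) B] : B →ₐ[OO k] FF k ⊗[OO k] B :=
  Algebra.TensorProduct.includeRight

/-- `B` as a lattice in `B ⊗ F`. -/
def baseLattice (B : Type*) [CommRing B] [Algebra (OO k) B] :
    Submodule (OO k) (FF k ⊗[OO k] B) :=
  LinearMap.range (toGeneric B).toLinearMap

/-- `ω(b₁, b₂) = β*(b₁ τ(b₂))`, where `β*` is the coefficient of `x ^ (2n-1)`. -/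
def spForm {n : ℕ} (a : Fin n → OO k) (v : Fin 2 → FF k ⊗[OO k] SpAlg a) : FF k :=
  extendScalars (coeffFun (evenPoly_monic a) (2 * n - 1))
    (v 0 * extendInvolution (spInvolution a) (v 1))

/-- `ω(b₁, b₂) = β*(b₁ τ(b₂))`, where `β*` is the coefficient of `x ^ (2n)`. -/
def soOddForm {n : ℕ} (a : Fin n → OO k) (v : Fin 2 → FF k ⊗[OO k] SOOddAlg a) : FF k :=
  extendScalars (coeffFun (oddPoly_monic a) (2 * n))
    (v 0 * extendInvolution (soOddInvolution a) (v 1))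

/-- `ω(b₁, b₂) = tr(𝔇⁻¹ b₁ τ(b₂))`. -/
def soEvenForm {m : ℕ} (a : Fin m → OO k) (p : OO k)
    (v : Fin 2 → FF k ⊗[OO k] SOEvenNormAlg a p) : FF k :=
  Algebra.trace (FF k) (FF k ⊗[OO k] SOEvenNormAlg a p)
    (Ring.inverse (toGeneric _ (soEvenDifferent a p)) * v 0 *
      extendInvolution (soEvenInvolution a p) (v 1))

/-! The group `G₂`. -/

/-- The map `(e, q) ↦ (-e, e² / 4, q)` from the base for `G₂` to the base for `SO₇`. -/
def g2Coeffs (e q : OO k) : Fin 3 → OO k := ![-e, (4⁻¹ : k) • e ^ 2, q]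

/-- The spectral algebra `B = 𝒪[x] / (x f₀)`, `f₀ = x⁶ - e x⁴ + (e² / 4) x² + q`. -/
abbrev G2Alg (e q : OO k) := SOOddAlg (g2Coeffs e q)

/-- `V = B ⊗ F`. -/
abbrev G2Space (e q : OO k) := FF k ⊗[OO k] G2Alg e q

section G2

variable (e q : OO k)

/-- The image of `x` in `V`. -/
def g2X : G2Space e q := toGeneric _ (AdjoinRoot.root (oddPoly (g2Coeffs e q)))

/-- `e` and `q` as elements of `F`. -/
def g2E : FF k := algebraMap (OO k) (FF k) e

/-- See `g2E`. -/
def g2Q : FF k := algebraMap (OO k) (FF k) q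

/-- `z = x (x² - e / 2)`. -/
def g2Z : G2Space e q := g2X e q ^ 3 - (g2E e / 2) • g2X e q

/-- `f₀(x)` as an element of `V`. -/
def g2F0 : G2Space e q :=
  g2X e q ^ 6 - g2E e • g2X e q ^ 4 + (g2E e ^ 2 / 4) • g2X e q ^ 2 + g2Q q • 1

/-- The coefficient of `x ^ i` on `V`. -/
def g2Coord (i : ℕ) : G2Space e q →ₗ[FF k] FF k :=
  extendScalars (coeffFun (oddPoly_monic (g2Coeffs e q)) i)

/-! The basis dual to `f₀, x, x², x³, x z, x² z, x³ z` (see `g2Dual_apply`). -/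

def g2Eps : G2Space e q →ₗ[FF k] FF k := (g2Q q)⁻¹ • g2Coord e q 0
def g2Eta3 : G2Space e q →ₗ[FF k] FF k := g2Coord e q 6 - g2Eps e q
def g2Eta2 : G2Space e q →ₗ[FF k] FF k := g2Coord e q 5
def g2Eta1 : G2Space e q →ₗ[FF k] FF k :=
  g2Coord e q 4 + g2E e • g2Eps e q + (g2E e / 2) • g2Eta3 e q
def g2Delta3 : G2Space e q →ₗ[FF k] FF k := g2Coord e q 3 + (g2E e / 2) • g2Eta2 e q
def g2Delta2 : G2Space e q →ₗ[FF k] FF k :=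
  g2Coord e q 2 - (g2E e ^ 2 / 4) • g2Eps e q + (g2E e / 2) • g2Eta1 e q
def g2Delta1 : G2Space e q →ₗ[FF k] FF k := g2Coord e q 1

/-- The seven linear forms. -/
def g2Dual : Fin 7 → G2Space e q →ₗ[FF k] FF k :=
  ![g2Eps e q, g2Delta1 e q, g2Delta2 e q, g2Delta3 e q, g2Eta1 e q, g2Eta2 e q, g2Eta3 e q]

/-- The seven vectors. -/
def g2Vec : Fin 7 → G2Space e q :=
  ![g2F0 e q, g2X e q, g2X e q ^ 2, g2X e q ^ 3,
    g2X e q * g2Z e q, g2X e q ^ 2 * g2Z e q, g2X e q ^ 3 * g2Z e q]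

theorem g2Coord_pow (i j : ℕ) (hj : j < 7) :
    g2Coord e q i (g2X e q ^ j) = if i = j then 1 else 0 := by
  have hdeg : (Polynomial.X ^ j : (OO k)[X]).degree < (oddPoly (g2Coeffs e q)).degree := by
    rw [Polynomial.degree_X_pow, oddPoly, Polynomial.Monic.degree_mul (evenPoly_monic _),
      Polynomial.degree_X, evenPoly_degree]
    have : j < 1 + 2 * 3 := by omega
    exact_mod_cast this
  have hx : g2X e q ^ j = (1 : FF k) ⊗ₜ[OO k]
      (AdjoinRoot.mk (oddPoly (g2Coeffs e q)) (Polynomial.X ^ j)) := by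
    rw [g2X, ← map_pow, map_pow (AdjoinRoot.mk _), AdjoinRoot.mk_X]
    rfl
  rw [hx, g2Coord, extendScalars, LinearMap.comp_apply, LinearMap.baseChange_tmul, coeffFun,
    LinearMap.comp_apply, AdjoinRoot.modByMonicHom_mk,
    (Polynomial.modByMonic_eq_self_iff (oddPoly_monic _)).2 hdeg]
  simp [Polynomial.coeff_X_pow, Algebra.smul_def]

/-- The coordinates of the seven vectors in the basis `1, x, …, x⁶`. -/
def g2Rows : Fin 7 → Fin 7 → FF k :=
  ![![g2Q q, 0, g2E e ^ 2 / 4, 0, -g2E e, 0, 1],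
    ![0, 1, 0, 0, 0, 0, 0], ![0, 0, 1, 0, 0, 0, 0], ![0, 0, 0, 1, 0, 0, 0],
    ![0, 0, -(g2E e / 2), 0, 1, 0, 0], ![0, 0, 0, -(g2E e / 2), 0, 1, 0],
    ![0, 0, 0, 0, -(g2E e / 2), 0, 1]]

theorem g2Rows_spec {A : Type*} [CommRing A] [Algebra (FF k) A] (x : A) (j : Fin 7) :
    (![x ^ 6 - g2E e • x ^ 4 + (g2E e ^ 2 / 4) • x ^ 2 + g2Q q • 1, x, x ^ 2, x ^ 3,
      x * (x ^ 3 - (g2E e / 2) • x), x ^ 2 * (x ^ 3 - (g2E e / 2) • x),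
      x ^ 3 * (x ^ 3 - (g2E e / 2) • x)] : Fin 7 → A) j =
      ∑ l : Fin 7, g2Rows e q j l • x ^ (l : ℕ) := by
  simp only [Fin.sum_univ_seven, g2Rows, Algebra.smul_def]
  fin_cases j <;> simp <;> ring

theorem g2Vec_eq (j : Fin 7) :
    g2Vec e q j = ∑ l : Fin 7, g2Rows e q j l • g2X e q ^ (l : ℕ) :=
  g2Rows_spec e q (g2X e q) j

theorem g2Coord_vec (i j : Fin 7) : g2Coord e q i (g2Vec e q j) = g2Rows e q j i := by
  rw [g2Vec_eq, map_sum, Finset.sum_eq_single i]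
  · rw [map_smul, g2Coord_pow e q i i i.2, if_pos rfl, smul_eq_mul, mul_one]
  · intro l _ hl
    rw [map_smul, g2Coord_pow e q i l l.2, if_neg fun h => hl (Fin.ext h.symm), smul_zero]
  · simp

theorem g2Dual_apply (hq : q ≠ 0) (i j : Fin 7) :
    g2Dual e q i (g2Vec e q j) = if i = j then 1 else 0 := by
  have hq' : g2Q q ≠ 0 := by
    rw [g2Q, Ne, FaithfulSMul.algebraMap_eq_zero_iff]
    exact hq
  have h0 := g2Coord_vec e q 0 j
  have h1 := g2Coord_vec e q 1 j
  have h2 := g2Coord_vec e q 2 j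
  have h3 := g2Coord_vec e q 3 j
  have h4 := g2Coord_vec e q 4 j
  have h5 := g2Coord_vec e q 5 j
  have h6 := g2Coord_vec e q 6 j
  simp only [Fin.isValue, Fin.coe_ofNat_eq_mod, Nat.reduceMod, Nat.zero_mod] at h0 h1 h2 h3 h4 h5 h6
  generalize g2Vec e q j = w at *
  fin_cases i <;>
    simp only [g2Dual, g2Eps, g2Delta1, g2Delta2, g2Delta3, g2Eta1, g2Eta2, g2Eta3,
      LinearMap.add_apply, LinearMap.sub_apply, LinearMap.smul_apply, smul_eq_mul,
      Fin.mk_one, Fin.zero_eta, Fin.reduceFinMk, Matrix.cons_val, h0, h1, h2, h3, h4, h5, h6] <;>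
    fin_cases j <;> simp [g2Rows, hq']

/-- `α ∧ β ∧ γ`. -/
def wedge3 {V : Type*} [AddCommGroup V] [Module (FF k) V] (α β γ : V →ₗ[FF k] FF k)
    (v : Fin 3 → V) : FF k :=
  Matrix.det (Matrix.of fun i j : Fin 3 => ![α, β, γ] i (v j))

/-- `tr_z(g, h) = tr(g(x) h(-x) z / f'(x)) = β*(g τ(h) z)`. -/
def g2TrZ (g h : G2Space e q) : FF k :=
  g2Coord e q 6 (g * extendInvolution (soOddInvolution (g2Coeffs e q)) h * g2Z e q)

/-- The alternating form `ρ = δ₁∧δ₂∧η₃ + δ₁∧η₂∧δ₃ + η₁∧δ₂∧δ₃ - q η₁∧η₂∧η₃ + ε∧tr_z`. -/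
def g2Form (v : Fin 3 → G2Space e q) : FF k :=
  wedge3 (g2Delta1 e q) (g2Delta2 e q) (g2Eta3 e q) v
    + wedge3 (g2Delta1 e q) (g2Eta2 e q) (g2Delta3 e q) v
    + wedge3 (g2Eta1 e q) (g2Delta2 e q) (g2Delta3 e q) v
    - g2Q q * wedge3 (g2Eta1 e q) (g2Eta2 e q) (g2Eta3 e q) v
    + (g2Eps e q (v 0) * g2TrZ e q (v 1) (v 2) - g2Eps e q (v 1) * g2TrZ e q (v 0) (v 2)
      + g2Eps e q (v 2) * g2TrZ e q (v 0) (v 1))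

end G2

end Forms

/-! ### The standard tensors

Each is the canonical form of the nilpotent fiber `a = 0` in the basis of monomials. -/

/-- The symplectic form on `R ^ (2n)` with `⟨e_i, e_j⟩ = (-1) ^ j` if `i + j = 2n - 1`. -/
def spTensor (n : ℕ) (s : Fin 2 → Fin (2 * n)) : ℤ :=
  if (s 0 : ℕ) + s 1 + 1 = 2 * n then (-1) ^ (s 1 : ℕ) else 0

/-- The symmetric form on `R ^ (2n+1)` with `⟨e_i, e_j⟩ = (-1) ^ j` if `i + j = 2n`. -/
def soOddTensor (n : ℕ) (s : Fin 2 → Fin (2 * n + 1)) : ℤ :=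
  if (s 0 : ℕ) + s 1 = 2 * n then (-1) ^ (s 1 : ℕ) else 0

/-- The symmetric form on `R ^ (2m+2)` which is the form of `soOddTensor m` on
`e_0, …, e_{2m}`, plus a vector `e_{2m+1}` orthogonal to them with `⟨e_{2m+1}, e_{2m+1}⟩ = 1`. -/
def soEvenTensor (m : ℕ) (s : Fin 2 → Fin (2 * (m + 1))) : ℤ :=
  if (s 0 : ℕ) + s 1 = 2 * m then (-1) ^ (s 1 : ℕ)
  else if (s 0 : ℕ) = 2 * m + 1 ∧ (s 1 : ℕ) = 2 * m + 1 then 1 else 0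

/-- The coefficients of `e_{t 0}^* ∧ e_{t 1}^* ∧ e_{t 2}^*`. -/
def wedgeTensor (t s : Fin 3 → Fin 7) : ℤ :=
  Matrix.det (Matrix.of fun a b : Fin 3 => if s a = t b then (1 : ℤ) else 0)

/-- The alternating form `-e₀₃₆ + 2 e₀₄₅ + e₁₂₆ - e₁₃₅ + e₂₃₄` on `R ^ 7`. -/
def g2Tensor (s : Fin 3 → Fin 7) : ℤ :=
  -wedgeTensor ![0, 3, 6] s + 2 * wedgeTensor ![0, 4, 5] s + wedgeTensor ![1, 2, 6] s
    - wedgeTensor ![1, 3, 5] s + wedgeTensor ![2, 3, 4] s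

/-! ### The map `𝔤 → 𝔤 // G` -/

/-- The Pfaffian of an alternating matrix, by expansion along the first row. -/
def pfaffian {R : Type*} [CommRing R] :
    (n : ℕ) → Matrix (Fin (2 * n)) (Fin (2 * n)) R → R
  | 0, _ => 1
  | n + 1, M => ∑ j : Fin (2 * n + 1), (-1) ^ (j : ℕ) * M 0 j.succ *
      pfaffian n (M.submatrix (fun i => (j.succAbove i).succ) (fun i => (j.succAbove i).succ))

/-- The Gram matrix of `soEvenTensor m`. -/
def soEvenGram (m : ℕ) (R : Type*) [CommRing R] :
    Matrix (Fin (2 * (m + 1))) (Fin (2 * (m + 1))) R :=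
  Matrix.of fun i j => (soEvenTensor m ![i, j] : R)

section Chevalley

variable {k : Type*} [Field k]

/-- `χ(γ) = a` for `Sp`. -/
def spChi {n : ℕ} (a : Fin n → OO k) (γ : Matrix (Fin (2 * n)) (Fin (2 * n)) (FF k)) : Prop :=
  γ.charpoly = (evenPoly a).map (algebraMap (OO k) (FF k))

/-- `χ(γ) = a` for odd `SO`. -/
def soOddChi {n : ℕ} (a : Fin n → OO k)
    (γ : Matrix (Fin (2 * n + 1)) (Fin (2 * n + 1)) (FF k)) : Prop :=
  γ.charpoly = (oddPoly a).map (algebraMap (OO k) (FF k))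

/-- `χ(γ) = (a, p)` for even `SO`: characteristic polynomial and Pfaffian. -/
def soEvenChi {m : ℕ} (a : Fin m → OO k) (p : OO k)
    (γ : Matrix (Fin (2 * (m + 1))) (Fin (2 * (m + 1))) (FF k)) : Prop :=
  γ.charpoly = (soEvenPoly a p).map (algebraMap (OO k) (FF k)) ∧
    pfaffian (m + 1) (soEvenGram m (FF k) * γ) = algebraMap (OO k) (FF k) p

/-- `χ(γ) = (e, q)` for `G₂`. -/
def g2Chi (e q : OO k) (γ : Matrix (Fin 7) (Fin 7) (FF k)) : Prop :=
  γ.charpoly = (oddPoly (g2Coeffs e q)).map (algebraMap (OO k) (FF k))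

/-! The regular semisimple locus: over an algebraic closure of `F`, the point is the image of a point
`t` of the Cartan subalgebra (with eigenvalues `±t i`, and `0` if the dimension is odd) at which no
root vanishes. -/

/-- The ring homomorphism from `𝒪` to an algebraic closure of `F`. -/
def toClosure (k : Type*) [Field k] : OO k →+* AlgebraicClosure (FF k) :=
  (algebraMap (FF k) (AlgebraicClosure (FF k))).comp (algebraMap (OO k) (FF k))

/-- `∏ (x² - t_i²)`. -/
def torusPoly {n : ℕ} (t : Fin n → AlgebraicClosure (FF k)) : (AlgebraicClosure (FF k))[X] :=
  ∏ i, (Polynomial.X ^ 2 - Polynomial.C (t i ^ 2))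

/-- The roots are `±t_i ± t_j` for `i ≠ j`, and `±2 t_i`. -/
def spRegular {n : ℕ} (a : Fin n → OO k) : Prop :=
  ∃ t : Fin n → AlgebraicClosure (FF k), (evenPoly a).map (toClosure k) = torusPoly t ∧
    (∀ i j, i ≠ j → t i - t j ≠ 0 ∧ t i + t j ≠ 0) ∧ ∀ i, 2 * t i ≠ 0

/-- The roots are `±t_i ± t_j` for `i ≠ j`, and `±t_i`. -/
def soOddRegular {n : ℕ} (a : Fin n → OO k) : Prop :=
  ∃ t : Fin n → AlgebraicClosure (FF k),
    (oddPoly a).map (toClosure k) = Polynomial.X * torusPoly t ∧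
    (∀ i j, i ≠ j → t i - t j ≠ 0 ∧ t i + t j ≠ 0) ∧ ∀ i, t i ≠ 0

/-- The roots are `±t_i ± t_j` for `i ≠ j`. -/
def soEvenRegular {m : ℕ} (a : Fin m → OO k) (p : OO k) : Prop :=
  ∃ t : Fin (m + 1) → AlgebraicClosure (FF k),
    (soEvenPoly a p).map (toClosure k) = torusPoly t ∧
    ∀ i j, i ≠ j → t i - t j ≠ 0 ∧ t i + t j ≠ 0

/-- The Cartan subalgebra is `t₀ + t₁ + t₂ = 0`, the roots are `±t_i` and `t_i - t_j` for
`i ≠ j`. -/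
def g2Regular (e q : OO k) : Prop :=
  ∃ t : Fin 3 → AlgebraicClosure (FF k), t 0 + t 1 + t 2 = 0 ∧
    (oddPoly (g2Coeffs e q)).map (toClosure k) = Polynomial.X * torusPoly t ∧
    (∀ i j, i ≠ j → t i - t j ≠ 0) ∧ ∀ i, t i ≠ 0

end Chevalley

end Springer

end

open scoped TensorProduct Polynomial

set_option linter.unusedSectionVars false

noncomputable section

namespace Springer

/-! ### Lengths of quotients of lattices -/

section Length

open Module

variable {R : Type*} [CommRing R] [IsDomain R] {ι : Type*} [Fintype ι] [DecidableEq ι]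

theorem length_quotient_eq_ord_det [IsPrincipalIdealRing R] {M : Type*} [AddCommGroup M]
    [Module R M] (b : Basis ι R M) (N : Submodule R M) (n : Basis ι R N) :
    Module.length R (M ⧸ N) = Ring.ord R (b.det fun i => (n i : M)) := by
  have h : finrank R N = finrank R M := by
    rw [finrank_eq_card_basis b, finrank_eq_card_basis n]
  rw [(N.quotientEquivPiSpan b h).length_eq, Module.length_pi_of_fintype]
  set a := Submodule.smithNormalFormCoeffs b h
  set b' := Submodule.smithNormalFormTopBasis b h
  set n' := Submodule.smithNormalFormBotBasis b h
  have hn' : ∀ i, (n' i : M) = a i • b' i := Submodule.smithNormalFormBotBasis_def b h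
  have ha : ∀ i, a i ∈ nonZeroDivisors R := fun i =>
    mem_nonZeroDivisors_of_ne_zero (Submodule.smithNormalFormCoeffs_ne_zero b h i)
  have h1 : b'.det (fun i => (n i : M)) = n'.det n * b'.det (fun i => (n' i : M)) := by
    have : b'.toMatrix (fun i => (n i : M)) =
        b'.toMatrix (fun i => (n' i : M)) * n'.toMatrix n := by
      ext i j
      have := congrArg (fun v : N => b'.repr (v : M) i) (n'.sum_toMatrix_smul_self n j)
      simp only [Submodule.coe_sum, Submodule.coe_smul, map_sum, map_smul, Finsupp.coe_finsetSum,
        Finset.sum_apply, Finsupp.smul_apply, smul_eq_mul] at this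
      rw [Basis.toMatrix_apply, ← this, Matrix.mul_apply]
      simp only [Basis.toMatrix_apply, mul_comm]
    rw [Basis.det_apply, Basis.det_apply, Basis.det_apply, this, Matrix.det_mul, mul_comm]
  have h2 : b'.det (fun i => (n' i : M)) = ∏ i, a i := by
    simp only [hn']
    rw [AlternatingMap.map_smul_univ, Basis.det_self, smul_eq_mul, mul_one]
  have h3 : (b.det fun i => (n i : M)) = b.det b' * b'.det fun i => (n i : M) := by
    rw [Basis.det_apply, Basis.det_apply, Basis.det_apply, ← Matrix.det_mul,
      Basis.toMatrix_mul_toMatrix]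
  rw [h3, h1, h2, Ring.ord_mul_of_isUnit_left (b.isUnit_det b'),
    Ring.ord_mul_of_isUnit_left (n'.isUnit_det n)]
  have key : ∀ s : Finset ι, Ring.ord R (∏ i ∈ s, a i) = ∑ i ∈ s, Ring.ord R (a i) := by
    intro s
    induction s using Finset.induction_on with
    | empty => simp
    | insert i s hi ih => rw [Finset.prod_insert hi, Finset.sum_insert hi, Ring.ord_mul' R (ha i), ih]
  rw [key]
  rfl

theorem ord_ne_top [IsDiscreteValuationRing R] {x : R} (hx : x ≠ 0) : Ring.ord R x ≠ ⊤ := by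
  obtain ⟨ϖ, hϖ⟩ := IsDiscreteValuationRing.exists_irreducible R
  obtain ⟨n, u, rfl⟩ := IsDiscreteValuationRing.eq_unit_mul_pow_irreducible hx hϖ
  rw [Ring.ord_mul_of_isUnit_left u.isUnit, Ring.ord_pow (mem_nonZeroDivisors_of_ne_zero hϖ.ne_zero),
    Ring.ord_of_irreducible hϖ]
  simp

theorem ord_eq_iff_associated [IsDiscreteValuationRing R] {x y : R} (hx : x ≠ 0) (hy : y ≠ 0) :
    Ring.ord R x = Ring.ord R y ↔ Associated x y := by
  refine ⟨fun h => ?_, Ring.ord_eq_of_associated⟩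
  obtain ⟨ϖ, hϖ⟩ := IsDiscreteValuationRing.exists_irreducible R
  obtain ⟨n, u, rfl⟩ := IsDiscreteValuationRing.eq_unit_mul_pow_irreducible hx hϖ
  obtain ⟨m, v, rfl⟩ := IsDiscreteValuationRing.eq_unit_mul_pow_irreducible hy hϖ
  have hz := mem_nonZeroDivisors_of_ne_zero hϖ.ne_zero
  rw [Ring.ord_mul_of_isUnit_left u.isUnit, Ring.ord_mul_of_isUnit_left v.isUnit,
    Ring.ord_pow hz, Ring.ord_pow hz, Ring.ord_of_irreducible hϖ] at h
  have : n = m := by simpa using h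
  subst this
  exact ((associated_unit_mul_left _ _ u.isUnit).trans
    (associated_unit_mul_left _ _ v.isUnit).symm)

variable {K V : Type*} [Field K] [Algebra R K] [IsFractionRing R K]
  [AddCommGroup V] [Module K V] [Module R V] [IsScalarTower R K V]

theorem linearIndependent_basis_restrict (b : Basis ι K V) : LinearIndependent R b :=
  (LinearIndependent.iff_fractionRing R K).2 b.linearIndependent

theorem mem_span_basis_iff (b : Basis ι K V) (v : V) :
    v ∈ Submodule.span R (Set.range b) ↔ ∀ i, b.repr v i ∈ Set.range (algebraMap R K) :=
  b.mem_span_iff_repr_mem R v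

theorem length_quotient_span [IsDiscreteValuationRing R] (b n : Basis ι K V)
    (h : Submodule.span R (Set.range n) ≤ Submodule.span R (Set.range b)) :
    ∃ x : R, x ≠ 0 ∧ algebraMap R K x = b.det n ∧
      Module.length R (Submodule.span R (Set.range b) ⧸
        (Submodule.span R (Set.range n)).submoduleOf (Submodule.span R (Set.range b))) =
        Ring.ord R x := by
  let b' : Basis ι R (Submodule.span R (Set.range b)) :=
    Basis.span (linearIndependent_basis_restrict b)
  let n' : Basis ι R (Submodule.span R (Set.range n)) :=
    Basis.span (linearIndependent_basis_restrict n)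
  let n'' := n'.map (Submodule.submoduleOfEquivOfLe h).symm
  have hb' : ∀ i, (b' i : V) = b i := fun i => by simp [b', Basis.span_apply]
  have hn'' : ∀ i, ((n'' i : Submodule.span R (Set.range b)) : V) = n i := fun i => by
    simp [n'', n', Basis.span_apply, Submodule.submoduleOfEquivOfLe]
  have hdet : algebraMap R K (b'.det fun i => (n'' i : Submodule.span R (Set.range b))) =
      b.det n := by
    rw [Basis.det_apply, Basis.det_apply, RingHom.map_det]
    congr 1
    ext i j
    rw [RingHom.mapMatrix_apply, Matrix.map_apply, Basis.toMatrix_apply, Basis.toMatrix_apply]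
    have h1 := congrArg (Subtype.val : Submodule.span R (Set.range b) → V) (b'.sum_repr (n'' j).1)
    have h2 := congrArg (fun v => b.repr v i) h1
    simp only [Submodule.coe_sum, Submodule.coe_smul, hb', hn'', map_sum, Finsupp.coe_finsetSum,
      Finset.sum_apply] at h2
    rw [← h2, Finset.sum_eq_single i]
    · rw [← algebraMap_smul K, map_smul]
      simp [Algebra.smul_def]
    · intro l _ hl
      rw [← algebraMap_smul K, map_smul]
      simp [hl]
    · simp
  refine ⟨_, ?_, hdet, length_quotient_eq_ord_det b' _ n''⟩
  intro h0
  rw [h0, map_zero] at hdet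
  exact (b.isUnit_det n).ne_zero hdet.symm

theorem length_quotient_add (L M N : Submodule R V) (h2 : N ≤ M) :
    Module.length R (L ⧸ N.submoduleOf L) =
      Module.length R (↥(L ⊓ M) ⧸ N.submoduleOf (L ⊓ M)) +
        Module.length R (L ⧸ M.submoduleOf L) := by
  let f : (↥(L ⊓ M) ⧸ N.submoduleOf (L ⊓ M)) →ₗ[R] (L ⧸ N.submoduleOf L) :=
    Submodule.mapQ _ _ (Submodule.inclusion inf_le_left) (fun x hx => hx)
  let g : (L ⧸ N.submoduleOf L) →ₗ[R] (L ⧸ M.submoduleOf L) :=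
    Submodule.mapQ _ _ LinearMap.id (fun x hx => h2 hx)
  refine Module.length_eq_add_of_exact f g ?_ ?_ ?_
  · rw [← LinearMap.ker_eq_bot, LinearMap.ker_eq_bot']
    intro m hm
    induction m using Submodule.Quotient.induction_on with | _ m =>
    rw [show f (Submodule.Quotient.mk m) = Submodule.Quotient.mk _ from
      Submodule.mapQ_apply _ _ _ _, Submodule.Quotient.mk_eq_zero] at hm
    rw [Submodule.Quotient.mk_eq_zero]
    exact hm
  · intro y
    induction y using Submodule.Quotient.induction_on with | _ y =>
    exact ⟨Submodule.Quotient.mk y, rfl⟩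
  · intro y
    induction y using Submodule.Quotient.induction_on with | _ y =>
    rw [show g (Submodule.Quotient.mk y) = Submodule.Quotient.mk _ from
      Submodule.mapQ_apply _ _ _ _, Submodule.Quotient.mk_eq_zero]
    constructor
    · intro hy
      exact ⟨Submodule.Quotient.mk ⟨y, y.2, hy⟩, rfl⟩
    · rintro ⟨z, hz⟩
      induction z using Submodule.Quotient.induction_on with | _ z =>
      rw [show f (Submodule.Quotient.mk z) = Submodule.Quotient.mk _ from
        Submodule.mapQ_apply _ _ _ _, Submodule.Quotient.eq] at hz
      have hz2 : ((z : V) - y) ∈ M := h2 hz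
      have : (y : V) = z - (z - y) := by abel
      change (y : V) ∈ M
      rw [this]
      exact M.sub_mem z.2.2 hz2

theorem exists_smul_mem_span [IsDiscreteValuationRing R] (b : Basis ι K V) (s : Finset V) :
    ∃ a : R, a ≠ 0 ∧ ∀ v ∈ s, a • v ∈ Submodule.span R (Set.range b) := by
  classical
  obtain ⟨⟨a, ha⟩, h⟩ := IsLocalization.exist_integer_multiples_of_finset (nonZeroDivisors R)
    (s.biUnion fun v => Finset.univ.image fun i => b.repr v i)
  refine ⟨a, nonZeroDivisors.ne_zero ha, fun v hv => (mem_span_basis_iff b _).2 fun i => ?_⟩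
  obtain ⟨r, hr⟩ := h (b.repr v i) (by simp only [Finset.mem_biUnion]; exact ⟨v, hv, by simp⟩)
  refine ⟨r, hr.trans ?_⟩
  rw [← algebraMap_smul K a v, map_smul]
  simp [Algebra.smul_def]

theorem finite_length_and_det [IsDiscreteValuationRing R] (b c : Basis ι K V) :
    ((Module.length R (Submodule.span R (Set.range c) ⧸
        (Submodule.span R (Set.range b)).submoduleOf (Submodule.span R (Set.range c)))).toNat : ℤ) -
      ((Module.length R (Submodule.span R (Set.range b) ⧸
        (Submodule.span R (Set.range c)).submoduleOf (Submodule.span R (Set.range b)))).toNat : ℤ)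
      = 0 ↔ ∃ u : Rˣ, b.det c = algebraMap R K u := by
  classical
  obtain ⟨a, ha, h⟩ := exists_smul_mem_span (R := R) c (Finset.univ.image b)
  let n : Basis ι K V := b.unitsSMul fun _ =>
    Units.mk0 (algebraMap R K a) (by simpa using ha)
  have hn : ∀ i, n i = a • b i := fun i => by
    simp only [n, Basis.unitsSMul_apply, Units.smul_def, Units.val_mk0, algebraMap_smul]
  have hnb : Submodule.span R (Set.range n) ≤ Submodule.span R (Set.range b) := by
    rw [Submodule.span_le]
    rintro _ ⟨i, rfl⟩
    rw [hn]
    exact Submodule.smul_mem _ _ (Submodule.subset_span ⟨i, rfl⟩)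
  have hnc : Submodule.span R (Set.range n) ≤ Submodule.span R (Set.range c) := by
    rw [Submodule.span_le]
    rintro _ ⟨i, rfl⟩
    rw [hn]
    exact h _ (by simp)
  obtain ⟨x, hx0, hx, hlx⟩ := length_quotient_span b n hnb
  obtain ⟨y, hy0, hy, hly⟩ := length_quotient_span c n hnc
  rw [length_quotient_add _ _ _ hnc] at hlx
  rw [length_quotient_add _ _ _ hnb, inf_comm] at hly
  have hxt := ord_ne_top hx0
  have hyt := ord_ne_top hy0
  have hc : Ring.ord R x = Ring.ord R y ↔ ∃ u : Rˣ, b.det c = algebraMap R K u := by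
    rw [ord_eq_iff_associated hx0 hy0]
    have hbc : b.det c * algebraMap R K y = algebraMap R K x := by
      rw [hx, hy, b.det_mul_det]
    have hyK : algebraMap R K y ≠ 0 := by simpa using hy0
    constructor
    · intro h'
      obtain ⟨u, hu⟩ := h'.symm
      refine ⟨u, mul_right_cancel₀ hyK ?_⟩
      rw [hbc, ← hu, map_mul, mul_comm]
    · rintro ⟨u, hu⟩
      refine Associated.symm ⟨u, IsFractionRing.injective R K ?_⟩
      rw [← hbc, hu, map_mul, mul_comm]
  rw [← hc, ← hlx, ← hly]
  rw [← hlx] at hxt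
  rw [← hly] at hyt
  generalize Module.length R (↥(Submodule.span R (Set.range b) ⊓ Submodule.span R (Set.range c)) ⧸
    (Submodule.span R (Set.range n)).submoduleOf _) = l0 at *
  generalize Module.length R (Submodule.span R (Set.range b) ⧸
    (Submodule.span R (Set.range c)).submoduleOf _) = l1 at *
  generalize Module.length R (Submodule.span R (Set.range c) ⧸
    (Submodule.span R (Set.range b)).submoduleOf _) = l2 at *
  rw [Ne, ENat.add_eq_top, not_or] at hxt hyt
  lift l0 to ℕ using hxt.1
  lift l1 to ℕ using hxt.2
  lift l2 to ℕ using hyt.2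
  rw [ENat.toNat_natCast, ENat.toNat_natCast, sub_eq_zero]
  norm_cast
  omega

end Length

section General

open Module

variable {m : ℕ} {ι : Type} [Fintype ι] [DecidableEq ι]

/-- `tensorForm` as a multilinear map. -/
def tensorMultilinear (T : (Fin m → ι) → ℤ) (R : Type*) [CommRing R] :
    MultilinearMap R (fun _ : Fin m => ι → R) R :=
  ∑ s : Fin m → ι, (T s : R) •
    (MultilinearMap.mkPiAlgebra R (Fin m) R).compLinearMap fun j => LinearMap.proj (s j)

@[simp]
theorem tensorMultilinear_apply (T : (Fin m → ι) → ℤ) (R : Type*) [CommRing R]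
    (v : Fin m → ι → R) : tensorMultilinear T R v = tensorForm T R v := by
  simp [tensorMultilinear, tensorForm]

theorem tensorForm_single (T : (Fin m → ι) → ℤ) (R : Type*) [CommRing R] (s : Fin m → ι) :
    tensorForm T R (fun j => Pi.single (s j) 1) = T s := by
  rw [tensorForm, Finset.sum_eq_single s]
  · simp
  · intro t _ ht
    obtain ⟨j, hj⟩ := Function.ne_iff.1 ht
    rw [Finset.prod_eq_zero (Finset.mem_univ j), mul_zero]
    simp [hj]
  · simp

theorem tensorForm_map (T : (Fin m → ι) → ℤ) {R S : Type*} [CommRing R] [CommRing S] (f : R →+* S)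
    (v : Fin m → ι → R) : tensorForm T S (fun j i => f (v j i)) = f (tensorForm T R v) := by
  simp [tensorForm]

/-- `A` preserves the tensor `T`. -/
def Preserves (T : (Fin m → ι) → ℤ) {R : Type*} [CommRing R] (A : Matrix ι ι R) : Prop :=
  ∀ s : Fin m → ι, tensorForm T R (fun j => A.col (s j)) = T s

theorem preserves_iff (T : (Fin m → ι) → ℤ) {R : Type*} [CommRing R] (A : Matrix ι ι R) :
    Preserves T A ↔ ∀ v : Fin m → ι → R,
      tensorForm T R (fun j => A.mulVec (v j)) = tensorForm T R v := by
  constructor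
  · intro h v
    have : (tensorMultilinear T R).compLinearMap (fun _ => A.mulVecLin) =
        tensorMultilinear T R := by
      refine Basis.ext_multilinear (fun _ => Pi.basisFun R ι) fun s => ?_
      simp only [MultilinearMap.compLinearMap_apply, tensorMultilinear_apply,
        Matrix.mulVecLin_apply, Pi.basisFun_apply, Matrix.mulVec_single_one, tensorForm_single]
      exact h s
    simpa using congrArg (fun f => f v) this
  · intro h s
    have := h fun j => Pi.single (s j) 1
    simpa only [Matrix.mulVec_single_one, tensorForm_single] using this

theorem Preserves.mul {T : (Fin m → ι) → ℤ} {R : Type*} [CommRing R] {A B : Matrix ι ι R}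
    (hA : Preserves T A) (hB : Preserves T B) : Preserves T (A * B) := by
  rw [preserves_iff] at *
  intro v
  simp only [← Matrix.mulVec_mulVec, hA, hB]

theorem preserves_of_mul {T : (Fin m → ι) → ℤ} {R : Type*} [CommRing R] {A B : Matrix ι ι R}
    (h : A * B = 1) (hA : Preserves T A) : Preserves T B := by
  rw [preserves_iff] at *
  intro v
  rw [← hA]
  simp [Matrix.mulVec_mulVec, h]

theorem preserves_map_iff (T : (Fin m → ι) → ℤ) {R S : Type*} [CommRing R] [CommRing S]
    (f : R →+* S) (hf : Function.Injective f) (A : Matrix ι ι R) :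
    Preserves T (A.map f) ↔ Preserves T A := by
  refine forall_congr' fun s => ?_
  rw [← hf.eq_iff, ← tensorForm_map, map_intCast]
  rfl

theorem mem_tensorGroup_iff (T : (Fin m → ι) → ℤ) {R : Type*} [CommRing R]
    (g : Matrix.GeneralLinearGroup ι R) :
    g ∈ tensorGroup T R ↔ (g : Matrix ι ι R).det = 1 ∧ Preserves T (g : Matrix ι ι R) := by
  rw [preserves_iff]
  rfl

variable {k : Type*} [Field k]

theorem algebraMap_injective_OO : Function.Injective (algebraMap (OO k) (FF k)) :=
  IsFractionRing.injective _ _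

/-- The entrywise image in `F` of a matrix over `𝒪`. -/
def toFF (Q : Matrix ι ι (OO k)) : Matrix ι ι (FF k) := Q.map (algebraMap (OO k) (FF k))

theorem toFF_mul (P Q : Matrix ι ι (OO k)) : toFF (P * Q) = toFF P * toFF Q := Matrix.map_mul

theorem toFF_one : toFF (1 : Matrix ι ι (OO k)) = 1 := by
  simp [toFF]

theorem det_toFF (Q : Matrix ι ι (OO k)) : (toFF Q).det = algebraMap (OO k) (FF k) Q.det :=
  (RingHom.map_det _ _).symm

theorem toFF_injective : Function.Injective (toFF : Matrix ι ι (OO k) → _) :=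
  Matrix.map_injective algebraMap_injective_OO

theorem mem_integralLie_iff (T : (Fin m → ι) → ℤ) (γ : Matrix ι ι (FF k)) :
    γ ∈ integralLie k T ↔ (∃ Q, γ = toFF Q) ∧ γ ∈ tensorLie T (FF k) := by
  have key : ∀ Q : Matrix ι ι (OO k), toFF Q ∈ tensorLie T (FF k) ↔ Q ∈ tensorLie T (OO k) := by
    intro Q
    refine and_congr ?_ ⟨fun h v => ?_, fun h => ?_⟩
    · rw [toFF, ← AddMonoidHom.map_trace, FaithfulSMul.algebraMap_eq_zero_iff]
    · apply algebraMap_injective_OO (k := k)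
      rw [map_sum, map_zero, ← h fun j i => algebraMap _ _ (v j i)]
      refine Finset.sum_congr rfl fun j _ => ?_
      rw [← tensorForm_map]
      congr 1
      funext l i
      rcases eq_or_ne l j with rfl | hl
      · simp [toFF, Matrix.mulVec, dotProduct]
      · simp [hl]
    · have : ∑ j, (tensorMultilinear T (FF k)).compLinearMap
          (Function.update (fun _ => LinearMap.id) j (toFF Q).mulVecLin) = 0 := by
        refine Basis.ext_multilinear (fun _ => Pi.basisFun (FF k) ι) fun s => ?_
        have := congrArg (algebraMap (OO k) (FF k)) (h fun j => Pi.single (s j) 1)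
        rw [map_sum, map_zero] at this
        rw [sum_apply, zero_apply, ← this]
        refine Finset.sum_congr rfl fun j _ => ?_
        rw [← tensorForm_map, MultilinearMap.compLinearMap_apply, tensorMultilinear_apply]
        congr 1
        funext l i
        rcases eq_or_ne l j with rfl | hl
        · simp [toFF]
        · simp [hl, Pi.single_apply]
      intro v
      have := congrArg (fun f => f v) this
      simp only [sum_apply, zero_apply,
        MultilinearMap.compLinearMap_apply, tensorMultilinear_apply] at this
      rw [← this]
      refine Finset.sum_congr rfl fun j _ => ?_
      congr 1
      funext l
      rcases eq_or_ne l j with rfl | hl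
      · simp
      · simp [hl]
  constructor
  · rintro ⟨Q, hQ, rfl⟩
    exact ⟨⟨Q, rfl⟩, (key Q).2 hQ⟩
  · rintro ⟨⟨Q, rfl⟩, h⟩
    exact ⟨Q, (key Q).1 h, rfl⟩

variable {V : Type*} [CommRing V] [Algebra (FF k) V] [Algebra (OO k) V]
  [IsScalarTower (OO k) (FF k) V]

/-- The family whose coordinates in the basis `b` are the columns of `A`. -/
def colFamily (b : Basis ι (FF k) V) (A : Matrix ι ι (FF k)) (j : ι) : V := ∑ i, A i j • b i

theorem repr_colFamily (b : Basis ι (FF k) V) (A : Matrix ι ι (FF k)) (i j : ι) :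
    b.repr (colFamily b A j) i = A i j := by
  simp [colFamily, Finsupp.single_apply]

theorem colFamily_toMatrix (b : Basis ι (FF k) V) (v : ι → V) :
    colFamily b (b.toMatrix v) = v := by
  funext j
  exact b.sum_toMatrix_smul_self v j

theorem toMatrix_colFamily (b : Basis ι (FF k) V) (A : Matrix ι ι (FF k)) :
    b.toMatrix (colFamily b A) = A := by
  ext i j
  rw [Basis.toMatrix_apply, repr_colFamily]

theorem colFamily_mul (b : Basis ι (FF k) V) (A B : Matrix ι ι (FF k)) (j : ι) :
    colFamily b (A * B) j = ∑ i, B i j • colFamily b A i := by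
  simp only [colFamily, Matrix.mul_apply, Finset.sum_smul, Finset.smul_sum, smul_smul]
  rw [Finset.sum_comm]
  simp only [mul_comm]

/-- The basis with coordinates the columns of an invertible matrix. -/
def colBasis (b : Basis ι (FF k) V) (A : Matrix ι ι (FF k)) (hA : A.det ≠ 0) :
    Basis ι (FF k) V :=
  have h : IsUnit (b.det (colFamily b A)) := by
    rw [Basis.det_apply, toMatrix_colFamily]
    exact hA.isUnit
  Basis.mk ((Basis.is_basis_iff_det b).2 h).1 ((Basis.is_basis_iff_det b).2 h).2.ge

@[simp]
theorem coe_colBasis (b : Basis ι (FF k) V) (A : Matrix ι ι (FF k)) (hA : A.det ≠ 0) :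
    ⇑(colBasis b A hA) = colFamily b A := by
  simp [colBasis]

theorem frameLattice_le_iff (b : Basis ι (FF k) V) {A B : Matrix ι ι (FF k)} :
    frameLattice b A ≤ frameLattice b B ↔ ∃ Q : Matrix ι ι (OO k), A = B * toFF Q := by
  have hfB : frameLattice b B = Submodule.span (OO k) (Set.range (colFamily b B)) := rfl
  constructor
  · intro h
    have h1 : ∀ j, ∃ q : ι → OO k, ∑ i, q i • colFamily b B i = colFamily b A j := by
      intro j
      have : colFamily b A j ∈ frameLattice b B := h (Submodule.subset_span ⟨j, rfl⟩)
      rw [hfB] at this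
      obtain ⟨q, hq⟩ := (Submodule.mem_span_range_iff_exists_fun (OO k)).1 this
      exact ⟨q, hq⟩
    choose q hq using h1
    refine ⟨Matrix.of fun i j => q j i, ?_⟩
    rw [← toMatrix_colFamily b A, ← toMatrix_colFamily b (B * _)]
    congr 1
    funext j
    rw [← hq, colFamily_mul]
    refine Finset.sum_congr rfl fun i _ => ?_
    rw [← algebraMap_smul (FF k)]
    rfl
  · rintro ⟨Q, rfl⟩
    refine Submodule.span_le.2 ?_
    rintro _ ⟨j, rfl⟩
    change colFamily b (B * toFF Q) j ∈ frameLattice b B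
    rw [colFamily_mul]
    refine Submodule.sum_mem _ fun i _ => ?_
    have : toFF Q i j = algebraMap (OO k) (FF k) (Q i j) := rfl
    rw [this, algebraMap_smul]
    exact Submodule.smul_mem _ _ (Submodule.subset_span ⟨i, rfl⟩)

theorem exists_unit_of_frameLattice_eq (b : Basis ι (FF k) V) {A B : Matrix ι ι (FF k)}
    (hB : B.det ≠ 0) (h : frameLattice b A = frameLattice b B) :
    ∃ Q : Matrix.GeneralLinearGroup ι (OO k), A = B * toFF (Q : Matrix ι ι (OO k)) := by
  obtain ⟨Q, hQ⟩ := (frameLattice_le_iff b).1 h.le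
  obtain ⟨P, hP⟩ := (frameLattice_le_iff b).1 h.ge
  have hQP : Q * P = 1 := by
    apply toFF_injective (k := k)
    rw [toFF_mul, toFF_one]
    have hBu : IsUnit B := (Matrix.isUnit_iff_isUnit_det B).2 hB.isUnit
    apply hBu.mul_left_cancel
    rw [← mul_assoc, ← hQ, ← hP, mul_one]
  exact ⟨⟨Q, P, hQP, mul_eq_one_comm.1 hQP⟩, hQ⟩

theorem frameLattice_mul_toFF (b : Basis ι (FF k) V) {A : Matrix ι ι (FF k)}
    {Q : Matrix ι ι (OO k)} (hQ : IsUnit Q.det) :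
    frameLattice b (A * toFF Q) = frameLattice b A := by
  refine le_antisymm ((frameLattice_le_iff b).2 ⟨Q, rfl⟩)
    ((frameLattice_le_iff b).2 ⟨Q⁻¹, ?_⟩)
  rw [mul_assoc, ← toFF_mul, Matrix.mul_nonsing_inv _ hQ, toFF_one, mul_one]

theorem relDegree_eq_zero_iff (b c : Basis ι (FF k) V) :
    relDegree (Submodule.span (OO k) (Set.range c)) (Submodule.span (OO k) (Set.range b)) = 0 ↔
      ∃ u : (OO k)ˣ, b.det c = algebraMap (OO k) (FF k) u :=
  finite_length_and_det b c

theorem exists_basis_of_isLattice (b : Basis ι (FF k) V) (L : Submodule (OO k) V)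
    [hL : Submodule.IsLattice (FF k) L] :
    ∃ c : Basis ι (FF k) V, Submodule.span (OO k) (Set.range c) = L := by
  let e := Module.Free.chooseBasis (OO k) L
  let e' := e.extendOfIsLattice (FF k)
  let σ := e'.indexEquiv b
  refine ⟨e'.reindex σ, ?_⟩
  rw [Basis.coe_reindex, EquivLike.range_comp]
  have : ⇑e' = L.subtype ∘ e := by
    funext i
    simp [e']
  rw [this, Set.range_comp, ← Submodule.map_span, e.span_eq, Submodule.map_top,
    Submodule.range_subtype]

theorem isLattice_span (c : Basis ι (FF k) V) :
    Submodule.IsLattice (FF k) (Submodule.span (OO k) (Set.range c)) where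
  fg := Submodule.fg_span (Set.finite_range c)
  span_eq_top := by
    rw [Submodule.span_span_of_tower, c.span_eq]

theorem multilinear_eq_tensorForm {T : (Fin m → ι) → ℤ}
    (Ω : MultilinearMap (FF k) (fun _ : Fin m => V) (FF k)) (b : Basis ι (FF k) V)
    (hb : ∀ s : Fin m → ι, Ω (fun j => b (s j)) = (T s : FF k)) (v : Fin m → V) :
    Ω v = tensorForm T (FF k) (fun j => b.repr (v j)) := by
  have : Ω = (tensorMultilinear T (FF k)).compLinearMap fun _ => b.equivFun.toLinearMap := by
    refine Basis.ext_multilinear (fun _ => b) fun s => ?_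
    rw [hb, MultilinearMap.compLinearMap_apply, tensorMultilinear_apply, ← tensorForm_single]
    congr 1
    funext j i
    simp [Pi.single_apply, eq_comm]
  rw [this, MultilinearMap.compLinearMap_apply, tensorMultilinear_apply]
  rfl

end General

section General

open Module

variable {m : ℕ} {ι : Type} [Fintype ι] [DecidableEq ι] {k : Type*} [Field k]

theorem conj_mem_tensorLie {T : (Fin m → ι) → ℤ} {R : Type*} [CommRing R]
    {g : Matrix.GeneralLinearGroup ι R} (hg : g ∈ tensorGroup T R) {γ : Matrix ι ι R}
    (hγ : γ ∈ tensorLie T R) :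
    ((g⁻¹ : Matrix.GeneralLinearGroup ι R) : Matrix ι ι R) * γ * (g : Matrix ι ι R) ∈
      tensorLie T R := by
  refine ⟨?_, fun v => ?_⟩
  · rw [Matrix.trace_mul_comm, ← mul_assoc, ← Units.val_mul, mul_inv_cancel, Units.val_one, one_mul,
      hγ.1]
  · rw [← hγ.2 fun j => (g : Matrix ι ι R).mulVec (v j)]
    refine Finset.sum_congr rfl fun j _ => ?_
    rw [← hg.2]
    congr 1
    funext l
    rcases eq_or_ne l j with rfl | hl
    · simp only [Function.update_self, Matrix.mulVec_mulVec]
      congr 1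
      rw [← mul_assoc, ← mul_assoc, ← Units.val_mul, mul_inv_cancel, Units.val_one, one_mul]
    · simp [hl]

theorem exists_integral_of_mk_eq {T : (Fin m → ι) → ℤ}
    {g h : tensorGroup T (FF k)}
    (hgh : (QuotientGroup.mk g : Grassmannian k T) = QuotientGroup.mk h) :
    ∃ Q ∈ tensorGroup T (OO k),
      ((h : Matrix.GeneralLinearGroup ι (FF k)) : Matrix ι ι (FF k)) =
        ((g : Matrix.GeneralLinearGroup ι (FF k)) : Matrix ι ι (FF k)) *
          toFF (Q : Matrix ι ι (OO k)) := by
  rw [QuotientGroup.eq, Subgroup.mem_subgroupOf] at hgh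
  obtain ⟨Q, hQ, hQ'⟩ := hgh
  refine ⟨Q, hQ, ?_⟩
  have h1 : toFF (Q : Matrix ι ι (OO k)) =
      ((((g⁻¹ * h : tensorGroup T (FF k)) : Matrix.GeneralLinearGroup ι (FF k))) :
        Matrix ι ι (FF k)) := by
    rw [← hQ']
    rfl
  rw [h1, Subgroup.coe_mul, Units.val_mul, ← mul_assoc, Subgroup.coe_inv, ← Units.val_mul,
    mul_inv_cancel, Units.val_one, one_mul]

variable {V : Type*} [CommRing V] [Algebra (FF k) V] [Algebra (OO k) V]
  [IsScalarTower (OO k) (FF k) V]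

/-- The lattice attached to a point of the affine Grassmannian. -/
def grassmannianLattice (b : Basis ι (FF k) V) (T : (Fin m → ι) → ℤ) :
    Grassmannian k T → Submodule (OO k) V :=
  Quotient.lift (fun g : tensorGroup T (FF k) =>
      frameLattice b ((g : Matrix.GeneralLinearGroup ι (FF k)) : Matrix ι ι (FF k))) (by
    intro g h hgh
    obtain ⟨Q, hQ, hQ'⟩ := exists_integral_of_mk_eq (Quotient.sound hgh)
    have : IsUnit ((Q : Matrix ι ι (OO k)).det) := by
      rw [hQ.1]
      exact isUnit_one
    change frameLattice b _ = frameLattice b _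
    rw [hQ', frameLattice_mul_toFF b this])

theorem mk_mem_affineSpringerFiber_iff {T : (Fin m → ι) → ℤ} {γ : Matrix ι ι (FF k)}
    (hγ : γ ∈ tensorLie T (FF k)) (g : tensorGroup T (FF k)) :
    (QuotientGroup.mk g : Grassmannian k T) ∈ affineSpringerFiber T γ ↔
      ∃ Q : Matrix ι ι (OO k),
        γ * ((g : Matrix.GeneralLinearGroup ι (FF k)) : Matrix ι ι (FF k)) =
          ((g : Matrix.GeneralLinearGroup ι (FF k)) : Matrix ι ι (FF k)) * toFF Q := by
  have key : ∀ h : tensorGroup T (FF k),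
      (((h⁻¹ : Matrix.GeneralLinearGroup ι (FF k)) : Matrix ι ι (FF k)) * γ *
        ((h : Matrix.GeneralLinearGroup ι (FF k)) : Matrix ι ι (FF k)) ∈ integralLie k T) ↔
      ∃ Q : Matrix ι ι (OO k),
        γ * ((h : Matrix.GeneralLinearGroup ι (FF k)) : Matrix ι ι (FF k)) =
          ((h : Matrix.GeneralLinearGroup ι (FF k)) : Matrix ι ι (FF k)) * toFF Q := by
    intro h
    rw [mem_integralLie_iff, and_iff_left (conj_mem_tensorLie h.2 hγ)]
    refine exists_congr fun Q => ?_
    constructor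
    · intro e
      rw [← e, ← mul_assoc, ← mul_assoc, ← Units.val_mul, mul_inv_cancel, Units.val_one, one_mul]
    · intro e
      rw [mul_assoc, e, ← mul_assoc, ← Units.val_mul, inv_mul_cancel, Units.val_one, one_mul]
  constructor
  · rintro ⟨h, hh, hm⟩
    obtain ⟨P, hP⟩ := (key h).1 hm
    obtain ⟨Q, -, hQ⟩ := exists_integral_of_mk_eq hh
    refine ⟨((Q⁻¹ : Matrix.GeneralLinearGroup ι (OO k)) : Matrix ι ι (OO k)) * P *
      (Q : Matrix ι ι (OO k)), ?_⟩
    have hQ1 : toFF (Q : Matrix ι ι (OO k)) *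
        toFF ((Q⁻¹ : Matrix.GeneralLinearGroup ι (OO k)) : Matrix ι ι (OO k)) = 1 := by
      rw [← toFF_mul, ← Units.val_mul, mul_inv_cancel, Units.val_one, toFF_one]
    rw [hQ, ← mul_assoc, hP, toFF_mul, toFF_mul]
    simp only [mul_assoc]
    rw [← mul_assoc (toFF (Q : Matrix ι ι (OO k))), hQ1, one_mul]
  · intro h
    exact ⟨g, rfl, (key g).2 h⟩

theorem colFamily_smul (b : Basis ι (FF k) V) {x : V} {γ : Matrix ι ι (FF k)}
    (hγ : LinearMap.toMatrix b b (LinearMap.mulLeft (FF k) x) = γ) (A : Matrix ι ι (FF k)) (j : ι) :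
    x * colFamily b A j = colFamily b (γ * A) j := by
  have h1 : ∀ i, x * b i = colFamily b γ i := by
    intro i
    apply b.repr.injective
    ext l
    rw [repr_colFamily, ← hγ, LinearMap.toMatrix_apply, LinearMap.mulLeft_apply]
  rw [colFamily_mul, colFamily, Finset.mul_sum]
  simp only [mul_smul_comm, h1]

theorem act_mul_mem_of_adjoin {B : Type*} [CommRing B] [Algebra (OO k) B]
    (act : B →ₐ[OO k] V) {x : B} (hx : Algebra.adjoin (OO k) {x} = ⊤)
    {L : Submodule (OO k) V} (hL : ∀ v ∈ L, act x * v ∈ L) (b : B) (v : V) (hv : v ∈ L) :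
    act b * v ∈ L := by
  have hb : b ∈ Algebra.adjoin (OO k) {x} := hx ▸ Algebra.mem_top
  induction hb using Algebra.adjoin_induction generalizing v with
  | mem y hy =>
    rw [Set.mem_singleton_iff.1 hy]
    exact hL v hv
  | algebraMap r =>
    rw [AlgHom.commutes, ← Algebra.smul_def]
    exact L.smul_mem r hv
  | add y z _ _ ihy ihz =>
    rw [map_add, add_mul]
    exact L.add_mem (ihy v hv) (ihz v hv)
  | mul y z _ _ ihy ihz =>
    rw [map_mul, mul_assoc]
    exact ihy _ (ihz v hv)

theorem mem_tensorLie_of_isFraming {T : (Fin m → ι) → ℤ}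
    (Ω : MultilinearMap (FF k) (fun _ : Fin m => V) (FF k)) {x : V}
    (hskew : ∀ v : Fin m → V, ∑ j, Ω (Function.update v j (x * v j)) = 0)
    {γ : Matrix ι ι (FF k)} {b : Basis ι (FF k) V} (hb : IsFraming T x Ω γ b)
    (htr : γ.trace = 0) : γ ∈ tensorLie T (FF k) := by
  refine ⟨htr, fun v => ?_⟩
  rw [← hskew fun j => b.equivFun.symm (v j)]
  refine Finset.sum_congr rfl fun j _ => ?_
  rw [multilinear_eq_tensorForm Ω b hb.1]
  congr 1
  funext l
  rcases eq_or_ne l j with rfl | hl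
  · rw [Function.update_self, Function.update_self, ← hb.2]
    have := LinearMap.toMatrix_mulVec_repr b b (LinearMap.mulLeft (FF k) x)
      (b.equivFun.symm (v l))
    rw [LinearMap.mulLeft_apply] at this
    rw [← this]
    congr 1
    funext i
    exact (congrFun (b.equivFun.apply_symm_apply (v l)) i).symm
  · rw [Function.update_of_ne hl, Function.update_of_ne hl]
    exact (b.equivFun.apply_symm_apply (v l)).symm

theorem det_colBasis (b : Basis ι (FF k) V) (A : Matrix ι ι (FF k)) (hA : A.det ≠ 0) :
    b.det (colBasis b A hA) = A.det := by
  rw [Basis.det_apply, coe_colBasis, toMatrix_colFamily]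

theorem toMatrix_preserves {T : (Fin m → ι) → ℤ}
    (Ω : MultilinearMap (FF k) (fun _ : Fin m => V) (FF k)) {b c : Basis ι (FF k) V}
    (hb : ∀ s : Fin m → ι, Ω (fun j => b (s j)) = (T s : FF k))
    (hc : ∀ s : Fin m → ι, Ω (fun j => c (s j)) = (T s : FF k)) :
    Preserves T (b.toMatrix c) := by
  intro s
  rw [← hc, multilinear_eq_tensorForm Ω b hb]
  rfl

theorem latticeDescription_of {T : (Fin m → ι) → ℤ} {χ : Matrix ι ι (FF k) → Prop}
    {B : Type*} [CommRing B] [Algebra (OO k) B] {act : B →ₐ[OO k] V} {x : B}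
    {L₀ : Submodule (OO k) V} (Ω : MultilinearMap (FF k) (fun _ : Fin m => V) (FF k))
    (hx : Algebra.adjoin (OO k) {x} = ⊤)
    (hT : ∀ A : Matrix ι ι (FF k), A.det ≠ 0 → Preserves T A →
      ∃ u : (OO k)ˣ, A.det = algebraMap (OO k) (FF k) u)
    (hlat : ∀ A : Matrix ι ι (FF k), (∃ u : (OO k)ˣ, A.det = algebraMap (OO k) (FF k) u) →
      (∀ s : Fin m → ι, tensorForm T (FF k) (fun j => A.col (s j)) ∈
        Set.range (algebraMap (OO k) (FF k))) →
      ∃ Q : Matrix ι ι (OO k), IsUnit Q.det ∧ (A * toFF Q).det = 1 ∧ Preserves T (A * toFF Q))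
    (hbase : ∃ b : Basis ι (FF k) V, (∀ s : Fin m → ι, Ω (fun j => b (s j)) = (T s : FF k)) ∧
      Submodule.span (OO k) (Set.range b) = L₀ ∧
      χ (LinearMap.toMatrix b b (LinearMap.mulLeft (FF k) (act x))))
    (hskew : ∀ v : Fin m → V, ∑ j, Ω (Function.update v j (act x * v j)) = 0)
    (htr : ∀ γ, χ γ → γ.trace = 0)
    (hL₀ : ∀ v ∈ L₀, act x * v ∈ L₀)
    (hconj : IsAlgClosed k → ∀ γ ∈ tensorLie T (FF k), ∀ γ' ∈ tensorLie T (FF k), χ γ → χ γ' →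
      ∃ A : Matrix ι ι (FF k), A.det ≠ 0 ∧ Preserves T A ∧ γ' * A = A * γ) :
    LatticeDescription T χ act x L₀ Ω := by
  obtain ⟨b₀, hb₀, hspan, hχ₀⟩ := hbase
  set γ₀ := LinearMap.toMatrix b₀ b₀ (LinearMap.mulLeft (FF k) (act x)) with hγ₀
  have hfr₀ : IsFraming T (act x) Ω γ₀ b₀ := ⟨hb₀, hγ₀.symm⟩
  have hlie₀ := mem_tensorLie_of_isFraming Ω hskew hfr₀ (htr _ hχ₀)
  refine ⟨⟨γ₀, ?_, hχ₀, b₀, hfr₀, hspan⟩, fun γ hγ _ b hb => ?_, fun hk γ hγ hχ => ?_⟩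
  · rw [mem_integralLie_iff]
    refine ⟨?_, hlie₀⟩
    have : ∀ i j, ∃ q : OO k, algebraMap (OO k) (FF k) q = γ₀ i j := by
      intro i j
      have : act x * b₀ j ∈ Submodule.span (OO k) (Set.range b₀) :=
        hspan ▸ hL₀ _ (hspan ▸ Submodule.subset_span ⟨j, rfl⟩)
      rw [hγ₀, LinearMap.toMatrix_apply]
      exact (mem_span_basis_iff b₀ _).1 this i
    choose q hq using this
    exact ⟨Matrix.of q, Matrix.ext fun i j => (hq i j).symm⟩
  · have hdetg : ∀ g : tensorGroup T (FF k),
        ((g : Matrix.GeneralLinearGroup ι (FF k)) : Matrix ι ι (FF k)).det = 1 := fun g => g.2.1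
    have hstab : ∀ A : Matrix ι ι (FF k), (∀ v ∈ frameLattice b A, act x * v ∈ frameLattice b A) ↔
        ∃ Q : Matrix ι ι (OO k), γ * A = A * toFF Q := by
      intro A
      rw [← frameLattice_le_iff b]
      constructor
      · intro h
        refine Submodule.span_le.2 ?_
        rintro _ ⟨j, rfl⟩
        change colFamily b (γ * A) j ∈ _
        rw [← colFamily_smul b hb.2]
        exact h _ (Submodule.subset_span ⟨j, rfl⟩)
      · intro h v hv
        have hmap : (frameLattice b A).map (LinearMap.mulLeft (OO k) (act x)) ≤
            frameLattice b (γ * A) := by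
          rw [frameLattice, Submodule.map_span, Submodule.span_le]
          rintro _ ⟨_, ⟨j, rfl⟩, rfl⟩
          change act x * colFamily b A j ∈ _
          rw [colFamily_smul b hb.2]
          exact Submodule.subset_span ⟨j, rfl⟩
        exact h (hmap ⟨v, hv, rfl⟩)
    have hb₀b : ∃ u : (OO k)ˣ, b₀.det b = algebraMap (OO k) (FF k) u := by
      rw [Basis.det_apply]
      refine hT _ ?_ (toMatrix_preserves Ω hb₀ hb.1)
      rw [← Basis.det_apply]
      exact (b₀.isUnit_det b).ne_zero
    have hdeg : ∀ (A : Matrix ι ι (FF k)), A.det ≠ 0 →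
        (relDegree (frameLattice b A) L₀ = 0 ↔
          ∃ u : (OO k)ˣ, A.det = algebraMap (OO k) (FF k) u) := by
      intro A hA
      have : frameLattice b A = Submodule.span (OO k) (Set.range (colBasis b A hA)) := by
        rw [coe_colBasis]
        rfl
      rw [this, ← hspan, relDegree_eq_zero_iff, ← b₀.det_mul_det b, det_colBasis]
      obtain ⟨u, hu⟩ := hb₀b
      rw [hu]
      constructor
      · rintro ⟨v, hv⟩
        refine ⟨u⁻¹ * v, ?_⟩
        rw [Units.val_mul, map_mul, ← hv, ← mul_assoc, ← map_mul, Units.inv_mul, map_one, one_mul]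
      · rintro ⟨v, hv⟩
        exact ⟨u * v, by rw [hv, Units.val_mul, map_mul]⟩
    have hmem : ∀ y : affineSpringerFiber T γ,
        IsSpringerLattice act L₀ Ω (grassmannianLattice b T y.1) := by
      rintro ⟨y, hy⟩
      induction y using QuotientGroup.induction_on with | H g =>
      have hgdet : ((g : Matrix.GeneralLinearGroup ι (FF k)) : Matrix ι ι (FF k)).det ≠ 0 := by
        rw [hdetg]
        exact one_ne_zero
      change IsSpringerLattice act L₀ Ω (frameLattice b _)
      refine ⟨?_, ?_, ?_, ?_⟩
      · have := isLattice_span (colBasis b _ hgdet)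
        rwa [coe_colBasis] at this
      · exact act_mul_mem_of_adjoin act hx
          ((hstab _).2 ((mk_mem_affineSpringerFiber_iff hγ g).1 hy))
      · intro v hv
        have hv' : ∀ j, ∃ q : ι → OO k, v j = ∑ i, q i • colFamily b
            ((g : Matrix.GeneralLinearGroup ι (FF k)) : Matrix ι ι (FF k)) i := by
          intro j
          obtain ⟨q, hq⟩ := (Submodule.mem_span_range_iff_exists_fun (OO k)).1 (hv j)
          exact ⟨q, hq.symm⟩
        choose q hq using hv'
        refine ⟨tensorForm T (OO k) q, ?_⟩
        rw [multilinear_eq_tensorForm Ω b hb.1, ← tensorForm_map, ← g.2.2]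
        congr 1
        funext j i
        rw [hq j, map_sum, Finsupp.coe_finsetSum, Finset.sum_apply]
        refine Finset.sum_congr rfl fun l _ => ?_
        rw [← algebraMap_smul (FF k), map_smul, Finsupp.smul_apply, repr_colFamily, smul_eq_mul,
          mul_comm]
      · exact (hdeg _ hgdet).2 ⟨1, by rw [hdetg]; simp⟩
    let Φ : affineSpringerFiber T γ →
        {L : Submodule (OO k) V // IsSpringerLattice act L₀ Ω L} :=
      fun y => ⟨grassmannianLattice b T y.1, hmem y⟩
    have hΦ : Function.Bijective Φ := by
      constructor
      · rintro ⟨y, hy⟩ ⟨z, hz⟩ hyz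
        induction y using QuotientGroup.induction_on with | H g =>
        induction z using QuotientGroup.induction_on with | H h =>
        have hyz' : frameLattice b ((h : Matrix.GeneralLinearGroup ι (FF k)) : Matrix ι ι (FF k)) =
            frameLattice b ((g : Matrix.GeneralLinearGroup ι (FF k)) : Matrix ι ι (FF k)) :=
          (congrArg Subtype.val hyz).symm
        obtain ⟨Q, hQ⟩ := exists_unit_of_frameLattice_eq b
          (by rw [hdetg]; exact one_ne_zero) hyz'
        rw [Subtype.mk.injEq, QuotientGroup.eq, Subgroup.mem_subgroupOf]
        have hQ' : (((g⁻¹ * h : tensorGroup T (FF k)) : Matrix.GeneralLinearGroup ι (FF k)) :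
            Matrix ι ι (FF k)) = toFF (Q : Matrix ι ι (OO k)) := by
          rw [Subgroup.coe_mul, Units.val_mul, hQ, ← mul_assoc, Subgroup.coe_inv, ← Units.val_mul,
            inv_mul_cancel, Units.val_one, one_mul]
        have hgh := (mem_tensorGroup_iff T _).1 (g⁻¹ * h : tensorGroup T (FF k)).2
        rw [hQ'] at hgh
        refine ⟨Q, (mem_tensorGroup_iff T _).2 ⟨?_, ?_⟩, ?_⟩
        · apply algebraMap_injective_OO (k := k)
          rw [← det_toFF, hgh.1, map_one]
        · exact (preserves_map_iff T _ algebraMap_injective_OO _).1 hgh.2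
        · apply Units.ext
          exact hQ'.symm
      · rintro ⟨L, hL⟩
        have := hL.isLattice
        obtain ⟨c, hc⟩ := exists_basis_of_isLattice b L
        have hAdet : (b.toMatrix c).det ≠ 0 := by
          rw [← Basis.det_apply]
          exact (b.isUnit_det c).ne_zero
        have hLA : frameLattice b (b.toMatrix c) = L := by
          rw [← hc]
          change Submodule.span (OO k) (Set.range (colFamily b (b.toMatrix c))) = _
          rw [colFamily_toMatrix]
        obtain ⟨Q, hQ, hQd, hQT⟩ := hlat (b.toMatrix c)
          ((hdeg _ hAdet).1 (by rw [hLA]; exact hL.degree)) (by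
            intro s
            have h1 := hL.integral (fun j => c (s j))
              (fun j => hc ▸ Submodule.subset_span ⟨_, rfl⟩)
            rw [multilinear_eq_tensorForm Ω b hb.1] at h1
            exact h1)
        let g : tensorGroup T (FF k) := ⟨Matrix.GeneralLinearGroup.mkOfDetNeZero
          (b.toMatrix c * toFF Q) (by rw [hQd]; exact one_ne_zero),
          (mem_tensorGroup_iff T _).2 ⟨hQd, hQT⟩⟩
        have hg : frameLattice b ((g : Matrix.GeneralLinearGroup ι (FF k)) : Matrix ι ι (FF k)) =
            L := by
          rw [← hLA]
          exact frameLattice_mul_toFF b hQ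
        refine ⟨⟨QuotientGroup.mk g, (mk_mem_affineSpringerFiber_iff hγ g).2 ((hstab _).1 ?_)⟩,
          Subtype.ext hg⟩
        rw [hg]
        exact fun v hv => hL.module x v hv
    exact ⟨Equiv.ofBijective Φ hΦ, fun g hg => rfl⟩
  · obtain ⟨A, hA, hAT, hAγ⟩ := hconj hk γ hγ γ₀ hlie₀ hχ hχ₀
    refine ⟨colBasis b₀ A hA, ?_, ?_⟩
    · intro s
      rw [multilinear_eq_tensorForm Ω b₀ hb₀, coe_colBasis, ← hAT]
      congr 1
      funext j i
      exact repr_colFamily b₀ A i (s j)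
    · ext i j
      rw [LinearMap.toMatrix_apply, LinearMap.mulLeft_apply]
      have h1 : act x * colBasis b₀ A hA j = ∑ l, γ l j • colBasis b₀ A hA l := by
        rw [coe_colBasis, colFamily_smul b₀ hγ₀.symm, hAγ, colFamily_mul]
      rw [h1, Basis.repr_sum_self]

end General

/-! ### Reflections -/

section Reflection

variable {K V : Type*} [Field K] [AddCommGroup V] [Module K V]

/-- The reflection in a vector `x`. -/
def reflectionMap (B : LinearMap.BilinForm K V) (x : V) : V →ₗ[K] V :=
  LinearMap.id - (2 / B x x) • (LinearMap.toSpanSingleton K V x ∘ₗ B x)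

theorem reflectionMap_apply (B : LinearMap.BilinForm K V) (x y : V) :
    reflectionMap B x y = y - (2 / B x x * B x y) • x := by
  simp [reflectionMap, smul_smul]

variable {B : LinearMap.BilinForm K V}

theorem reflectionMap_isometry (hB : B.IsSymm) {x : V} (hx : B x x ≠ 0) (y z : V) :
    B (reflectionMap B x y) (reflectionMap B x z) = B y z := by
  simp only [reflectionMap_apply, map_sub, LinearMap.sub_apply, map_smul, LinearMap.smul_apply,
    smul_eq_mul]
  rw [hB.eq y x]
  field_simp
  ring

theorem reflectionMap_of_orthogonal {x y : V} (h : B x y = 0) : reflectionMap B x y = y := by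
  simp [reflectionMap_apply, h]

theorem exists_isometry_map_eq (h2 : (2 : K) ≠ 0) (hB : B.IsSymm) {y y' : V} (hy : B y y ≠ 0)
    (hyy' : B y y = B y' y') :
    ∃ σ : V →ₗ[K] V, (∀ u v, B (σ u) (σ v) = B u v) ∧ σ y = y' ∧
      ∀ z, B y z = 0 → B y' z = 0 → σ z = z := by
  have hs : B y y' = B y' y := hB.eq y y'
  by_cases h : B (y - y') (y - y') = 0
  · have h4 : B (y + y') (y + y') ≠ 0 := by
      intro h'
      simp only [map_sub, map_add, LinearMap.sub_apply, LinearMap.add_apply] at h h'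
      rw [← hyy', ← hs] at h h'
      apply hy
      have : (2 * 2) * B y y = 0 := by linear_combination h + h'
      simpa [h2] using this
    have hy' : B y' y' ≠ 0 := hyy' ▸ hy
    refine ⟨reflectionMap B y' ∘ₗ reflectionMap B (y + y'), fun u v => ?_, ?_, fun z h1 h3 => ?_⟩
    · rw [LinearMap.comp_apply, LinearMap.comp_apply, reflectionMap_isometry hB hy',
        reflectionMap_isometry hB h4]
    · have e1 : reflectionMap B (y + y') y = -y' := by
        have : 2 / B (y + y') (y + y') * B (y + y') y = 1 := by
          rw [div_mul_eq_mul_div, div_eq_one_iff_eq h4]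
          simp only [map_add, LinearMap.add_apply]
          rw [← hyy', ← hs]
          ring
        rw [reflectionMap_apply, this]
        module
      have e2 : 2 / B y' y' * B y' y' = 2 := by field_simp
      rw [LinearMap.comp_apply, e1, map_neg, reflectionMap_apply, e2]
      module
    · rw [LinearMap.comp_apply, reflectionMap_of_orthogonal (x := y + y') (by simp [h1, h3]),
        reflectionMap_of_orthogonal h3]
  · refine ⟨reflectionMap B (y - y'), reflectionMap_isometry hB h, ?_, fun z h1 h3 => ?_⟩
    · have : 2 / B (y - y') (y - y') * B (y - y') y = 1 := by
        rw [div_mul_eq_mul_div, div_eq_one_iff_eq h]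
        simp only [map_sub, LinearMap.sub_apply]
        rw [← hyy', ← hs]
        ring
      rw [reflectionMap_apply, this]
      module
    · exact reflectionMap_of_orthogonal (by simp [h1, h3])

/-- Witt's extension theorem for orthogonal families of anisotropic vectors. -/
theorem exists_isometry_extending (h2 : (2 : K) ≠ 0) (hB : B.IsSymm) {κ : Type*} [Fintype κ]
    (e e' : κ → V) (he : ∀ i j, i ≠ j → B (e i) (e j) = 0) (hn : ∀ i, B (e i) (e i) ≠ 0)
    (hee' : ∀ i j, B (e i) (e j) = B (e' i) (e' j)) :
    ∃ σ : V →ₗ[K] V, (∀ u v, B (σ u) (σ v) = B u v) ∧ ∀ i, σ (e i) = e' i := by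
  classical
  suffices h : ∀ s : Finset κ, ∃ σ : V →ₗ[K] V, (∀ u v, B (σ u) (σ v) = B u v) ∧
      ∀ i ∈ s, σ (e i) = e' i by
    obtain ⟨σ, h1, h3⟩ := h Finset.univ
    exact ⟨σ, h1, fun i => h3 i (Finset.mem_univ i)⟩
  intro s
  induction s using Finset.induction_on with
  | empty => exact ⟨LinearMap.id, fun _ _ => rfl, by simp⟩
  | insert j s hj ih =>
    obtain ⟨σ, h1, h3⟩ := ih
    obtain ⟨τ, t1, t2, t3⟩ := exists_isometry_map_eq h2 hB (y := σ (e j)) (y' := e' j)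
      (by rw [h1]; exact hn j) (by rw [h1, hee'])
    refine ⟨τ ∘ₗ σ, fun u v => by rw [LinearMap.comp_apply, LinearMap.comp_apply, t1, h1], ?_⟩
    intro i hi
    rw [LinearMap.comp_apply]
    rcases Finset.mem_insert.1 hi with rfl | hi
    · exact t2
    · have hij : j ≠ i := fun h => hj (h ▸ hi)
      rw [h3 i hi]
      refine t3 _ ?_ ?_
      · rw [← h3 i hi, h1, he j i hij]
      · rw [← hee', he j i hij]

variable {R : Type*} [CommRing R] [IsDomain R] [Algebra R K] [IsFractionRing R K]
  [Module R V] [IsScalarTower R K V]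

/-- A self-dual lattice in a quadratic space with an orthogonal basis of unit norms `c i` contains
an orthogonal family with these norms. -/
theorem exists_orthogonal_family_mem [ValuationRing R] (h2 : IsUnit (2 : R))
    (hsq : ∀ a ∈ IsLocalRing.maximalIdeal R, ∃ r : R, r ^ 2 = 1 + a)
    (hB : B.IsSymm) (L : Submodule R V)
    (hint : ∀ x ∈ L, ∀ y ∈ L, B x y ∈ Set.range (algebraMap R K))
    (hdual : ∀ v : V, v ≠ 0 → ∃ a : K, ∃ w ∈ L, ∃ u ∈ L, v = a • w ∧ B w u = 1)
    {κ : Type*} [Fintype κ] (c : κ → Rˣ) (e : κ → V) (he : ∀ i j, i ≠ j → B (e i) (e j) = 0)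
    (hn : ∀ i, B (e i) (e i) = algebraMap R K (c i)) :
    ∃ v : κ → V, (∀ i j, i ≠ j → B (v i) (v j) = 0) ∧
      (∀ i, B (v i) (v i) = algebraMap R K (c i)) ∧ ∀ i, v i ∈ L := by
  classical
  have h2K : (2 : K) ≠ 0 := by
    have := (h2.map (algebraMap R K)).ne_zero
    rwa [map_ofNat] at this
  suffices h : ∀ s : Finset κ, ∃ v : κ → V, (∀ i j, i ≠ j → B (v i) (v j) = 0) ∧
      (∀ i, B (v i) (v i) = algebraMap R K (c i)) ∧ ∀ i ∈ s, v i ∈ L by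
    obtain ⟨v, h1, h3, h4⟩ := h Finset.univ
    exact ⟨v, h1, h3, fun i => h4 i (Finset.mem_univ i)⟩
  intro s
  induction s using Finset.induction_on with
  | empty => exact ⟨e, he, hn, by simp⟩
  | insert j s hj ih =>
    obtain ⟨v, h1, h3, h4⟩ := ih
    have hcK : ∀ i, algebraMap R K (c i) ≠ 0 := fun i =>
      ((c i).isUnit.map (algebraMap R K)).ne_zero
    suffices h : ∃ v' ∈ L, B v' v' = algebraMap R K (c j) ∧ ∀ i ∈ s, B (v i) v' = 0 by
      obtain ⟨v', hv'L, hv'n, hv's⟩ := h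
      obtain ⟨σ, t1, t2, t3⟩ := exists_isometry_map_eq h2K hB (y := v j) (y' := v')
        (by rw [h3]; exact hcK j) (by rw [h3, hv'n])
      refine ⟨fun i => σ (v i), fun i l hil => by rw [t1, h1 i l hil], fun i => by rw [t1, h3],
        fun i hi => ?_⟩
      rcases Finset.mem_insert.1 hi with rfl | hi
      · change σ (v i) ∈ L
        rw [t2]
        exact hv'L
      · have hij : j ≠ i := fun h => hj (h ▸ hi)
        change σ (v i) ∈ L
        rw [t3 _ (h1 j i hij) (by rw [← hv's i hi]; exact hB.eq v' (v i))]
        exact h4 i hi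
    have hvj : v j ≠ 0 := by
      intro h0
      have := h3 j
      rw [h0, map_zero] at this
      exact hcK j this.symm
    obtain ⟨a, w, hw, u, hu, hvw, hwu⟩ := hdual (v j) hvj
    have ha0 : a ≠ 0 := by
      rintro rfl
      exact hvj (by rw [hvw, zero_smul])
    rcases ValuationRing.isInteger_or_isInteger R a with ⟨r, hr⟩ | ⟨r, hr⟩
    · refine ⟨v j, ?_, h3 j, fun i hi => h1 i j fun h => hj (h ▸ hi)⟩
      rw [hvw, ← hr, algebraMap_smul]
      exact L.smul_mem r hw
    by_cases hru : IsUnit r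
    · refine ⟨v j, ?_, h3 j, fun i hi => h1 i j fun h => hj (h ▸ hi)⟩
      obtain ⟨r, rfl⟩ := hru
      have : a = algebraMap R K (r⁻¹ : Rˣ) := by
        rw [← inv_inv a, ← hr]
        exact inv_eq_of_mul_eq_one_right (by rw [← map_mul, Units.mul_inv, map_one])
      rw [hvw, this, algebraMap_smul]
      exact L.smul_mem _ hw
    -- `w` is primitive and isotropic modulo the maximal ideal
    have hwv : w = algebraMap R K r • v j := by
      rw [hvw, smul_smul, hr, inv_mul_cancel₀ ha0, one_smul]
    have hws : ∀ i ∈ s, B (v i) w = 0 := fun i hi => by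
      rw [hwv, map_smul, h1 i j fun h => hj (h ▸ hi), smul_zero]
    have hww : B w w = algebraMap R K (r ^ 2 * c j) := by
      rw [hwv, map_smul, map_smul, LinearMap.smul_apply, h3, smul_eq_mul, smul_eq_mul, map_mul,
        map_pow]
      ring
    choose! q hq using fun i (hi : i ∈ s) => hint (v i) (h4 i hi) u hu
    set u' := u - ∑ i ∈ s, (q i * ((c i)⁻¹ : Rˣ)) • v i with hu'
    have hu'L : u' ∈ L := L.sub_mem hu (L.sum_mem fun i hi => L.smul_mem _ (h4 i hi))
    have hu's : ∀ i ∈ s, B (v i) u' = 0 := by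
      intro i hi
      rw [hu', map_sub, map_sum, Finset.sum_eq_single_of_mem i hi, ← algebraMap_smul K, map_smul,
        h3, smul_eq_mul, ← hq i hi, ← map_mul, mul_assoc, Units.inv_mul, mul_one, sub_self]
      intro l _ hli
      rw [← algebraMap_smul K, map_smul, h1 i l hli.symm, smul_zero]
    have hwu' : B w u' = 1 := by
      rw [hu', map_sub, map_sum, hwu, Finset.sum_eq_zero, sub_zero]
      intro i hi
      rw [← algebraMap_smul K, map_smul, hB.eq w (v i), hws i hi, smul_zero]
    obtain ⟨n, hn'⟩ := hint u' hu'L u' hu'L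
    set A := r ^ 2 * (c j : R)
    set C := n - c j
    have hA : A ∈ IsLocalRing.maximalIdeal R :=
      Ideal.mul_mem_right _ _ (Ideal.pow_mem_of_mem _ ((IsLocalRing.mem_maximalIdeal r).2 hru) 2
        (by norm_num))
    obtain ⟨ρ, hρ, hρu⟩ : ∃ ρ : R, ρ ^ 2 = 1 - A * C ∧ IsUnit (ρ + 1) := by
      obtain ⟨ρ, hρ⟩ := hsq (-(A * C)) (neg_mem (Ideal.mul_mem_right _ _ hA))
      by_cases hu1 : IsUnit (ρ + 1)
      · exact ⟨ρ, by rw [hρ]; ring, hu1⟩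
      · refine ⟨-ρ, by rw [neg_sq, hρ]; ring, ?_⟩
        have : (-ρ + 1) = 2 - (ρ + 1) := by ring
        rw [this]
        by_contra h'
        have h5 := Ideal.add_mem _ ((IsLocalRing.mem_maximalIdeal _).2 h')
          ((IsLocalRing.mem_maximalIdeal _).2 hu1)
        rw [sub_add_cancel] at h5
        exact h5 h2
    obtain ⟨δ, hδ⟩ := hρu
    set s' : R := -C * (δ⁻¹ : Rˣ)
    refine ⟨s' • w + u', L.add_mem (L.smul_mem _ hw) hu'L, ?_, fun i hi => ?_⟩
    · have hu'w : B u' w = 1 := by rw [hB.eq, hwu']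
      rw [← algebraMap_smul K s' w]
      simp only [map_add, map_smul, LinearMap.add_apply, LinearMap.smul_apply, smul_eq_mul]
      rw [hww, hwu', hu'w, ← hn']
      have key : s' * (s' * A) + s' + (s' + n) = c j := by
        have h6 : (δ : R) * (δ⁻¹ : Rˣ) = 1 := δ.mul_inv
        rw [hδ] at h6
        simp only [s']
        generalize ((δ⁻¹ : Rˣ) : R) = δ' at *
        linear_combination C * δ' ^ 2 * hρ + (C * δ' * (1 - ρ) - C) * h6
      rw [← key]
      simp only [map_add, map_mul, mul_one]
      ring
    · rw [map_add, hu's i hi, ← algebraMap_smul K, map_smul, hws i hi, smul_zero, add_zero]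

end Reflection

section SymmetricLattice

open Matrix

variable {k : Type*} [Field k]

instance : HenselianLocalRing (OO k) where
  is_henselian f hf a₀ h₁ h₂ := by
    rw [PowerSeries.maximalIdeal_eq_span_X] at h₁ ⊢
    exact HenselianRing.is_henselian f hf a₀ h₁ (h₂.map _)

theorem isUnit_natCast_OO {n : ℕ} (hn : (n : k) ≠ 0) : IsUnit (n : OO k) := by
  have := hn.isUnit.map (PowerSeries.C (R := k))
  rwa [map_natCast] at this

theorem isUnit_two_OO (h2 : (2 : k) ≠ 0) : IsUnit (2 : OO k) := by
  exact_mod_cast isUnit_natCast_OO (k := k) (n := 2) (by exact_mod_cast h2)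

theorem two_ne_zero_FF (h2 : (2 : k) ≠ 0) : (2 : FF k) ≠ 0 := by
  have := ((isUnit_two_OO h2).map (algebraMap (OO k) (FF k))).ne_zero
  rwa [map_ofNat] at this

theorem exists_sq_eq_one_add (h2 : (2 : k) ≠ 0) (a : OO k)
    (ha : a ∈ IsLocalRing.maximalIdeal (OO k)) : ∃ r : OO k, r ^ 2 = 1 + a := by
  obtain ⟨r, hr, -⟩ := HenselianLocalRing.is_henselian
    (Polynomial.X ^ 2 - Polynomial.C (1 + a) : (OO k)[X])
    (Polynomial.monic_X_pow_sub_C _ two_ne_zero) 1 (by simpa using ha)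
    (by simpa [one_add_one_eq_two] using isUnit_two_OO h2)
  exact ⟨r, by simpa [Polynomial.IsRoot, sub_eq_zero] using hr⟩

variable {ι : Type} [Fintype ι] [DecidableEq ι]

/-- The entrywise image in `F` of a vector over `𝒪`. -/
def vecToFF (q : ι → OO k) : ι → FF k := fun i => algebraMap (OO k) (FF k) (q i)

theorem toFF_mulVec (Q : Matrix ι ι (OO k)) (q : ι → OO k) :
    (toFF Q).mulVec (vecToFF q) = vecToFF (Q.mulVec q) := by
  funext i
  simp [toFF, vecToFF, Matrix.mulVec, dotProduct]

theorem vecToFF_dotProduct (p q : ι → OO k) :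
    vecToFF p ⬝ᵥ vecToFF q = algebraMap (OO k) (FF k) (p ⬝ᵥ q) := by
  simp [vecToFF, dotProduct]

theorem exists_primitive_multiple (x : ι → FF k) (hx : x ≠ 0) :
    ∃ (a : FF k) (q : ι → OO k), (∃ i, q i = 1) ∧ x = a • vecToFF q := by
  classical
  obtain ⟨⟨d, hd⟩, h⟩ := IsLocalization.exist_integer_multiples_of_finset
    (nonZeroDivisors (OO k)) (Finset.univ.image x)
  choose r hr using fun i => h (x i) (by simp)
  have hr' : ∀ i, algebraMap (OO k) (FF k) (r i) = algebraMap (OO k) (FF k) d * x i :=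
    fun i => (hr i).trans (Algebra.smul_def _ _)
  have hd0 : algebraMap (OO k) (FF k) d ≠ 0 :=
    (map_ne_zero_iff _ algebraMap_injective_OO).2 (nonZeroDivisors.ne_zero hd)
  obtain ⟨i₀, hi₀⟩ := Function.ne_iff.1 hx
  obtain ⟨i, -, hi⟩ := Finset.exists_min_image Finset.univ
    (fun i => IsDiscreteValuationRing.addVal (OO k) (r i)) ⟨i₀, Finset.mem_univ _⟩
  choose q hq using fun j =>
    IsDiscreteValuationRing.addVal_le_iff_dvd.1 (hi j (Finset.mem_univ j))
  have hri : r i ≠ 0 := by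
    intro h0
    have : r i₀ = 0 := by rw [hq i₀, h0, zero_mul]
    have h3 := hr' i₀
    rw [this, map_zero, eq_comm, mul_eq_zero] at h3
    exact h3.elim hd0 hi₀
  refine ⟨algebraMap (OO k) (FF k) (r i) / algebraMap (OO k) (FF k) d, q, ⟨i, ?_⟩, ?_⟩
  · exact mul_left_cancel₀ hri (by rw [← hq i, mul_one])
  · funext j
    rw [Pi.smul_apply, smul_eq_mul, vecToFF, div_mul_eq_mul_div, ← map_mul, ← hq j, hr' j,
      mul_div_cancel_left₀ _ hd0]

theorem exists_isUnit_mulVec {G : Matrix ι ι (OO k)} (hG : IsUnit G.det) {q : ι → OO k}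
    (hq : ∃ i, q i = 1) : ∃ l, IsUnit (G.mulVec q l) := by
  by_contra! h
  obtain ⟨i, hi⟩ := hq
  have h1 : q = G⁻¹.mulVec (G.mulVec q) := by
    rw [mulVec_mulVec, nonsing_inv_mul _ hG, one_mulVec]
  have h2 : q i ∈ IsLocalRing.maximalIdeal (OO k) := by
    rw [h1]
    exact Ideal.sum_mem _ fun l _ => Ideal.mul_mem_left _ _ ((IsLocalRing.mem_maximalIdeal _).2 (h l))
  rw [hi] at h2
  exact h2 isUnit_one

/-- The columns of `A` span a self-dual lattice if the Gram matrix is unimodular. -/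
theorem exists_columns_orthogonal (h2 : (2 : k) ≠ 0) {S G : Matrix ι ι (OO k)} (hS : Sᵀ = S)
    {A : Matrix ι ι (FF k)} (hA : IsUnit A.det) (hG : IsUnit G.det)
    (hAG : Aᵀ * toFF S * A = toFF G) {κ : Type*} [Fintype κ] [DecidableEq κ] (c : κ → (OO k)ˣ)
    (e : κ → ι → FF k) (he : ∀ i j, e i ⬝ᵥ (toFF S).mulVec (e j) =
      if i = j then algebraMap (OO k) (FF k) (c i) else 0) :
    ∃ q : κ → ι → OO k, ∀ i j, q i ⬝ᵥ G.mulVec (q j) = if i = j then (c i : OO k) else 0 := by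
  set B := Matrix.toBilin' (toFF S)
  have hB : B.IsSymm := LinearMap.BilinForm.isSymm_def.2 fun x y => by
    simp only [B, Matrix.toBilin'_apply']
    rw [dotProduct_mulVec, ← mulVec_transpose, dotProduct_comm, toFF, ← transpose_map, hS]
  let f : (ι → OO k) →ₗ[OO k] (ι → FF k) :=
    { toFun := fun q => A.mulVec (vecToFF q)
      map_add' := fun p q => by
        rw [← mulVec_add]
        congr 1
        funext i
        simp [vecToFF]
      map_smul' := fun r q => by
        have : vecToFF (r • q) = algebraMap (OO k) (FF k) r • vecToFF q :=
          funext fun i => map_mul _ _ _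
        rw [RingHom.id_apply, this, mulVec_smul, algebraMap_smul] }
  have hBf : ∀ p q, B (f p) (f q) = algebraMap (OO k) (FF k) (p ⬝ᵥ G.mulVec q) := by
    intro p q
    have h3 : f p = A.mulVec (vecToFF p) := rfl
    have h4 : f q = A.mulVec (vecToFF q) := rfl
    rw [Matrix.toBilin'_apply', h3, h4, mulVec_mulVec, ← vecMul_transpose, ← dotProduct_mulVec,
      mulVec_mulVec, ← mul_assoc, hAG, toFF_mulVec, vecToFF_dotProduct]
  have hGs : Gᵀ = G := by
    apply toFF_injective (k := k)
    have : toFF Gᵀ = (toFF G)ᵀ := rfl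
    rw [this, ← hAG, transpose_mul, transpose_mul, transpose_transpose, ← mul_assoc]
    congr 2
    exact congrArg toFF hS
  obtain ⟨v, hv1, hv2, hv3⟩ := exists_orthogonal_family_mem (R := OO k) (isUnit_two_OO h2)
    (exists_sq_eq_one_add h2) hB (LinearMap.range f) (by
      rintro _ ⟨p, rfl⟩ _ ⟨q, rfl⟩
      exact ⟨_, (hBf p q).symm⟩) (by
      intro v hv
      have hx : A⁻¹.mulVec v ≠ 0 := by
        intro h0
        apply hv
        have : A.mulVec (A⁻¹.mulVec v) = v := by
          rw [mulVec_mulVec, mul_nonsing_inv _ hA, one_mulVec]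
        rw [← this, h0, mulVec_zero]
      obtain ⟨a, q, hq1, hq⟩ := exists_primitive_multiple _ hx
      obtain ⟨l, hl⟩ := exists_isUnit_mulVec hG hq1
      refine ⟨a, f q, ⟨q, rfl⟩, f (Pi.single l (hl.unit⁻¹ : (OO k)ˣ)), ⟨_, rfl⟩, ?_, ?_⟩
      · have : f q = A.mulVec (vecToFF q) := rfl
        rw [this, ← mulVec_smul, ← hq, mulVec_mulVec, mul_nonsing_inv _ hA, one_mulVec]
      · rw [hBf, dotProduct_mulVec, ← mulVec_transpose, hGs, dotProduct_single, IsUnit.mul_val_inv,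
          map_one])
    c e (fun i j hij => by rw [Matrix.toBilin'_apply', he, if_neg hij])
    (fun i => by rw [Matrix.toBilin'_apply', he, if_pos rfl])
  choose q hq using hv3
  refine ⟨q, fun i j => algebraMap_injective_OO ?_⟩
  rw [← hBf, hq, hq]
  split_ifs with h
  · rw [← h, hv2]
  · rw [hv1 i j h, map_zero]

theorem exists_isometric_basis_of_symm (h2 : (2 : k) ≠ 0) {S : Matrix ι ι (OO k)} (hS : Sᵀ = S)
    (hSd : IsUnit S.det) (c : ι → (OO k)ˣ) (e : ι → ι → FF k)
    (he : ∀ i j, e i ⬝ᵥ (toFF S).mulVec (e j) =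
      if i = j then algebraMap (OO k) (FF k) (c i) else 0)
    {A : Matrix ι ι (FF k)} {u : (OO k)ˣ} (hA : A.det = algebraMap (OO k) (FF k) u)
    {G : Matrix ι ι (OO k)} (hG : Aᵀ * toFF S * A = toFF G) :
    ∃ Q : Matrix ι ι (OO k), IsUnit Q.det ∧ (A * toFF Q)ᵀ * toFF S * (A * toFF Q) = toFF S := by
  have hA' : IsUnit A.det := hA ▸ u.isUnit.map _
  have hGd : IsUnit G.det := by
    have : G.det = u * S.det * u := by
      apply algebraMap_injective_OO (k := k)
      rw [← det_toFF, ← hG, det_mul, det_mul, det_transpose, hA, det_toFF, map_mul, map_mul]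
    rw [this]
    exact (u.isUnit.mul hSd).mul u.isUnit
  obtain ⟨q, hq⟩ := exists_columns_orthogonal h2 hS hA' hGd hG c e he
  obtain ⟨p, hp⟩ := exists_columns_orthogonal h2 hS (A := 1) (G := S) (by simp) hSd
    (by simp) c e he
  have key : ∀ (r : ι → ι → OO k) (G : Matrix ι ι (OO k)),
      (∀ i j, r i ⬝ᵥ G.mulVec (r j) = if i = j then (c i : OO k) else 0) →
      Matrix.of r * G * (Matrix.of r)ᵀ = diagonal fun i => (c i : OO k) := by
    intro r G h
    ext i j
    rw [diagonal_apply, ← h i j, mul_assoc, mul_apply]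
    rfl
  have hq' := key q G hq
  have hp' := key p S hp
  set P := (Matrix.of p)ᵀ with hP
  set Q := (Matrix.of q)ᵀ with hQ
  have hPt : Matrix.of p = Pᵀ := by rw [hP, transpose_transpose]
  have hQt : Matrix.of q = Qᵀ := by rw [hQ, transpose_transpose]
  rw [hPt] at hp'
  rw [hQt] at hq'
  have hdiag : IsUnit (diagonal fun i => (c i : OO k)).det := by
    rw [det_diagonal]
    exact IsUnit.prod_univ_iff.2 fun i => (c i).isUnit
  have hPu : IsUnit P.det := by
    rw [← hp', det_mul] at hdiag
    exact (IsUnit.mul_iff.1 hdiag).2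
  have hQu : IsUnit Q.det := by
    rw [← hq', det_mul] at hdiag
    exact (IsUnit.mul_iff.1 hdiag).2
  refine ⟨Q * P⁻¹, ?_, ?_⟩
  · rw [det_mul]
    exact hQu.mul (P.isUnit_nonsing_inv_det hPu)
  · have h1 : (A * toFF (Q * P⁻¹))ᵀ * toFF S * (A * toFF (Q * P⁻¹)) =
        (toFF (Q * P⁻¹))ᵀ * (Aᵀ * toFF S * A) * toFF (Q * P⁻¹) := by
      rw [transpose_mul]
      simp only [mul_assoc]
    have h3 : (toFF (Q * P⁻¹))ᵀ = toFF (Q * P⁻¹)ᵀ := rfl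
    rw [h1, hG, h3, ← toFF_mul, ← toFF_mul]
    congr 1
    have h4 : (Q * P⁻¹)ᵀ * G * (Q * P⁻¹) = (P⁻¹)ᵀ * (Qᵀ * G * Q) * P⁻¹ := by
      rw [transpose_mul]
      simp only [mul_assoc]
    rw [h4, hq', ← hp']
    have h5 : (P⁻¹)ᵀ * Pᵀ = 1 := by rw [← transpose_mul, mul_nonsing_inv _ hPu, transpose_one]
    have h6 : (P⁻¹)ᵀ * (Pᵀ * S * P) * P⁻¹ = ((P⁻¹)ᵀ * Pᵀ) * S * (P * P⁻¹) := by
      simp only [mul_assoc]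
    rw [h6, h5, mul_nonsing_inv _ hPu, one_mul, mul_one]

end SymmetricLattice

/-! ### Symplectic bases -/

section Symplectic

open Module Matrix

theorem linearIndependent_of_gram {R M κ : Type*} [CommRing R] [AddCommGroup M] [Module R M]
    [Fintype κ] [DecidableEq κ] (B : LinearMap.BilinForm R M) (v : κ → M)
    (h : IsUnit (Matrix.of fun i j => B (v i) (v j)).det) : LinearIndependent R v := by
  rw [Fintype.linearIndependent_iff]
  intro g hg
  have h1 : (Matrix.of fun i j => B (v i) (v j)).mulVec g = 0 := by
    funext i
    have := congrArg (B (v i)) hg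
    rw [map_sum, map_zero] at this
    simp only [map_smul, smul_eq_mul] at this
    simp only [mulVec, dotProduct, of_apply, Pi.zero_apply]
    rw [← this]
    exact Finset.sum_congr rfl fun j _ => mul_comm _ _
  have h2 := congrArg ((Matrix.of fun i j => B (v i) (v j))⁻¹.mulVec) h1
  rw [mulVec_mulVec, nonsing_inv_mul _ h, one_mulVec, mulVec_zero] at h2
  exact congrFun h2

theorem exists_symplectic_basis {R : Type*} [CommRing R] [IsDomain R] [IsPrincipalIdealRing R]
    {M : Type*} [AddCommGroup M] [Module R M] [Module.Free R M] [Module.Finite R M]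
    (B : LinearMap.BilinForm R M) (hB : ∀ x, B x x = 0)
    (hperf : ∀ φ : M →ₗ[R] R, ∃ v, B v = φ) :
    ∃ (n : ℕ) (b : Basis (Fin n ⊕ Fin n) R M), ∀ i j, B (b i) (b j) = Matrix.J (Fin n) R i j := by
  induction hd : finrank R M using Nat.strong_induction_on generalizing M with | _ d ih =>
  have hskew : ∀ x y, B x y = -B y x := by
    intro x y
    have := hB (x + y)
    simp only [map_add, LinearMap.add_apply, hB, zero_add, add_zero] at this
    exact eq_neg_of_add_eq_zero_right this
  rcases subsingleton_or_nontrivial M with hM | hM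
  · exact ⟨0, Basis.empty M, fun i => i.elim (fun i => i.elim0) fun i => i.elim0⟩
  let b₀ := Module.Free.chooseBasis R M
  obtain ⟨i₀⟩ := b₀.index_nonempty
  set f := b₀ i₀ with hf
  obtain ⟨e, he⟩ := hperf (b₀.coord i₀)
  have hef : B e f = 1 := by rw [he, hf, Basis.coord_apply, Basis.repr_self, Finsupp.single_eq_same]
  have hfe : B f e = -1 := by rw [hskew, hef]
  let W : Submodule R M := LinearMap.ker (B e) ⊓ LinearMap.ker (B f)
  have hWe : ∀ w : W, B e w = 0 := fun w => w.2.1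
  have hWf : ∀ w : W, B f w = 0 := fun w => w.2.2
  let proj : M → M := fun x => x + B f x • e - B e x • f
  have hproj : ∀ x, proj x ∈ W := fun x => by
    constructor
    · simp [proj, LinearMap.mem_ker, hB, hef]
    · simp [proj, LinearMap.mem_ker, hB, hfe]
  have hlt : finrank R W < d := by
    have h1 : finrank R W ≤ finrank R (LinearMap.ker (B e)) := Submodule.finrank_mono inf_le_left
    have h2 := Submodule.finrank_quotient_add_finrank (LinearMap.ker (B e))
    have h3 : Function.Surjective (B e) := fun r => ⟨r • f, by simp [hef]⟩
    rw [((B e).quotKerEquivOfSurjective h3).finrank_eq, finrank_self] at h2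
    omega
  obtain ⟨n, b, hb⟩ := ih _ hlt (B.compl₁₂ W.subtype W.subtype) (fun x => hB x) (by
    intro φ
    let pr : M →ₗ[R] W :=
      { toFun := fun x => ⟨proj x, hproj x⟩
        map_add' := fun x y => Subtype.ext (by simp only [proj, map_add, Submodule.coe_add]; module)
        map_smul' := fun r x => Subtype.ext (by
          simp only [proj, map_smul, smul_eq_mul, RingHom.id_apply, Submodule.coe_smul]; module) }
    obtain ⟨v, hv⟩ := hperf (φ ∘ₗ pr)
    refine ⟨⟨proj v, hproj v⟩, LinearMap.ext fun w => ?_⟩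
    have h1 : pr w = w := Subtype.ext (by simp [pr, proj, hWe, hWf])
    have h2 : B v w = φ w := by rw [hv, LinearMap.comp_apply, h1]
    rw [LinearMap.compl₁₂_apply, ← h2]
    simp [proj, hWe, hWf]) rfl
  simp only [LinearMap.compl₁₂_apply, Submodule.subtype_apply] at hb
  let v : Fin (n + 1) ⊕ Fin (n + 1) → M :=
    Sum.elim (Fin.cons f fun i => b (Sum.inl i)) (Fin.cons e fun i => b (Sum.inr i))
  have hWe' : ∀ w : W, B w e = 0 := fun w => by rw [hskew, hWe, neg_zero]
  have hWf' : ∀ w : W, B w f = 0 := fun w => by rw [hskew, hWf, neg_zero]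
  have hgram : ∀ i j, B (v i) (v j) = Matrix.J (Fin (n + 1)) R i j := by
    rintro (i | i) (j | j) <;> refine Fin.cases ?_ (fun i => ?_) i <;>
      refine Fin.cases ?_ (fun j => ?_) j <;>
      simp [v, Matrix.J, hB, hef, hfe, hWe, hWf, hWe', hWf', hb, Matrix.one_apply,
        Fin.succ_ne_zero, (Fin.succ_ne_zero _).symm]
  have hli : LinearIndependent R v := by
    refine linearIndependent_of_gram B v ?_
    have : (Matrix.of fun i j => B (v i) (v j)) = Matrix.J (Fin (n + 1)) R := by
      ext i j
      exact hgram i j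
    rw [this, SymplecticGroup.det_eq_one (SymplecticGroup.J_mem _ _)]
    exact isUnit_one
  have hsp : ⊤ ≤ Submodule.span R (Set.range v) := by
    have hfm : f ∈ Submodule.span R (Set.range v) := Submodule.subset_span ⟨Sum.inl 0, by simp [v]⟩
    have hem : e ∈ Submodule.span R (Set.range v) := Submodule.subset_span ⟨Sum.inr 0, by simp [v]⟩
    have hWm : W ≤ Submodule.span R (Set.range v) := by
      have h1 : W = Submodule.map W.subtype (Submodule.span R (Set.range b)) := by
        rw [b.span_eq, Submodule.map_top, Submodule.range_subtype]
      rw [h1, Submodule.map_span, Submodule.span_le]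
      rintro _ ⟨_, ⟨i, rfl⟩, rfl⟩
      refine Submodule.subset_span ?_
      rcases i with i | i
      · exact ⟨Sum.inl i.succ, by simp [v]⟩
      · exact ⟨Sum.inr i.succ, by simp [v]⟩
    intro x _
    have hx : x = proj x - B f x • e + B e x • f := by simp only [proj]; module
    rw [hx]
    exact Submodule.add_mem _ (Submodule.sub_mem _ (hWm (hproj x)) (Submodule.smul_mem _ _ hem))
      (Submodule.smul_mem _ _ hfm)
  refine ⟨n + 1, Basis.mk hli hsp, fun i j => ?_⟩
  rw [Basis.mk_apply, Basis.mk_apply, hgram]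

end Symplectic

/-! ### Pfaffians -/

section Pfaffian

open Matrix ExteriorAlgebra

variable {R : Type*} [CommRing R] {M : Type*} [AddCommGroup M] [Module R M]

theorem contractLeft_ιMulti (d : Module.Dual R M) (r : ℕ) (w : Fin (r + 1) → M) :
    CliffordAlgebra.contractLeft (Q := (0 : QuadraticForm R M)) d (ιMulti R (r + 1) w) =
      ∑ j : Fin (r + 1), ((-1) ^ (j : ℕ) * d (w j)) • ιMulti R r fun i => w (j.succAbove i) := by
  induction r with
  | zero =>
    rw [ιMulti_succ_apply]
    simp only [ιMulti_zero_apply, mul_one]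
    refine (CliffordAlgebra.contractLeft_ι (0 : QuadraticForm R M) d (w 0)).trans ?_
    simp [Algebra.algebraMap_eq_smul_one]
  | succ r ih =>
    rw [ιMulti_succ_apply]
    refine (CliffordAlgebra.contractLeft_ι_mul d (w 0) _).trans ?_
    rw [ih, Finset.mul_sum, sub_eq_add_neg, ← Finset.sum_neg_distrib]
    refine Eq.trans ?_ (Fin.sum_univ_succ _).symm
    congr 1
    · simp [vecTail, Function.comp_def]
    · refine Finset.sum_congr rfl fun j _ => ?_
      rw [ιMulti_succ_apply, mul_smul_comm, ← neg_smul]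
      congr 1
      · simp [vecTail, pow_succ]
      · congr 2
        funext i
        simp [vecTail]

/-- The scalar part of the Clifford product of vectors, for a Clifford algebra obtained from the
exterior algebra by deforming with an alternating form `B`. -/
def wickForm {B : LinearMap.BilinForm R M}
    (h : B.toQuadraticMap = (0 : QuadraticForm R M) - (0 : QuadraticForm R M)) (n : ℕ) :
    M [⋀^Fin n]→ₗ[R] R :=
  ((algebraMapInv (R := R) (M := M)).toLinearMap ∘ₗ
    CliffordAlgebra.changeForm h).compAlternatingMap (ιMulti R n)

theorem wickForm_succ {B : LinearMap.BilinForm R M}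
    (h : B.toQuadraticMap = (0 : QuadraticForm R M) - (0 : QuadraticForm R M)) (n : ℕ)
    (v : Fin (n + 2) → M) :
    wickForm h (n + 2) v = -∑ j : Fin (n + 1), (-1) ^ (j : ℕ) * B (v 0) (v j.succ) *
      wickForm h n fun i => v (j.succAbove i).succ := by
  have h1 : wickForm h (n + 2) v =
      algebraMapInv (CliffordAlgebra.changeForm h (ιMulti R (n + 2) v)) := rfl
  rw [h1, ιMulti_succ_apply]
  have h2 := CliffordAlgebra.changeForm_ι_mul h (v 0) (ιMulti R (n + 1) (vecTail v))
  have h3 := CliffordAlgebra.changeForm_contractLeft h (B (v 0)) (ιMulti R (n + 1) (vecTail v))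
  rw [← h3, contractLeft_ιMulti] at h2
  refine (congrArg algebraMapInv h2).trans ?_
  have h4 : algebraMapInv (CliffordAlgebra.ι (0 : QuadraticForm R M) (v 0) *
      CliffordAlgebra.changeForm h (ιMulti R (n + 1) (vecTail v))) = 0 := by
    rw [map_mul]
    have : algebraMapInv (CliffordAlgebra.ι (0 : QuadraticForm R M) (v 0)) = 0 := by
      refine (lift_ι_apply R (0 : M →ₗ[R] R) (by simp) (v 0)).trans ?_
      simp
    rw [this, zero_mul]
  rw [map_sub, h4, zero_sub, map_sum, map_sum]
  congr 1
  refine Finset.sum_congr rfl fun j _ => ?_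
  rw [map_smul, map_smul, smul_eq_mul]
  rfl

theorem pfaffian_gram {B : LinearMap.BilinForm R M}
    (h : B.toQuadraticMap = (0 : QuadraticForm R M) - (0 : QuadraticForm R M)) (n : ℕ)
    (v : Fin (2 * n) → M) :
    pfaffian n (Matrix.of fun i j => B (v i) (v j)) = (-1) ^ n * wickForm h (2 * n) v := by
  induction n with
  | zero =>
    have : wickForm h (2 * 0) v = algebraMapInv (CliffordAlgebra.changeForm h
      (ιMulti R 0 v)) := rfl
    rw [this, ιMulti_zero_apply]
    have h2 := CliffordAlgebra.changeForm_one h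
    refine Eq.trans ?_ (congrArg (fun x => (-1) ^ 0 * algebraMapInv x) h2.symm)
    simp [pfaffian]
  | succ n ih =>
    rw [pfaffian]
    refine Eq.trans ?_ (congrArg (fun x => (-1) ^ (n + 1) * x) (wickForm_succ h (2 * n) v).symm)
    rw [pow_succ, mul_assoc, neg_one_mul, neg_neg, Finset.mul_sum]
    refine Finset.sum_congr rfl fun j _ => ?_
    have := ih fun i => v (j.succAbove i).succ
    rw [mul_left_comm, ← this]
    rfl

theorem toQuadraticMap_toBilin'_eq_zero {ι : Type*} [Fintype ι] [DecidableEq ι]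
    (A : Matrix ι ι R) (hA : Aᵀ = -A) (hA0 : ∀ i, A i i = 0) (x : ι → R) :
    Matrix.toBilin' A x x = 0 := by
  rw [Matrix.toBilin'_apply]
  rw [← Finset.sum_product', Finset.sum_involution (fun p _ => (p.2, p.1))]
  · intro p _
    have := congrFun (congrFun hA p.1) p.2
    simp only [transpose_apply, Matrix.neg_apply] at this
    simp only [this]
    ring
  · rintro ⟨i, j⟩ _ h1 h2
    simp only [Prod.mk.injEq] at h2
    rw [h2.2, hA0] at h1
    simp at h1
  · simp
  · simp

theorem pfaffian_transpose_mul_mul {n : ℕ} (A C : Matrix (Fin (2 * n)) (Fin (2 * n)) R)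
    (hA : Aᵀ = -A) (hA0 : ∀ i, A i i = 0) :
    pfaffian n (Cᵀ * A * C) = C.det * pfaffian n A := by
  set B := Matrix.toBilin' A
  have hB : B.toQuadraticMap = (0 : QuadraticForm R (Fin (2 * n) → R)) -
      (0 : QuadraticForm R (Fin (2 * n) → R)) := by
    ext x
    simpa using toQuadraticMap_toBilin'_eq_zero A hA hA0 x
  have key : ∀ D : Matrix (Fin (2 * n)) (Fin (2 * n)) R,
      Dᵀ * A * D = Matrix.of fun i j => B (fun l => D l i) (fun l => D l j) := by
    intro D
    ext i j
    rw [of_apply, Matrix.toBilin'_apply', mul_assoc, mul_apply]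
    rfl
  have h1 : pfaffian n A = pfaffian n ((1 : Matrix _ _ R)ᵀ * A * 1) := by simp
  rw [h1, key, key, pfaffian_gram hB _ (fun i l => C l i),
    pfaffian_gram hB _ (fun i l => (1 : Matrix _ _ R) l i),
    (wickForm hB (2 * n)).eq_smul_basis_det (Pi.basisFun R (Fin (2 * n)))]
  have h2 : ∀ D : Matrix (Fin (2 * n)) (Fin (2 * n)) R,
      (Pi.basisFun R (Fin (2 * n))).det (fun i l => D l i) = D.det := by
    intro D
    rw [Module.Basis.det_apply]
    congr 1
  simp only [AlternatingMap.smul_apply, h2, det_one, smul_eq_mul]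
  ring

end Pfaffian

/-! ### Bilinear forms given by integral Gram matrices -/

section Gram

open Matrix

variable {ι : Type} [Fintype ι] [DecidableEq ι]

/-- The Gram matrix of an integral bilinear form, over any ring. -/
def gramMatrix (T : (Fin 2 → ι) → ℤ) (R : Type*) [CommRing R] : Matrix ι ι R :=
  Matrix.of fun i j => (T ![i, j] : R)

theorem gramMatrix_map (T : (Fin 2 → ι) → ℤ) {R S : Type*} [CommRing R] [CommRing S]
    (f : R →+* S) : (gramMatrix T R).map f = gramMatrix T S := by
  ext i j
  simp [gramMatrix]

theorem tensorForm_two (T : (Fin 2 → ι) → ℤ) (R : Type*) [CommRing R] (v : Fin 2 → ι → R) :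
    tensorForm T R v = v 0 ⬝ᵥ (gramMatrix T R).mulVec (v 1) := by
  rw [tensorForm, ← (finTwoArrowEquiv ι).symm.sum_comp, Fintype.sum_prod_type]
  simp only [dotProduct, mulVec, Finset.mul_sum]
  refine Finset.sum_congr rfl fun i _ => Finset.sum_congr rfl fun j _ => ?_
  change (T ![i, j] : R) * ∏ l : Fin 2, v l (![i, j] l) = v 0 i * ((T ![i, j] : R) * v 1 j)
  rw [Fin.prod_univ_two]
  simp only [cons_val_zero, cons_val_one]
  ring

theorem col_gram_col {R : Type*} [CommRing R] (A S : Matrix ι ι R) (i j : ι) :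
    A.col i ⬝ᵥ S.mulVec (A.col j) = (Aᵀ * S * A) i j := by
  rw [mul_assoc, mul_apply]
  rfl

theorem preserves_two_iff (T : (Fin 2 → ι) → ℤ) {R : Type*} [CommRing R] (A : Matrix ι ι R) :
    Preserves T A ↔ Aᵀ * gramMatrix T R * A = gramMatrix T R := by
  simp only [Preserves, tensorForm_two, col_gram_col]
  constructor
  · intro h
    ext i j
    exact h ![i, j]
  · intro h s
    rw [h, gramMatrix, of_apply]
    congr 2
    funext l
    fin_cases l <;> rfl

theorem mem_tensorLie_two_iff (T : (Fin 2 → ι) → ℤ) {R : Type*} [CommRing R] (γ : Matrix ι ι R) :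
    γ ∈ tensorLie T R ↔ γ.trace = 0 ∧ γᵀ * gramMatrix T R + gramMatrix T R * γ = 0 := by
  refine and_congr_right fun _ => ?_
  have key : ∀ v : Fin 2 → ι → R,
      ∑ j, tensorForm T R (Function.update v j (γ.mulVec (v j))) =
        v 0 ⬝ᵥ (γᵀ * gramMatrix T R + gramMatrix T R * γ).mulVec (v 1) := by
    intro v
    simp only [Fin.sum_univ_two, tensorForm_two, add_mulVec, dotProduct_add]
    congr 1
    · simp [← mulVec_mulVec, dotProduct_mulVec, vecMul_transpose]
    · simp [← mulVec_mulVec]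
  simp only [key]
  constructor
  · intro h
    ext i j
    simpa using h ![Pi.single i 1, Pi.single j 1]
  · intro h v
    rw [h, zero_mulVec, dotProduct_zero]

variable {k : Type*} [Field k]

theorem toFF_transpose (A : Matrix ι ι (OO k)) : toFF Aᵀ = (toFF A)ᵀ := rfl

theorem toFF_neg (A : Matrix ι ι (OO k)) : toFF (-A) = -toFF A := by
  ext
  simp [toFF]

theorem exists_unit_det_of_gram {T : (Fin 2 → ι) → ℤ} (hS : IsUnit (gramMatrix T (OO k)).det)
    {A : Matrix ι ι (FF k)} (hA : Preserves T A) :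
    ∃ u : (OO k)ˣ, A.det = algebraMap (OO k) (FF k) u := by
  rw [preserves_two_iff] at hA
  have hS' : (gramMatrix T (FF k)).det ≠ 0 := by
    rw [← gramMatrix_map T (algebraMap (OO k) (FF k)), ← RingHom.mapMatrix_apply,
      ← RingHom.map_det]
    exact (hS.map _).ne_zero
  have h := congrArg det hA
  rw [det_mul, det_mul, det_transpose] at h
  have h2 : (A.det - 1) * (A.det + 1) = 0 := by
    apply mul_left_cancel₀ hS'
    linear_combination h
  rcases mul_eq_zero.1 h2 with h3 | h3
  · exact ⟨1, by simpa using sub_eq_zero.1 h3⟩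
  · exact ⟨-1, by simpa using eq_neg_of_add_eq_zero_left h3⟩

theorem exists_gram_integral {T : (Fin 2 → ι) → ℤ} {A : Matrix ι ι (FF k)}
    (h : ∀ s : Fin 2 → ι, tensorForm T (FF k) (fun j => A.col (s j)) ∈
        Set.range (algebraMap (OO k) (FF k))) :
    ∃ G : Matrix ι ι (OO k), Aᵀ * gramMatrix T (FF k) * A = toFF G := by
  choose G hG using fun i j => h ![i, j]
  refine ⟨Matrix.of G, ?_⟩
  ext i j
  rw [toFF, map_apply, of_apply, hG, tensorForm_two, ← col_gram_col]
  rfl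

theorem isUnit_det_gram {S G : Matrix ι ι (OO k)} (hS : IsUnit S.det) {A : Matrix ι ι (FF k)}
    {u : (OO k)ˣ} (hA : A.det = algebraMap (OO k) (FF k) u) (hG : Aᵀ * toFF S * A = toFF G) :
    IsUnit G.det := by
  have : G.det = u * S.det * u := by
    apply algebraMap_injective_OO (k := k)
    rw [← det_toFF, ← hG, det_mul, det_mul, det_transpose, hA, det_toFF, map_mul, map_mul]
  rw [this]
  exact (u.isUnit.mul hS).mul u.isUnit

theorem exists_transpose_mul_mul_eq_J {R : Type*} [CommRing R] [IsDomain R]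
    [IsPrincipalIdealRing R] (A : Matrix ι ι R) (hA : Aᵀ = -A) (hA0 : ∀ i, A i i = 0)
    (hdet : IsUnit A.det) {n : ℕ} (σ : Fin n ⊕ Fin n ≃ ι) :
    ∃ C : Matrix ι ι R, IsUnit C.det ∧ Cᵀ * A * C = (Matrix.J (Fin n) R).submatrix σ.symm σ.symm := by
  obtain ⟨n', b, hb⟩ := exists_symplectic_basis (Matrix.toBilin' A)
    (toQuadraticMap_toBilin'_eq_zero A hA hA0) (by
      intro φ
      refine ⟨(A⁻¹)ᵀ.mulVec fun i => φ (Pi.single i 1), ?_⟩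
      refine LinearMap.pi_ext' fun i => LinearMap.ext_ring ?_
      simp only [LinearMap.comp_apply, LinearMap.single_apply, Matrix.toBilin'_apply']
      rw [mulVec_single_one, dotProduct_comm, mulVec_transpose, dotProduct_comm,
        ← dotProduct_mulVec]
      have : A⁻¹.mulVec (A.col i) = Pi.single i 1 := by
        rw [← mulVec_single_one, mulVec_mulVec, nonsing_inv_mul _ hdet, one_mulVec]
      rw [this, dotProduct_single_one])
  have hc : n' = n := by
    have h1 := Fintype.card_congr (b.indexEquiv (Pi.basisFun R ι))
    have h2 := Fintype.card_congr σ
    rw [← h2] at h1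
    simp only [Fintype.card_sum, Fintype.card_fin] at h1
    omega
  subst hc
  refine ⟨(Pi.basisFun R ι).toMatrix (b.reindex σ), ?_, ?_⟩
  · rw [← Module.Basis.det_apply]
    exact Module.Basis.isUnit_det _ _
  · ext i j
    rw [← col_gram_col, ← Matrix.toBilin'_apply']
    have h1 : ∀ j, ((Pi.basisFun R ι).toMatrix (b.reindex σ)).col j = b (σ.symm j) := by
      intro j
      ext i
      simp [Module.Basis.toMatrix_apply]
    rw [h1, h1, hb, submatrix_apply]

theorem det_J {n : ℕ} (R : Type*) [CommRing R] : (Matrix.J (Fin n) R).det = 1 :=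
  SymplecticGroup.det_eq_one (SymplecticGroup.J_mem _ _)

theorem det_submatrix_J {R : Type*} [CommRing R] {n : ℕ} (σ : Fin n ⊕ Fin n ≃ ι) :
    ((Matrix.J (Fin n) R).submatrix σ.symm σ.symm).det = 1 := by
  rw [det_submatrix_equiv_self, det_J]

theorem det_eq_one_of_preserves_alternating {R : Type*} [CommRing R] [IsDomain R]
    [IsPrincipalIdealRing R] {S : Matrix ι ι R} (hS : Sᵀ = -S) (hS0 : ∀ i, S i i = 0)
    (hdet : IsUnit S.det) {n : ℕ} (σ : Fin n ⊕ Fin n ≃ ι) {A : Matrix ι ι R}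
    (hA : Aᵀ * S * A = S) : A.det = 1 := by
  obtain ⟨C, hC, hCS⟩ := exists_transpose_mul_mul_eq_J S hS hS0 hdet σ
  set J := (Matrix.J (Fin n) R).submatrix σ.symm σ.symm with hJ
  have h1 : (C⁻¹ * A * C)ᵀ * J * (C⁻¹ * A * C) = J := by
    rw [← hCS]
    have h2 : C * C⁻¹ = 1 := mul_nonsing_inv _ hC
    have h3 : (C⁻¹)ᵀ * Cᵀ = 1 := by rw [← transpose_mul, h2, transpose_one]
    calc (C⁻¹ * A * C)ᵀ * (Cᵀ * S * C) * (C⁻¹ * A * C)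
        = Cᵀ * Aᵀ * ((C⁻¹)ᵀ * Cᵀ) * S * (C * C⁻¹) * A * C := by
          simp only [transpose_mul, mul_assoc]
      _ = Cᵀ * (Aᵀ * S * A) * C := by simp only [h2, h3, mul_one, mul_assoc]
      _ = Cᵀ * S * C := by rw [hA]
  have h4 : (C⁻¹ * A * C).submatrix σ σ ∈ Matrix.symplecticGroup (Fin n) R := by
    rw [SymplecticGroup.mem_iff']
    have h5 : Matrix.J (Fin n) R = J.submatrix σ σ := by simp [hJ]
    rw [h5, transpose_submatrix, submatrix_mul_equiv, submatrix_mul_equiv, h1]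
  have h6 := SymplecticGroup.det_eq_one h4
  rwa [det_submatrix_equiv_self, det_mul, det_mul, mul_right_comm, ← det_mul, nonsing_inv_mul _ hC,
    det_one, one_mul] at h6

theorem exists_preserving_of_alternating {T : (Fin 2 → ι) → ℤ}
    (hS : (gramMatrix T (OO k))ᵀ = -gramMatrix T (OO k)) (hS0 : ∀ i, gramMatrix T (OO k) i i = 0)
    (hdet : IsUnit (gramMatrix T (OO k)).det) {n : ℕ} (σ : Fin n ⊕ Fin n ≃ ι)
    (A : Matrix ι ι (FF k)) (hA : ∃ u : (OO k)ˣ, A.det = algebraMap (OO k) (FF k) u)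
    (h : ∀ s : Fin 2 → ι, tensorForm T (FF k) (fun j => A.col (s j)) ∈
        Set.range (algebraMap (OO k) (FF k))) :
    ∃ Q : Matrix ι ι (OO k), IsUnit Q.det ∧ (A * toFF Q).det = 1 ∧ Preserves T (A * toFF Q) := by
  obtain ⟨u, hu⟩ := hA
  obtain ⟨G, hG⟩ := exists_gram_integral h
  set S := gramMatrix T (OO k) with hSd
  have hSF : toFF S = gramMatrix T (FF k) := gramMatrix_map T _
  rw [← hSF] at hG
  have hGd : IsUnit G.det := isUnit_det_gram hdet hu hG
  have hGS : Gᵀ = -G := by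
    apply toFF_injective (k := k)
    have h4 : (toFF S)ᵀ = -toFF S := by rw [← toFF_neg, ← hS, toFF_transpose]
    rw [toFF_neg, toFF_transpose, ← hG, transpose_mul, transpose_mul, transpose_transpose, h4]
    simp [mul_assoc]
  have hG0 : ∀ i, G i i = 0 := by
    intro i
    apply algebraMap_injective_OO (k := k)
    have h1 := congrFun (congrFun hG i) i
    rw [← col_gram_col, ← Matrix.toBilin'_apply'] at h1
    rw [map_zero]
    refine h1.symm.trans ?_
    refine toQuadraticMap_toBilin'_eq_zero _ ?_ ?_ _
    · rw [← toFF_neg, ← hS, toFF_transpose]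
    · intro i
      rw [toFF, map_apply, hS0, map_zero]
  obtain ⟨C, hC, hCG⟩ := exists_transpose_mul_mul_eq_J G hGS hG0 hGd σ
  obtain ⟨D, hD, hDS⟩ := exists_transpose_mul_mul_eq_J S hS hS0 hdet σ
  rw [← hCG] at hDS
  have hD1 : D * D⁻¹ = 1 := mul_nonsing_inv _ hD
  have hQ : (C * D⁻¹)ᵀ * G * (C * D⁻¹) = S := by
    calc (C * D⁻¹)ᵀ * G * (C * D⁻¹) = (D⁻¹)ᵀ * (Cᵀ * G * C) * D⁻¹ := by
          simp only [transpose_mul, mul_assoc]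
      _ = (D * D⁻¹)ᵀ * S * (D * D⁻¹) := by rw [← hDS]; simp only [transpose_mul, mul_assoc]
      _ = S := by simp [hD1]
  have hpres : (A * toFF (C * D⁻¹))ᵀ * toFF S * (A * toFF (C * D⁻¹)) = toFF S := by
    calc (A * toFF (C * D⁻¹))ᵀ * toFF S * (A * toFF (C * D⁻¹))
        = (toFF (C * D⁻¹))ᵀ * (Aᵀ * toFF S * A) * toFF (C * D⁻¹) := by
          simp only [transpose_mul, mul_assoc]
      _ = toFF ((C * D⁻¹)ᵀ * G * (C * D⁻¹)) := by
          rw [hG, toFF_mul (_ * _), toFF_mul _ G, toFF_transpose]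
      _ = toFF S := by rw [hQ]
  refine ⟨C * D⁻¹, ?_, ?_, ?_⟩
  · rw [det_mul]
    exact hC.mul (isUnit_nonsing_inv_det _ hD)
  · refine det_eq_one_of_preserves_alternating (S := toFF S) ?_ ?_ ?_ σ hpres
    · rw [← toFF_neg, ← hS, toFF_transpose]
    · intro i
      rw [toFF, map_apply, hS0, map_zero]
    · rw [det_toFF]
      exact hdet.map _
  · rw [preserves_two_iff, ← hSF]
    exact hpres

theorem exists_preserving_of_symmetric (h2 : (2 : k) ≠ 0) {T : (Fin 2 → ι) → ℤ}
    (hS : (gramMatrix T (OO k))ᵀ = gramMatrix T (OO k))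
    (hdet : IsUnit (gramMatrix T (OO k)).det)
    (c : ι → (OO k)ˣ) (e : ι → ι → FF k)
    (he : ∀ i j, e i ⬝ᵥ (gramMatrix T (FF k)).mulVec (e j) =
      if i = j then algebraMap (OO k) (FF k) (c i) else 0)
    (R : Matrix ι ι (OO k)) (hR : Rᵀ * gramMatrix T (OO k) * R = gramMatrix T (OO k))
    (hRd : R.det = -1)
    (A : Matrix ι ι (FF k)) (hA : ∃ u : (OO k)ˣ, A.det = algebraMap (OO k) (FF k) u)
    (h : ∀ s : Fin 2 → ι, tensorForm T (FF k) (fun j => A.col (s j)) ∈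
        Set.range (algebraMap (OO k) (FF k))) :
    ∃ Q : Matrix ι ι (OO k), IsUnit Q.det ∧ (A * toFF Q).det = 1 ∧ Preserves T (A * toFF Q) := by
  obtain ⟨u, hu⟩ := hA
  obtain ⟨G, hG⟩ := exists_gram_integral h
  set S := gramMatrix T (OO k) with hSd
  have hSF : toFF S = gramMatrix T (FF k) := gramMatrix_map T _
  rw [← hSF] at hG he
  obtain ⟨Q, hQ, hQS⟩ := exists_isometric_basis_of_symm h2 hS hdet c e he hu hG
  have hdetS : (toFF S).det ≠ 0 := by
    rw [det_toFF]
    exact (hdet.map _).ne_zero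
  have hd := congrArg det hQS
  rw [det_mul, det_mul, det_transpose] at hd
  have hd2 : ((A * toFF Q).det - 1) * ((A * toFF Q).det + 1) = 0 := by
    apply mul_left_cancel₀ hdetS
    linear_combination hd
  rcases mul_eq_zero.1 hd2 with h3 | h3
  · exact ⟨Q, hQ, sub_eq_zero.1 h3, (preserves_two_iff _ _).2 (by rw [← hSF, hQS])⟩
  · refine ⟨Q * R, ?_, ?_, ?_⟩
    · rw [det_mul, hRd]
      exact hQ.mul isUnit_one.neg
    · rw [toFF_mul, ← mul_assoc, det_mul, eq_neg_of_add_eq_zero_left h3, det_toFF, hRd]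
      simp
    · rw [toFF_mul, ← mul_assoc]
      refine Preserves.mul ((preserves_two_iff _ _).2 (by rw [← hSF, hQS])) ?_
      rw [preserves_two_iff, ← hSF]
      calc (toFF R)ᵀ * toFF S * toFF R = toFF (Rᵀ * S * R) := by
            rw [toFF_mul (_ * _), toFF_mul _ S, toFF_transpose]
        _ = toFF S := by rw [hR]

end Gram

/-! ### The standard bilinear forms -/

section StandardGram

open Matrix

variable (R : Type*) [CommRing R]

theorem neg_one_pow_congr {i j : ℕ} (h : i % 2 = j % 2) : (-1 : R) ^ i = (-1) ^ j := by
  rw [neg_one_pow_eq_pow_mod_two, h, ← neg_one_pow_eq_pow_mod_two]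

theorem spGram_apply (n : ℕ) (i j : Fin (2 * n)) : gramMatrix (spTensor n) R i j =
    if (i : ℕ) + j + 1 = 2 * n then (-1) ^ (j : ℕ) else 0 := by
  simp [gramMatrix, spTensor]

theorem soOddGram_apply (n : ℕ) (i j : Fin (2 * n + 1)) : gramMatrix (soOddTensor n) R i j =
    if (i : ℕ) + j = 2 * n then (-1) ^ (j : ℕ) else 0 := by
  simp [gramMatrix, soOddTensor]

theorem soEvenGram_apply (m : ℕ) (i j : Fin (2 * (m + 1))) :
    gramMatrix (soEvenTensor m) R i j = if (i : ℕ) + j = 2 * m then (-1) ^ (j : ℕ)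
      else if (i : ℕ) = 2 * m + 1 ∧ (j : ℕ) = 2 * m + 1 then 1 else 0 := by
  simp [gramMatrix, soEvenTensor]

theorem spGram_transpose (n : ℕ) : (gramMatrix (spTensor n) R)ᵀ = -gramMatrix (spTensor n) R := by
  ext i j
  rw [transpose_apply, Matrix.neg_apply, spGram_apply, spGram_apply]
  by_cases h : (i : ℕ) + j + 1 = 2 * n
  · rw [if_pos h, if_pos (by omega), neg_one_pow_congr R (j := (j : ℕ) + 1) (by omega), pow_succ]
    ring
  · rw [if_neg h, if_neg (by omega), neg_zero]

theorem spGram_diag (n : ℕ) (i : Fin (2 * n)) : gramMatrix (spTensor n) R i i = 0 := by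
  rw [spGram_apply, if_neg (by omega)]

theorem soOddGram_transpose (n : ℕ) :
    (gramMatrix (soOddTensor n) R)ᵀ = gramMatrix (soOddTensor n) R := by
  ext i j
  rw [transpose_apply, soOddGram_apply, soOddGram_apply]
  by_cases h : (i : ℕ) + j = 2 * n
  · rw [if_pos h, if_pos (by omega), neg_one_pow_congr R (j := (j : ℕ)) (by omega)]
  · rw [if_neg h, if_neg (by omega)]

theorem soEvenGram_transpose (m : ℕ) :
    (gramMatrix (soEvenTensor m) R)ᵀ = gramMatrix (soEvenTensor m) R := by
  ext i j
  rw [transpose_apply, soEvenGram_apply, soEvenGram_apply]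
  by_cases h : (i : ℕ) + j = 2 * m
  · rw [if_pos h, if_pos (by omega), neg_one_pow_congr R (j := (j : ℕ)) (by omega)]
  · rw [if_neg h, if_neg (by omega)]
    simp only [and_comm]

theorem soOddGram_mul_self (n : ℕ) :
    gramMatrix (soOddTensor n) R * gramMatrix (soOddTensor n) R = 1 := by
  ext i j
  rw [mul_apply, Finset.sum_eq_single (⟨2 * n - i, by omega⟩ : Fin (2 * n + 1))]
  · rw [soOddGram_apply, soOddGram_apply, one_apply, if_pos (by simp; omega)]
    by_cases h : i = j
    · subst h
      rw [if_pos rfl, if_pos (by simp; omega), ← pow_add, Even.neg_one_pow]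
      rw [Nat.even_iff]
      simp only
      omega
    · rw [if_neg h, if_neg (by simp only; omega), mul_zero]
  · intro l _ hl
    rw [soOddGram_apply, if_neg, zero_mul]
    intro h
    apply hl
    ext
    simp only
    omega
  · simp

theorem soEvenGram_castSucc (m : ℕ) (i j : Fin (2 * m + 1)) :
    gramMatrix (soEvenTensor m) R (Fin.castSucc i) (Fin.castSucc j) =
      gramMatrix (soOddTensor m) R i j := by
  rw [soEvenGram_apply, soOddGram_apply]
  simp only [Fin.val_castSucc]
  have hi : (i : ℕ) < 2 * m + 1 := i.2
  refine if_congr Iff.rfl rfl (if_neg (by omega))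

theorem soEvenGram_castSucc_last (m : ℕ) (i : Fin (2 * m + 1)) :
    gramMatrix (soEvenTensor m) R (Fin.castSucc i) (Fin.last (2 * m + 1)) = 0 := by
  have hi : (i : ℕ) < 2 * m + 1 := i.2
  rw [soEvenGram_apply, if_neg (by simp only [Fin.val_castSucc, Fin.val_last]; omega),
    if_neg (by simp only [Fin.val_castSucc, Fin.val_last]; omega)]

theorem soEvenGram_last_castSucc (m : ℕ) (i : Fin (2 * m + 1)) :
    gramMatrix (soEvenTensor m) R (Fin.last (2 * m + 1)) (Fin.castSucc i) = 0 := by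
  rw [← soEvenGram_transpose, transpose_apply, soEvenGram_castSucc_last]

theorem soEvenGram_last_last (m : ℕ) :
    gramMatrix (soEvenTensor m) R (Fin.last (2 * m + 1)) (Fin.last (2 * m + 1)) = 1 := by
  rw [soEvenGram_apply, if_neg (by simp only [Fin.val_last]; omega),
    if_pos (by simp only [Fin.val_last, and_self])]

theorem soEvenGram_mul_self (m : ℕ) :
    gramMatrix (soEvenTensor m) R * gramMatrix (soEvenTensor m) R = 1 := by
  ext i j
  rw [mul_apply]
  refine (Fin.sum_univ_castSucc (n := 2 * m + 1) _).trans ?_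
  have h := fun i j => congrFun (congrFun (soOddGram_mul_self R m) i) j
  simp only [mul_apply] at h
  refine Fin.lastCases (n := 2 * m + 1) ?_ (fun i => ?_) i <;>
    refine Fin.lastCases (n := 2 * m + 1) ?_ (fun j => ?_) j
  · simp [soEvenGram_castSucc_last, soEvenGram_last_castSucc, soEvenGram_last_last]
  · simp only [soEvenGram_last_castSucc, soEvenGram_last_last, zero_mul, mul_zero,
      Finset.sum_const_zero, add_zero]
    rw [one_apply_ne]
    exact (Fin.castSucc_lt_last j).ne'
  · simp only [soEvenGram_castSucc_last, zero_mul, mul_zero, Finset.sum_const_zero, add_zero]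
    rw [one_apply_ne]
    exact (Fin.castSucc_lt_last i).ne
  · simp only [soEvenGram_castSucc, soEvenGram_castSucc_last, zero_mul, add_zero]
    rw [h, one_apply, one_apply]
    exact if_congr (Fin.castSucc_injective _).eq_iff.symm rfl rfl

theorem spGram_mul_self (n : ℕ) :
    gramMatrix (spTensor n) R * gramMatrix (spTensor n) R = -1 := by
  ext i j
  rw [mul_apply, Finset.sum_eq_single (⟨2 * n - 1 - i, by omega⟩ : Fin (2 * n))]
  · rw [spGram_apply, spGram_apply, Matrix.neg_apply, one_apply, if_pos (by simp only; omega)]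
    by_cases h : i = j
    · subst h
      rw [if_pos rfl, if_pos (by simp only; omega), ← pow_add, Odd.neg_one_pow]
      rw [Nat.odd_iff]
      simp only
      omega
    · rw [if_neg h, if_neg (by simp only; omega), mul_zero, neg_zero]
  · intro l _ hl
    rw [spGram_apply, if_neg, zero_mul]
    intro h
    apply hl
    ext
    simp only
    omega
  · simp

theorem isUnit_det_soOddGram (n : ℕ) : IsUnit (gramMatrix (soOddTensor n) R).det :=
  isUnit_det_of_left_inverse (soOddGram_mul_self R n)

theorem isUnit_det_soEvenGram (n : ℕ) : IsUnit (gramMatrix (soEvenTensor n) R).det :=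
  isUnit_det_of_left_inverse (soEvenGram_mul_self R n)

theorem isUnit_det_spGram (n : ℕ) : IsUnit (gramMatrix (spTensor n) R).det := by
  refine isUnit_det_of_left_inverse (B := -gramMatrix (spTensor n) R) ?_
  rw [neg_mul, spGram_mul_self, neg_neg]

theorem det_gramMatrix_map {ι : Type} [Fintype ι] [DecidableEq ι] (T : (Fin 2 → ι) → ℤ) :
    (gramMatrix T R).det = ((gramMatrix T ℤ).det : R) := by
  rw [← gramMatrix_map T (Int.castRingHom R), ← RingHom.mapMatrix_apply, ← RingHom.map_det]
  rfl

/-- The indices `0, …, n - 1` and `n, …, 2n - 1`. -/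
def finHalves (n : ℕ) : Fin n ⊕ Fin n ≃ Fin (2 * n) :=
  finSumFinEquiv.trans (finCongr (two_mul n).symm)

theorem det_spGram (n : ℕ) : (gramMatrix (spTensor n) R).det = 1 := by
  rw [det_gramMatrix_map]
  obtain ⟨C, hC, hCS⟩ := exists_transpose_mul_mul_eq_J (gramMatrix (spTensor n) ℤ)
    (spGram_transpose ℤ n) (spGram_diag ℤ n) (isUnit_det_spGram ℤ n) (finHalves n)
  have h := congrArg det hCS
  rw [det_submatrix_J, det_mul, det_mul, det_transpose] at h
  rcases Int.isUnit_iff.1 hC with h1 | h1 <;> rw [h1] at h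
  · have : (gramMatrix (spTensor n) ℤ).det = 1 := by linear_combination h
    simp [this]
  · have : (gramMatrix (spTensor n) ℤ).det = 1 := by linear_combination h
    simp [this]

theorem det_soOddGram (n : ℕ) : (gramMatrix (soOddTensor n) R).det = 1 := by
  induction n with
  | zero =>
    refine (det_fin_one _).trans ?_
    rw [soOddGram_apply]
    simp
  | succ n ih =>
    have h1 : (gramMatrix (soOddTensor (n + 1)) R).det =
        ((gramMatrix (soOddTensor (n + 1)) R).submatrix Fin.succ Fin.castSucc).det := by
      refine (det_succ_row_zero (n := 2 * n + 2) _).trans ?_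
      rw [Finset.sum_eq_single (Fin.last (2 * n + 2))]
      · rw [soOddGram_apply, if_pos (by simp; omega), Fin.succAbove_last, Fin.val_last,
          Even.neg_one_pow (by rw [Nat.even_iff]; omega), one_mul, one_mul]
      · intro j _ hj
        rw [soOddGram_apply, if_neg, mul_zero, zero_mul]
        intro h
        apply hj
        ext
        simp only [Fin.val_zero, Fin.val_last] at h ⊢
        omega
      · simp
    have h2 : ((gramMatrix (soOddTensor (n + 1)) R).submatrix Fin.succ Fin.castSucc).det =
        -(-gramMatrix (soOddTensor n) R).det := by
      refine (det_succ_row (n := 2 * n + 1) _ (Fin.last (2 * n + 1))).trans ?_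
      rw [Finset.sum_eq_single (0 : Fin (2 * n + 2))]
      · rw [submatrix_apply, soOddGram_apply, if_pos (by simp; omega), submatrix_submatrix,
          Fin.succAbove_last, Fin.val_last, Fin.val_zero, add_zero,
          Odd.neg_one_pow (by rw [Nat.odd_iff]; omega), Fin.castSucc_zero, Fin.val_zero, pow_zero,
          mul_one, neg_one_mul]
        congr 2
        ext i j
        simp only [submatrix_apply, soOddGram_apply, Matrix.neg_apply, Function.comp_apply,
          Fin.succ_castSucc, Fin.val_castSucc, Fin.val_succ, Fin.succAbove_zero, pow_succ]
        by_cases h : (i : ℕ) + j = 2 * n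
        · rw [if_pos h, if_pos (by omega)]
          ring
        · rw [if_neg h, if_neg (by omega), neg_zero]
      · intro j _ hj
        rw [submatrix_apply, soOddGram_apply, if_neg, mul_zero, zero_mul]
        intro h
        apply hj
        ext
        simp only [Fin.val_zero, Fin.succ_last, Fin.val_last, Fin.val_castSucc] at h ⊢
        omega
      · simp
    rw [h1, h2, det_neg, ih, Fintype.card_fin, Odd.neg_one_pow (by rw [Nat.odd_iff]; omega)]
    simp

theorem det_soEvenGram (m : ℕ) : (gramMatrix (soEvenTensor m) R).det = 1 := by
  refine (det_succ_row (n := 2 * m + 1) _ (Fin.last (2 * m + 1))).trans ?_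
  rw [Finset.sum_eq_single (Fin.last (2 * m + 1))]
  · rw [soEvenGram_last_last, Fin.succAbove_last, ← two_mul,
      Even.neg_one_pow (even_two_mul _), one_mul, one_mul, ← det_soOddGram R m]
    congr 1
    ext i j
    exact soEvenGram_castSucc R m i j
  · intro j _ hj
    obtain ⟨j, rfl⟩ := Fin.exists_castSucc_eq.2 hj
    rw [soEvenGram_last_castSucc, mul_zero, zero_mul]
  · simp

end StandardGram

/-! ### The square of the Pfaffian -/

section PfaffianSquare

open Matrix

theorem pfaffian_smul {R : Type*} [CommRing R] (c : R) (n : ℕ)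
    (A : Matrix (Fin (2 * n)) (Fin (2 * n)) R) : pfaffian n (c • A) = c ^ n * pfaffian n A := by
  induction n with
  | zero => simp [pfaffian]
  | succ n ih =>
    rw [pfaffian, pfaffian, Finset.mul_sum]
    refine Finset.sum_congr rfl fun j _ => ?_
    have : (c • A).submatrix (fun i : Fin (2 * n) => (j.succAbove i).succ)
        (fun i : Fin (2 * n) => (j.succAbove i).succ) =
      c • A.submatrix (fun i : Fin (2 * n) => (j.succAbove i).succ)
        (fun i : Fin (2 * n) => (j.succAbove i).succ) := rfl
    refine (congrArg (fun B => (-1) ^ (j : ℕ) * (c • A) 0 j.succ * pfaffian n B) this).trans ?_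
    rw [ih, Matrix.smul_apply, smul_eq_mul, pow_succ]
    ring

theorem pfaffian_map {R S : Type*} [CommRing R] [CommRing S] (f : R →+* S) (n : ℕ)
    (A : Matrix (Fin (2 * n)) (Fin (2 * n)) R) : pfaffian n (A.map f) = f (pfaffian n A) := by
  induction n with
  | zero => simp [pfaffian]
  | succ n ih =>
    rw [pfaffian, pfaffian, map_sum]
    refine Finset.sum_congr rfl fun j _ => ?_
    rw [map_mul, map_mul, map_pow, map_neg, map_one, ← ih]
    rfl

theorem pfaffian_spGram_sq (R : Type*) [CommRing R] (n : ℕ) :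
    pfaffian n (gramMatrix (spTensor n) R) ^ 2 = 1 := by
  induction n with
  | zero => simp [pfaffian]
  | succ n ih =>
    have h1 : pfaffian (n + 1) (gramMatrix (spTensor (n + 1)) R) =
        -((-1) ^ n * pfaffian n (gramMatrix (spTensor n) R)) := by
      rw [pfaffian, Finset.sum_eq_single (Fin.last (2 * n)), ← pfaffian_smul]
      · have h2 : (gramMatrix (spTensor (n + 1)) R).submatrix
            (fun i : Fin (2 * n) => ((Fin.last (2 * n)).succAbove i).succ)
            (fun i : Fin (2 * n) => ((Fin.last (2 * n)).succAbove i).succ) =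
            (-1 : R) • gramMatrix (spTensor n) R := by
          ext i j
          simp only [submatrix_apply, Fin.succAbove_last, Matrix.smul_apply, smul_eq_mul]
          refine (spGram_apply R (n + 1) _ _).trans ?_
          rw [spGram_apply]
          simp only [Fin.val_succ, Fin.val_castSucc, pow_succ]
          by_cases h : (i : ℕ) + j + 1 = 2 * n
          · rw [if_pos h, if_pos (by omega)]
            ring
          · rw [if_neg h, if_neg (by omega), mul_zero]
        have h3 : gramMatrix (spTensor (n + 1)) R 0 (Fin.last (2 * n)).succ = -1 := by
          refine (spGram_apply R (n + 1) 0 (Fin.last (2 * n + 1))).trans ?_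
          rw [if_pos (by simp only [Fin.val_zero, Fin.val_last]; omega), Fin.val_last,
            Odd.neg_one_pow (by rw [Nat.odd_iff]; omega)]
        refine (congrArg₂ (fun a B => (-1) ^ (Fin.last (2 * n) : ℕ) * a * pfaffian n B) h3 h2).trans ?_
        rw [Fin.val_last, Even.neg_one_pow (even_two_mul n)]
        ring
      · intro j _ hj
        have h3 : gramMatrix (spTensor (n + 1)) R 0 j.succ = 0 := by
          refine (spGram_apply R (n + 1) 0 j.succ).trans (if_neg ?_)
          intro h
          apply hj
          ext
          simp only [Fin.val_zero, Fin.val_succ, Fin.val_last] at h ⊢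
          omega
        rw [h3, mul_zero, zero_mul]
      · simp
    rw [h1, neg_sq, mul_pow, ih, ← pow_mul, mul_one, Even.neg_one_pow (even_two_mul n |> fun h => mul_comm 2 n ▸ h)]

theorem pfaffian_sq_of_det_ne_zero {K : Type*} [Field K] {n : ℕ}
    (A : Matrix (Fin (2 * n)) (Fin (2 * n)) K) (hA : Aᵀ = -A) (hA0 : ∀ i, A i i = 0)
    (hd : A.det ≠ 0) : pfaffian n A ^ 2 = A.det := by
  obtain ⟨C, hC, hCA⟩ := exists_transpose_mul_mul_eq_J A hA hA0 hd.isUnit (finHalves n)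
  obtain ⟨D, hD, hDS⟩ := exists_transpose_mul_mul_eq_J (gramMatrix (spTensor n) K)
    (spGram_transpose K n) (spGram_diag K n) (isUnit_det_spGram K n) (finHalves n)
  have h1 := pfaffian_transpose_mul_mul A C hA hA0
  have h2 := pfaffian_transpose_mul_mul _ D (spGram_transpose K n) (spGram_diag K n)
  rw [hCA, ← hDS, h2] at h1
  rw [← hDS] at hCA
  have h3 := congrArg det hCA
  rw [det_mul, det_mul, det_mul, det_mul, det_transpose, det_transpose, det_spGram] at h3
  have h4 := congrArg (· ^ 2) h1
  simp only [mul_pow, pfaffian_spGram_sq, mul_one] at h4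
  have h5 : C.det ^ 2 ≠ 0 := pow_ne_zero 2 hC.ne_zero
  apply mul_left_cancel₀ h5
  linear_combination -h4 - h3

theorem pfaffian_sq {K : Type*} [Field K] {n : ℕ}
    (A : Matrix (Fin (2 * n)) (Fin (2 * n)) K) (hA : Aᵀ = -A) (hA0 : ∀ i, A i i = 0) :
    pfaffian n A ^ 2 = A.det := by
  let P : Matrix (Fin (2 * n)) (Fin (2 * n)) K[X] :=
    (Polynomial.X : K[X]) • (gramMatrix (spTensor n) K).map Polynomial.C + A.map Polynomial.C
  have hP : P.det ≠ 0 := by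
    intro h
    have h1 := Polynomial.coeff_det_X_add_C_card (gramMatrix (spTensor n) K) A
    rw [show det _ = P.det from rfl, h, det_spGram] at h1
    simp at h1
  have hPt : Pᵀ = -P := by
    have h1 := spGram_transpose K n
    ext i j : 1
    have h2 := congrFun (congrFun h1 i) j
    have h3 := congrFun (congrFun hA i) j
    simp only [transpose_apply, Matrix.neg_apply] at h2 h3
    simp only [P, transpose_apply, Matrix.add_apply, Matrix.smul_apply, map_apply, h2, h3,
      Matrix.neg_apply, map_neg, smul_eq_mul]
    ring
  have hP0 : ∀ i, P i i = 0 := by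
    intro i
    simp [P, spGram_diag, hA0]
  let ι := algebraMap K[X] (FractionRing K[X])
  have hinj : Function.Injective ι := IsFractionRing.injective _ _
  have h1 := pfaffian_sq_of_det_ne_zero (P.map ι)
    (by rw [← transpose_map, hPt]; ext; simp) (by simp [hP0])
    (by rw [← RingHom.mapMatrix_apply, ← RingHom.map_det]; exact (map_ne_zero_iff _ hinj).2 hP)
  rw [pfaffian_map, ← RingHom.mapMatrix_apply, ← RingHom.map_det, ← map_pow] at h1
  have h2 := congrArg (Polynomial.evalRingHom (0 : K)) (hinj h1)
  have h3 : P.map (Polynomial.evalRingHom (0 : K)) = A := by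
    ext
    simp [P]
  rwa [map_pow, ← pfaffian_map, RingHom.map_det, RingHom.mapMatrix_apply, h3] at h2

end PfaffianSquare

/-! ### Lattices in the standard bilinear spaces -/

section StandardLattice

open Matrix

theorem exists_orthogonal_of_paired {ι : Type} [Fintype ι] [LinearOrder ι] {R : Type*} [CommRing R]
    (h2 : IsUnit (2 : R)) {S : Matrix ι ι R} (hS : Sᵀ = S) (ρ : ι → ι) (hρ : ∀ i, ρ (ρ i) = i)
    (hS0 : ∀ i j, j ≠ ρ i → S i j = 0) (hSu : ∀ i, IsUnit (S i (ρ i))) :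
    ∃ (c : ι → Rˣ) (e : ι → ι → R), ∀ i j,
      e i ⬝ᵥ S.mulVec (e j) = if i = j then (c i : R) else 0 := by
  let s : ι → R := fun i => if i < ρ i then 1 else if ρ i < i then -1 else 0
  let e : ι → ι → R := fun i => Pi.single i 1 + s i • Pi.single (ρ i) 1
  have key : ∀ i j, e i ⬝ᵥ S.mulVec (e j) =
      S i j + s j * S i (ρ j) + (s i * S (ρ i) j + s i * (s j * S (ρ i) (ρ j))) := by
    intro i j
    simp only [e, mulVec_add, mulVec_smul, mulVec_single_one, add_dotProduct, dotProduct_add,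
      smul_dotProduct, dotProduct_smul, single_one_dotProduct, smul_eq_mul, col_apply]
    ring
  have hsym : ∀ i, S (ρ i) i = S i (ρ i) := fun i => congrFun (congrFun hS i) (ρ i)
  have hfix : ∀ i, ρ i = i → s i = 0 := fun i hi => by simp [s, hi]
  have hsneg : ∀ i, s (ρ i) = -s i := by
    intro i
    simp only [s, hρ]
    rcases lt_trichotomy i (ρ i) with h | h | h
    · simp [h, h.not_gt]
    · simp [← h]
    · simp [h, h.not_gt]
  have hsu : ∀ i, ρ i ≠ i → IsUnit (s i) := by
    intro i hi
    rcases lt_trichotomy i (ρ i) with h | h | h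
    · simp [s, h]
    · exact absurd h.symm hi
    · simp [s, h, h.not_gt]
  have hu : ∀ i, IsUnit (if ρ i = i then S i i else 2 * s i * S i (ρ i)) := by
    intro i
    by_cases hi : ρ i = i
    · rw [if_pos hi]
      simpa [hi] using hSu i
    · rw [if_neg hi]
      exact (h2.mul (hsu i hi)).mul (hSu i)
  refine ⟨fun i => (hu i).unit, e, fun i j => ?_⟩
  rw [key, IsUnit.unit_spec]
  by_cases hij : i = j
  · subst hij
    rw [if_pos rfl]
    by_cases hi : ρ i = i
    · rw [if_pos hi, hfix i hi]
      ring
    · rw [if_neg hi, hS0 i i (Ne.symm hi), hS0 (ρ i) (ρ i) (by rw [hρ]; exact hi), hsym]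
      ring
  · rw [if_neg hij, hS0 i (ρ j) (fun h => hij (by rw [← hρ i, ← h, hρ])), hS0 (ρ i) j
      (fun h => hij (by rw [h, hρ]))]
    by_cases hj : j = ρ i
    · subst hj
      rw [hρ, hsym, hsneg]
      have : s i * s i * S i (ρ i) = S i (ρ i) := by
        rcases lt_trichotomy i (ρ i) with h | h | h
        · simp [s, h]
        · exact absurd h hij
        · simp [s, h, h.not_gt]
      linear_combination -this
    · rw [hS0 i j hj, hS0 (ρ i) (ρ j) (fun h => hj (by rw [hρ] at h; rw [← h, hρ]))]
      ring

variable {k : Type*} [Field k]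

theorem soOdd_exists_preserving (h2 : (2 : k) ≠ 0) (n : ℕ)
    (A : Matrix (Fin (2 * n + 1)) (Fin (2 * n + 1)) (FF k))
    (hA : ∃ u : (OO k)ˣ, A.det = algebraMap (OO k) (FF k) u)
    (h : ∀ s : Fin 2 → Fin (2 * n + 1), tensorForm (soOddTensor n) (FF k) (fun j => A.col (s j)) ∈
        Set.range (algebraMap (OO k) (FF k))) :
    ∃ Q : Matrix (Fin (2 * n + 1)) (Fin (2 * n + 1)) (OO k), IsUnit Q.det ∧
      (A * toFF Q).det = 1 ∧ Preserves (soOddTensor n) (A * toFF Q) := by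
  obtain ⟨c, e, hce⟩ := exists_orthogonal_of_paired (isUnit_two_OO h2)
    (soOddGram_transpose (OO k) n) (fun i => ⟨2 * n - i, by omega⟩)
    (fun i => Fin.ext (by simp only; omega))
    (fun i j hij => by
      rw [soOddGram_apply, if_neg]
      exact fun h => hij (Fin.ext (by simp only; omega)))
    (fun i => by
      rw [soOddGram_apply, if_pos (by simp only; omega)]
      exact isUnit_one.neg.pow _)
  refine exists_preserving_of_symmetric h2 (soOddGram_transpose _ n) (isUnit_det_soOddGram _ n) c
    (fun i => vecToFF (e i)) ?_ (-1) (by simp) ?_ A hA h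
  · intro i j
    rw [← gramMatrix_map _ (algebraMap (OO k) (FF k))]
    refine (congrArg _ (toFF_mulVec _ _)).trans ?_
    rw [vecToFF_dotProduct, hce, apply_ite (algebraMap (OO k) (FF k)), map_zero]
  · rw [det_neg, det_one, Fintype.card_fin, Odd.neg_one_pow (odd_two_mul_add_one n), mul_one]

theorem soEven_exists_preserving (h2 : (2 : k) ≠ 0) (m : ℕ)
    (A : Matrix (Fin (2 * (m + 1))) (Fin (2 * (m + 1))) (FF k))
    (hA : ∃ u : (OO k)ˣ, A.det = algebraMap (OO k) (FF k) u)
    (h : ∀ s : Fin 2 → Fin (2 * (m + 1)), tensorForm (soEvenTensor m) (FF k)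
      (fun j => A.col (s j)) ∈ Set.range (algebraMap (OO k) (FF k))) :
    ∃ Q : Matrix (Fin (2 * (m + 1))) (Fin (2 * (m + 1))) (OO k), IsUnit Q.det ∧
      (A * toFF Q).det = 1 ∧ Preserves (soEvenTensor m) (A * toFF Q) := by
  obtain ⟨c, e, hce⟩ := exists_orthogonal_of_paired (isUnit_two_OO h2)
    (soEvenGram_transpose (OO k) m)
    (fun i => if (i : ℕ) = 2 * m + 1 then i else ⟨2 * m - i, by omega⟩)
    (fun i => by
      by_cases hi : (i : ℕ) = 2 * m + 1
      · simp only [if_pos hi]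
      · simp only [if_neg hi]
        rw [if_neg (by omega)]
        exact Fin.ext (by simp only; omega))
    (fun i j hij => by
      rw [soEvenGram_apply]
      by_cases hi : (i : ℕ) = 2 * m + 1
      · rw [if_neg (by omega), if_neg]
        simp only [if_pos hi] at hij
        exact fun h => hij (Fin.ext (by omega))
      · simp only [if_neg hi] at hij
        rw [if_neg, if_neg (by omega)]
        exact fun h => hij (Fin.ext (by simp only; omega)))
    (fun i => by
      rw [soEvenGram_apply]
      by_cases hi : (i : ℕ) = 2 * m + 1
      · rw [if_pos hi, if_neg (by omega), if_pos ⟨hi, hi⟩]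
        exact isUnit_one
      · rw [if_neg hi, if_pos (by simp only; omega)]
        exact isUnit_one.neg.pow _)
  let d : Fin (2 * (m + 1)) → OO k := fun i => if i = Fin.last (2 * m + 1) then -1 else 1
  refine exists_preserving_of_symmetric h2 (soEvenGram_transpose _ m) (isUnit_det_soEvenGram _ m) c
    (fun i => vecToFF (e i)) ?_ (Matrix.diagonal d) ?_ ?_ A hA h
  · intro i j
    rw [← gramMatrix_map _ (algebraMap (OO k) (FF k))]
    refine (congrArg _ (toFF_mulVec _ _)).trans ?_
    rw [vecToFF_dotProduct, hce, apply_ite (algebraMap (OO k) (FF k)), map_zero]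
  · ext i j
    rw [diagonal_transpose, mul_diagonal, diagonal_mul, soEvenGram_apply]
    simp only [d, Fin.ext_iff, Fin.val_last]
    by_cases h1 : (i : ℕ) + j = 2 * m
    · rw [if_pos h1, if_neg (by omega), if_neg (by omega)]
      ring_nf
    · rw [if_neg h1]
      by_cases h3 : (i : ℕ) = 2 * m + 1 ∧ (j : ℕ) = 2 * m + 1
      · rw [if_pos h3, if_pos h3.1, if_pos h3.2]
        ring_nf
      · rw [if_neg h3]
        ring_nf
  · rw [det_diagonal]
    refine (Finset.prod_eq_single (Fin.last (2 * m + 1)) ?_ ?_).trans ?_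
    · intro i _ hi
      simp only [d, if_neg hi]
    · simp
    · simp [d]

theorem sp_exists_preserving (n : ℕ) (A : Matrix (Fin (2 * n)) (Fin (2 * n)) (FF k))
    (hA : ∃ u : (OO k)ˣ, A.det = algebraMap (OO k) (FF k) u)
    (h : ∀ s : Fin 2 → Fin (2 * n), tensorForm (spTensor n) (FF k) (fun j => A.col (s j)) ∈
        Set.range (algebraMap (OO k) (FF k))) :
    ∃ Q : Matrix (Fin (2 * n)) (Fin (2 * n)) (OO k), IsUnit Q.det ∧
      (A * toFF Q).det = 1 ∧ Preserves (spTensor n) (A * toFF Q) :=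
  exists_preserving_of_alternating (spGram_transpose _ n) (spGram_diag _ n) (isUnit_det_spGram _ n)
    (finHalves n) A hA h

end StandardLattice

/-! ### Square roots of unipotent matrices -/

section SquareRoot

open Matrix

variable {ι : Type} [Fintype ι] [DecidableEq ι] {R : Type*} [CommRing R]

theorem isNilpotent_of_strictUpper {d : ℕ} (N : Matrix (Fin d) (Fin d) R)
    (h : ∀ i j, j ≤ i → N i j = 0) : IsNilpotent N := by
  have h1 : N.charpoly = Polynomial.X ^ d := by
    rw [Matrix.charpoly_of_isUpperTriangular]
    · simp [h]
    · intro i j hij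
      exact h i j hij.le
  refine ⟨d, ?_⟩
  have h2 := N.aeval_self_charpoly
  rwa [h1, map_pow, Polynomial.aeval_X] at h2

theorem exists_isometric_of_unipotent (h2 : IsUnit (2 : R)) {S N : Matrix ι ι R}
    (hSN : Nᵀ * S = S * N) (hN : IsNilpotent N) :
    ∃ U : Matrix ι ι R, IsUnit U.det ∧ Uᵀ * (S * (1 + N)) * U = S := by
  let A := Algebra.adjoin R {N}
  let ν : A := ⟨N, Algebra.self_mem_adjoin_singleton R N⟩
  have : IsMulCommutative A := Algebra.isMulCommutative_adjoin R (by simp)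
  let _ : CommRing A := inferInstance
  have hν : IsNilpotent ν := by
    obtain ⟨n, hn⟩ := hN
    exact ⟨n, Subtype.ext (by simpa [ν] using hn)⟩
  have hu : IsUnit (1 + ν) := hν.isUnit_one_add
  have h2A : IsUnit (2 : A) := by
    have := h2.map (algebraMap R A)
    rwa [map_ofNat] at this
  obtain ⟨r, ⟨-, hr⟩, -⟩ := Polynomial.existsUnique_nilpotent_sub_and_aeval_eq_zero
    (P := (Polynomial.C (1 + ν) * Polynomial.X ^ 2 - 1 : A[X])) (x := (1 : A))
    (by simpa using hν) (by simpa [one_add_one_eq_two] using hu.mul h2A)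
  have hr' : (1 + ν) * r ^ 2 = 1 := by
    simpa [sub_eq_zero] using hr
  have hrN : (1 + N) * (r * r : Matrix ι ι R) = 1 := by
    have := congrArg (Subtype.val) hr'
    simpa [ν, pow_two] using this
  have hcomm : ∀ a ∈ A, aᵀ * S = S * a := by
    intro a ha
    induction ha using Algebra.adjoin_induction with
    | mem y hy => rw [Set.mem_singleton_iff.1 hy, hSN]
    | algebraMap c => simp [Algebra.algebraMap_eq_smul_one]
    | add a b _ _ ha hb => rw [transpose_add, add_mul, mul_add, ha, hb]
    | mul a b ha' hb' ha hb =>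
      have : a * b = b * a := congrArg Subtype.val (mul_comm (⟨a, ha'⟩ : A) ⟨b, hb'⟩)
      rw [transpose_mul, mul_assoc, ha, ← mul_assoc, hb, mul_assoc, ← this]
  refine ⟨r, ?_, ?_⟩
  · have h3 := congrArg det hrN
    rw [det_mul, det_mul, det_one] at h3
    exact IsUnit.of_mul_eq_one ((1 + N).det * (r : Matrix ι ι R).det) (by linear_combination h3)
  · have h3 : (r : Matrix ι ι R) * (1 + N) = (1 + N) * r :=
      congrArg Subtype.val (mul_comm r (1 + ν))
    calc (r : Matrix ι ι R)ᵀ * (S * (1 + N)) * r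
        = (r : Matrix ι ι R)ᵀ * S * (1 + N) * r := by simp only [mul_assoc]
      _ = S * (r * (1 + N)) * r := by rw [hcomm _ r.2]; simp only [mul_assoc]
      _ = S * ((1 + N) * (r * r)) := by rw [h3]; simp only [mul_assoc]
      _ = S := by rw [hrN, mul_one]

theorem exists_isometric_of_strictUpper (h2 : IsUnit (2 : R)) {d : ℕ}
    {S S' G : Matrix (Fin d) (Fin d) R} {ε : R} (hε : ε * ε = 1) (hSS : S * S' = 1)
    (hS : Sᵀ = ε • S) (hG : Gᵀ = ε • G)
    (h : ∀ i j, j ≤ i → ∀ l, S' i l * (G l j - S l j) = 0) :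
    ∃ U : Matrix (Fin d) (Fin d) R, IsUnit U.det ∧ Uᵀ * G * U = S := by
  have h1 : S * (S' * (G - S)) = G - S := by rw [← mul_assoc, hSS, one_mul]
  have h3 : S * (1 + S' * (G - S)) = G := by rw [mul_add, h1, mul_one, add_sub_cancel]
  rw [← h3]
  refine exists_isometric_of_unipotent h2 ?_ (isNilpotent_of_strictUpper _ fun i j hij => ?_)
  · have hS2 : S = ε • Sᵀ := by rw [hS, smul_smul, hε, one_smul]
    calc (S' * (G - S))ᵀ * S = (S' * (G - S))ᵀ * (ε • Sᵀ) := by rw [← hS2]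
      _ = ε • (S * (S' * (G - S)))ᵀ := by rw [Matrix.mul_smul, ← transpose_mul]
      _ = S * (S' * (G - S)) := by
        rw [h1, transpose_sub, hS, hG, ← smul_sub, smul_smul, hε, one_smul]
  · rw [mul_apply]
    exact Finset.sum_eq_zero fun l _ => h i j hij l

theorem exists_basis_of_gram_eq {M : Type*} [AddCommGroup M] [Module R M]
    (ω : LinearMap.BilinForm R M) (b : Module.Basis ι R M) (U S : Matrix ι ι R)
    (hU : IsUnit U.det) (h : Uᵀ * (Matrix.of fun i j => ω (b i) (b j)) * U = S) :
    ∃ c : Module.Basis ι R M, ∀ i j, ω (c i) (c j) = S i j := by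
  let v : ι → M := fun j => ∑ i, U i j • b i
  have hv : b.toMatrix v = U := by
    ext i j
    simp [v, Module.Basis.toMatrix_apply, Finsupp.single_apply]
  have hb : IsUnit (b.det v) := by rwa [Module.Basis.det_apply, hv]
  obtain ⟨hli, hsp⟩ := (Module.Basis.is_basis_iff_det b).2 hb
  refine ⟨Module.Basis.mk hli hsp.ge, fun i j => ?_⟩
  rw [Module.Basis.mk_apply, Module.Basis.mk_apply, ← h]
  simp only [v, map_sum, LinearMap.sum_apply, map_smul, LinearMap.smul_apply, smul_eq_mul,
    mul_apply, transpose_apply, of_apply, Finset.mul_sum, Finset.sum_mul]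
  exact Finset.sum_congr rfl fun l _ => Finset.sum_congr rfl fun l' _ => by ring

end SquareRoot

/-! ### Bases of `B` and of `B ⊗ F` -/

section BaseChange

open Module

variable {k : Type*} [Field k] {B : Type*} [CommRing B] [Algebra (OO k) B]
  {ι : Type} [Fintype ι] [DecidableEq ι]

theorem toGeneric_apply (x : B) : toGeneric (k := k) B x = 1 ⊗ₜ x := rfl

theorem span_baseChange (b : Basis ι (OO k) B) :
    Submodule.span (OO k) (Set.range (b.baseChange (FF k))) = baseLattice B := by
  have h1 : ⇑(b.baseChange (FF k)) = (toGeneric B).toLinearMap ∘ b := by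
    funext i
    rw [Basis.baseChange_apply]
    rfl
  rw [h1, Set.range_comp, Submodule.span_image, b.span_eq, Submodule.map_top, baseLattice]

theorem toMatrix_mulLeft_baseChange (b : Basis ι (OO k) B) (x : B) :
    LinearMap.toMatrix (b.baseChange (FF k)) (b.baseChange (FF k))
      (LinearMap.mulLeft (FF k) (toGeneric B x)) = toFF (Algebra.leftMulMatrix b x) := by
  have h1 : LinearMap.mulLeft (FF k) (toGeneric B x) =
      (LinearMap.mulLeft (OO k) x).baseChange (FF k) := by
    ext y
    simp [toGeneric_apply]
  ext i j
  rw [h1, LinearMap.toMatrix_apply, Basis.baseChange_apply, LinearMap.baseChange_tmul,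
    Basis.baseChange_repr_tmul, toFF, Matrix.map_apply, Algebra.leftMulMatrix_eq_repr_mul,
    LinearMap.mulLeft_apply, Algebra.smul_def, mul_one]

theorem charpoly_toFF (A : Matrix ι ι (OO k)) :
    (toFF A).charpoly = A.charpoly.map (algebraMap (OO k) (FF k)) :=
  Matrix.charpoly_map A _

theorem baseLattice_mul_mem (x : B) {v : FF k ⊗[OO k] B} (hv : v ∈ baseLattice B) :
    toGeneric B x * v ∈ baseLattice B := by
  obtain ⟨y, rfl⟩ := hv
  exact ⟨x * y, by simp⟩

theorem charpoly_leftMulMatrix_root {R : Type*} [CommRing R] [IsDomain R] {f : R[X]}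
    (hf : f.Monic) (b : Basis ι R (AdjoinRoot f)) (hd : f.natDegree = Fintype.card ι) :
    (Algebra.leftMulMatrix b (AdjoinRoot.root f)).charpoly = f := by
  refine Polynomial.eq_of_monic_of_dvd_of_natDegree_le hf (Matrix.charpoly_monic _) ?_ ?_
  · rw [← AdjoinRoot.mk_eq_zero, ← AdjoinRoot.aeval_eq]
    apply (injective_iff_map_eq_zero _).1 (Algebra.leftMulMatrix_injective b)
    rw [← Polynomial.aeval_algHom_apply, Matrix.aeval_self_charpoly]
  · rw [Matrix.charpoly_natDegree_eq_dim, hd]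

theorem adjoin_root_eq_top {R : Type*} [CommRing R] (f : R[X]) :
    Algebra.adjoin R {AdjoinRoot.root f} = ⊤ := AdjoinRoot.adjoinRoot_eq_top

/-- The basis `1, x, …, x ^ (d - 1)`. -/
def monomialBasis {R : Type*} [CommRing R] {f : R[X]} (hf : f.Monic) {d : ℕ}
    (hd : f.natDegree = d) : Basis (Fin d) R (AdjoinRoot f) :=
  (AdjoinRoot.powerBasisAux' hf).reindex (finCongr hd)

theorem monomialBasis_apply {R : Type*} [CommRing R] {f : R[X]} (hf : f.Monic) {d : ℕ}
    (hd : f.natDegree = d) (i : Fin d) :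
    monomialBasis hf hd i = AdjoinRoot.root f ^ (i : ℕ) := by
  subst hd
  exact (AdjoinRoot.powerBasis' hf).basis_eq_pow i

theorem coeffFun_root_pow {R : Type*} [CommRing R] [Nontrivial R] {f : R[X]} (hf : f.Monic)
    (i j : ℕ) (hj : j < f.natDegree) :
    coeffFun hf i (AdjoinRoot.root f ^ j) = if i = j then 1 else 0 := by
  have hdeg : (Polynomial.X ^ j : R[X]).degree < f.degree := by
    rw [Polynomial.degree_X_pow, Polynomial.degree_eq_natDegree hf.ne_zero]
    exact_mod_cast hj
  rw [← AdjoinRoot.mk_X, ← map_pow, coeffFun, LinearMap.comp_apply, AdjoinRoot.modByMonicHom_mk,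
    (Polynomial.modByMonic_eq_self_iff hf).2 hdeg]
  simp [Polynomial.coeff_X_pow]

theorem involution_root {R : Type*} [CommRing R] {f : R[X]}
    (hτ : Polynomial.aeval (-AdjoinRoot.root f) f = 0) :
    involution hτ (AdjoinRoot.root f) = -AdjoinRoot.root f :=
  AdjoinRoot.liftAlgHom_root ..

theorem coeffFun_involution {R : Type*} [CommRing R] [Nontrivial R] {f : R[X]} (hf : f.Monic)
    (hτ : Polynomial.aeval (-AdjoinRoot.root f) f = 0) (i : ℕ) (b : AdjoinRoot f) :
    coeffFun hf i (involution hτ b) = (-1) ^ i * coeffFun hf i b := by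
  have h : coeffFun hf i ∘ₗ (involution hτ).toLinearMap = (-1 : R) ^ i • coeffFun hf i := by
    refine (monomialBasis hf rfl).ext fun j => ?_
    rw [monomialBasis_apply, LinearMap.comp_apply, AlgHom.toLinearMap_apply, map_pow, involution_root,
      neg_pow, ← map_one (algebraMap R _), ← map_neg, ← map_pow,
      ← Algebra.smul_def, map_smul, LinearMap.smul_apply, coeffFun_root_pow hf i j j.2]
    split_ifs with h
    · rw [h]
    · simp
  exact congrArg (fun φ => φ b) h

/-- The bilinear form `(b₁, b₂) ↦ φ(b₁ τ(b₂))`. -/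
def twistedForm {R A : Type*} [CommRing R] [CommRing A] [Algebra R A] (φ : A →ₗ[R] R)
    (τ : A →ₐ[R] A) : LinearMap.BilinForm R A :=
  LinearMap.mk₂ R (fun b c => φ (b * τ c)) (by intros; simp [add_mul]) (by intros; simp)
    (by intros; simp [mul_add]) (by intros; simp)

@[simp]
theorem twistedForm_apply {R A : Type*} [CommRing R] [CommRing A] [Algebra R A] (φ : A →ₗ[R] R)
    (τ : A →ₐ[R] A) (b c : A) : twistedForm φ τ b c = φ (b * τ c) := rfl

theorem extendScalars_toGeneric (φ : B →ₗ[OO k] OO k) (b : B) :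
    extendScalars φ (toGeneric B b) = algebraMap (OO k) (FF k) (φ b) := by
  simp [extendScalars, toGeneric_apply, Algebra.smul_def]

theorem extendInvolution_toGeneric (τ : B →ₐ[OO k] B) (b : B) :
    extendInvolution τ (toGeneric B b) = toGeneric B (τ b) := by
  simp [extendInvolution, toGeneric_apply]

/-- A bilinear form as a multilinear map. -/
def bilinMultilinear {R A : Type*} [CommRing R] [AddCommGroup A] [Module R A]
    (ω : LinearMap.BilinForm R A) : MultilinearMap R (fun _ : Fin 2 => A) R where
  toFun v := ω (v 0) (v 1)
  map_update_add' v i x y := by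
    fin_cases i <;> simp [Function.update]
  map_update_smul' v i c x := by
    fin_cases i <;> simp [Function.update]

@[simp]
theorem bilinMultilinear_apply {R A : Type*} [CommRing R] [AddCommGroup A] [Module R A]
    (ω : LinearMap.BilinForm R A) (v : Fin 2 → A) : bilinMultilinear ω v = ω (v 0) (v 1) := rfl

theorem bilinMultilinear_skew {R A : Type*} [CommRing R] [CommRing A] [Algebra R A] (φ : A →ₗ[R] R)
    (τ : A →ₐ[R] A) {x : A} (hx : τ x = -x) (v : Fin 2 → A) :
    ∑ j, bilinMultilinear (twistedForm φ τ) (Function.update v j (x * v j)) = 0 := by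
  simp [Fin.sum_univ_two, Function.update, hx]
  rw [← map_neg, ← map_add]
  convert map_zero φ using 2
  ring

theorem trace_eq_zero_of_charpoly {R : Type*} [CommRing R] {d : ℕ}
    {γ : Matrix (Fin d) (Fin d) R} (h : d ≠ 0 → γ.charpoly.coeff (d - 1) = 0) : γ.trace = 0 := by
  rcases Nat.eq_zero_or_pos d with rfl | hd
  · simp [Matrix.trace]
  · have : Nonempty (Fin d) := ⟨⟨0, hd⟩⟩
    rw [Matrix.trace_eq_neg_charpoly_coeff, Fintype.card_fin, h hd.ne', neg_zero]

end BaseChange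

/-! ### The companion section for `Sp` and odd `SO` -/

section Companion

open Module Matrix

theorem map_neg_one_pow_mul {R M A : Type*} [CommRing R] [AddCommGroup M] [Module R M]
    [CommRing A] [Algebra R A] (φ : A →ₗ[R] M) (i : ℕ) (x : A) :
    φ ((-1) ^ i * x) = (-1 : R) ^ i • φ x := by
  rw [← map_smul, Algebra.smul_def, map_pow, map_neg, map_one]

theorem exists_antidiagonal_basis {R : Type*} [CommRing R] [Nontrivial R] (h2 : IsUnit (2 : R))
    {f : R[X]} (hf : f.Monic) {d : ℕ} (hd : f.natDegree = d)
    (hτ : Polynomial.aeval (-AdjoinRoot.root f) f = 0) {S : Matrix (Fin d) (Fin d) R}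
    (hS : ∀ i j : Fin d, S i j = if (i : ℕ) + j + 1 = d then (-1) ^ (j : ℕ) else 0)
    (hSS : S * S = (-1 : R) ^ (d - 1) • (1 : Matrix (Fin d) (Fin d) R))
    (hST : Sᵀ = (-1 : R) ^ (d - 1) • S) :
    ∃ c : Basis (Fin d) R (AdjoinRoot f), ∀ i j,
      twistedForm (coeffFun hf (d - 1)) (involution hτ) (c i) (c j) = S i j := by
  set ω := twistedForm (coeffFun hf (d - 1)) (involution hτ)
  set b := monomialBasis hf hd
  have hε : (-1 : R) ^ (d - 1) * (-1) ^ (d - 1) = 1 := by rw [← mul_pow]; simp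
  have hpow : ∀ i : ℕ, (-1 : R) ^ i * (-1) ^ i = 1 := fun i => by rw [← mul_pow]; simp
  have hG : ∀ i j : Fin d, ω (b i) (b j) =
      (-1) ^ (j : ℕ) * coeffFun hf (d - 1) (AdjoinRoot.root f ^ ((i : ℕ) + j)) := by
    intro i j
    simp only [ω, b, twistedForm_apply, monomialBasis_apply, map_pow, involution_root]
    rw [neg_pow, mul_left_comm, ← pow_add, map_neg_one_pow_mul, smul_eq_mul]
  obtain ⟨U, hU, hUG⟩ := exists_isometric_of_strictUpper h2 (S := S)
    (S' := (-1 : R) ^ (d - 1) • S) (G := Matrix.of fun i j => ω (b i) (b j)) hε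
    (by rw [Matrix.mul_smul, hSS, smul_smul, hε, one_smul]) hST (by
      ext i j
      rw [transpose_apply, of_apply, Matrix.smul_apply, of_apply, hG, hG, smul_eq_mul]
      have h1 := coeffFun_involution hf hτ (d - 1) (AdjoinRoot.root f ^ ((i : ℕ) + j))
      rw [map_pow, involution_root, neg_pow, map_neg_one_pow_mul, smul_eq_mul, pow_add (-1 : R)] at h1
      rw [add_comm (j : ℕ) i, mul_left_comm, ← h1]
      linear_combination (-(-1 : R) ^ (i : ℕ) *
        coeffFun hf (d - 1) (AdjoinRoot.root f ^ ((i : ℕ) + j))) * hpow j) (by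
      intro i j hij l
      rw [Matrix.smul_apply, hS i l, of_apply, hG, hS l j]
      have hij' : (j : ℕ) ≤ i := hij
      by_cases h1 : (i : ℕ) + l + 1 = d
      · rw [coeffFun_root_pow hf _ _ (by omega)]
        by_cases h3 : (l : ℕ) + j + 1 = d
        · rw [if_pos (c := d - 1 = (l : ℕ) + j) (by omega), if_pos h3, mul_one, sub_self, mul_zero]
        · rw [if_neg (c := d - 1 = (l : ℕ) + j) (by omega), if_neg h3, mul_zero, sub_self,
            mul_zero]
      · rw [if_neg h1, smul_zero, zero_mul])
  exact exists_basis_of_gram_eq ω b U S hU hUG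

variable {k : Type*} [Field k]

theorem evenPoly_natDegree {R : Type*} [CommRing R] [Nontrivial R] {n : ℕ} (a : Fin n → R) :
    (evenPoly a).natDegree = 2 * n :=
  Polynomial.natDegree_eq_of_degree_eq_some (evenPoly_degree a)

theorem oddPoly_natDegree {R : Type*} [CommRing R] [Nontrivial R] {n : ℕ} (a : Fin n → R) :
    (oddPoly a).natDegree = 2 * n + 1 := by
  rw [oddPoly, Polynomial.natDegree_X_mul (evenPoly_monic a).ne_zero, evenPoly_natDegree]

theorem evenPoly_coeff_odd {R : Type*} [CommRing R] {n : ℕ} (a : Fin n → R) {i : ℕ}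
    (hi : i % 2 = 1) : (evenPoly a).coeff i = 0 := by
  rw [evenPoly, Polynomial.coeff_add, Polynomial.coeff_X_pow, if_neg (by omega), zero_add,
    Polynomial.finsetSum_coeff]
  refine Finset.sum_eq_zero fun j _ => ?_
  rw [Polynomial.coeff_C_mul, Polynomial.coeff_X_pow, if_neg (by omega), mul_zero]

theorem gram_of_basis {B : Type*} [CommRing B] [Algebra (OO k) B] {d : ℕ}
    {T : (Fin 2 → Fin d) → ℤ} {φ : B →ₗ[OO k] OO k} {τ : B →ₐ[OO k] B}
    {c : Basis (Fin d) (OO k) B}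
    (hc : ∀ i j, twistedForm φ τ (c i) (c j) = gramMatrix T (OO k) i j) (s : Fin 2 → Fin d) :
    twistedForm (extendScalars φ) (extendInvolution τ) (c.baseChange (FF k) (s 0))
      (c.baseChange (FF k) (s 1)) = (T s : FF k) := by
  have h1 : ∀ i, c.baseChange (FF k) i = toGeneric B (c i) := fun i => Basis.baseChange_apply ..
  rw [h1, h1, twistedForm_apply, extendInvolution_toGeneric, ← map_mul, extendScalars_toGeneric,
    ← twistedForm_apply, hc, gramMatrix, of_apply, map_intCast]
  congr 2
  funext l
  fin_cases l <;> rfl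

theorem sp_latticeDescription (h2 : (2 : k) ≠ 0) {n : ℕ} (a : Fin n → OO k)
    (hconj : IsAlgClosed k → ∀ γ ∈ tensorLie (spTensor n) (FF k),
      ∀ γ' ∈ tensorLie (spTensor n) (FF k), spChi a γ → spChi a γ' →
        ∃ A : Matrix _ _ (FF k), A.det ≠ 0 ∧ Preserves (spTensor n) A ∧ γ' * A = A * γ) :
    LatticeDescription (spTensor n) (spChi a) (toGeneric (SpAlg a)) (AdjoinRoot.root _)
      (baseLattice (SpAlg a)) (spForm a) := by
  have hf := evenPoly_monic a
  have hd := evenPoly_natDegree a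
  obtain ⟨c, hc⟩ := exists_antidiagonal_basis (isUnit_two_OO h2) hf hd
    (by rw [aeval_neg_evenPoly]; simp) (S := gramMatrix (spTensor n) (OO k))
    (spGram_apply _ n) (by
      ext i j
      have hi := i.2
      rw [spGram_mul_self, Odd.neg_one_pow (by rw [Nat.odd_iff]; omega), neg_one_smul]) (by
      ext i j
      have hi := i.2
      rw [spGram_transpose, Odd.neg_one_pow (by rw [Nat.odd_iff]; omega), neg_one_smul])
  refine latticeDescription_of (bilinMultilinear (twistedForm
      (extendScalars (coeffFun (evenPoly_monic a) (2 * n - 1))) (extendInvolution (spInvolution a))))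
    (adjoin_root_eq_top _) (fun A _ hA => exists_unit_det_of_gram (isUnit_det_spGram _ n) hA)
    (sp_exists_preserving n) ⟨c.baseChange (FF k), fun s => gram_of_basis hc s,
      span_baseChange c, ?_⟩ (bilinMultilinear_skew _ _ ?_) ?_
      (fun v hv => baseLattice_mul_mem _ hv) hconj
  · rw [spChi, toMatrix_mulLeft_baseChange, charpoly_toFF,
      charpoly_leftMulMatrix_root hf c (by rw [hd, Fintype.card_fin])]
  · rw [extendInvolution_toGeneric, spInvolution, involution_root, map_neg]
  · intro γ hγ
    refine trace_eq_zero_of_charpoly fun hn => ?_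
    rw [hγ, Polynomial.coeff_map, evenPoly_coeff_odd a (by omega), map_zero]

theorem soOdd_latticeDescription (h2 : (2 : k) ≠ 0) {n : ℕ} (a : Fin n → OO k)
    (hconj : IsAlgClosed k → ∀ γ ∈ tensorLie (soOddTensor n) (FF k),
      ∀ γ' ∈ tensorLie (soOddTensor n) (FF k), soOddChi a γ → soOddChi a γ' →
        ∃ A : Matrix _ _ (FF k), A.det ≠ 0 ∧ Preserves (soOddTensor n) A ∧ γ' * A = A * γ) :
    LatticeDescription (soOddTensor n) (soOddChi a) (toGeneric (SOOddAlg a)) (AdjoinRoot.root _)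
      (baseLattice (SOOddAlg a)) (soOddForm a) := by
  have hf := oddPoly_monic a
  have hd := oddPoly_natDegree a
  have hτ : Polynomial.aeval (-AdjoinRoot.root (oddPoly a)) (oddPoly a) = 0 := by
    have h : Polynomial.aeval (AdjoinRoot.root (oddPoly a)) (oddPoly a) = 0 := by simp
    rw [oddPoly, map_mul, Polynomial.aeval_X] at h ⊢
    rw [aeval_neg_evenPoly, neg_mul, neg_eq_zero]
    exact h
  obtain ⟨c, hc⟩ := exists_antidiagonal_basis (isUnit_two_OO h2) hf hd hτ
    (S := gramMatrix (soOddTensor n) (OO k))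
    (fun i j => (soOddGram_apply _ n i j).trans (if_congr (by omega) rfl rfl)) (by
      ext i j
      rw [soOddGram_mul_self, Even.neg_one_pow (by rw [Nat.even_iff]; omega), one_smul]) (by
      ext i j
      rw [soOddGram_transpose, Even.neg_one_pow (by rw [Nat.even_iff]; omega), one_smul])
  refine latticeDescription_of (bilinMultilinear (twistedForm
      (extendScalars (coeffFun (oddPoly_monic a) (2 * n))) (extendInvolution (soOddInvolution a))))
    (adjoin_root_eq_top _) (fun A _ hA => exists_unit_det_of_gram (isUnit_det_soOddGram _ n) hA)
    (soOdd_exists_preserving h2 n) ⟨c.baseChange (FF k), fun s => gram_of_basis hc s,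
      span_baseChange c, ?_⟩ (bilinMultilinear_skew _ _ ?_) ?_
      (fun v hv => baseLattice_mul_mem _ hv) hconj
  · rw [soOddChi, toMatrix_mulLeft_baseChange, charpoly_toFF,
      charpoly_leftMulMatrix_root hf c (by rw [hd, Fintype.card_fin])]
  · rw [extendInvolution_toGeneric, soOddInvolution, involution_root, map_neg]
  · intro γ hγ
    refine trace_eq_zero_of_charpoly fun hn => ?_
    rw [hγ, Polynomial.coeff_map, oddPoly, add_tsub_cancel_right]
    rcases n with _ | n
    · simp [evenPoly]
    · rw [(by omega : 2 * (n + 1) = 2 * n + 1 + 1), Polynomial.coeff_X_mul,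
        evenPoly_coeff_odd a (by omega), map_zero]

end Companion

/-! ### The normalized spectral algebra for even `SO` -/

section SOEvenAlgebra

open Module

variable {R : Type*} [CommRing R] {m : ℕ} (a : Fin m → R) (p : R)

/-- The family `1, x, …, x ^ (2m), y`. -/
def soEvenFamily (i : Fin (2 * (m + 1))) : SOEvenNormAlg a p :=
  if (i : ℕ) = 2 * m + 1 then soEvenY a p else soEvenX a p ^ (i : ℕ)

/-- The homomorphism from `B̃` given by a solution of its equations. -/
def soEvenLift {S : Type*} [CommRing S] [Algebra R S] (x y : S) (h₁ : x * y = algebraMap R S p)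
    (h₂ : Polynomial.aeval x (evenPoly a) + y ^ 2 = 0) : SOEvenNormAlg a p →ₐ[R] S :=
  Ideal.Quotient.liftₐ (soEvenIdeal a p) (MvPolynomial.aeval ![x, y]) (by
    intro z hz
    rw [← RingHom.mem_ker]
    revert z
    change Ideal.span _ ≤ RingHom.ker _
    rw [Ideal.span_le]
    rintro z (rfl | rfl)
    · simp [RingHom.mem_ker, h₁]
    · simp [RingHom.mem_ker, ← Polynomial.aeval_algHom_apply, h₂])

theorem soEvenLift_X {S : Type*} [CommRing S] [Algebra R S] (x y : S)
    (h₁ : x * y = algebraMap R S p) (h₂ : Polynomial.aeval x (evenPoly a) + y ^ 2 = 0) :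
    soEvenLift a p x y h₁ h₂ (soEvenX a p) = x := by
  refine (Ideal.Quotient.liftₐ_apply ..).trans ?_
  refine (Ideal.Quotient.lift_mk ..).trans ?_
  simp

theorem soEvenLift_Y {S : Type*} [CommRing S] [Algebra R S] (x y : S)
    (h₁ : x * y = algebraMap R S p) (h₂ : Polynomial.aeval x (evenPoly a) + y ^ 2 = 0) :
    soEvenLift a p x y h₁ h₂ (soEvenY a p) = y := by
  refine (Ideal.Quotient.liftₐ_apply ..).trans ?_
  refine (Ideal.Quotient.lift_mk ..).trans ?_
  simp

theorem soEvenInvolution_X : soEvenInvolution a p (soEvenX a p) = -soEvenX a p := by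
  refine (Ideal.Quotient.liftₐ_apply ..).trans ?_
  refine (Ideal.Quotient.lift_mk ..).trans ?_
  simp

theorem soEvenInvolution_Y : soEvenInvolution a p (soEvenY a p) = -soEvenY a p := by
  refine (Ideal.Quotient.liftₐ_apply ..).trans ?_
  refine (Ideal.Quotient.lift_mk ..).trans ?_
  simp

theorem soEven_smul_def (r : R) (z : SOEvenNormAlg a p) : r • z = algebraMap R _ r * z :=
  Algebra.smul_def r z

theorem aeval_soEvenX : Polynomial.aeval (soEvenX a p) (evenPoly a) = -soEvenY a p ^ 2 :=
  eq_neg_of_add_eq_zero_left (aeval_soEvenX_add a p)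

theorem aeval_evenPoly {S : Type*} [CommRing S] [Algebra R S] (x : S) :
    Polynomial.aeval x (evenPoly a) = x ^ (2 * m) + ∑ i : Fin m, a i • x ^ (2 * (m - 1 - (i : ℕ))) := by
  simp [evenPoly, Algebra.smul_def]

theorem soEvenX_pow_mem_span {i : ℕ} (hi : i ≤ 2 * m) :
    soEvenX a p ^ i ∈ Submodule.span R (Set.range (soEvenFamily a p)) :=
  Submodule.subset_span ⟨⟨i, by omega⟩, by rw [soEvenFamily, if_neg (by simp only; omega)]⟩

theorem soEvenY_mem_span : soEvenY a p ∈ Submodule.span R (Set.range (soEvenFamily a p)) :=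
  Submodule.subset_span ⟨⟨2 * m + 1, by omega⟩, by rw [soEvenFamily, if_pos rfl]⟩

theorem soEvenX_pow_succ : soEvenX a p ^ (2 * m + 1) =
    -∑ i : Fin m, a i • soEvenX a p ^ (2 * (m - 1 - (i : ℕ)) + 1) - p • soEvenY a p := by
  have h1 : soEvenX a p * Polynomial.aeval (soEvenX a p) (evenPoly a) = -(p • soEvenY a p) := by
    rw [aeval_soEvenX, soEven_smul_def, ← soEvenX_mul_soEvenY]
    ring
  rw [aeval_evenPoly, mul_add, Finset.mul_sum] at h1
  simp only [mul_smul_comm, ← pow_succ'] at h1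
  rw [eq_sub_iff_add_eq, ← sub_eq_zero]
  rw [← sub_eq_zero] at h1
  rw [← h1]
  abel

theorem soEvenX_mul_mem_span {z : SOEvenNormAlg a p}
    (hz : z ∈ Submodule.span R (Set.range (soEvenFamily a p))) :
    soEvenX a p * z ∈ Submodule.span R (Set.range (soEvenFamily a p)) := by
  have h1 : Submodule.span R (Set.range (soEvenFamily a p)) ≤
      (Submodule.span R (Set.range (soEvenFamily a p))).comap
        (LinearMap.mulLeft R (soEvenX a p)) := by
    rw [Submodule.span_le]
    rintro _ ⟨i, rfl⟩
    rw [SetLike.mem_coe, Submodule.mem_comap, LinearMap.mulLeft_apply, soEvenFamily]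
    have hi := i.2
    split_ifs with h
    · rw [soEvenX_mul_soEvenY, Algebra.algebraMap_eq_smul_one, ← pow_zero (soEvenX a p)]
      exact Submodule.smul_mem _ _ (soEvenX_pow_mem_span a p (by omega))
    · rw [← pow_succ']
      by_cases h3 : (i : ℕ) = 2 * m
      · rw [h3, soEvenX_pow_succ]
        refine Submodule.sub_mem _ (Submodule.neg_mem _ (Submodule.sum_mem _ fun j _ => ?_))
          (Submodule.smul_mem _ _ (soEvenY_mem_span a p))
        exact Submodule.smul_mem _ _ (soEvenX_pow_mem_span a p (by omega))
      · exact soEvenX_pow_mem_span a p (by omega)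
  exact h1 hz

theorem soEvenY_mul_X_pow (i : ℕ) : soEvenY a p * soEvenX a p ^ (i + 1) = p • soEvenX a p ^ i := by
  rw [pow_succ', ← mul_assoc, mul_comm (soEvenY a p), soEvenX_mul_soEvenY, soEven_smul_def]

theorem soEvenY_mul_mem_span {z : SOEvenNormAlg a p}
    (hz : z ∈ Submodule.span R (Set.range (soEvenFamily a p))) :
    soEvenY a p * z ∈ Submodule.span R (Set.range (soEvenFamily a p)) := by
  have h1 : Submodule.span R (Set.range (soEvenFamily a p)) ≤
      (Submodule.span R (Set.range (soEvenFamily a p))).comap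
        (LinearMap.mulLeft R (soEvenY a p)) := by
    rw [Submodule.span_le]
    rintro _ ⟨i, rfl⟩
    rw [SetLike.mem_coe, Submodule.mem_comap, LinearMap.mulLeft_apply, soEvenFamily]
    have hi := i.2
    split_ifs with h
    · rw [← pow_two, ← neg_neg (soEvenY a p ^ 2), ← aeval_soEvenX, aeval_evenPoly]
      refine Submodule.neg_mem _ (Submodule.add_mem _ (soEvenX_pow_mem_span a p le_rfl)
        (Submodule.sum_mem _ fun j _ => Submodule.smul_mem _ _
          (soEvenX_pow_mem_span a p (by omega))))
    · rcases Nat.eq_zero_or_pos (i : ℕ) with h3 | h3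
      · rw [h3, pow_zero, mul_one]
        exact soEvenY_mem_span a p
      · obtain ⟨j, hj⟩ := Nat.exists_eq_add_of_lt h3
        rw [hj, zero_add, soEvenY_mul_X_pow]
        exact Submodule.smul_mem _ _ (soEvenX_pow_mem_span a p (by omega))
  exact h1 hz

theorem span_soEvenFamily : Submodule.span R (Set.range (soEvenFamily a p)) = ⊤ := by
  refine eq_top_iff.2 fun z _ => ?_
  clear * -
  obtain ⟨z, rfl⟩ := Ideal.Quotient.mk_surjective z
  induction z using MvPolynomial.induction_on with
  | C c =>
    have h1 : Ideal.Quotient.mk (soEvenIdeal a p) (MvPolynomial.C c) =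
        c • soEvenX a p ^ 0 := by
      rw [pow_zero, soEven_smul_def, mul_one]
      rfl
    rw [h1]
    exact Submodule.smul_mem _ _ (soEvenX_pow_mem_span a p (by omega))
  | add z w hz hw =>
    rw [map_add]
    exact Submodule.add_mem _ hz hw
  | mul_X z i hz =>
    rw [map_mul, mul_comm (Ideal.Quotient.mk _ z)]
    fin_cases i
    · exact soEvenX_mul_mem_span a p hz
    · exact soEvenY_mul_mem_span a p hz

theorem sum_smul_soEvenFamily (c : Fin (2 * (m + 1)) → R) : ∑ i, c i • soEvenFamily a p i =
    Polynomial.aeval (soEvenX a p)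
      (∑ i : Fin (2 * m + 1), Polynomial.monomial (i : ℕ) (c (Fin.castSucc (n := 2 * m + 1) i))) +
    c (Fin.last (2 * m + 1)) • soEvenY a p := by
  refine (Fin.sum_univ_castSucc (n := 2 * m + 1) _).trans ?_
  rw [map_sum]
  congr 1
  · refine Finset.sum_congr rfl fun i _ => ?_
    have hi : (i : ℕ) < 2 * m + 1 := i.2
    rw [Polynomial.aeval_monomial, ← Algebra.smul_def, soEvenFamily,
      if_neg (by rw [Fin.val_castSucc]; omega), Fin.val_castSucc]
  · rw [soEvenFamily, if_pos (by rw [Fin.val_last])]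

variable [IsDomain R]

theorem degree_lt_of_sum_monomial {d : ℕ} (c : Fin d → R) :
    (∑ i : Fin d, Polynomial.monomial (i : ℕ) (c i)).degree < d := by
  refine (Polynomial.degree_sum_le _ _).trans_lt ?_
  rw [Finset.sup_lt_iff (WithBot.bot_lt_coe _)]
  intro i _
  refine (Polynomial.degree_monomial_le _ _).trans_lt ?_
  exact_mod_cast i.2

theorem coeff_sum_monomial {d : ℕ} (c : Fin d → R) (i : Fin d) :
    (∑ i : Fin d, Polynomial.monomial (i : ℕ) (c i)).coeff i = c i := by
  rw [Polynomial.finsetSum_coeff, Finset.sum_eq_single i]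
  · simp
  · intro j _ hj
    rw [Polynomial.coeff_monomial, if_neg fun h => hj (Fin.ext h)]
  · simp

theorem soEvenPoly_monic : (soEvenPoly a p).Monic := by
  refine ((Polynomial.monic_X_pow 2).mul (evenPoly_monic a)).add_of_left ?_
  refine Polynomial.degree_C_le.trans_lt ?_
  rw [Polynomial.Monic.degree_mul (evenPoly_monic a), Polynomial.degree_X_pow, evenPoly_degree]
  exact_mod_cast (by omega : 0 < 2 + 2 * m)

theorem soEvenPoly_natDegree : (soEvenPoly a p).natDegree = 2 * (m + 1) := by
  rw [soEvenPoly, Polynomial.natDegree_add_C, Polynomial.Monic.natDegree_mul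
    (Polynomial.monic_X_pow 2) (evenPoly_monic a), Polynomial.natDegree_X_pow, evenPoly_natDegree]
  omega

/-- For `p ≠ 0`, the relations of `B̃` hold in `K[x] / (f)` with `y = -x g / p`. -/
theorem exists_soEven_hom (hp : p ≠ 0) :
    ∃ φ : SOEvenNormAlg a p →ₐ[R] AdjoinRoot ((soEvenPoly a p).map
        (algebraMap R (FractionRing R))),
      φ (soEvenX a p) = AdjoinRoot.root _ ∧
      (algebraMap R (FractionRing R) p) • φ (soEvenY a p) =
        -(AdjoinRoot.root _ * Polynomial.aeval (AdjoinRoot.root _) (evenPoly a)) := by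
  set K := FractionRing R
  set f := (soEvenPoly a p).map (algebraMap R K)
  set x := AdjoinRoot.root f
  set q := algebraMap R K p with hqdef
  have hq : q ≠ 0 := by
    rw [hqdef, Ne, FaithfulSMul.algebraMap_eq_zero_iff]
    exact hp
  set g := Polynomial.aeval x (evenPoly a) with hg
  have hx : x ^ 2 * g + algebraMap K _ q ^ 2 = 0 := by
    have h1 : Polynomial.aeval x f = 0 := by
      rw [AdjoinRoot.aeval_eq, AdjoinRoot.mk_self]
    rw [Polynomial.aeval_map_algebraMap, soEvenPoly] at h1
    simpa only [hqdef, ← IsScalarTower.algebraMap_apply, map_add, map_mul, map_pow,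
      Polynomial.aeval_X, Polynomial.aeval_C] using h1
  have hqi : algebraMap K (AdjoinRoot f) q * algebraMap K _ q⁻¹ = 1 := by
    rw [← map_mul, mul_inv_cancel₀ hq, map_one]
  refine ⟨soEvenLift a p x (-(algebraMap K _ q⁻¹ * (x * g))) ?_ ?_, soEvenLift_X .., ?_⟩
  · rw [IsScalarTower.algebraMap_apply R K]
    linear_combination (-algebraMap K (AdjoinRoot f) q⁻¹) * hx + algebraMap K (AdjoinRoot f) q * hqi
  · rw [← hg]
    linear_combination (algebraMap K (AdjoinRoot f) q⁻¹) ^ 2 * g * hx -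
      g * (1 + algebraMap K (AdjoinRoot f) q * algebraMap K (AdjoinRoot f) q⁻¹) * hqi
  · rw [soEvenLift_Y, Algebra.smul_def]
    linear_combination -(x * g) * hqi

/-- For `p = 0`, the homomorphism from `B̃` to `R[x] / (g)`. -/
theorem exists_soEven_hom_X (hp : p = 0) : ∃ φ : SOEvenNormAlg a p →ₐ[R] AdjoinRoot (evenPoly a),
    φ (soEvenX a p) = AdjoinRoot.root _ ∧ φ (soEvenY a p) = 0 :=
  ⟨soEvenLift a p (AdjoinRoot.root _) 0 (by simp [hp]) (by simp), soEvenLift_X .., soEvenLift_Y ..⟩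

/-- For `p = 0`, the homomorphism from `B̃` to `R[y] / (y² + g(0))`. -/
theorem exists_soEven_hom_Y (hp : p = 0) : ∃ φ : SOEvenNormAlg a p →ₐ[R]
      AdjoinRoot (Polynomial.X ^ 2 + Polynomial.C ((evenPoly a).coeff 0)),
    φ (soEvenX a p) = 0 ∧ φ (soEvenY a p) = AdjoinRoot.root _ := by
  refine ⟨soEvenLift a p 0 (AdjoinRoot.root _) (by simp [hp]) ?_, soEvenLift_X .., soEvenLift_Y ..⟩
  have h1 : Polynomial.aeval (AdjoinRoot.root (Polynomial.X ^ 2 + Polynomial.C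
      ((evenPoly a).coeff 0))) (Polynomial.X ^ 2 + Polynomial.C ((evenPoly a).coeff 0)) = 0 := by
    rw [AdjoinRoot.aeval_eq, AdjoinRoot.mk_self]
  rw [map_add, map_pow, Polynomial.aeval_X, Polynomial.aeval_C] at h1
  refine Eq.trans ?_ h1
  rw [← Polynomial.coeff_zero_eq_aeval_zero']
  exact add_comm _ _

theorem linearIndependent_soEvenFamily (h : p = 0 → (evenPoly a).coeff 0 ≠ 0) :
    LinearIndependent R (soEvenFamily a p) := by
  rw [Fintype.linearIndependent_iff]
  intro c hc
  rw [sum_smul_soEvenFamily] at hc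
  set P : R[X] :=
    ∑ i : Fin (2 * m + 1), Polynomial.monomial (i : ℕ) (c (Fin.castSucc (n := 2 * m + 1) i)) with hP
  set d := c (Fin.last (2 * m + 1)) with hd
  have hdeg : P.degree < ((2 * m + 1 : ℕ) : WithBot ℕ) :=
    degree_lt_of_sum_monomial fun i : Fin (2 * m + 1) => c (Fin.castSucc (n := 2 * m + 1) i)
  suffices h0 : P = 0 ∧ d = 0 by
    intro i
    refine Fin.lastCases (n := 2 * m + 1) h0.2 (fun i => ?_) i
    have := coeff_sum_monomial (fun i : Fin (2 * m + 1) => c (Fin.castSucc (n := 2 * m + 1) i)) i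
    rw [← hP, h0.1, Polynomial.coeff_zero] at this
    exact this.symm
  by_cases hp : p = 0
  · obtain ⟨φ, hφX, hφY⟩ := exists_soEven_hom_X a p hp
    obtain ⟨ψ, hψX, hψY⟩ := exists_soEven_hom_Y a p hp
    have h1 := congrArg φ hc
    have h2 := congrArg ψ hc
    rw [map_add, map_smul, ← Polynomial.aeval_algHom_apply, hφX, hφY, smul_zero, add_zero, map_zero,
      AdjoinRoot.aeval_eq, AdjoinRoot.mk_eq_zero] at h1
    rw [map_add, map_smul, ← Polynomial.aeval_algHom_apply, hψX, hψY, map_zero,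
      ← Polynomial.coeff_zero_eq_aeval_zero'] at h2
    set r := Polynomial.X ^ 2 + Polynomial.C ((evenPoly a).coeff 0) with hr
    have hr2 : r.degree = 2 := Polynomial.degree_X_pow_add_C (by norm_num) _
    have hrm : r.Monic := Polynomial.monic_X_pow_add_C _ (by norm_num)
    have h3 : AdjoinRoot.mk r (Polynomial.C (P.coeff 0) + Polynomial.C d * Polynomial.X) = 0 := by
      rw [map_add, map_mul, AdjoinRoot.mk_X, ← h2, Algebra.smul_def]
      rfl
    rw [AdjoinRoot.mk_eq_zero] at h3
    have h4 := Polynomial.eq_zero_of_dvd_of_degree_lt h3 (by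
      rw [hr2, add_comm]
      exact (Polynomial.degree_linear_le).trans_lt (by norm_num))
    have h5 := congrArg (Polynomial.coeff · 0) h4
    have h6 := congrArg (Polynomial.coeff · 1) h4
    simp [Polynomial.coeff_X, Polynomial.coeff_C] at h5 h6
    refine ⟨?_, h6⟩
    obtain ⟨q, hq⟩ := h1
    have hgm := evenPoly_monic a
    have hqd : q = Polynomial.C (q.coeff 0) := by
      rcases eq_or_ne q 0 with rfl | hq0
      · simp
      have h7 : P ≠ 0 := by
        rw [hq]
        exact mul_ne_zero hgm.ne_zero hq0
      have h8 := (Polynomial.natDegree_lt_iff_degree_lt h7).2 hdeg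
      rw [hq, hgm.natDegree_mul' hq0, evenPoly_natDegree] at h8
      exact Polynomial.eq_C_of_natDegree_eq_zero (by omega)
    have h7 : (evenPoly a).coeff 0 * q.coeff 0 = 0 := by
      rw [← Polynomial.mul_coeff_zero, ← hq, h5]
    rw [hq, hqd, (mul_eq_zero.1 h7).resolve_left (h hp), map_zero, mul_zero]
  · obtain ⟨φ, hφX, hφY⟩ := exists_soEven_hom a p hp
    have h1 := congrArg φ hc
    rw [map_add, map_smul, ← Polynomial.aeval_algHom_apply, hφX, map_zero] at h1
    set K := FractionRing R
    set f := (soEvenPoly a p).map (algebraMap R K)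
    have hinj : Function.Injective (algebraMap R K) := IsFractionRing.injective _ _
    have h2 : AdjoinRoot.mk f ((Polynomial.C p * P - Polynomial.C d * (Polynomial.X * evenPoly a)).map
        (algebraMap R K)) = 0 := by
      have h3 := congrArg (fun z => algebraMap R K p • z) h1
      simp only [smul_add, smul_zero] at h3
      rw [smul_comm, hφY] at h3
      rw [← AdjoinRoot.aeval_eq, Polynomial.aeval_map_algebraMap, map_sub, map_mul, map_mul, map_mul,
        Polynomial.aeval_X, Polynomial.aeval_C, Polynomial.aeval_C, ← h3, algebraMap_smul,
        Algebra.smul_def, Algebra.smul_def]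
      ring
    rw [AdjoinRoot.mk_eq_zero] at h2
    have hdeg2 : (Polynomial.C p * P).degree < ((2 * m + 1 : ℕ) : WithBot ℕ) := by
      rwa [Polynomial.degree_C_mul hp]
    have hdeg3 : (Polynomial.C d * (Polynomial.X * evenPoly a)).degree ≤
        ((2 * m + 1 : ℕ) : WithBot ℕ) := by
      refine (Polynomial.degree_mul_le _ _).trans ((add_le_add_left Polynomial.degree_C_le _).trans ?_)
      rw [zero_add]
      rw [← oddPoly, Polynomial.degree_eq_natDegree (oddPoly_monic a).ne_zero, oddPoly_natDegree]
    have hf : f.degree = ((2 * (m + 1) : ℕ) : WithBot ℕ) := by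
      rw [Polynomial.degree_map_eq_of_injective hinj,
        Polynomial.degree_eq_natDegree (soEvenPoly_monic a p).ne_zero, soEvenPoly_natDegree]
    have h3 := Polynomial.eq_zero_of_dvd_of_degree_lt h2 (by
      rw [hf, Polynomial.degree_map_eq_of_injective hinj]
      refine (Polynomial.degree_sub_le _ _).trans_lt (max_lt (hdeg2.trans ?_)
        (hdeg3.trans_lt ?_)) <;> exact_mod_cast (by omega))
    rw [Polynomial.map_eq_zero_iff hinj, sub_eq_zero] at h3
    have hd0 : d = 0 := by
      by_contra hd0
      rw [h3, Polynomial.degree_C_mul hd0, ← oddPoly,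
        Polynomial.degree_eq_natDegree (oddPoly_monic a).ne_zero, oddPoly_natDegree] at hdeg2
      exact lt_irrefl _ hdeg2
    refine ⟨?_, hd0⟩
    rw [hd0, map_zero, zero_mul, mul_eq_zero, Polynomial.C_eq_zero] at h3
    exact h3.resolve_left hp

end SOEvenAlgebra

section SOEvenTrace

open Module

variable {R : Type*} [CommRing R] {m : ℕ} (a : Fin m → R) (p : R)

theorem soEven_neg_pow (z : SOEvenNormAlg a p) (n : ℕ) : (-z) ^ n = (-1) ^ n * z ^ n :=
  neg_pow z n

theorem soEven_mul_neg (z w : SOEvenNormAlg a p) : z * -w = -(z * w) :=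
  mul_neg z w

theorem soEvenInvolution_involution (z : SOEvenNormAlg a p) :
    soEvenInvolution a p (soEvenInvolution a p z) = z := by
  have h : (soEvenInvolution a p).comp (soEvenInvolution a p) = AlgHom.id R _ := by
    refine Ideal.Quotient.algHom_ext _ (MvPolynomial.algHom_ext fun i => ?_)
    fin_cases i
    · change soEvenInvolution a p (soEvenInvolution a p (soEvenX a p)) = soEvenX a p
      rw [soEvenInvolution_X, map_neg, soEvenInvolution_X, neg_neg]
    · change soEvenInvolution a p (soEvenInvolution a p (soEvenY a p)) = soEvenY a p
      rw [soEvenInvolution_Y, map_neg, soEvenInvolution_Y, neg_neg]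
  exact congrArg (fun φ => φ z) h

variable [IsDomain R] (h : p = 0 → (evenPoly a).coeff 0 ≠ 0)

/-- The basis `1, x, …, x ^ (2m), y` of `B̃`. -/
def soEvenBasis : Basis (Fin (2 * (m + 1))) R (SOEvenNormAlg a p) :=
  Basis.mk (linearIndependent_soEvenFamily a p h) (span_soEvenFamily a p).ge

theorem soEvenBasis_apply (i : Fin (2 * (m + 1))) :
    soEvenBasis a p h i = if (i : ℕ) = 2 * m + 1 then soEvenY a p else soEvenX a p ^ (i : ℕ) :=
  Basis.mk_apply ..

theorem soEvenBasis_X {i : ℕ} (hi : i ≤ 2 * m) :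
    soEvenBasis a p h ⟨i, by omega⟩ = soEvenX a p ^ i := by
  rw [soEvenBasis_apply, if_neg (by simp only; omega)]

theorem soEvenBasis_Y : soEvenBasis a p h ⟨2 * m + 1, by omega⟩ = soEvenY a p := by
  rw [soEvenBasis_apply, if_pos rfl]

/-- The coefficient of `x ^ (2m)`. -/
def soEvenTop : SOEvenNormAlg a p →ₗ[R] R := (soEvenBasis a p h).coord ⟨2 * m, by omega⟩

theorem soEvenTop_X {i : ℕ} (hi : i ≤ 2 * m) :
    soEvenTop a p h (soEvenX a p ^ i) = if i = 2 * m then 1 else 0 := by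
  rw [← soEvenBasis_X a p h hi, soEvenTop, Basis.coord_apply, Basis.repr_self,
    Finsupp.single_apply]
  exact if_congr (by rw [Fin.mk.injEq]) rfl rfl

theorem soEvenTop_Y : soEvenTop a p h (soEvenY a p) = 0 := by
  rw [← soEvenBasis_Y a p h, soEvenTop, Basis.coord_apply, Basis.repr_self, Finsupp.single_apply,
    if_neg (by simp)]

theorem soEvenTop_aeval {P : R[X]} (hP : P.natDegree ≤ 2 * m) :
    soEvenTop a p h (Polynomial.aeval (soEvenX a p) P) = P.coeff (2 * m) := by
  rw [Polynomial.aeval_eq_sum_range' (Nat.lt_succ_of_le hP), map_sum,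
    Finset.sum_eq_single (2 * m)]
  · rw [map_smul, soEvenTop_X a p h le_rfl, if_pos rfl, smul_eq_mul, mul_one]
  · intro i hi hne
    have := Finset.mem_range.1 hi
    rw [map_smul, soEvenTop_X a p h (by omega), if_neg hne, smul_zero]
  · simp

theorem soEvenTop_involution (z : SOEvenNormAlg a p) :
    soEvenTop a p h (soEvenInvolution a p z) = soEvenTop a p h z := by
  have h1 : soEvenTop a p h ∘ₗ (soEvenInvolution a p).toLinearMap = soEvenTop a p h := by
    refine (soEvenBasis a p h).ext fun i => ?_
    rw [LinearMap.comp_apply, AlgHom.toLinearMap_apply, soEvenBasis_apply]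
    have hi := i.2
    split_ifs with h2
    · rw [soEvenInvolution_Y, map_neg, soEvenTop_Y, neg_zero]
    · rw [map_pow, soEvenInvolution_X, soEven_neg_pow, map_neg_one_pow_mul, soEvenTop_X a p h (by omega)]
      split_ifs with h3
      · rw [h3, Even.neg_one_pow (even_two_mul m), one_smul]
      · rw [smul_zero]
  exact congrArg (fun φ => φ z) h1

theorem coeff_divX_iterate (P : R[X]) (i n : ℕ) :
    (Polynomial.divX^[i] P).coeff n = P.coeff (n + i) := by
  induction i generalizing n with
  | zero => rfl
  | succ i ih =>
    rw [Function.iterate_succ_apply', Polynomial.coeff_divX, ih]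
    congr 1
    omega

theorem coeff_evenPoly_of_lt {i : ℕ} (hi : 2 * m < i) : (evenPoly a).coeff i = 0 :=
  Polynomial.coeff_eq_zero_of_natDegree_lt (by rwa [evenPoly_natDegree])

theorem coeff_evenPoly_top : (evenPoly a).coeff (2 * m) = 1 := by
  have := (evenPoly_monic a).coeff_natDegree
  rwa [evenPoly_natDegree] at this

theorem natDegree_divX_iterate_le (i : ℕ) :
    (Polynomial.divX^[i] (evenPoly a)).natDegree ≤ 2 * m - i := by
  rw [Polynomial.natDegree_le_iff_coeff_eq_zero]
  intro n hn
  rw [coeff_divX_iterate, coeff_evenPoly_of_lt a (by omega)]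

theorem soEvenTop_Y_mul_X_pow {i : ℕ} (hi : i ≤ 2 * m) :
    soEvenTop a p h (soEvenY a p * soEvenX a p ^ i) = 0 := by
  rcases i with _ | i
  · rw [pow_zero, mul_one, soEvenTop_Y]
  · rw [soEvenY_mul_X_pow, map_smul, soEvenTop_X a p h (by omega), if_neg (by omega), smul_zero]

theorem soEvenTop_Y_sq : soEvenTop a p h (soEvenY a p ^ 2) = -1 := by
  rw [← neg_neg (soEvenY a p ^ 2), ← aeval_soEvenX, map_neg,
    soEvenTop_aeval a p h (evenPoly_natDegree a).le, coeff_evenPoly_top]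

/-- The basis dual to `soEvenBasis` for the form `(b, c) ↦ soEvenTop (b c)`. -/
def soEvenDual (i : Fin (2 * (m + 1))) : SOEvenNormAlg a p :=
  if (i : ℕ) = 2 * m + 1 then -soEvenY a p
  else Polynomial.aeval (soEvenX a p) (Polynomial.divX^[(i : ℕ)] (evenPoly a))

theorem X_pow_mul_divX_iterate (P : R[X]) (i : ℕ) :
    Polynomial.X ^ i * Polynomial.divX^[i] P =
      P - ∑ l ∈ Finset.range i, Polynomial.C (P.coeff l) * Polynomial.X ^ l := by
  ext n
  rw [Polynomial.coeff_X_pow_mul', Polynomial.coeff_sub, Polynomial.finsetSum_coeff]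
  simp only [Polynomial.coeff_C_mul, Polynomial.coeff_X_pow, mul_ite, mul_one, mul_zero,
    Finset.sum_ite_eq, Finset.mem_range]
  split_ifs with h1 h2 h2
  · omega
  · rw [coeff_divX_iterate, Nat.sub_add_cancel h1, sub_zero]
  · rw [sub_self]
  · omega

theorem soEvenTop_X_pow_mul_divX {i j : ℕ} (hi : i ≤ 2 * m) (hj : j ≤ 2 * m) :
    soEvenTop a p h (soEvenX a p ^ j * Polynomial.aeval (soEvenX a p)
      (Polynomial.divX^[i] (evenPoly a))) = if i = j then 1 else 0 := by
  rcases le_or_gt j i with hji | hji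
  · have h1 : soEvenX a p ^ j * Polynomial.aeval (soEvenX a p)
        (Polynomial.divX^[i] (evenPoly a)) = Polynomial.aeval (soEvenX a p)
          (Polynomial.X ^ j * Polynomial.divX^[i] (evenPoly a)) := by
      rw [map_mul, map_pow, Polynomial.aeval_X]
    rw [h1, soEvenTop_aeval, Polynomial.coeff_X_pow_mul', if_pos hj, coeff_divX_iterate]
    · split_ifs with hij
      · rw [← coeff_evenPoly_top a]
        congr 1
        omega
      · exact coeff_evenPoly_of_lt a (by omega)
    · refine Polynomial.natDegree_mul_le.trans ?_
      rw [Polynomial.natDegree_X_pow]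
      have := natDegree_divX_iterate_le a i
      omega
  · rw [if_neg hji.ne]
    obtain ⟨l, rfl⟩ := Nat.exists_eq_add_of_lt hji
    have h1 : soEvenX a p ^ (i + l + 1) * Polynomial.aeval (soEvenX a p)
        (Polynomial.divX^[i] (evenPoly a)) = soEvenX a p ^ (l + 1) * Polynomial.aeval (soEvenX a p)
          (Polynomial.X ^ i * Polynomial.divX^[i] (evenPoly a)) := by
      rw [map_mul, map_pow, Polynomial.aeval_X]
      ring
    have h3 : soEvenX a p ^ (l + 1) * -soEvenY a p ^ 2 = -(p • (soEvenY a p * soEvenX a p ^ l)) := by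
      rw [soEven_smul_def, ← soEvenX_mul_soEvenY]
      ring
    rw [h1, X_pow_mul_divX_iterate, map_sub, aeval_soEvenX, mul_sub, h3, map_sub, map_neg, map_smul,
      soEvenTop_Y_mul_X_pow a p h (by omega), smul_zero, neg_zero, zero_sub,
      map_sum (Polynomial.aeval (soEvenX a p)), Finset.mul_sum, map_sum, neg_eq_zero]
    refine Finset.sum_eq_zero fun r hr => ?_
    have := Finset.mem_range.1 hr
    rw [map_mul (Polynomial.aeval (soEvenX a p)), map_pow (Polynomial.aeval (soEvenX a p)),
      Polynomial.aeval_X, Polynomial.aeval_C, mul_left_comm, ← pow_add, ← soEven_smul_def, map_smul, soEvenTop_X a p h (by omega), if_neg (by omega), smul_zero]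

theorem soEvenTop_Y_mul_divX {i : ℕ} (hi : i ≤ 2 * m) :
    soEvenTop a p h (soEvenY a p * Polynomial.aeval (soEvenX a p)
      (Polynomial.divX^[i] (evenPoly a))) = 0 := by
  have hd := natDegree_divX_iterate_le a i
  rw [Polynomial.aeval_eq_sum_range' (Nat.lt_succ_of_le hd), Finset.mul_sum, map_sum]
  refine Finset.sum_eq_zero fun l hl => ?_
  have := Finset.mem_range.1 hl
  rw [mul_smul_comm, map_smul, soEvenTop_Y_mul_X_pow a p h (by omega), smul_zero]

theorem soEvenTop_basis_mul_dual (i j : Fin (2 * (m + 1))) :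
    soEvenTop a p h (soEvenBasis a p h j * soEvenDual a p i) = if i = j then 1 else 0 := by
  rw [soEvenBasis_apply, soEvenDual]
  have hi := i.2
  have hj := j.2
  by_cases h1 : (i : ℕ) = 2 * m + 1 <;> by_cases h2 : (j : ℕ) = 2 * m + 1
  · rw [if_pos h1, if_pos h2, if_pos (Fin.ext (by omega)), soEven_mul_neg, ← pow_two, map_neg,
      soEvenTop_Y_sq, neg_neg]
  · rw [if_pos h1, if_neg h2, if_neg (fun hij => h2 (by rw [← hij]; exact h1)), soEven_mul_neg, map_neg, mul_comm,
      soEvenTop_Y_mul_X_pow a p h (by omega), neg_zero]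
  · rw [if_neg h1, if_pos h2, if_neg (fun hij => h1 (by rw [hij]; exact h2)),
      soEvenTop_Y_mul_divX a p h (by omega)]
  · rw [if_neg h1, if_neg h2, soEvenTop_X_pow_mul_divX a p h (by omega) (by omega)]
    exact if_congr Fin.ext_iff.symm rfl rfl

theorem sum_X_pow_mul_divX (P : R[X]) {d : ℕ} (hP : P.natDegree ≤ d) :
    ∑ i ∈ Finset.range (d + 1), Polynomial.X ^ i * Polynomial.divX^[i] P =
      Polynomial.X * Polynomial.derivative P + P := by
  ext n
  rw [Polynomial.finsetSum_coeff]
  have h1 : ∀ i, (Polynomial.X ^ i * Polynomial.divX^[i] P).coeff n =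
      if i ∈ Finset.range (n + 1) then P.coeff n else 0 := by
    intro i
    rw [Polynomial.coeff_X_pow_mul', coeff_divX_iterate]
    by_cases hi : i ≤ n
    · rw [if_pos hi, if_pos (Finset.mem_range.2 (by omega)), Nat.sub_add_cancel hi]
    · rw [if_neg hi, if_neg (fun h => hi (by have := Finset.mem_range.1 h; omega))]
  simp only [h1]
  rw [Polynomial.coeff_add]
  by_cases hn : n ≤ d
  · rw [← Finset.sum_filter]
    have h2 : (Finset.range (d + 1)).filter (· ∈ Finset.range (n + 1)) = Finset.range (n + 1) := by
      ext i
      simp only [Finset.mem_filter, Finset.mem_range]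
      omega
    rw [h2, Finset.sum_const, Finset.card_range]
    rcases n with _ | n
    · simp
    · rw [Polynomial.coeff_X_mul, Polynomial.coeff_derivative]
      simp
      ring
  · have h2 : ∀ l, n ≤ l → P.coeff l = 0 := fun l hl =>
      Polynomial.coeff_eq_zero_of_natDegree_lt (by omega)
    rw [h2 n le_rfl]
    rcases n with _ | n
    · simp
    · rw [Polynomial.coeff_X_mul, Polynomial.coeff_derivative, h2 (n + 1) le_rfl]
      simp

theorem sum_basis_mul_dual :
    ∑ i, soEvenBasis a p h i * soEvenDual a p i = soEvenDifferent a p := by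
  refine (Fin.sum_univ_castSucc (n := 2 * m + 1) _).trans ?_
  have h1 : ∀ i : Fin (2 * m + 1), soEvenBasis a p h (Fin.castSucc (n := 2 * m + 1) i) *
      soEvenDual a p (Fin.castSucc (n := 2 * m + 1) i) = Polynomial.aeval (soEvenX a p)
        (Polynomial.X ^ (i : ℕ) * Polynomial.divX^[(i : ℕ)] (evenPoly a)) := by
    intro i
    have hi : (i : ℕ) < 2 * m + 1 := i.2
    rw [soEvenBasis_apply, soEvenDual, if_neg (by rw [Fin.val_castSucc]; omega),
      if_neg (by rw [Fin.val_castSucc]; omega), map_mul, map_pow, Polynomial.aeval_X,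
      Fin.val_castSucc]
  simp only [h1]
  rw [Fin.sum_univ_eq_sum_range (fun i => Polynomial.aeval (soEvenX a p)
    (Polynomial.X ^ i * Polynomial.divX^[i] (evenPoly a))), ← map_sum,
    sum_X_pow_mul_divX _ (evenPoly_natDegree a).le, map_add, map_mul, Polynomial.aeval_X,
    aeval_soEvenX, soEvenBasis_apply, soEvenDual, if_pos (Fin.val_last _), if_pos (Fin.val_last _),
    soEvenDifferent, Matrix.det_fin_two_of]
  ring

theorem trace_soEven (z : SOEvenNormAlg a p) :
    Algebra.trace R (SOEvenNormAlg a p) z = soEvenTop a p h (soEvenDifferent a p * z) := by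
  have h1 : ∀ (w : SOEvenNormAlg a p) (i), (soEvenBasis a p h).repr w i =
      soEvenTop a p h (w * soEvenDual a p i) := by
    intro w i
    have h2 : (soEvenBasis a p h).coord i =
        soEvenTop a p h ∘ₗ LinearMap.mulRight R (soEvenDual a p i) := by
      refine (soEvenBasis a p h).ext fun j => ?_
      rw [LinearMap.comp_apply, LinearMap.mulRight_apply, soEvenTop_basis_mul_dual,
        Basis.coord_apply, Basis.repr_self, Finsupp.single_apply]
      exact if_congr eq_comm rfl rfl
    exact congrArg (fun φ => φ w) h2
  rw [Algebra.trace_eq_matrix_trace (soEvenBasis a p h), Matrix.trace]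
  simp only [Matrix.diag_apply, Algebra.leftMulMatrix_eq_repr_mul, h1]
  rw [← map_sum, ← sum_basis_mul_dual a p h, Finset.sum_mul]
  congr 1
  exact Finset.sum_congr rfl fun i _ => by ring

theorem trace_soEvenX (h2 : (2 : R) ≠ 0) :
    Algebra.trace R (SOEvenNormAlg a p) (soEvenX a p) = 0 := by
  let e : SOEvenNormAlg a p ≃ₐ[R] SOEvenNormAlg a p :=
    AlgEquiv.ofAlgHom (soEvenInvolution a p) (soEvenInvolution a p)
      (AlgHom.ext (soEvenInvolution_involution a p)) (AlgHom.ext (soEvenInvolution_involution a p))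
  have h1 : Algebra.trace R _ (e (soEvenX a p)) = Algebra.trace R _ (soEvenX a p) :=
    Algebra.trace_eq_of_algEquiv e _
  have h3 : e (soEvenX a p) = -soEvenX a p := soEvenInvolution_X a p
  rw [h3, map_neg, neg_eq_iff_add_eq_zero, ← two_mul] at h1
  exact (mul_eq_zero.1 h1).resolve_left h2

theorem charpoly_soEvenX (h2 : (2 : R) ≠ 0) :
    (Algebra.leftMulMatrix (soEvenBasis a p h) (soEvenX a p)).charpoly = soEvenPoly a p := by
  set χ := (Algebra.leftMulMatrix (soEvenBasis a p h) (soEvenX a p)).charpoly with hχ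
  have hχm : χ.Monic := Matrix.charpoly_monic _
  have hχd : χ.natDegree = 2 * (m + 1) := by
    rw [hχ, Matrix.charpoly_natDegree_eq_dim, Fintype.card_fin]
  have h0 : Polynomial.aeval (soEvenX a p) χ = 0 := by
    apply (injective_iff_map_eq_zero _).1 (Algebra.leftMulMatrix_injective (soEvenBasis a p h))
    rw [← Polynomial.aeval_algHom_apply, Matrix.aeval_self_charpoly]
  by_cases hp : p = 0
  · obtain ⟨φ, hφX, hφY⟩ := exists_soEven_hom_X a p hp
    obtain ⟨ψ, hψX, hψY⟩ := exists_soEven_hom_Y a p hp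
    have h1 := congrArg φ h0
    have h3 := congrArg ψ h0
    rw [← Polynomial.aeval_algHom_apply, hφX, map_zero, AdjoinRoot.aeval_eq,
      AdjoinRoot.mk_eq_zero] at h1
    rw [← Polynomial.aeval_algHom_apply, hψX, map_zero,
      ← Polynomial.coeff_zero_eq_aeval_zero'] at h3
    have h4 : χ.coeff 0 = 0 := by
      have h5 : AdjoinRoot.mk (Polynomial.X ^ 2 + Polynomial.C ((evenPoly a).coeff 0))
        (Polynomial.C (χ.coeff 0)) = 0 := h3
      rw [AdjoinRoot.mk_eq_zero] at h5
      have h6 := Polynomial.eq_zero_of_dvd_of_degree_lt h5 (by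
        rw [Polynomial.degree_X_pow_add_C (by norm_num)]
        exact Polynomial.degree_C_le.trans_lt (by norm_num))
      rwa [Polynomial.C_eq_zero] at h6
    obtain ⟨q, hq⟩ := h1
    have hgm := evenPoly_monic a
    have hqm : q.Monic := hgm.of_mul_monic_left (hq ▸ hχm)
    have hqd : q.natDegree = 2 := by
      rw [hq, hgm.natDegree_mul hqm, evenPoly_natDegree] at hχd
      omega
    have hqe : q = Polynomial.X ^ 2 + Polynomial.C (q.coeff 1) * Polynomial.X +
        Polynomial.C (q.coeff 0) := by
      have h5 := hqm.coeff_natDegree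
      rw [hqd] at h5
      have h6 := Polynomial.as_sum_range_C_mul_X_pow' (p := q) (n := 3) (by omega)
      rw [Finset.sum_range_succ, Finset.sum_range_succ, Finset.sum_range_one, h5] at h6
      rw [h6]
      simp
      ring
    have h5 : q.coeff 0 = 0 := by
      rw [hq, Polynomial.mul_coeff_zero] at h4
      exact (mul_eq_zero.1 h4).resolve_left (h hp)
    have h6 : χ.coeff (2 * m + 1) = 0 := by
      have h7 := trace_soEvenX a p h2
      have : Nonempty (Fin (2 * (m + 1))) := ⟨⟨0, by omega⟩⟩
      rw [Algebra.trace_eq_matrix_trace (soEvenBasis a p h), Matrix.trace_eq_neg_charpoly_coeff,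
        neg_eq_zero, Fintype.card_fin] at h7
      exact h7
    have h7 : q.coeff 1 = 0 := by
      rw [hq, hqe, h5, map_zero, add_zero, mul_add, Polynomial.coeff_add, mul_left_comm,
        Polynomial.coeff_C_mul, Polynomial.coeff_mul_X, coeff_evenPoly_top, mul_one,
        Polynomial.coeff_mul_X_pow'] at h6
      split_ifs at h6 with h8
      · rwa [evenPoly_coeff_odd a (by omega), zero_add] at h6
      · rwa [zero_add] at h6
    rw [hq, hqe, h5, h7, soEvenPoly, hp]
    simp [mul_comm]
  · obtain ⟨φ, hφX, hφY⟩ := exists_soEven_hom a p hp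
    have h1 := congrArg φ h0
    rw [← Polynomial.aeval_algHom_apply, hφX, map_zero,
      ← Polynomial.aeval_map_algebraMap (FractionRing R), AdjoinRoot.aeval_eq,
      AdjoinRoot.mk_eq_zero] at h1
    have hinj : Function.Injective (algebraMap R (FractionRing R)) := IsFractionRing.injective _ _
    have h3 := Polynomial.eq_of_monic_of_dvd_of_natDegree_le ((soEvenPoly_monic a p).map _)
      (hχm.map (algebraMap R (FractionRing R))) h1 (by
        rw [hχm.natDegree_map, (soEvenPoly_monic a p).natDegree_map, hχd, soEvenPoly_natDegree])
    exact Polynomial.map_injective _ hinj h3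

theorem exists_soEven_isometric_basis (h2 : IsUnit (2 : R)) :
    ∃ c : Basis (Fin (2 * (m + 1))) R (SOEvenNormAlg a p), ∀ i j,
      twistedForm (soEvenTop a p h) (soEvenInvolution a p) (c i) (c j) =
        gramMatrix (soEvenTensor m) R i j := by
  set ω := twistedForm (soEvenTop a p h) (soEvenInvolution a p) with hω
  set b := soEvenBasis a p h with hb
  have hlow : ∀ l j : Fin (2 * (m + 1)), (l : ℕ) + j ≤ 2 * m → ω (b l) (b j) =
      if (l : ℕ) + j = 2 * m then (-1) ^ (j : ℕ) else 0 := by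
    intro l j hlj
    rw [hω, twistedForm_apply, hb, soEvenBasis_apply, soEvenBasis_apply, if_neg (by omega),
      if_neg (by omega), map_pow, soEvenInvolution_X, soEven_neg_pow, mul_left_comm, ← pow_add,
      map_neg_one_pow_mul, soEvenTop_X a p h hlj, smul_eq_mul, mul_ite, mul_one, mul_zero]
  have hlast : ∀ l j : Fin (2 * (m + 1)), (l : ℕ) = 2 * m + 1 → ω (b l) (b j) =
      if (j : ℕ) = 2 * m + 1 then 1 else 0 := by
    intro l j hl
    have hj := j.2
    rw [hω, twistedForm_apply, hb, soEvenBasis_apply, soEvenBasis_apply, if_pos hl]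
    split_ifs with h3
    · rw [soEvenInvolution_Y, soEven_mul_neg, map_neg, ← pow_two, soEvenTop_Y_sq, neg_neg]
    · rw [map_pow, soEvenInvolution_X, soEven_neg_pow, mul_left_comm, map_neg_one_pow_mul,
        soEvenTop_Y_mul_X_pow a p h (by omega), smul_zero]
  obtain ⟨U, hU, hUG⟩ := exists_isometric_of_strictUpper h2 (S := gramMatrix (soEvenTensor m) R)
    (S' := gramMatrix (soEvenTensor m) R) (G := Matrix.of fun i j => ω (b i) (b j)) (ε := 1)
    (mul_one _) (soEvenGram_mul_self R m) (by rw [soEvenGram_transpose, one_smul]) (by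
      ext i j
      rw [one_smul, Matrix.transpose_apply, Matrix.of_apply, Matrix.of_apply, hω, twistedForm_apply,
        twistedForm_apply, ← soEvenTop_involution, map_mul, soEvenInvolution_involution, mul_comm])
    (by
      intro i j hij l
      have hij' : (j : ℕ) ≤ i := hij
      rw [soEvenGram_apply, soEvenGram_apply, Matrix.of_apply]
      by_cases h1 : (i : ℕ) + l = 2 * m
      · rw [hlow l j (by omega), if_neg (c := (l : ℕ) = 2 * m + 1 ∧ (j : ℕ) = 2 * m + 1) (by omega),
          sub_self, mul_zero]
      · rw [if_neg h1]
        by_cases h3 : (i : ℕ) = 2 * m + 1 ∧ (l : ℕ) = 2 * m + 1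
        · rw [hlast l j h3.2, if_neg (c := (l : ℕ) + j = 2 * m) (by omega)]
          by_cases h4 : (j : ℕ) = 2 * m + 1
          · rw [if_pos h4, if_pos (c := (l : ℕ) = 2 * m + 1 ∧ _) ⟨h3.2, h4⟩, sub_self, mul_zero]
          · rw [if_neg h4, if_neg (c := (l : ℕ) = 2 * m + 1 ∧ _) (fun h => h4 h.2), sub_self,
              mul_zero]
        · rw [if_neg h3, zero_mul])
  exact exists_basis_of_gram_eq ω b U _ hU hUG

end SOEvenTrace

/-! ### Regularity and separability -/

section Separability

open Polynomial

/-- `s ^ n + a₂ s ^ (n-1) + ⋯ + a₂ₙ`. -/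
def halfPoly {R : Type*} [CommRing R] {n : ℕ} (a : Fin n → R) : R[X] :=
  X ^ n + ∑ i : Fin n, C (a i) * X ^ (n - 1 - (i : ℕ))

theorem expand_halfPoly {R : Type*} [CommRing R] {n : ℕ} (a : Fin n → R) :
    expand R 2 (halfPoly a) = evenPoly a := by
  simp [halfPoly, evenPoly, ← pow_mul]

theorem expand_soEvenHalf {R : Type*} [CommRing R] {n : ℕ} (a : Fin n → R) (p : R) :
    expand R 2 (X * halfPoly a + C (p ^ 2)) = soEvenPoly a p := by
  rw [map_add, map_mul, expand_X, expand_halfPoly, expand_C, soEvenPoly]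

theorem torusPoly_eq {k : Type*} [Field k] {n : ℕ} (t : Fin n → AlgebraicClosure (FF k)) :
    torusPoly t = expand _ 2 (∏ i, (X - C (t i ^ 2))) := by
  simp [torusPoly, map_prod]

variable {k : Type*} [Field k] {n : ℕ}

/-- The reduction from `𝒪` to `F` of a polynomial. -/
abbrev polyFF (P : (OO k)[X]) : (FF k)[X] := P.map (algebraMap (OO k) (FF k))

theorem map_toClosure (P : (OO k)[X]) :
    P.map (toClosure k) = (polyFF P).map (algebraMap (FF k) (AlgebraicClosure (FF k))) := by
  rw [Polynomial.map_map]
  rfl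

theorem separable_of_map_expand {P : (OO k)[X]} {t : Fin n → AlgebraicClosure (FF k)}
    (h : (expand _ 2 P).map (toClosure k) = torusPoly t)
    (ht : ∀ i j, i ≠ j → t i - t j ≠ 0 ∧ t i + t j ≠ 0) : (polyFF P).Separable := by
  rw [torusPoly_eq, map_expand] at h
  have h1 := expand_injective (by norm_num) h
  rw [map_toClosure] at h1
  rw [← separable_map (algebraMap (FF k) (AlgebraicClosure (FF k))), h1,
    separable_prod_X_sub_C_iff]
  intro i j hij
  by_contra hne
  have h3 : (t i - t j) * (t i + t j) = 0 := by linear_combination hij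
  exact (mul_ne_zero (ht i j hne).1 (ht i j hne).2) h3

theorem separable_X_mul_of_map_expand {P : (OO k)[X]} {t : Fin n → AlgebraicClosure (FF k)}
    (h : (expand _ 2 P).map (toClosure k) = torusPoly t)
    (ht : ∀ i j, i ≠ j → t i - t j ≠ 0 ∧ t i + t j ≠ 0) (ht0 : ∀ i, t i ≠ 0) :
    (X * polyFF P).Separable := by
  have hsep := separable_of_map_expand h ht
  refine separable_X.mul hsep ?_
  rw [torusPoly_eq, map_expand] at h
  have h1 := expand_injective (by norm_num) h
  rw [map_toClosure] at h1
  have h3 : (polyFF P).coeff 0 ≠ 0 := by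
    intro h3
    have h4 := congrArg (eval 0) h1
    rw [← coeff_zero_eq_eval_zero, coeff_map, h3, map_zero, eval_prod] at h4
    obtain ⟨i, -, hi⟩ := Finset.prod_eq_zero_iff.1 h4.symm
    simp at hi
    exact ht0 i hi
  refine (Irreducible.coprime_iff_not_dvd irreducible_X).2 ?_
  rwa [X_dvd_iff]

theorem spRegular.separable {a : Fin n → OO k} (h : spRegular a) :
    (X * polyFF (halfPoly a)).Separable := by
  obtain ⟨t, h1, h3, h4⟩ := h
  rw [← expand_halfPoly] at h1
  exact separable_X_mul_of_map_expand h1 h3 fun i hi => h4 i (by rw [hi, mul_zero])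

theorem soOddRegular.separable {a : Fin n → OO k} (h : soOddRegular a) :
    (X * polyFF (halfPoly a)).Separable := by
  obtain ⟨t, h1, h3, h4⟩ := h
  rw [oddPoly, Polynomial.map_mul, map_X] at h1
  have h5 := mul_left_cancel₀ X_ne_zero h1
  rw [← expand_halfPoly] at h5
  exact separable_X_mul_of_map_expand h5 h3 h4

theorem soEvenRegular.separable {a : Fin n → OO k} {p : OO k} (h : soEvenRegular a p) :
    (polyFF (X * halfPoly a + C (p ^ 2))).Separable := by
  obtain ⟨t, h1, h3⟩ := h
  rw [← expand_soEvenHalf] at h1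
  exact separable_of_map_expand h1 h3

theorem soEvenRegular.coeff_zero_ne_zero {a : Fin n → OO k} {p : OO k} (h : soEvenRegular a p)
    (hp : p = 0) : (evenPoly a).coeff 0 ≠ 0 := by
  intro h0
  have h1 := h.separable
  rw [hp, zero_pow (by norm_num), map_zero, add_zero, polyFF, Polynomial.map_mul, map_X] at h1
  have h3 := h1.isCoprime
  rw [Irreducible.coprime_iff_not_dvd irreducible_X, X_dvd_iff, coeff_map] at h3
  apply h3
  have h4 : (halfPoly a).coeff 0 = (evenPoly a).coeff 0 := by
    rw [← expand_halfPoly, coeff_expand (by norm_num)]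
    simp
  rw [h4, h0, map_zero]

end Separability

/-! ### The companion section for even `SO` -/

section SOEvenCompanion

open Module Matrix

variable {k : Type*} [Field k] {m : ℕ} {a : Fin m → OO k} {p : OO k}

theorem trace_toGeneric {B : Type*} [CommRing B] [Algebra (OO k) B] {ι : Type} [Fintype ι]
    [DecidableEq ι] (b : Basis ι (OO k) B) (z : B) :
    Algebra.trace (FF k) (FF k ⊗[OO k] B) (toGeneric B z) =
      algebraMap (OO k) (FF k) (Algebra.trace (OO k) B z) := by
  rw [Algebra.trace_apply, LinearMap.trace_eq_matrix_trace _ (b.baseChange (FF k)),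
    Algebra.trace_eq_matrix_trace b]
  refine (congrArg Matrix.trace (toMatrix_mulLeft_baseChange b z)).trans ?_
  rw [toFF]
  exact (AddMonoidHom.map_trace (algebraMap (OO k) (FF k)).toAddMonoidHom _).symm

theorem isUnit_two_of_algebra {K : Type*} [Field K] (A : Type*) [CommRing A] [Algebra K A]
    (h2 : (2 : K) ≠ 0) : IsUnit (2 : A) := by
  have h := h2.isUnit.map (algebraMap K A)
  rwa [map_ofNat] at h

theorem isUnit_soEvenDifferent (h2 : (2 : k) ≠ 0) (h : soEvenRegular a p) :
    IsUnit (toGeneric (k := k) _ (soEvenDifferent a p)) := by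
  obtain ⟨u, v, huv⟩ := h.separable
  set s := toGeneric (k := k) _ (soEvenX a p) ^ 2 with hs
  have h0 : Polynomial.aeval (soEvenX a p ^ 2) (halfPoly a) = -soEvenY a p ^ 2 := by
    rw [← Polynomial.expand_aeval, expand_halfPoly, aeval_soEvenX]
  have h1 : Polynomial.aeval s (polyFF (Polynomial.X * halfPoly a + Polynomial.C (p ^ 2))) = 0 := by
    rw [Polynomial.aeval_map_algebraMap, hs, ← map_pow, Polynomial.aeval_algHom_apply, map_add,
      map_mul, Polynomial.aeval_X, h0, Polynomial.aeval_C, map_pow, ← soEvenX_mul_soEvenY]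
    refine (congrArg _ ?_).trans (map_zero (toGeneric (k := k) _))
    ring
  have h3 : soEvenDifferent a p = 2 * Polynomial.aeval (soEvenX a p ^ 2)
      (Polynomial.derivative (Polynomial.X * halfPoly a + Polynomial.C (p ^ 2))) := by
    rw [soEvenDifferent, Matrix.det_fin_two_of, ← expand_halfPoly, Polynomial.derivative_expand]
    simp only [map_add, map_mul, Polynomial.derivative_mul, Polynomial.derivative_X,
      Polynomial.derivative_C, one_mul, add_zero, Polynomial.aeval_X, h0, Polynomial.expand_aeval,
      pow_one, Nat.cast_ofNat, map_ofNat, Nat.reduceSub]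
    ring
  have h4 := congrArg (Polynomial.aeval s) huv
  rw [map_add, map_mul, map_mul, h1, mul_zero, zero_add, map_one, Polynomial.derivative_map,
    Polynomial.aeval_map_algebraMap, hs, ← map_pow,
    Polynomial.aeval_algHom_apply (toGeneric (k := k) _) (soEvenX a p ^ 2)] at h4
  rw [h3, map_mul, map_ofNat]
  refine IsUnit.mul ?_ (IsUnit.of_mul_eq_one_right _ h4)
  exact isUnit_two_of_algebra _ (two_ne_zero_FF h2)

theorem trace_soEven_generic (h2 : (2 : k) ≠ 0) (h : soEvenRegular a p)
    (v : FF k ⊗[OO k] SOEvenNormAlg a p) :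
    Algebra.trace (FF k) _ (Ring.inverse (toGeneric _ (soEvenDifferent a p)) * v) =
      extendScalars (soEvenTop a p h.coeff_zero_ne_zero) v := by
  set D := toGeneric (k := k) _ (soEvenDifferent a p)
  have h1 : ∀ w, Algebra.trace (FF k) (FF k ⊗[OO k] SOEvenNormAlg a p) w =
      extendScalars (soEvenTop a p h.coeff_zero_ne_zero) (D * w) := by
    intro w
    have h3 : Algebra.trace (FF k) (FF k ⊗[OO k] SOEvenNormAlg a p) =
        extendScalars (soEvenTop a p h.coeff_zero_ne_zero) ∘ₗ LinearMap.mulLeft (FF k) D := by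
      refine ((soEvenBasis a p h.coeff_zero_ne_zero).baseChange (FF k)).ext fun i => ?_
      rw [Basis.baseChange_apply, LinearMap.comp_apply, LinearMap.mulLeft_apply, ← toGeneric_apply,
        ← map_mul, extendScalars_toGeneric, trace_toGeneric (soEvenBasis a p h.coeff_zero_ne_zero),
        trace_soEven a p h.coeff_zero_ne_zero]
    exact congrArg (fun φ => φ w) h3
  rw [h1, ← mul_assoc, Ring.mul_inverse_cancel _ (isUnit_soEvenDifferent h2 h), one_mul]

theorem soEvenPoly_coeff_odd (a : Fin m → OO k) (p : OO k) {i : ℕ} (hi : i % 2 = 1) :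
    (soEvenPoly a p).coeff i = 0 := by
  rw [← expand_soEvenHalf, Polynomial.coeff_expand (by norm_num), if_neg (by omega)]

theorem soEvenPoly_coeff_zero (a : Fin m → OO k) (p : OO k) : (soEvenPoly a p).coeff 0 = p ^ 2 := by
  rw [soEvenPoly, Polynomial.coeff_add, Polynomial.mul_coeff_zero, Polynomial.coeff_C_zero]
  simp

theorem soEven_exists_framing (h2 : (2 : k) ≠ 0) (h : soEvenRegular a p) :
    ∃ b : Basis (Fin (2 * (m + 1))) (FF k) (FF k ⊗[OO k] SOEvenNormAlg a p),
      (∀ s : Fin 2 → Fin (2 * (m + 1)), bilinMultilinear (twistedForm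
        (extendScalars (soEvenTop a p h.coeff_zero_ne_zero))
        (extendInvolution (soEvenInvolution a p))) (fun j => b (s j)) = soEvenTensor m s) ∧
      Submodule.span (OO k) (Set.range b) = baseLattice (SOEvenNormAlg a p) ∧
      soEvenChi a p (LinearMap.toMatrix b b (LinearMap.mulLeft (FF k)
        (toGeneric _ (soEvenX a p)))) := by
  have hc0 := h.coeff_zero_ne_zero
  obtain ⟨c, hc⟩ := exists_soEven_isometric_basis a p hc0 (isUnit_two_OO h2)
  set ω := twistedForm (extendScalars (soEvenTop a p h.coeff_zero_ne_zero))
        (extendInvolution (soEvenInvolution a p)) with hω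
  set S := gramMatrix (soEvenTensor m) (FF k) with hS
  have hO2 : (2 : OO k) ≠ 0 := (isUnit_two_OO h2).ne_zero
  have hchar : ∀ b : Basis (Fin (2 * (m + 1))) (FF k) (FF k ⊗[OO k] SOEvenNormAlg a p),
      (LinearMap.toMatrix b b (LinearMap.mulLeft (FF k)
        (toGeneric _ (soEvenX a p)))).charpoly = polyFF (soEvenPoly a p) := by
    intro b
    have h3 := charpoly_soEvenX a p hc0 hO2
    have : Module.Finite (FF k) (FF k ⊗[OO k] SOEvenNormAlg a p) := Module.Finite.of_basis b
    have : Module.Free (FF k) (FF k ⊗[OO k] SOEvenNormAlg a p) := Module.Free.of_basis b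
    rw [LinearMap.charpoly_toMatrix,
      ← LinearMap.charpoly_toMatrix _ ((soEvenBasis a p hc0).baseChange (FF k)),
      toMatrix_mulLeft_baseChange, charpoly_toFF, h3]
  have hskew : ∀ v, ∑ j, bilinMultilinear ω (Function.update v j
      (toGeneric _ (soEvenX a p) * v j)) = 0 := by
    refine bilinMultilinear_skew _ _ ?_
    rw [extendInvolution_toGeneric, soEvenInvolution_X]
    exact map_neg _ _
  have hdet1 : ∀ b : Basis (Fin (2 * (m + 1))) (FF k) (FF k ⊗[OO k] SOEvenNormAlg a p),
      (∀ s : Fin 2 → Fin (2 * (m + 1)), bilinMultilinear ω (fun j => b (s j)) =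
        soEvenTensor m s) →
      (S * LinearMap.toMatrix b b (LinearMap.mulLeft (FF k) (toGeneric _ (soEvenX a p))))ᵀ =
        -(S * LinearMap.toMatrix b b (LinearMap.mulLeft (FF k) (toGeneric _ (soEvenX a p)))) := by
    intro b hb
    have h3 := mem_tensorLie_of_isFraming (bilinMultilinear ω) hskew ⟨hb, rfl⟩
      (trace_eq_zero_of_charpoly fun _ => by
        rw [hchar, Polynomial.coeff_map, soEvenPoly_coeff_odd a p (by omega), map_zero])
    rw [mem_tensorLie_two_iff] at h3
    rw [transpose_mul, soEvenGram_transpose]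
    exact eq_neg_of_add_eq_zero_left h3.2
  have hpf : ∀ b : Basis (Fin (2 * (m + 1))) (FF k) (FF k ⊗[OO k] SOEvenNormAlg a p),
      (∀ s : Fin 2 → Fin (2 * (m + 1)), bilinMultilinear ω (fun j => b (s j)) =
        soEvenTensor m s) →
      pfaffian (m + 1) (S * LinearMap.toMatrix b b (LinearMap.mulLeft (FF k)
        (toGeneric _ (soEvenX a p)))) ^ 2 = algebraMap (OO k) (FF k) p ^ 2 := by
    intro b hb
    have h3 := hdet1 b hb
    rw [pfaffian_sq _ h3, det_mul, det_soEvenGram, one_mul, Matrix.det_eq_sign_charpoly_coeff,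
      hchar, Polynomial.coeff_map, soEvenPoly_coeff_zero, Fintype.card_fin, map_pow,
      Even.neg_one_pow (even_two_mul _), one_mul]
    intro i
    have h4 := congrFun (congrFun h3 i) i
    rw [transpose_apply, Matrix.neg_apply, eq_neg_iff_add_eq_zero, ← two_mul] at h4
    exact (mul_eq_zero.1 h4).resolve_left (two_ne_zero_FF h2)
  have hb : ∀ s : Fin 2 → Fin (2 * (m + 1)), bilinMultilinear ω
      (fun j => c.baseChange (FF k) (s j)) = soEvenTensor m s := gram_of_basis hc
  rcases eq_or_eq_neg_of_sq_eq_sq _ _ (hpf (c.baseChange (FF k)) hb) with h3 | h3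
  · exact ⟨c.baseChange (FF k), hb, span_baseChange c, hchar _, h3⟩
  · let w : Fin (2 * (m + 1)) → (OO k)ˣ := fun i => if (i : ℕ) = 2 * m + 1 then -1 else 1
    let c' := c.unitsSMul w
    have hc' : ∀ i j, twistedForm (soEvenTop a p hc0) (soEvenInvolution a p) (c' i) (c' j) =
        gramMatrix (soEvenTensor m) (OO k) i j := by
      intro i j
      have h4 : c' i = (w i : OO k) • c i := by
        rw [Basis.unitsSMul_apply]
        rfl
      have h5 : c' j = (w j : OO k) • c j := by
        rw [Basis.unitsSMul_apply]
        rfl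
      rw [h4, h5, map_smul, LinearMap.map_smul₂, hc, soEvenGram_apply]
      by_cases h6 : (i : ℕ) + j = 2 * m
      · rw [if_pos h6]
        have hwi : w i = 1 := if_neg (by omega)
        have hwj : w j = 1 := if_neg (by omega)
        simp [hwi, hwj]
      · rw [if_neg h6]
        split_ifs with h7
        · simp [w, h7.1, h7.2]
        · simp
    have hb' : ∀ s : Fin 2 → Fin (2 * (m + 1)), bilinMultilinear ω
        (fun j => c'.baseChange (FF k) (s j)) = soEvenTensor m s := gram_of_basis hc'
    refine ⟨c'.baseChange (FF k), hb', span_baseChange c', hchar _, ?_⟩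
    set b := c.baseChange (FF k)
    set b' := c'.baseChange (FF k)
    set A := b.toMatrix b'
    have hA : A = toFF (Matrix.diagonal fun i => (w i : OO k)) := by
      refine Matrix.ext fun i j => ?_
      have h4 : c' j = (w j : OO k) • c j := by
        rw [Basis.unitsSMul_apply]
        rfl
      refine (Basis.toMatrix_apply ..).trans ?_
      rw [Basis.baseChange_apply, Basis.baseChange_repr_tmul, h4, map_smul,
        Finsupp.smul_apply, Basis.repr_self, toFF, map_apply, diagonal_apply, Finsupp.single_apply,
        Algebra.smul_def, mul_one]
      by_cases h5 : i = j
      · simp [h5]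
      · simp [h5, Ne.symm h5]
    have hAd : A.det = -1 := by
      rw [hA, det_toFF, det_diagonal]
      have : ∏ i, (w i : OO k) = -1 := by
        refine (Finset.prod_eq_single (Fin.last (2 * m + 1)) ?_ ?_).trans ?_
        · intro i _ hi
          simp only [w]
          rw [if_neg (c := (i : ℕ) = 2 * m + 1) fun h4 => hi (Fin.ext h4), Units.val_one]
        · simp
        · simp [w]
      rw [this, map_neg, map_one]
    have hAp : Preserves (soEvenTensor m) A := toMatrix_preserves (bilinMultilinear ω) hb hb'
    have hAS : Aᵀ * S * A = S := (preserves_two_iff _ _).1 hAp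
    set γ := LinearMap.toMatrix b b (LinearMap.mulLeft (FF k) (toGeneric _ (soEvenX a p)))
    set γ' := LinearMap.toMatrix b' b' (LinearMap.mulLeft (FF k) (toGeneric _ (soEvenX a p)))
    have hAγ : A * γ' = γ * A := by
      rw [basis_toMatrix_mul_linearMap_toMatrix, linearMap_toMatrix_mul_basis_toMatrix]
    have h5 : S * γ' = Aᵀ * (S * γ) * A := by
      conv_lhs => rw [← hAS]
      rw [mul_assoc, hAγ]
      simp only [mul_assoc]
    have h6 := hdet1 b hb
    change pfaffian (m + 1) (S * γ') = _
    rw [h5, pfaffian_transpose_mul_mul _ _ h6, hAd, h3, neg_one_mul, neg_neg]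
    intro i
    have h4 := congrFun (congrFun h6 i) i
    rw [transpose_apply, Matrix.neg_apply, eq_neg_iff_add_eq_zero, ← two_mul] at h4
    exact (mul_eq_zero.1 h4).resolve_left (two_ne_zero_FF h2)

theorem soEven_latticeDescription (h2 : (2 : k) ≠ 0) (h : soEvenRegular a p)
    (hconj : IsAlgClosed k → ∀ γ ∈ tensorLie (soEvenTensor m) (FF k),
      ∀ γ' ∈ tensorLie (soEvenTensor m) (FF k), soEvenChi a p γ → soEvenChi a p γ' →
        ∃ A : Matrix _ _ (FF k), A.det ≠ 0 ∧ Preserves (soEvenTensor m) A ∧ γ' * A = A * γ) :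
    LatticeDescription (soEvenTensor m) (soEvenChi a p)
      ((toGeneric (SOEvenNormAlg a p)).comp (soEvenToNorm a p)) (AdjoinRoot.root _)
      (baseLattice (SOEvenNormAlg a p)) (soEvenForm a p) := by
  have hact : ((toGeneric (k := k) (SOEvenNormAlg a p)).comp (soEvenToNorm a p))
      (AdjoinRoot.root _) = toGeneric _ (soEvenX a p) := by
    rw [AlgHom.comp_apply, soEvenToNorm]
    exact congrArg _ (AdjoinRoot.liftAlgHom_root ..)
  have hform : soEvenForm a p = bilinMultilinear (twistedForm
      (extendScalars (soEvenTop a p h.coeff_zero_ne_zero))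
      (extendInvolution (soEvenInvolution a p))) := by
    funext v
    rw [soEvenForm, mul_assoc, trace_soEven_generic h2 h]
    rfl
  rw [hform]
  refine latticeDescription_of _ (adjoin_root_eq_top _)
    (fun A _ hA => exists_unit_det_of_gram (isUnit_det_soEvenGram _ m) hA)
    (soEven_exists_preserving h2 m) ?_ ?_ ?_ ?_ hconj
  · rw [hact]
    exact soEven_exists_framing h2 h
  · refine bilinMultilinear_skew _ _ ?_
    rw [hact, extendInvolution_toGeneric, soEvenInvolution_X]
    exact map_neg _ _
  · intro γ hγ
    refine trace_eq_zero_of_charpoly fun _ => ?_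
    rw [hγ.1, Polynomial.coeff_map, soEvenPoly_coeff_odd a p (by omega), map_zero]
  · intro v hv
    rw [hact]
    exact baseLattice_mul_mem _ hv

end SOEvenCompanion

/-! ### Square classes of finite extensions of `F` -/

section Complete

open Module Polynomial

variable {R M : Type*} [CommRing R] [AddCommGroup M] [Module R M] {ι : Type*} [Fintype ι]

theorem mem_ideal_smul_top_iff (b : Basis ι R M) (I : Ideal R) (x : M) :
    x ∈ (I • ⊤ : Submodule R M) ↔ ∀ i, b.repr x i ∈ I := by
  constructor
  · intro hx i
    have h1 := Submodule.mem_map_of_mem (f := b.coord i) hx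
    rw [Submodule.map_smul''] at h1
    exact Submodule.smul_le.2 (fun r hr n _ => I.mul_mem_right n hr) h1
  · intro h
    rw [← b.sum_repr x]
    exact Submodule.sum_mem _ fun i _ => Submodule.smul_mem_smul (h i) trivial

theorem isAdicComplete_of_basis (b : Basis ι R M) (I : Ideal R) [IsAdicComplete I R] :
    IsAdicComplete I M where
  haus' x hx := by
    refine b.ext_elem fun i => ?_
    rw [map_zero, Finsupp.zero_apply]
    refine IsHausdorff.haus (I := I) inferInstance _ fun n => ?_
    have h1 := hx n
    rw [SModEq.sub_mem, sub_zero, mem_ideal_smul_top_iff b] at h1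
    rw [SModEq.sub_mem, sub_zero, smul_eq_mul, Ideal.mul_top]
    exact h1 i
  prec' f hf := by
    have h1 : ∀ i, ∃ L : R, ∀ n, b.repr (f n) i ≡ L [SMOD (I ^ n • ⊤ : Submodule R R)] := by
      intro i
      refine IsPrecomplete.prec (I := I) inferInstance fun {m n} hmn => ?_
      have h2 := hf hmn
      rw [SModEq.sub_mem, mem_ideal_smul_top_iff b] at h2
      rw [SModEq.sub_mem, smul_eq_mul, Ideal.mul_top]
      have h3 := h2 i
      rwa [map_sub, Finsupp.sub_apply] at h3
    choose L hL using h1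
    refine ⟨∑ i, L i • b i, fun n => ?_⟩
    rw [SModEq.sub_mem, mem_ideal_smul_top_iff b]
    intro i
    have h2 := hL i n
    rw [SModEq.sub_mem, smul_eq_mul, Ideal.mul_top] at h2
    rwa [map_sub, Finsupp.sub_apply, b.repr_sum_self]

theorem isAdicComplete_map_of_basis {A : Type*} [CommRing A] [Algebra R A] (b : Basis ι R A)
    (I : Ideal R) [IsAdicComplete I R] : IsAdicComplete (I.map (algebraMap R A)) A :=
  (IsAdicComplete.map_algebraMap_iff I A).2 (isAdicComplete_of_basis b I)

theorem isUnit_or_isNilpotent_of_idempotents {A : Type*} [CommRing A] [IsArtinianRing A]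
    (h : ∀ e : A, e * e = e → e = 0 ∨ e = 1) (x : A) : IsUnit x ∨ IsNilpotent x := by
  obtain ⟨n, hn⟩ := IsArtinian.exists_pow_succ_smul_dvd x (1 : A)
  have h1 : ∀ m, ∃ y, x ^ n = x ^ (n + m) * y := by
    obtain ⟨y, hy⟩ := hn
    rw [smul_eq_mul, smul_eq_mul, mul_one] at hy
    intro m
    induction m with
    | zero => exact ⟨1, by simp⟩
    | succ m ih =>
      obtain ⟨z, hz⟩ := ih
      exact ⟨y * z, by rw [pow_succ] at hy; linear_combination hz - x ^ m * z * hy⟩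
  obtain ⟨y, hy⟩ := h1 n
  rcases h (x ^ n * y) (by linear_combination -y * hy) with h2 | h2
  · refine Or.inr ⟨n, ?_⟩
    linear_combination hy + x ^ n * h2
  · rcases Nat.eq_zero_or_pos n with rfl | hn0
    · obtain ⟨z, hz⟩ := hn
      rw [smul_eq_mul, smul_eq_mul, mul_one] at hz
      exact Or.inl (IsUnit.of_mul_eq_one z (by linear_combination hz))
    · obtain ⟨n, rfl⟩ := Nat.exists_eq_succ_of_ne_zero hn0.ne'
      exact Or.inl (IsUnit.of_mul_eq_one (x ^ n * y) (by rw [Nat.succ_eq_add_one, pow_succ] at h2; linear_combination h2))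

end Complete

section FiniteExtension

open Module Polynomial

variable {k : Type*} [Field k] [IsAlgClosed k]

/-- A finite free domain over `O` is local, and its units are squares. -/
theorem isLocalRing_and_isSquare {A : Type*} [CommRing A] [IsDedekindDomain A] [Algebra (OO k) A]
    [Module.Finite (OO k) A] [Module.Free (OO k) A] (h2 : (2 : k) ≠ 0) :
    IsLocalRing A ∧ ∀ u : A, IsUnit u → IsSquare u := by
  have b := Module.Free.chooseBasis (OO k) A
  set I := (Ideal.span {PowerSeries.X} : Ideal (OO k)).map (algebraMap (OO k) A) with hI
  have hc : IsAdicComplete I A := isAdicComplete_map_of_basis b _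
  have hh : HenselianRing A I := inferInstance
  set t := algebraMap (OO k) A PowerSeries.X with ht
  have hIt : I = Ideal.span {t} := by rw [hI, Ideal.map_span, Set.image_singleton]
  have hinj : Function.Injective (algebraMap (OO k) A) := FaithfulSMul.algebraMap_injective _ _
  have ht0 : t ≠ 0 := by
    rw [ht, Ne, map_eq_zero_iff _ hinj]
    exact PowerSeries.X_ne_zero
  have hart : IsArtinianRing (A ⧸ I) := by
    rw [hIt]
    exact isArtinian_of_tower A ((isFiniteLength_iff_isNoetherian_isArtinian.1
      (isFiniteLength_quotient_span_singleton A (mem_nonZeroDivisors_of_ne_zero ht0))).2)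
  have hunit : ∀ x : A, IsUnit (Ideal.Quotient.mk I x) → IsUnit x := by
    intro x hx
    have := isLocalHom_of_le_jacobson_bot I hh.jac
    exact hx.of_map _
  have hne : Nontrivial (A ⧸ I) := by
    rw [Ideal.Quotient.nontrivial_iff]
    rintro h
    have h3 : IsUnit t := by
      rw [← Ideal.span_singleton_eq_top, ← hIt, h]
    have h4 := (Ideal.mem_jacobson_bot.1 (hh.jac (hIt ▸ Ideal.mem_span_singleton_self t)))
      (-(h3.unit⁻¹ : Aˣ))
    rw [mul_neg, IsUnit.mul_val_inv, neg_add_cancel] at h4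
    exact not_isUnit_zero h4
  have hid : ∀ e : A ⧸ I, e * e = e → e = 0 ∨ e = 1 := by
    intro e he
    obtain ⟨e, rfl⟩ := Ideal.Quotient.mk_surjective e
    obtain ⟨a, ha, hae⟩ := hh.is_henselian (X ^ 2 - X) (monic_X_pow_sub (by simp)) e (by
      rw [← Ideal.Quotient.eq_zero_iff_mem]
      simp [sq, he]) (by
      refine IsUnit.of_mul_eq_one (Ideal.Quotient.mk I
        (Polynomial.eval e (Polynomial.derivative (X ^ 2 - X : A[X])))) ?_
      simp only [derivative_X_pow, derivative_X, eval_sub, eval_mul,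
        eval_X, eval_one, map_sub, map_mul, map_one, Nat.cast_ofNat, Nat.reduceSub, pow_one,
        eval_ofNat, map_ofNat]
      linear_combination 4 * he)
    have h3 : Ideal.Quotient.mk I e = Ideal.Quotient.mk I a := (Ideal.Quotient.eq.2 hae).symm
    have h4 : a * (a - 1) = 0 := by
      have : a ^ 2 - a = 0 := by simpa using ha
      linear_combination this
    rcases mul_eq_zero.1 h4 with h5 | h5
    · exact Or.inl (by rw [h3, h5, map_zero])
    · exact Or.inr (by rw [h3, sub_eq_zero.1 h5, map_one])
  have hdich := isUnit_or_isNilpotent_of_idempotents hid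
  refine ⟨IsLocalRing.of_isUnit_or_isUnit_one_sub_self fun x => ?_, fun u hu => ?_⟩
  · rcases hdich (Ideal.Quotient.mk I x) with h3 | h3
    · exact Or.inl (hunit _ h3)
    · refine Or.inr (hunit _ ?_)
      rw [map_sub, map_one]
      exact h3.isUnit_one_sub
  set φ : k →+* A ⧸ I := ((Ideal.Quotient.mk I).comp (algebraMap (OO k) A)).comp PowerSeries.C
  have hφ : (Ideal.Quotient.mk I).comp (algebraMap (OO k) A) =
      φ.comp PowerSeries.constantCoeff := by
    refine RingHom.ext fun r => ?_
    refine Ideal.Quotient.eq.2 ?_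
    rw [← map_sub]
    refine Ideal.mem_map_of_mem _ (Ideal.mem_span_singleton.2 ?_)
    rw [PowerSeries.X_dvd_iff]
    simp
  have hint : IsIntegral (OO k) u := IsIntegral.of_finite _ _
  set P := (minpoly (OO k) u).map PowerSeries.constantCoeff
  have hP : P.Monic := (minpoly.monic hint).map _
  have hP0 : P.eval₂ φ (Ideal.Quotient.mk I u) = 0 := by
    rw [eval₂_map, ← hφ, ← hom_eval₂, ← aeval_def, minpoly.aeval, map_zero]
  obtain ⟨c, hc⟩ : ∃ c : k, ¬ IsUnit (Ideal.Quotient.mk I u - φ c) := by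
    by_contra! h
    rw [(IsAlgClosed.splits P).eq_prod_roots_of_monic hP, ← coe_eval₂RingHom, map_multiset_prod,
      Multiset.map_map] at hP0
    refine not_isUnit_zero (M₀ := A ⧸ I) (hP0 ▸ Multiset.prod_induction IsUnit _
      (fun a b ha hb => ha.mul hb) isUnit_one ?_)
    intro a ha
    obtain ⟨d, _, rfl⟩ := Multiset.mem_map.1 ha
    simpa using h d
  have hn := (hdich _).resolve_left hc
  have hu' : IsUnit (Ideal.Quotient.mk I u) := hu.map _
  have h2A : IsUnit (2 : A ⧸ I) := by
    have h3 := h2.isUnit.map φ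
    rwa [map_ofNat] at h3
  obtain ⟨d, hd⟩ := IsAlgClosed.exists_pow_nat_eq c (n := 2) (by norm_num)
  have hd0 : d ≠ 0 := by
    rintro rfl
    rw [← hd] at hn
    simp only [ne_eq, OfNat.ofNat_ne_zero, not_false_eq_true, zero_pow, map_zero, sub_zero] at hn
    exact hn.not_isUnit hu'
  obtain ⟨v, ⟨-, hv⟩, -⟩ := Polynomial.existsUnique_nilpotent_sub_and_aeval_eq_zero
    (P := X ^ 2 - C (Ideal.Quotient.mk I u)) (x := φ d) (by
      have h3 : aeval (φ d) (X ^ 2 - C (Ideal.Quotient.mk I u)) =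
          -(Ideal.Quotient.mk I u - φ c) := by
        rw [← hd]; simp
      rw [h3]
      exact hn.neg) (by
      have h3 : aeval (φ d) (derivative (X ^ 2 - C (Ideal.Quotient.mk I u))) = 2 * φ d := by
        simp [one_add_one_eq_two]
      rw [h3]
      exact h2A.mul (hd0.isUnit.map φ))
  obtain ⟨v, rfl⟩ := Ideal.Quotient.mk_surjective v
  have hv2 : Ideal.Quotient.mk I v ^ 2 = Ideal.Quotient.mk I u := by
    simpa [sub_eq_zero] using hv
  obtain ⟨w, hw, -⟩ := hh.is_henselian (X ^ 2 - C u) (monic_X_pow_sub_C _ (by norm_num)) v (by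
      rw [← Ideal.Quotient.eq_zero_iff_mem]
      simp [hv2]) (by
      have h3 : Ideal.Quotient.mk I (eval v (derivative (X ^ 2 - C u))) =
        2 * Ideal.Quotient.mk I v := by
        simp only [derivative_sub, derivative_X_pow, derivative_C]
        simp only [Nat.cast_ofNat, Nat.reduceSub, pow_one, sub_zero, eval_mul, eval_C, eval_X,
          map_mul]
        exact congrArg (· * _) (map_ofNat (Ideal.Quotient.mk I) 2)
      rw [h3]
      refine h2A.mul ?_
      rw [← isUnit_pow_iff two_ne_zero, hv2]
      exact hu')
  refine ⟨w, ?_⟩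
  have h3 : w ^ 2 - u = 0 := by simpa using hw
  linear_combination -h3

/-- In a finite separable extension of `F`, the form `⟨1, -s⟩` is universal. -/
theorem exists_sq_sub_mul_sq (h2 : (2 : k) ≠ 0) (E : Type*) [Field E] [Algebra (FF k) E]
    [Algebra (OO k) E] [IsScalarTower (OO k) (FF k) E] [FiniteDimensional (FF k) E]
    [Algebra.IsSeparable (FF k) E] {s : E} (hs : s ≠ 0) (c : E) :
    ∃ a b : E, a ^ 2 - s * b ^ 2 = c := by
  have hinj : Function.Injective (algebraMap (OO k) E) := by
    rw [IsScalarTower.algebraMap_eq (OO k) (FF k) E]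
    exact (algebraMap (FF k) E).injective.comp algebraMap_injective_OO
  let A := integralClosure (OO k) E
  have : IsDedekindDomain A := integralClosure.isDedekindDomain (OO k) (FF k) E
  have : Module.Finite (OO k) A := IsIntegralClosure.finite (OO k) (FF k) E A
  have : Module.IsTorsionFree (OO k) E := by
    have := (faithfulSMul_iff_algebraMap_injective (OO k) E).2 hinj
    infer_instance
  have : Module.Free (OO k) A := IsIntegralClosure.module_free (OO k) (FF k) E A
  have : IsFractionRing A E := integralClosure.isFractionRing_of_finite_extension (FF k) E
  obtain ⟨hloc, hsq⟩ := isLocalRing_and_isSquare (A := A) h2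
  have hpid : IsPrincipalIdealRing A :=
    ((tfae_of_isNoetherianRing_of_isLocalRing_of_isDomain (R := A)).out 2 0 rfl rfl).1 ‹_›
  -- modulo squares, every element is `1` or `π`
  obtain ⟨π, hπ⟩ : ∃ π : E, ∀ x : E, IsSquare x ∨ ∃ y, x = π * y ^ 2 := by
    by_cases hfield : IsField A
    · refine ⟨1, fun x => Or.inl ?_⟩
      obtain ⟨a, b, hb, rfl⟩ := IsFractionRing.div_surjective (A := A) x
      have hsq' : ∀ a : A, IsSquare a := fun a => by
        by_cases h0 : a = 0
        · exact ⟨0, by simp [h0]⟩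
        · obtain ⟨b, hb⟩ := hfield.mul_inv_cancel h0
          exact hsq _ (IsUnit.of_mul_eq_one b hb)
      exact ((hsq' a).map _).div ((hsq' b).map _)
    have : IsDiscreteValuationRing A :=
      { not_a_field' := by rwa [Ne, ← IsLocalRing.isField_iff_maximalIdeal_eq] }
    obtain ⟨ϖ, hϖ⟩ := IsDiscreteValuationRing.exists_irreducible A
    refine ⟨algebraMap A E ϖ, fun x => ?_⟩
    have hA : ∀ a : A, IsSquare a ∨ ∃ y, a = ϖ * y ^ 2 := by
      intro a
      by_cases h0 : a = 0
      · exact Or.inl ⟨0, by simp [h0]⟩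
      obtain ⟨n, u, rfl⟩ := IsDiscreteValuationRing.eq_unit_mul_pow_irreducible h0 hϖ
      obtain ⟨r, hr⟩ := hsq u u.isUnit
      rcases Nat.even_or_odd' n with ⟨m, rfl | rfl⟩
      · exact Or.inl ⟨r * ϖ ^ m, by rw [hr]; ring⟩
      · exact Or.inr ⟨r * ϖ ^ m, by rw [hr]; ring⟩
    obtain ⟨a, b, hb, rfl⟩ := IsFractionRing.div_surjective (A := A) x
    have hb0 : algebraMap A E b ≠ 0 := by
      rw [Ne, map_eq_zero_iff _ (IsFractionRing.injective A E)]
      exact nonZeroDivisors.ne_zero hb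
    rcases hA (a * b) with ⟨y, hy⟩ | ⟨y, hy⟩
    · refine Or.inl ⟨algebraMap A E y / algebraMap A E b, ?_⟩
      have := congrArg (algebraMap A E) hy
      rw [map_mul, map_mul] at this
      field_simp
      linear_combination this
    · refine Or.inr ⟨algebraMap A E y / algebraMap A E b, ?_⟩
      have := congrArg (algebraMap A E) hy
      rw [map_mul, map_mul, map_pow] at this
      field_simp
      linear_combination this
  have h2E : (2 : E) ≠ 0 := (isUnit_two_of_algebra E (two_ne_zero_FF h2)).ne_zero
  rcases hπ c with ⟨r, rfl⟩ | ⟨r, rfl⟩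
  · exact ⟨r, 0, by ring⟩
  rcases hπ s with ⟨w, rfl⟩ | ⟨w, rfl⟩
  · have hw : w ≠ 0 := fun h => hs (by rw [h, zero_mul])
    refine ⟨(1 + π * r ^ 2) / 2, (1 - π * r ^ 2) / (2 * w), ?_⟩
    field_simp
    ring
  · have hw : w ≠ 0 := fun h => hs (by rw [h]; ring)
    obtain ⟨i, hi⟩ := IsAlgClosed.exists_pow_nat_eq (-1 : k) (n := 2) (by norm_num)
    set j := algebraMap (FF k) E (algebraMap (OO k) (FF k) (PowerSeries.C i))
    have hj : j ^ 2 = -1 := by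
      simp only [j, ← map_pow, hi, map_neg, map_one]
    refine ⟨0, j * r / w, ?_⟩
    field_simp
    linear_combination (-π * r ^ 2) * hj

/-- `X` is coprime to `g`, and `g` is separable: `⟨1, -X⟩` is universal modulo `g`. -/
theorem exists_dvd_sq_sub (h2 : (2 : k) ≠ 0) (c : (FF k)[X]) {g : (FF k)[X]}
    (hg : (X * g).Separable) : ∃ a b : (FF k)[X], g ∣ a ^ 2 - X * b ^ 2 - c := by
  have hg0 : g ≠ 0 := by
    rintro rfl
    exact (mul_zero (X : (FF k)[X]) ▸ hg).ne_zero rfl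
  induction g using UniqueFactorizationMonoid.induction_on_prime with
  | h₁ => exact absurd rfl hg0
  | h₂ u hu => exact ⟨0, 0, hu.dvd⟩
  | h₃ g p hg1 hp ih =>
    have hgs : (X * g).Separable :=
      hg.of_dvd (mul_dvd_mul_left _ (dvd_mul_left _ _))
    obtain ⟨a, b, d, hd⟩ := ih hgs hg1
    have hps : (X * p).Separable :=
      hg.of_dvd (mul_dvd_mul_left _ (dvd_mul_right _ _))
    have hpg : IsCoprime p g := (hg.of_dvd (dvd_mul_left _ _)).isCoprime
    have hXp : IsCoprime X p := hps.isCoprime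
    have : Fact (Irreducible p) := ⟨hp.irreducible⟩
    have : FiniteDimensional (FF k) (AdjoinRoot p) :=
      (AdjoinRoot.powerBasis hp.ne_zero).finite
    have : Algebra.IsSeparable (FF k) (AdjoinRoot p) := by
      have h3 : IsSeparable (FF k) (AdjoinRoot.root p) :=
        hps.of_mul_right.of_dvd (minpoly.dvd _ _ (by simp))
      have h4 := (IntermediateField.isSeparable_adjoin_simple_iff_isSeparable _ _).2 h3
      have h5 : IntermediateField.adjoin (FF k) {AdjoinRoot.root p} = ⊤ := by
        rw [← IntermediateField.toSubalgebra_inj]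
        rw [IntermediateField.adjoin_simple_toSubalgebra_of_isAlgebraic h3.isIntegral.isAlgebraic]
        exact AdjoinRoot.adjoinRoot_eq_top
      rw [h5] at h4
      exact Algebra.IsSeparable.of_equiv_equiv (RingEquiv.refl (FF k))
        (IntermediateField.topEquiv (F := FF k) (E := AdjoinRoot p)).toRingEquiv rfl
    have hs : AdjoinRoot.root p ≠ 0 := by
      intro h0
      obtain ⟨u, v, huv⟩ := hXp
      have := congrArg (AdjoinRoot.mk p) huv
      simp [h0] at this
    obtain ⟨a', b', hab⟩ := exists_sq_sub_mul_sq h2 (AdjoinRoot p) hs (AdjoinRoot.mk p c)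
    obtain ⟨a', rfl⟩ := AdjoinRoot.mk_surjective a'
    obtain ⟨b', rfl⟩ := AdjoinRoot.mk_surjective b'
    rw [← AdjoinRoot.mk_X, ← map_pow, ← map_pow, ← map_mul, ← map_sub, AdjoinRoot.mk_eq_mk] at hab
    obtain ⟨d', hd'⟩ := hab
    obtain ⟨u, v, huv⟩ := id hpg
    refine ⟨u * p * a + v * g * a', u * p * b + v * g * b', ?_⟩
    refine IsCoprime.mul_dvd hpg ?_ ?_
    · refine ⟨d' + u * ((a - a') * (u * p * a + v * g * a' + a') - X * (b - b') *
        (u * p * b + v * g * b' + b')), ?_⟩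
      have hv : v * g = 1 - u * p := by linear_combination huv
      rw [hv]
      linear_combination hd'
    · refine ⟨d + v * ((a' - a) * (u * p * a + v * g * a' + a) - X * (b' - b) *
        (u * p * b + v * g * b' + b)), ?_⟩
      have hv : u * p = 1 - v * g := by linear_combination huv
      rw [hv]
      linear_combination hd

end FiniteExtension

/-! ### Conjugacy of skew endomorphisms with the same characteristic polynomial -/

section Cyclic

open Module Polynomial

variable {K V : Type*} [Field K] [AddCommGroup V] [Module K V]

theorem dvd_of_aeval_eq_zero [FiniteDimensional K V] {γ : End K V} {f m : K[X]}
    (hf : f.Separable) (hfc : f ∣ γ.charpoly) (hm : aeval γ m = 0) : f ∣ m := by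
  by_cases hm0 : m = 0
  · rw [hm0]; exact dvd_zero _
  let b := Module.finBasis K V
  set M := LinearMap.toMatrix b b γ
  set L := AlgebraicClosure K
  rw [← LinearMap.charpoly_toMatrix γ b] at hfc
  have hM : aeval M m = 0 := by
    have := Polynomial.aeval_algHom_apply (LinearMap.toMatrixAlgEquiv b) γ m
    rw [hm, map_zero] at this
    exact this
  rw [← Polynomial.map_dvd_map' (algebraMap K L)]
  have hmL : m.map (algebraMap K L) ≠ 0 := (Polynomial.map_ne_zero_iff (algebraMap K L).injective).2 hm0
  refine Polynomial.Splits.dvd_of_roots_le_roots (IsAlgClosed.splits _)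
    ((Polynomial.map_ne_zero_iff (algebraMap K L).injective).2 hf.ne_zero) ?_
  rw [Multiset.le_iff_subset (nodup_roots hf.map)]
  intro α hα
  have h1 : (M.map (algebraMap K L)).charpoly.eval α = 0 := by
    rw [Matrix.charpoly_map]
    exact (IsRoot.dvd (isRoot_of_mem_roots hα) (Polynomial.map_dvd _ hfc)).eq_zero
  rw [Matrix.eval_charpoly] at h1
  obtain ⟨v, hv0, hv⟩ := Matrix.exists_mulVec_eq_zero_iff.2 h1
  rw [mem_roots hmL, IsRoot]
  have h2 : (M.map (algebraMap K L)).mulVec v = α • v := by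
    rw [Matrix.sub_mulVec, sub_eq_zero] at hv
    rw [← hv]
    simp
  have h3 : ∀ P : L[X], (aeval (M.map (algebraMap K L)) P).mulVec v = P.eval α • v := by
    intro P
    induction P using Polynomial.induction_on' with
    | add p q hp hq => rw [map_add, Matrix.add_mulVec, hp, hq, eval_add, add_smul]
    | monomial n a =>
      rw [aeval_monomial, eval_monomial, Algebra.algebraMap_eq_smul_one, smul_mul_assoc, one_mul,
        Matrix.smul_mulVec, mul_smul]
      congr 1
      induction n with
      | zero => simp
      | succ n ih => rw [pow_succ', ← Matrix.mulVec_mulVec, ih, Matrix.mulVec_smul, h2, smul_smul,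
          pow_succ]
  have h4 : aeval (M.map (algebraMap K L)) (m.map (algebraMap K L)) = 0 := by
    have := Polynomial.aeval_algHom_apply (Algebra.ofId K L).mapMatrix M m
    rw [hM, map_zero] at this
    rw [Polynomial.aeval_map_algebraMap]
    exact this
  have h5 := h3 (m.map (algebraMap K L))
  rw [h4, Matrix.zero_mulVec] at h5
  exact (smul_eq_zero.1 h5.symm).resolve_right hv0

/-- `v` generates a cyclic module with annihilator `f`. -/
def HasAnnihilator (γ : End K V) (f : K[X]) (v : V) : Prop :=
  ∀ P : K[X], aeval γ P v = 0 ↔ f ∣ P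

theorem exists_hasAnnihilator [FiniteDimensional K V] {γ : End K V} {f : K[X]} (hf : f.Separable)
    (hfc : f ∣ γ.charpoly) : ∃ v, HasAnnihilator γ f v := by
  obtain ⟨x, hx⟩ := exists_ker_toSpanSingleton_eq_annihilator K[X] (AEval' γ)
  obtain ⟨x, rfl⟩ := (AEval'.of _).surjective x
  obtain ⟨h, hh⟩ := dvd_of_aeval_eq_zero hf hfc (minpoly.aeval K γ)
  have hmin : minpoly K γ ≠ 0 := minpoly.ne_zero (Algebra.IsIntegral.isIntegral γ)
  have hx' : ∀ P : K[X], aeval γ P x = 0 ↔ minpoly K γ ∣ P := by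
    intro P
    rw [← Ideal.mem_span_singleton, span_minpoly_eq_annihilator, ← hx, LinearMap.mem_ker,
      LinearMap.toSpanSingleton_apply]
    exact ((AEval'.of γ).map_eq_zero_iff (x := aeval γ P x)).symm
  refine ⟨aeval γ h x, fun P => ?_⟩
  have hh0 : h ≠ 0 := by
    rintro rfl
    exact hmin (by rw [hh, mul_zero])
  rw [← End.mul_apply, ← map_mul, hx', hh]
  exact mul_dvd_mul_iff_right hh0

theorem HasAnnihilator.congr {γ : End K V} {f : K[X]} {v : V} (h : HasAnnihilator γ f v) {P Q : K[X]}
    (hPQ : f ∣ P - Q) : aeval γ P v = aeval γ Q v := by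
  rw [← sub_eq_zero, ← LinearMap.sub_apply, ← map_sub]
  exact (h _).2 hPQ

theorem rootMultiplicity_zero_X_pow_mul {f : K[X]} {r : ℕ} (hco : IsCoprime X f) (hf : f ≠ 0) :
    rootMultiplicity 0 (X ^ r * f) = r := by
  have h0 : ¬ IsRoot f 0 := by
    intro h
    obtain ⟨u, v, huv⟩ := hco
    have := congrArg (eval 0) huv
    simp [h.eq_zero] at this
  rw [rootMultiplicity_mul (mul_ne_zero (pow_ne_zero _ X_ne_zero) hf), rootMultiplicity_eq_zero h0,
    add_zero]
  have := rootMultiplicity_X_sub_C_pow (0 : K) r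
  rwa [C_0, sub_zero] at this

theorem finrank_ker_pow_le [FiniteDimensional K V] {γ : End K V} {f : K[X]} {r : ℕ}
    (hco : IsCoprime X f) (hf : f ≠ 0) (hc : γ.charpoly = X ^ r * f) (m : ℕ) :
    finrank K (LinearMap.ker (γ ^ m)) ≤ r := by
  have h1 := LinearMap.finrank_genEigenspace_le γ 0 m
  rwa [hc, rootMultiplicity_zero_X_pow_mul hco hf, End.genEigenspace_nat, zero_smul, sub_zero] at h1

theorem finrank_ker_aeval_le [FiniteDimensional K V] {γ : End K V} {f : K[X]} {r : ℕ}
    (hco : IsCoprime X f) (hf : f.Monic) (hc : γ.charpoly = X ^ r * f) :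
    finrank K (LinearMap.ker (aeval γ f)) ≤ f.natDegree := by
  have h1 := LinearMap.finrank_maxGenEigenspace_eq γ 0
  rw [hc, rootMultiplicity_zero_X_pow_mul hco hf.ne_zero,
    End.maxGenEigenspace_eq_genEigenspace_finrank, End.genEigenspace_nat, zero_smul, sub_zero] at h1
  have h2 := disjoint_ker_aeval_of_isCoprime γ (IsCoprime.pow_left (m := finrank K V) hco)
  rw [map_pow, aeval_X] at h2
  have h3 := Submodule.finrank_sup_add_finrank_inf_eq (LinearMap.ker (γ ^ finrank K V))
    (LinearMap.ker (aeval γ f))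
  rw [h2.eq_bot, finrank_bot, h1, add_zero] at h3
  have h4 := Submodule.finrank_le (LinearMap.ker (γ ^ finrank K V) ⊔ LinearMap.ker (aeval γ f))
  have h5 : γ.charpoly.natDegree = finrank K V := LinearMap.charpoly_natDegree γ
  rw [hc, (monic_X_pow r).natDegree_mul hf, natDegree_X_pow] at h5
  omega

/-- The vectors `P(γ) v` for `P` of degree `< n`. -/
def orbitMap (γ : End K V) (n : ℕ) (v : V) : degreeLT K n →ₗ[K] V :=
  LinearMap.applyₗ v ∘ₗ (aeval γ).toLinearMap ∘ₗ (degreeLT K n).subtype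

theorem orbitMap_apply (γ : End K V) (n : ℕ) (v : V) (P : degreeLT K n) :
    orbitMap γ n v P = aeval γ (P : K[X]) v := rfl

theorem HasAnnihilator.orbitMap_injective {γ : End K V} {f : K[X]} {v : V}
    (h : HasAnnihilator γ f v) (hf : f.Monic) :
    Function.Injective (orbitMap γ f.natDegree v) := by
  rw [injective_iff_map_eq_zero]
  intro P hP
  have h1 := (h _).1 hP
  have h2 := mem_degreeLT.1 P.2
  rw [← degree_eq_natDegree hf.ne_zero] at h2
  exact Subtype.ext (eq_zero_of_dvd_of_degree_lt h1 h2)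

theorem finrank_degreeLT (n : ℕ) : finrank K (degreeLT K n) = n := by
  rw [(degreeLTEquiv K n).finrank_eq, finrank_fin_fun]

instance (n : ℕ) : FiniteDimensional K (degreeLT K n) :=
  (degreeLTEquiv K n).symm.finiteDimensional

theorem HasAnnihilator.exists_eq [FiniteDimensional K V] {γ : End K V} {f : K[X]} {v : V} {r : ℕ}
    (h : HasAnnihilator γ f v) (hf : f.Monic) (hco : IsCoprime X f)
    (hc : γ.charpoly = X ^ r * f) {w : V} (hw : aeval γ f w = 0) : ∃ P : K[X], aeval γ P v = w := by
  have h1 : LinearMap.range (orbitMap γ f.natDegree v) ≤ LinearMap.ker (aeval γ f) := by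
    rintro _ ⟨P, rfl⟩
    rw [LinearMap.mem_ker, orbitMap_apply, ← End.mul_apply, ← map_mul, h]
    exact dvd_mul_right _ _
  have h2 := LinearMap.finrank_range_of_inj (h.orbitMap_injective hf)
  rw [finrank_degreeLT] at h2
  have h3 := Submodule.eq_of_le_of_finrank_le h1 ((finrank_ker_aeval_le hco hf hc).trans h2.ge)
  obtain ⟨P, hP⟩ := h3.ge hw
  exact ⟨P, hP⟩

theorem exists_add_of_charpoly [FiniteDimensional K V] {γ : End K V} {f : K[X]} {r : ℕ}
    (hco : IsCoprime X f) (hc : γ.charpoly = X ^ r * f) (x : V) :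
    ∃ w w₀, x = w + w₀ ∧ aeval γ f w = 0 ∧ (γ ^ r) w₀ = 0 := by
  obtain ⟨a, b, hab⟩ := IsCoprime.pow_left (m := r) hco
  have h0 : aeval γ (X ^ r * f) = 0 := hc ▸ LinearMap.aeval_self_charpoly γ
  refine ⟨aeval γ (a * X ^ r) x, aeval γ (b * f) x, ?_, ?_, ?_⟩
  · rw [← LinearMap.add_apply, ← map_add, hab, map_one, End.one_apply]
  · rw [← End.mul_apply, ← map_mul, show f * (a * X ^ r) = a * (X ^ r * f) by ring, map_mul, h0,
      mul_zero, LinearMap.zero_apply]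
  · have h1 : γ ^ r = aeval γ (X ^ r : K[X]) := by rw [map_pow, aeval_X]
    rw [h1, ← End.mul_apply, ← map_mul, show X ^ r * (b * f) = b * (X ^ r * f) by ring, map_mul, h0,
      mul_zero, LinearMap.zero_apply]

end Cyclic

section Skew

open Module Polynomial

variable {K V : Type*} [Field K] [AddCommGroup V] [Module K V]

theorem bilin_aeval_left {B : LinearMap.BilinForm K V} {γ : End K V}
    (hγ : ∀ x y, B (γ x) y = -B x (γ y)) (P : K[X]) (x y : V) :
    B (aeval γ P x) y = B x (aeval γ (P.comp (-X)) y) := by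
  induction P using Polynomial.induction_on' generalizing y with
  | add p q hp hq => simp only [map_add, LinearMap.add_apply, add_comp, hp, hq]
  | monomial n a =>
    rw [monomial_comp, ← C_mul_X_pow_eq_monomial, map_mul, map_mul, aeval_C, map_pow, map_pow,
      aeval_X, map_neg, aeval_X, End.mul_apply, End.mul_apply, Algebra.algebraMap_eq_smul_one,
      LinearMap.smul_apply, LinearMap.smul_apply, End.one_apply, End.one_apply, map_smul,
      map_smul, LinearMap.smul_apply]
    congr 1
    induction n generalizing y with
    | zero => simp
    | succ n ih =>
      rw [pow_succ', pow_succ, End.mul_apply, hγ, ih, End.mul_apply, LinearMap.neg_apply, map_neg,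
        map_neg]

theorem expand_two_comp_neg_X (P : K[X]) : (expand K 2 P).comp (-X) = expand K 2 P := by
  rw [expand_eq_comp_X_pow, comp_assoc, X_pow_comp, neg_sq]

theorem exists_add_comp_neg_X (P : K[X]) : ∃ c : K[X], P + P.comp (-X) = 2 * expand K 2 c := by
  induction P using Polynomial.induction_on' with
  | add p q hp hq =>
    obtain ⟨c, hc⟩ := hp
    obtain ⟨d, hd⟩ := hq
    exact ⟨c + d, by rw [add_comp, map_add]; linear_combination hc + hd⟩
  | monomial n a =>
    rw [monomial_comp, ← C_mul_X_pow_eq_monomial]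
    rcases Nat.even_or_odd' n with ⟨m, rfl | rfl⟩
    · refine ⟨C a * X ^ m, ?_⟩
      rw [map_mul, expand_C, map_pow, expand_X, pow_mul, pow_mul]
      ring
    · exact ⟨0, by rw [map_zero, Odd.neg_pow ⟨m, rfl⟩]; ring⟩

theorem comp_neg_X_comp_neg_X (P : K[X]) : (P.comp (-X)).comp (-X) = P := by
  rw [comp_assoc, neg_comp, X_comp, neg_neg, comp_X]

variable [FiniteDimensional K V] {B : LinearMap.BilinForm K V} {γ γ' : End K V} {g : K[X]} {r : ℕ}

theorem bilin_ker_ker (hγ : ∀ x y, B (γ x) y = -B x (γ y))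
    (hco : IsCoprime X (expand K 2 g)) {w w₀ : V} (hw : aeval γ (expand K 2 g) w = 0)
    (hw₀ : (γ ^ r) w₀ = 0) : B w w₀ = 0 := by
  obtain ⟨a, b, hab⟩ := IsCoprime.pow_left (m := r) hco
  have h1 : w = aeval γ (a * X ^ r) w := by
    have h2 := congrArg (fun P => aeval γ P w) hab
    simp only [map_add, LinearMap.add_apply, map_one, End.one_apply] at h2
    rw [map_mul _ b, End.mul_apply, hw, map_zero, add_zero] at h2
    exact h2.symm
  rw [h1, bilin_aeval_left hγ, mul_comp, X_pow_comp, neg_pow, ← mul_assoc, map_mul, map_pow, aeval_X,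
    End.mul_apply, hw₀, map_zero, map_zero]

theorem isCoprime_X_expand {g : K[X]} (h : (X * g).Separable) : IsCoprime X (expand K 2 g) := by
  have h1 := h.isCoprime.map (expand K 2).toRingHom
  have h2 : (expand K 2).toRingHom (X : K[X]) = X ^ 2 := expand_X ..
  rw [h2] at h1
  exact (IsCoprime.pow_left_iff (by norm_num)).1 h1

theorem separable_expand_two {g : K[X]} (h2 : (2 : K) ≠ 0) (h : (X * g).Separable) :
    (expand K 2 g).Separable := by
  have h1 : IsCoprime g (derivative g) := h.of_mul_right
  have h3 := h1.map (expand K 2).toRingHom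
  rw [Polynomial.Separable, derivative_expand]
  refine IsCoprime.mul_right h3 (IsCoprime.mul_right ?_ ?_)
  · rw [show ((2 : ℕ) : K[X]) = C 2 from (map_ofNat C 2).symm]
    exact isCoprime_one_right.of_isCoprime_of_dvd_right (isUnit_C.2 h2.isUnit).dvd
  · simpa using (isCoprime_X_expand h).symm

/-- The data of the matching lemma. -/
structure SkewPair (B : LinearMap.BilinForm K V) (γ γ' : End K V) (g : K[X]) (r : ℕ) : Prop where
  two_ne_zero : (2 : K) ≠ 0
  nondeg : B.Nondegenerate
  sign : ∃ ε : K, ε ≠ 0 ∧ ∀ x y, B x y = ε * B y x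
  skew : ∀ x y, B (γ x) y = -B x (γ y)
  skew' : ∀ x y, B (γ' x) y = -B x (γ' y)
  monic : g.Monic
  separable : (X * g).Separable
  charpoly : γ.charpoly = X ^ r * expand K 2 g
  charpoly' : γ'.charpoly = X ^ r * expand K 2 g

namespace SkewPair

theorem isCoprime (h : SkewPair B γ γ' g r) : IsCoprime X (expand K 2 g) :=
  isCoprime_X_expand h.separable

theorem separable_expand (h : SkewPair B γ γ' g r) : (expand K 2 g).Separable :=
  separable_expand_two h.two_ne_zero h.separable

theorem orthogonal_eq_zero (h : SkewPair B γ γ' g r) {v : V}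
    (hv : HasAnnihilator γ (expand K 2 g) v) {w : V} (hw : aeval γ (expand K 2 g) w = 0)
    (hwv : ∀ P : K[X], B w (aeval γ P v) = 0) : w = 0 := by
  refine h.nondeg.1 w fun x => ?_
  obtain ⟨y, y₀, rfl, hy, hy₀⟩ := exists_add_of_charpoly h.isCoprime h.charpoly x
  obtain ⟨P, rfl⟩ := hv.exists_eq ((Polynomial.monic_expand_iff (by norm_num)).2 h.monic) h.isCoprime h.charpoly hy
  rw [map_add, hwv, bilin_ker_ker h.skew h.isCoprime hw hy₀, add_zero]

/-- Two cyclic parts are isometric. -/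
theorem exists_matching (h : SkewPair B γ γ' g r)
    (hP : ∀ c : K[X], ∃ a b : K[X], g ∣ a ^ 2 - X * b ^ 2 - c) :
    ∃ v y, HasAnnihilator γ' (expand K 2 g) v ∧ HasAnnihilator γ (expand K 2 g) y ∧
      ∀ P Q : K[X], B (aeval γ P y) (aeval γ Q y) = B (aeval γ' P v) (aeval γ' Q v) := by
  set f := expand K 2 g with hf
  have hfm : f.Monic := (Polynomial.monic_expand_iff (by norm_num)).2 h.monic
  obtain ⟨v, hv⟩ := exists_hasAnnihilator h.separable_expand (h.charpoly' ▸ dvd_mul_left _ _)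
  obtain ⟨u, hu⟩ := exists_hasAnnihilator h.separable_expand (h.charpoly ▸ dvd_mul_left _ _)
  have h' : SkewPair B γ' γ g r := ⟨h.1, h.2, h.3, h.5, h.4, h.6, h.7, h.9, h.8⟩
  -- the form at `v` is a twist of the form at `u`
  obtain ⟨R, hR⟩ : ∃ R : K[X], ∀ P, B (aeval γ R u) (aeval γ P u) = B v (aeval γ' P v) := by
    let Ψ : degreeLT K f.natDegree →ₗ[K] Dual K (degreeLT K f.natDegree) :=
      (LinearMap.lcomp K K (orbitMap γ f.natDegree u)) ∘ₗ B ∘ₗ orbitMap γ f.natDegree u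
    have hmod : ∀ P : K[X], P %ₘ f ∈ degreeLT K f.natDegree := fun P => by
      rw [mem_degreeLT, ← degree_eq_natDegree hfm.ne_zero]
      exact degree_modByMonic_lt _ hfm
    have hmod' : ∀ P : K[X], f ∣ P - P %ₘ f := fun P =>
      ⟨P /ₘ f, by linear_combination -(modByMonic_add_div P f)⟩
    have hΨ : Function.Surjective Ψ := by
      rw [← LinearMap.injective_iff_surjective_of_finrank_eq_finrank
        Subspace.dual_finrank_eq.symm, injective_iff_map_eq_zero]
      intro R hR
      refine hu.orbitMap_injective hfm ?_
      rw [map_zero]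
      refine h.orthogonal_eq_zero hu ?_ fun P => ?_
      · rw [orbitMap_apply, ← End.mul_apply, ← map_mul, hu]
        exact dvd_mul_right _ _
      · rw [hu.congr (hmod' P)]
        exact congrArg (fun φ => φ ⟨_, hmod P⟩) hR
    obtain ⟨R, hR⟩ := hΨ (B v ∘ₗ orbitMap γ' f.natDegree v)
    refine ⟨R, fun P => ?_⟩
    rw [hu.congr (hmod' P), hv.congr (hmod' P)]
    exact congrArg (fun φ => φ ⟨_, hmod P⟩) hR
  obtain ⟨ε, hε0, hε⟩ := h.sign
  obtain ⟨c, hc⟩ := exists_add_comp_neg_X R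
  obtain ⟨a, b, d, hd⟩ := hP c
  have hR1 : ∀ P, B u (aeval γ (R.comp (-X) * P) u) = B v (aeval γ' P v) := fun P => by
    rw [← hR, bilin_aeval_left h.skew, map_mul, End.mul_apply]
  have hR2 : ∀ P, B u (aeval γ (R * P) u) = B v (aeval γ' P v) := fun P => by
    have h1 := hR1 (P.comp (-X))
    rw [← mul_comp, ← bilin_aeval_left h.skew, ← bilin_aeval_left h.skew', hε,
      hε (aeval γ' P v)] at h1
    exact mul_left_cancel₀ hε0 h1
  have hc2 : ∀ P, B u (aeval γ (expand K 2 c * P) u) = B v (aeval γ' P v) := fun P => by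
    have h1 : aeval γ (2 * expand K 2 c * P) u = aeval γ (R * P) u + aeval γ (R.comp (-X) * P) u := by
      rw [← hc, add_mul, map_add, LinearMap.add_apply]
    have h3 : aeval γ (2 * expand K 2 c * P) u = (2 : K) • aeval γ (expand K 2 c * P) u := by
      rw [mul_assoc, two_mul, map_add, LinearMap.add_apply, two_smul]
    rw [h3] at h1
    have h4 := congrArg (B u) h1
    rw [map_smul, map_add, hR1, hR2, ← two_mul, smul_eq_mul] at h4
    exact mul_left_cancel₀ h.two_ne_zero h4
  set U := expand K 2 a + X * expand K 2 b
  have hU : f ∣ U.comp (-X) * U - expand K 2 c := by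
    refine ⟨expand K 2 d, ?_⟩
    have h1 := congrArg (expand K 2) hd
    simp only [map_sub, map_mul, map_pow, expand_X] at h1
    simp only [U, add_comp, mul_comp, X_comp, expand_two_comp_neg_X]
    linear_combination h1
  have hy : ∀ P, B (aeval γ U u) (aeval γ (P * U) u) = B v (aeval γ' P v) := fun P => by
    rw [bilin_aeval_left h.skew, ← End.mul_apply, ← map_mul, ← hc2]
    refine congrArg _ (hu.congr ?_)
    obtain ⟨e, he⟩ := hU
    exact ⟨e * P, by linear_combination P * he⟩
  have hyy : ∀ P Q, B (aeval γ P (aeval γ U u)) (aeval γ Q (aeval γ U u)) =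
      B (aeval γ' P v) (aeval γ' Q v) := fun P Q => by
    rw [bilin_aeval_left h.skew, bilin_aeval_left h.skew', ← End.mul_apply, ← End.mul_apply,
      ← End.mul_apply, ← map_mul, ← map_mul, ← map_mul, hy]
  refine ⟨v, aeval γ U u, hv, fun P => ⟨fun hP0 => ?_, fun hfP => ?_⟩, hyy⟩
  · rw [← hv]
    refine h'.orthogonal_eq_zero hv ?_ fun Q => ?_
    · rw [← End.mul_apply, ← map_mul, hv]
      exact dvd_mul_right _ _
    · rw [← hyy, hP0, map_zero, LinearMap.zero_apply]
  · rw [← End.mul_apply, ← map_mul, hu]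
    exact hfP.mul_right _

end SkewPair

end Skew

section SkewConjugacy

open Module Polynomial

variable {K V : Type*} [Field K] [AddCommGroup V] [Module K V] [FiniteDimensional K V]
  {B : LinearMap.BilinForm K V} {γ γ' : End K V} {g : K[X]} {r : ℕ}

namespace SkewPair

theorem symm (h : SkewPair B γ γ' g r) : SkewPair B γ' γ g r :=
  ⟨h.1, h.2, h.3, h.5, h.4, h.6, h.7, h.9, h.8⟩

theorem monic_expand (h : SkewPair B γ γ' g r) : (expand K 2 g).Monic :=
  (Polynomial.monic_expand_iff (by norm_num)).2 h.monic

theorem exists_isometry_of_zero (h : SkewPair B γ γ' g 0)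
    (hP : ∀ c : K[X], ∃ a b : K[X], g ∣ a ^ 2 - X * b ^ 2 - c) :
    ∃ σ : End K V, (∀ x y, B (σ x) (σ y) = B x y) ∧ ∀ x, γ (σ x) = σ (γ' x) := by
  obtain ⟨v, y, hv, hy, hvy⟩ := h.exists_matching hP
  set f := expand K 2 g with hf
  have hall : ∀ w, ∃ P : K[X], aeval γ' P v = w := fun w => by
    refine hv.exists_eq h.monic_expand h.isCoprime h.charpoly' ?_
    have := LinearMap.aeval_self_charpoly γ'
    rw [h.charpoly', pow_zero, one_mul] at this
    rw [this, LinearMap.zero_apply]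
  have hmod : ∀ P : K[X], P %ₘ f ∈ degreeLT K f.natDegree := fun P => by
    rw [mem_degreeLT, ← degree_eq_natDegree h.monic_expand.ne_zero]
    exact degree_modByMonic_lt _ h.monic_expand
  have hmod' : ∀ P : K[X], f ∣ P - P %ₘ f := fun P =>
    ⟨P /ₘ f, by linear_combination -(modByMonic_add_div P f)⟩
  let e := LinearEquiv.ofBijective (orbitMap γ' f.natDegree v)
    ⟨hv.orbitMap_injective h.monic_expand, fun w => by
      obtain ⟨P, rfl⟩ := hall w
      exact ⟨⟨_, hmod P⟩, (hv.congr (hmod' P)).symm⟩⟩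
  let σ : End K V := orbitMap γ f.natDegree y ∘ₗ e.symm.toLinearMap
  have hσ : ∀ P : K[X], σ (aeval γ' P v) = aeval γ P y := fun P => by
    rw [hv.congr (hmod' P), hy.congr (hmod' P)]
    exact congrArg (orbitMap γ f.natDegree y) (e.symm_apply_apply ⟨_, hmod P⟩)
  refine ⟨σ, fun x z => ?_, fun x => ?_⟩
  · obtain ⟨P, rfl⟩ := hall x
    obtain ⟨Q, rfl⟩ := hall z
    rw [hσ, hσ, hvy]
  · obtain ⟨P, rfl⟩ := hall x
    have h1 : ∀ (δ : End K V) (u : V), δ (aeval δ P u) = aeval δ (X * P) u := fun δ u => by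
      rw [map_mul, aeval_X, End.mul_apply]
    rw [hσ, h1, h1, hσ]

theorem apply_eq_zero_of_pow (h : SkewPair B γ γ' g r) (hr : r ≤ 2) (hB : B.IsSymm) {x : V}
    (hx : (γ ^ r) x = 0) : γ x = 0 := by
  obtain hr | rfl : r ≤ 1 ∨ r = 2 := by omega
  · have h1 : (γ ^ 1) x = 0 := by
      rw [← Nat.sub_add_cancel hr, pow_add, End.mul_apply, hx, map_zero]
    rwa [pow_one] at h1
  by_contra hx0
  have hxx : γ (γ x) = 0 := by rwa [pow_two] at hx
  have hBx : B (γ x) x = 0 := by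
    have h1 := h.skew x x
    rw [hB.eq (γ x) x] at h1
    have h3 : (2 : K) * B x (γ x) = 0 := by linear_combination h1
    rw [← hB.eq x (γ x)]
    exact (mul_eq_zero.1 h3).resolve_left h.two_ne_zero
  have hli : LinearIndependent K ![x, γ x] := by
    rw [LinearIndependent.pair_iff]
    intro s t hst
    have h1 := congrArg γ hst
    rw [map_add, map_smul, map_smul, hxx, smul_zero, add_zero, map_zero] at h1
    have hs := (smul_eq_zero.1 h1).resolve_right hx0
    rw [hs, zero_smul, zero_add] at hst
    exact ⟨hs, (smul_eq_zero.1 hst).resolve_right hx0⟩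
  have hle : Submodule.span K (Set.range ![x, γ x]) ≤ LinearMap.ker (γ ^ 2) := by
    rw [Submodule.span_le]
    rintro _ ⟨i, rfl⟩
    fin_cases i
    · exact hx
    · change (γ ^ 2) (γ x) = 0
      rw [pow_two, End.mul_apply, hxx, map_zero]
  have heq := Submodule.eq_of_le_of_finrank_le hle (by
    rw [finrank_span_eq_card hli, Fintype.card_fin]
    exact finrank_ker_pow_le h.isCoprime h.monic_expand.ne_zero h.charpoly 2)
  refine hx0 (h.nondeg.1 _ fun z => ?_)
  obtain ⟨w, w₀, rfl, hw, hw₀⟩ := exists_add_of_charpoly h.isCoprime h.charpoly z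
  have h1 : B (γ x) w = 0 := by
    rw [hB.eq]
    refine bilin_ker_ker (r := 2) h.skew h.isCoprime hw ?_
    rw [pow_two, End.mul_apply, hxx, map_zero]
  have h3 : B (γ x) w₀ = 0 := by
    have h4 : w₀ ∈ Submodule.span K (Set.range ![x, γ x]) := heq.ge hw₀
    rw [Matrix.range_cons, Matrix.range_cons, Matrix.range_empty, Set.union_empty,
      Set.singleton_union, Submodule.mem_span_pair] at h4
    obtain ⟨s, t, rfl⟩ := h4
    rw [map_add, map_smul, map_smul, hBx, h.skew, hxx, map_zero, neg_zero, smul_zero, smul_zero,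
      add_zero]
  rw [map_add, h1, h3, add_zero]

theorem exists_isometry_of_symm (h : SkewPair B γ γ' g r) (hr : r ≤ 2) (hB : B.IsSymm)
    (hP : ∀ c : K[X], ∃ a b : K[X], g ∣ a ^ 2 - X * b ^ 2 - c) :
    ∃ σ : End K V, (∀ x y, B (σ x) (σ y) = B x y) ∧ ∀ x, γ (σ x) = σ (γ' x) := by
  obtain ⟨v, y, hv, hy, hvy⟩ := h.exists_matching hP
  set f := expand K 2 g with hf
  set W := LinearMap.ker (aeval γ' f)
  have hW : ∀ w ∈ W, ∃ P : K[X], aeval γ' P v = w := fun w hw =>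
    hv.exists_eq h.monic_expand h.isCoprime h.charpoly' hw
  have hvW : ∀ P : K[X], aeval γ' P v ∈ W := fun P => by
    rw [LinearMap.mem_ker, ← End.mul_apply, ← map_mul, hv]
    exact dvd_mul_right _ _
  have : Invertible (2 : K) := invertibleOfNonzero h.two_ne_zero
  obtain ⟨b, hb⟩ := LinearMap.BilinForm.exists_orthogonal_basis (B := B.restrict W)
    ⟨fun x z => hB.eq x z⟩
  choose p hp using fun i => hW _ (b i).2
  have hbo : ∀ i j, i ≠ j → B (b i : V) (b j) = 0 := fun i j hij => hb hij
  have hbn : ∀ i, B (b i : V) (b i) ≠ 0 := by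
    intro i h0
    refine b.ne_zero i (Subtype.ext ?_)
    refine h.symm.orthogonal_eq_zero hv (b i).2 fun P => ?_
    have h1 := b.sum_repr ⟨_, hvW P⟩
    have h2 := congrArg Subtype.val h1
    rw [AddSubmonoidClass.coe_finsetSum] at h2
    change B (b i : V) (Subtype.val (⟨_, hvW P⟩ : W)) = 0
    rw [← h2, map_sum]
    refine Finset.sum_eq_zero fun j _ => ?_
    rw [SetLike.val_smul, map_smul]
    by_cases hij : i = j
    · rw [← hij, h0, smul_zero]
    · rw [hbo i j hij, smul_zero]
  obtain ⟨σ, hσ, hσb⟩ := exists_isometry_extending h.two_ne_zero hB (fun i => (b i : V))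
    (fun i => aeval γ (p i) y) hbo hbn (fun i j => by rw [hvy, hp, hp])
  have hσv : ∀ P : K[X], σ (aeval γ' P v) = aeval γ P y := by
    intro P
    set c := b.repr ⟨_, hvW P⟩
    have h1 : aeval γ' P v = ∑ i, c i • (b i : V) := by
      have h2 := congrArg Subtype.val (b.sum_repr ⟨_, hvW P⟩)
      rw [AddSubmonoidClass.coe_finsetSum] at h2
      exact h2.symm
    have h3 : ∀ (δ : End K V) (u : V), aeval δ (∑ i, c i • p i) u = ∑ i, c i • aeval δ (p i) u :=
      fun δ u => by simp [LinearMap.sum_apply]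
    have h4 : f ∣ P - ∑ i, c i • p i := by
      rw [← hv, map_sub, LinearMap.sub_apply, h3, sub_eq_zero, h1]
      simp only [hp]
    rw [hy.congr h4, h3, h1, map_sum]
    refine Finset.sum_congr rfl fun i _ => ?_
    rw [map_smul, hσb]
  have hσi : Function.Injective σ := by
    rw [injective_iff_map_eq_zero]
    intro x hx
    refine h.nondeg.1 x fun z => ?_
    rw [← hσ, hx, map_zero, LinearMap.zero_apply]
  refine ⟨σ, hσ, fun x => ?_⟩
  obtain ⟨w, w₀, rfl, hw, hw₀⟩ := exists_add_of_charpoly h.isCoprime h.charpoly' x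
  obtain ⟨P, rfl⟩ := hW w hw
  have h1 : ∀ (δ : End K V) (u : V), δ (aeval δ P u) = aeval δ (X * P) u := fun δ u => by
    rw [map_mul, aeval_X, End.mul_apply]
  have h3 : γ (σ w₀) = 0 := by
    obtain ⟨z, z₀, hz, hz1, hz₀⟩ := exists_add_of_charpoly h.isCoprime h.charpoly (σ w₀)
    have hz0 : z = 0 := by
      refine h.orthogonal_eq_zero hy hz1 fun Q => ?_
      have h4 : B (aeval γ Q y) (σ w₀) = 0 := by
        rw [← hσv, hσ]
        exact bilin_ker_ker h.skew' h.isCoprime (hvW Q) hw₀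
      have h5 : B (aeval γ Q y) z₀ = 0 := by
        refine bilin_ker_ker h.skew h.isCoprime ?_ hz₀
        rw [← End.mul_apply, ← map_mul, hy]
        exact dvd_mul_right _ _
      rw [hz, map_add, h5, add_zero] at h4
      rw [hB.eq, h4]
    rw [hz, hz0, zero_add]
    exact h.apply_eq_zero_of_pow hr hB hz₀
  rw [map_add, map_add, map_add, map_add, h3, h.symm.apply_eq_zero_of_pow hr hB hw₀, map_zero, hσv,
    h1, h1, hσv]

end SkewPair

end SkewConjugacy

section MatrixConjugacy

open Module Polynomial Matrix

variable {ι : Type} [Fintype ι] [DecidableEq ι] {K : Type*} [Field K]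

theorem skewPair_of_mem {T : (Fin 2 → ι) → ℤ} (h2 : (2 : K) ≠ 0)
    (hT : IsUnit (gramMatrix T K).det) {ε : K} (hε : ε ≠ 0)
    (hTε : (gramMatrix T K)ᵀ = ε • gramMatrix T K) {γ γ' : Matrix ι ι K} (hγ : γ ∈ tensorLie T K)
    (hγ' : γ' ∈ tensorLie T K) {g : K[X]} {r : ℕ} (hm : g.Monic) (hs : (X * g).Separable)
    (hc : γ.charpoly = X ^ r * expand K 2 g) (hc' : γ'.charpoly = X ^ r * expand K 2 g) :
    SkewPair (Matrix.toBilin' (gramMatrix T K)) (Matrix.toLin' γ) (Matrix.toLin' γ') g r where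
  two_ne_zero := h2
  nondeg := LinearMap.BilinForm.nondegenerate_toBilin'_iff_det_ne_zero.2 hT.ne_zero
  sign := ⟨ε, hε, fun x y => by
    rw [Matrix.toBilin'_apply', Matrix.toBilin'_apply', dotProduct_mulVec, ← mulVec_transpose, hTε,
      smul_mulVec, smul_dotProduct, dotProduct_comm, smul_eq_mul]⟩
  skew x y := by
    have h := ((mem_tensorLie_two_iff _ _).1 hγ).2
    rw [Matrix.toBilin'_apply', Matrix.toBilin'_apply', Matrix.toLin'_apply, Matrix.toLin'_apply,
      mulVec_mulVec, ← neg_eq_of_add_eq_zero_right h, neg_mulVec, dotProduct_neg, neg_neg,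
      ← mulVec_mulVec, dotProduct_mulVec x, vecMul_transpose]
  skew' x y := by
    have h := ((mem_tensorLie_two_iff _ _).1 hγ').2
    rw [Matrix.toBilin'_apply', Matrix.toBilin'_apply', Matrix.toLin'_apply, Matrix.toLin'_apply,
      mulVec_mulVec, ← neg_eq_of_add_eq_zero_right h, neg_mulVec, dotProduct_neg, neg_neg,
      ← mulVec_mulVec, dotProduct_mulVec x, vecMul_transpose]
  monic := hm
  separable := hs
  charpoly := by rw [Matrix.charpoly_toLin', hc]
  charpoly' := by rw [Matrix.charpoly_toLin', hc']

theorem exists_preserves_of_isometry {T : (Fin 2 → ι) → ℤ} (hT : IsUnit (gramMatrix T K).det)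
    {γ γ' : Matrix ι ι K} (h : ∃ σ : End K (ι → K),
      (∀ x y, Matrix.toBilin' (gramMatrix T K) (σ x) (σ y) = Matrix.toBilin' (gramMatrix T K) x y) ∧
        ∀ x, Matrix.toLin' γ' (σ x) = σ (Matrix.toLin' γ x)) :
    ∃ A : Matrix ι ι K, A.det ≠ 0 ∧ Preserves T A ∧ γ' * A = A * γ := by
  obtain ⟨σ, h1, h3⟩ := h
  have hA : (LinearMap.toMatrix' σ)ᵀ * gramMatrix T K * LinearMap.toMatrix' σ = gramMatrix T K := by
    refine Matrix.ext fun i j => ?_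
    have h4 := h1 (Pi.single i 1) (Pi.single j 1)
    rw [Matrix.toBilin'_apply', ← LinearMap.toMatrix'_mulVec σ, ← LinearMap.toMatrix'_mulVec σ,
      mulVec_mulVec, ← vecMul_transpose, ← dotProduct_mulVec, mulVec_mulVec, ← mul_assoc,
      Matrix.toBilin'_apply'] at h4
    simpa using h4
  refine ⟨LinearMap.toMatrix' σ, ?_, (preserves_two_iff _ _).2 hA, ?_⟩
  · intro h0
    have h5 := congrArg Matrix.det hA
    rw [det_mul, h0, mul_zero] at h5
    exact hT.ne_zero h5.symm
  · apply Matrix.toLin'.injective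
    rw [Matrix.toLin'_mul, Matrix.toLin'_mul, Matrix.toLin'_toMatrix']
    exact LinearMap.ext h3

end MatrixConjugacy

section BilinearDescriptions

open Polynomial Matrix

variable {k : Type*} [Field k]

theorem polyFF_expand (P : (OO k)[X]) : expand (FF k) 2 (polyFF P) = polyFF (expand (OO k) 2 P) :=
  (Polynomial.map_expand ..).symm

theorem halfPoly_monic {n : ℕ} (a : Fin n → OO k) : (halfPoly a).Monic := by
  have h := evenPoly_monic a
  rwa [← expand_halfPoly, Polynomial.monic_expand_iff (by norm_num)] at h

theorem exists_preserves_of_symm [IsAlgClosed k] {ι : Type} [Fintype ι] [DecidableEq ι]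
    {T : (Fin 2 → ι) → ℤ} (h2 : (2 : k) ≠ 0)
    (hT : IsUnit (gramMatrix T (FF k)).det) (hTs : (gramMatrix T (FF k))ᵀ = gramMatrix T (FF k))
    {γ γ' : Matrix ι ι (FF k)} (hγ : γ ∈ tensorLie T (FF k))
    (hγ' : γ' ∈ tensorLie T (FF k)) {g : (FF k)[X]} {r : ℕ} (hr : r ≤ 2) (hm : g.Monic)
    (hs : (X * g).Separable) (hc : γ.charpoly = X ^ r * expand (FF k) 2 g)
    (hc' : γ'.charpoly = X ^ r * expand (FF k) 2 g) :
    ∃ A : Matrix ι ι (FF k), A.det ≠ 0 ∧ Preserves T A ∧ γ' * A = A * γ := by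
  have hp := skewPair_of_mem (two_ne_zero_FF h2) hT one_ne_zero (by rw [hTs, one_smul]) hγ' hγ hm hs
    hc' hc
  refine exists_preserves_of_isometry hT (hp.exists_isometry_of_symm hr ⟨fun x y => ?_⟩
    fun c => exists_dvd_sq_sub h2 c hs)
  rw [Matrix.toBilin'_apply', Matrix.toBilin'_apply', dotProduct_mulVec,
    ← mulVec_transpose, hTs, dotProduct_comm]

theorem sp_latticeDescription_of_regular (h2 : (2 : k) ≠ 0) {n : ℕ} (a : Fin n → OO k)
    (h : spRegular a) :
    LatticeDescription (spTensor n) (spChi a) (toGeneric (SpAlg a)) (AdjoinRoot.root _)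
      (baseLattice (SpAlg a)) (spForm a) := by
  refine sp_latticeDescription h2 a fun _ γ hγ γ' hγ' hc hc' => ?_
  have h1 : polyFF (evenPoly a) = X ^ 0 * expand (FF k) 2 (polyFF (halfPoly a)) := by
    rw [polyFF_expand, expand_halfPoly, pow_zero, one_mul]
  have hp := skewPair_of_mem (two_ne_zero_FF h2) (isUnit_det_spGram (FF k) n)
    (neg_ne_zero.2 one_ne_zero) (by rw [spGram_transpose, neg_one_smul]) hγ' hγ
    ((halfPoly_monic a).map _) h.separable (hc'.trans h1) (hc.trans h1)
  exact exists_preserves_of_isometry (isUnit_det_spGram (FF k) n)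
    (hp.exists_isometry_of_zero fun c => exists_dvd_sq_sub h2 c h.separable)

theorem soOdd_latticeDescription_of_regular (h2 : (2 : k) ≠ 0) {n : ℕ} (a : Fin n → OO k)
    (h : soOddRegular a) :
    LatticeDescription (soOddTensor n) (soOddChi a) (toGeneric (SOOddAlg a)) (AdjoinRoot.root _)
      (baseLattice (SOOddAlg a)) (soOddForm a) := by
  refine soOdd_latticeDescription h2 a fun _ γ hγ γ' hγ' hc hc' => ?_
  have h1 : polyFF (oddPoly a) = X ^ 1 * expand (FF k) 2 (polyFF (halfPoly a)) := by
    rw [polyFF_expand, expand_halfPoly, pow_one, oddPoly, polyFF, Polynomial.map_mul, Polynomial.map_X]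
  exact exists_preserves_of_symm h2 (isUnit_det_soOddGram (FF k) n) (soOddGram_transpose ..) hγ hγ'
    (by norm_num) ((halfPoly_monic a).map _) h.separable (hc.trans h1) (hc'.trans h1)

theorem soEven_latticeDescription_of_regular (h2 : (2 : k) ≠ 0) {m : ℕ} (a : Fin m → OO k)
    (p : OO k) (h : soEvenRegular a p) :
    LatticeDescription (soEvenTensor m) (soEvenChi a p)
      ((toGeneric (SOEvenNormAlg a p)).comp (soEvenToNorm a p)) (AdjoinRoot.root _)
      (baseLattice (SOEvenNormAlg a p)) (soEvenForm a p) := by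
  refine soEven_latticeDescription h2 h fun _ γ hγ γ' hγ' hc hc' => ?_
  have hs := h.separable
  by_cases hp : p = 0
  · subst hp
    rw [zero_pow two_ne_zero, C_0, add_zero, polyFF, Polynomial.map_mul, Polynomial.map_X] at hs
    have h1 : polyFF (soEvenPoly a 0) = X ^ 2 * expand (FF k) 2 (polyFF (halfPoly a)) := by
      rw [polyFF_expand, expand_halfPoly, soEvenPoly, zero_pow two_ne_zero, C_0, add_zero, polyFF,
        Polynomial.map_mul, Polynomial.map_pow, Polynomial.map_X]
    exact exists_preserves_of_symm h2 (isUnit_det_soEvenGram (FF k) m) (soEvenGram_transpose ..) hγ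
      hγ' le_rfl ((halfPoly_monic a).map _) hs (hc.1.trans h1) (hc'.1.trans h1)
  · have h1 : polyFF (soEvenPoly a p) =
        X ^ 0 * expand (FF k) 2 (polyFF (X * halfPoly a + C (p ^ 2))) := by
      rw [polyFF_expand, expand_soEvenHalf, pow_zero, one_mul]
    have hm : (X * halfPoly a + C (p ^ 2)).Monic := by
      refine (monic_X.mul (halfPoly_monic a)).add_of_left ?_
      refine (degree_C_le).trans_lt ?_
      rw [(halfPoly_monic a).degree_mul, degree_X, degree_eq_natDegree (halfPoly_monic a).ne_zero]
      norm_cast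
      omega
    have hX : IsCoprime X (polyFF (X * halfPoly a + C (p ^ 2))) := by
      have h0 : algebraMap (OO k) (FF k) p ≠ 0 := by
        rwa [Ne, map_eq_zero_iff _ algebraMap_injective_OO]
      refine ⟨-C ((algebraMap (OO k) (FF k) p)⁻¹ ^ 2) * polyFF (halfPoly a),
        C ((algebraMap (OO k) (FF k) p)⁻¹ ^ 2), ?_⟩
      have h3 : (C ((algebraMap (OO k) (FF k) p)⁻¹ ^ 2) * C (algebraMap (OO k) (FF k) p ^ 2) :
          (FF k)[X]) = 1 := by
        rw [← C_mul, ← mul_pow, inv_mul_cancel₀ h0, one_pow, C_1]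
      simp only [polyFF, Polynomial.map_add, Polynomial.map_mul, Polynomial.map_X,
        Polynomial.map_pow, Polynomial.map_C, map_pow] at h3 ⊢
      linear_combination h3
    exact exists_preserves_of_symm h2 (isUnit_det_soEvenGram (FF k) m) (soEvenGram_transpose ..) hγ
      hγ' (by norm_num) (hm.map _) (separable_X.mul hs hX) (hc.1.trans h1) (hc'.1.trans h1)

end BilinearDescriptions

/-! ### The tensor of `G₂` -/

section G2Tensor

open Matrix

variable {R : Type*} [CommRing R]

theorem tensorForm_wedgeTensor (t : Fin 3 → Fin 7) (v : Fin 3 → Fin 7 → R) :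
    tensorForm (wedgeTensor t) R v = Matrix.det (Matrix.of fun a b => v a (t b)) := by
  have h : ∀ s, ((wedgeTensor t s : ℤ) : R) * ∏ j, v j (s j) =
      ∑ σ : Equiv.Perm (Fin 3), Equiv.Perm.sign σ • ∏ a, if s (σ a) = t a then v (σ a) (s (σ a)) else 0 := by
    intro s
    rw [wedgeTensor, det_apply, Int.cast_sum, Finset.sum_mul]
    refine Finset.sum_congr rfl fun σ _ => ?_
    rw [← Equiv.prod_comp σ fun j => v j (s j), Units.smul_def, Units.smul_def, zsmul_eq_mul,
      zsmul_eq_mul, Int.cast_mul, mul_assoc, Int.cast_prod, ← Finset.prod_mul_distrib]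
    congr 1
    refine Finset.prod_congr rfl fun a _ => ?_
    rw [of_apply]
    split_ifs <;> simp
  rw [tensorForm, Finset.sum_congr rfl fun s _ => h s, Finset.sum_comm, det_apply]
  refine Finset.sum_congr rfl fun σ _ => ?_
  rw [← Finset.smul_sum]
  congr 1
  have h1 : ∀ s : Fin 3 → Fin 7, (∏ a, if s (σ a) = t a then v (σ a) (s (σ a)) else 0) =
      ∏ j, if s j = t (σ.symm j) then v j (s j) else 0 := fun s => by
    rw [← Equiv.prod_comp σ fun j => if s j = t (σ.symm j) then v j (s j) else 0]
    simp
  rw [Finset.sum_congr rfl fun s _ => h1 s,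
    ← Fintype.prod_sum (fun j i => if i = t (σ.symm j) then v j i else 0)]
  rw [← Equiv.prod_comp σ]
  simp

/-- The determinant of three columns of the array `u, v, w`. -/
def minor3 (u v w : Fin 7 → R) (i j l : Fin 7) : R :=
  u i * (v j * w l - v l * w j) - u j * (v i * w l - v l * w i) + u l * (v i * w j - v j * w i)

/-- The trilinear form of `G₂`. -/
def g2Tri (u v w : Fin 7 → R) : R :=
  -minor3 u v w 0 3 6 + 2 * minor3 u v w 0 4 5 + minor3 u v w 1 2 6 - minor3 u v w 1 3 5 +
    minor3 u v w 2 3 4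

theorem tensorForm_g2 (v : Fin 3 → Fin 7 → R) :
    tensorForm g2Tensor R v = g2Tri (v 0) (v 1) (v 2) := by
  have h : tensorForm g2Tensor R v = -tensorForm (wedgeTensor ![0, 3, 6]) R v +
      2 * tensorForm (wedgeTensor ![0, 4, 5]) R v + tensorForm (wedgeTensor ![1, 2, 6]) R v -
      tensorForm (wedgeTensor ![1, 3, 5]) R v + tensorForm (wedgeTensor ![2, 3, 4]) R v := by
    simp only [tensorForm, Finset.mul_sum, ← Finset.sum_neg_distrib, ← Finset.sum_add_distrib,
      ← Finset.sum_sub_distrib]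
    refine Finset.sum_congr rfl fun s _ => ?_
    rw [g2Tensor]
    push_cast
    ring
  rw [h]
  simp only [tensorForm_wedgeTensor, det_fin_three, g2Tri, minor3, of_apply, cons_val]
  ring

/-- The invariant quadratic form of `G₂`. -/
def g2Bil (u v : Fin 7 → R) : R :=
  u 0 * v 6 - u 1 * v 5 + u 2 * v 4 - u 3 * v 3 + u 4 * v 2 - u 5 * v 1 + u 6 * v 0

/-- The cross product: `B(u × v, w) = T(u, v, w)`. -/
def g2Cross (u v : Fin 7 → R) : Fin 7 → R :=
  ![(u 3 * v 0 - u 0 * v 3) + (u 1 * v 2 - u 2 * v 1),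
    2 * (u 4 * v 0 - u 0 * v 4) + (u 1 * v 3 - u 3 * v 1),
    2 * (u 5 * v 0 - u 0 * v 5) + (u 2 * v 3 - u 3 * v 2),
    (u 6 * v 0 - u 0 * v 6) + (u 5 * v 1 - u 1 * v 5) + (u 2 * v 4 - u 4 * v 2),
    (u 6 * v 1 - u 1 * v 6) + (u 3 * v 4 - u 4 * v 3),
    (u 6 * v 2 - u 2 * v 6) + (u 3 * v 5 - u 5 * v 3),
    (u 6 * v 3 - u 3 * v 6) + 2 * (u 4 * v 5 - u 5 * v 4)]

theorem g2Bil_cross (u v w : Fin 7 → R) : g2Bil (g2Cross u v) w = g2Tri u v w := by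
  simp only [g2Bil, g2Cross, g2Tri, minor3, cons_val]
  ring

theorem g2Cross_cross (u v : Fin 7 → R) :
    g2Cross u (g2Cross u v) = g2Bil v u • u - g2Bil u u • v := by
  funext i
  fin_cases i <;>
  · simp only [g2Bil, g2Cross, cons_val, Pi.sub_apply, Pi.smul_apply, smul_eq_mul, Fin.mk_one,
      Fin.zero_eta, Fin.reduceFinMk]
    ring

theorem g2Bil_comm (u v : Fin 7 → R) : g2Bil u v = g2Bil v u := by
  simp only [g2Bil]
  ring

theorem g2Tri_swap (u v w : Fin 7 → R) : g2Tri v u w = -g2Tri u v w := by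
  simp only [g2Tri, minor3]
  ring

theorem g2Tri_rotate (u v w : Fin 7 → R) : g2Tri v w u = g2Tri u v w := by
  simp only [g2Tri, minor3]
  ring

/-- The matrix `(0, -ξᵀ; ξ, T(u, ·, ·))`. -/
def g2Border (ξ u : Fin 7 → R) : Matrix (Fin (2 * 4)) (Fin (2 * 4)) R :=
  Matrix.of (Fin.cons (Fin.cons 0 ξ) fun i : Fin 7 =>
    Fin.cons (-ξ i) fun j : Fin 7 => g2Tri u (Pi.single i 1) (Pi.single j 1))

theorem g2Border_eq (ξ u : Fin 7 → R) : g2Border ξ u =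
    !![0, ξ 0, ξ 1, ξ 2, ξ 3, ξ 4, ξ 5, ξ 6;
      -ξ 0, 0, 0, 0, -u 6, 2 * u 5, -2 * u 4, u 3;
      -ξ 1, 0, 0, u 6, -u 5, 0, u 3, -u 2;
      -ξ 2, 0, -u 6, 0, u 4, -u 3, 0, u 1;
      -ξ 3, u 6, u 5, -u 4, 0, u 2, -u 1, -u 0;
      -ξ 4, -2 * u 5, 0, u 3, -u 2, 0, 2 * u 0, 0;
      -ξ 5, 2 * u 4, -u 3, 0, u 1, -2 * u 0, 0, 0;
      -ξ 6, -u 3, u 2, -u 1, u 0, 0, 0, 0] := by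
  refine Matrix.ext fun i j => ?_
  refine Fin.cases ?_ (fun i => ?_) i <;> refine Fin.cases ?_ (fun j => ?_) j
  · rfl
  · fin_cases j <;> rfl
  · fin_cases i <;> rfl
  · change g2Tri u (Pi.single i 1) (Pi.single j 1) = _
    fin_cases i <;> fin_cases j <;> simp [g2Tri, minor3, Pi.single_apply]

theorem pfaffian_g2Border (ξ u : Fin 7 → R) :
    pfaffian 4 (g2Border ξ u) = -(g2Bil u u * ∑ i, ξ i * u i) := by
  rw [g2Border_eq]
  simp [pfaffian, Fin.sum_univ_succ, Fin.succAbove, g2Bil]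
  ring

end G2Tensor

/-! ### Frames for `G₂` -/

section G2Frame

open Matrix

section Ring

variable {R : Type*} [CommRing R]

theorem g2Bil_add_left (u u' v : Fin 7 → R) : g2Bil (u + u') v = g2Bil u v + g2Bil u' v := by
  simp only [g2Bil, Pi.add_apply]
  ring

theorem g2Bil_smul_left (c : R) (u v : Fin 7 → R) : g2Bil (c • u) v = c * g2Bil u v := by
  simp only [g2Bil, Pi.smul_apply, smul_eq_mul]
  ring

/-- `g2Bil` as a bilinear form. -/
def g2BilForm (R : Type*) [CommRing R] : LinearMap.BilinForm R (Fin 7 → R) :=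
  LinearMap.mk₂ R g2Bil g2Bil_add_left g2Bil_smul_left
    (fun u v v' => by rw [g2Bil_comm, g2Bil_add_left, g2Bil_comm v, g2Bil_comm v'])
    (fun c u v => by rw [g2Bil_comm, g2Bil_smul_left, g2Bil_comm v, smul_eq_mul])

theorem g2BilForm_apply (u v : Fin 7 → R) : g2BilForm R u v = g2Bil u v := rfl

theorem g2Cross_swap (u v : Fin 7 → R) : g2Cross v u = -g2Cross u v := by
  funext i
  fin_cases i <;>
  · simp only [g2Cross, cons_val, Pi.neg_apply, Fin.mk_one, Fin.zero_eta, Fin.reduceFinMk]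
    ring

/-- The linear map `u × ·`. -/
def g2Ad (u : Fin 7 → R) : (Fin 7 → R) →ₗ[R] Fin 7 → R where
  toFun := g2Cross u
  map_add' v w := by
    funext i
    fin_cases i <;>
    · simp only [g2Cross, cons_val, Pi.add_apply, Fin.mk_one, Fin.zero_eta, Fin.reduceFinMk]
      ring
  map_smul' c v := by
    funext i
    fin_cases i <;>
    · simp only [g2Cross, cons_val, Pi.smul_apply, smul_eq_mul, Fin.mk_one, Fin.zero_eta,
        Fin.reduceFinMk, RingHom.id_apply]
      ring

theorem g2Cross_add (u v w : Fin 7 → R) : g2Cross u (v + w) = g2Cross u v + g2Cross u w :=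
  map_add (g2Ad u) v w

theorem g2Cross_smul (c : R) (u v : Fin 7 → R) : g2Cross u (c • v) = c • g2Cross u v :=
  map_smul (g2Ad u) c v

theorem g2Cross_neg (u v : Fin 7 → R) : g2Cross u (-v) = -g2Cross u v := map_neg (g2Ad u) v

theorem g2Cross_sub (u v w : Fin 7 → R) : g2Cross u (v - w) = g2Cross u v - g2Cross u w :=
  map_sub (g2Ad u) v w

theorem g2Cross_add_left (u v w : Fin 7 → R) : g2Cross (u + v) w = g2Cross u w + g2Cross v w := by
  rw [g2Cross_swap, g2Cross_add, g2Cross_swap u, g2Cross_swap v, neg_add, neg_neg, neg_neg]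

theorem g2Cross_smul_left (c : R) (u v : Fin 7 → R) : g2Cross (c • u) v = c • g2Cross u v := by
  rw [g2Cross_swap, g2Cross_smul, g2Cross_swap u, smul_neg, neg_neg]

theorem g2Tri_self (u v : Fin 7 → R) : g2Tri u u v = 0 := by
  simp only [g2Tri, minor3]
  ring

theorem g2Cross_cross_add (u w v : Fin 7 → R) :
    g2Cross u (g2Cross w v) + g2Cross w (g2Cross u v) =
      g2Bil v u • w + g2Bil v w • u - (2 * g2Bil u w) • v := by
  have h := g2Cross_cross (u + w) v
  have h1 := g2Cross_cross u v
  have h2 := g2Cross_cross w v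
  simp only [g2Cross_add_left, g2Cross_add] at h
  have e1 : g2Bil v (u + w) = g2Bil v u + g2Bil v w := (g2BilForm R v).map_add u w
  have e2 : g2Bil (u + w) (u + w) = g2Bil u u + g2Bil w w + 2 * g2Bil u w := by
    rw [g2Bil_add_left, g2Bil_comm u (u + w), g2Bil_comm w (u + w), g2Bil_add_left, g2Bil_add_left,
      g2Bil_comm w u]
    ring
  rw [e1, e2, h1, h2] at h
  rw [← sub_eq_zero] at h ⊢
  rw [← h]
  module

theorem exists_g2Bil_ne_zero {u : Fin 7 → R} (h : ∀ i, g2Bil u (Pi.single i 1) = 0) : u = 0 := by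
  funext i
  have := h i.rev
  fin_cases i <;> simpa [g2Bil, Pi.single_apply] using this

theorem g2Tri_col_ext {E E' : Fin 7 → Fin 7 → R}
    (h012 : g2Tri (E 0) (E 1) (E 2) = g2Tri (E' 0) (E' 1) (E' 2))
    (h013 : g2Tri (E 0) (E 1) (E 3) = g2Tri (E' 0) (E' 1) (E' 3))
    (h014 : g2Tri (E 0) (E 1) (E 4) = g2Tri (E' 0) (E' 1) (E' 4))
    (h015 : g2Tri (E 0) (E 1) (E 5) = g2Tri (E' 0) (E' 1) (E' 5))
    (h016 : g2Tri (E 0) (E 1) (E 6) = g2Tri (E' 0) (E' 1) (E' 6))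
    (h023 : g2Tri (E 0) (E 2) (E 3) = g2Tri (E' 0) (E' 2) (E' 3))
    (h024 : g2Tri (E 0) (E 2) (E 4) = g2Tri (E' 0) (E' 2) (E' 4))
    (h025 : g2Tri (E 0) (E 2) (E 5) = g2Tri (E' 0) (E' 2) (E' 5))
    (h026 : g2Tri (E 0) (E 2) (E 6) = g2Tri (E' 0) (E' 2) (E' 6))
    (h034 : g2Tri (E 0) (E 3) (E 4) = g2Tri (E' 0) (E' 3) (E' 4))
    (h035 : g2Tri (E 0) (E 3) (E 5) = g2Tri (E' 0) (E' 3) (E' 5))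
    (h036 : g2Tri (E 0) (E 3) (E 6) = g2Tri (E' 0) (E' 3) (E' 6))
    (h045 : g2Tri (E 0) (E 4) (E 5) = g2Tri (E' 0) (E' 4) (E' 5))
    (h046 : g2Tri (E 0) (E 4) (E 6) = g2Tri (E' 0) (E' 4) (E' 6))
    (h056 : g2Tri (E 0) (E 5) (E 6) = g2Tri (E' 0) (E' 5) (E' 6))
    (h123 : g2Tri (E 1) (E 2) (E 3) = g2Tri (E' 1) (E' 2) (E' 3))
    (h124 : g2Tri (E 1) (E 2) (E 4) = g2Tri (E' 1) (E' 2) (E' 4))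
    (h125 : g2Tri (E 1) (E 2) (E 5) = g2Tri (E' 1) (E' 2) (E' 5))
    (h126 : g2Tri (E 1) (E 2) (E 6) = g2Tri (E' 1) (E' 2) (E' 6))
    (h134 : g2Tri (E 1) (E 3) (E 4) = g2Tri (E' 1) (E' 3) (E' 4))
    (h135 : g2Tri (E 1) (E 3) (E 5) = g2Tri (E' 1) (E' 3) (E' 5))
    (h136 : g2Tri (E 1) (E 3) (E 6) = g2Tri (E' 1) (E' 3) (E' 6))
    (h145 : g2Tri (E 1) (E 4) (E 5) = g2Tri (E' 1) (E' 4) (E' 5))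
    (h146 : g2Tri (E 1) (E 4) (E 6) = g2Tri (E' 1) (E' 4) (E' 6))
    (h156 : g2Tri (E 1) (E 5) (E 6) = g2Tri (E' 1) (E' 5) (E' 6))
    (h234 : g2Tri (E 2) (E 3) (E 4) = g2Tri (E' 2) (E' 3) (E' 4))
    (h235 : g2Tri (E 2) (E 3) (E 5) = g2Tri (E' 2) (E' 3) (E' 5))
    (h236 : g2Tri (E 2) (E 3) (E 6) = g2Tri (E' 2) (E' 3) (E' 6))
    (h245 : g2Tri (E 2) (E 4) (E 5) = g2Tri (E' 2) (E' 4) (E' 5))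
    (h246 : g2Tri (E 2) (E 4) (E 6) = g2Tri (E' 2) (E' 4) (E' 6))
    (h256 : g2Tri (E 2) (E 5) (E 6) = g2Tri (E' 2) (E' 5) (E' 6))
    (h345 : g2Tri (E 3) (E 4) (E 5) = g2Tri (E' 3) (E' 4) (E' 5))
    (h346 : g2Tri (E 3) (E 4) (E 6) = g2Tri (E' 3) (E' 4) (E' 6))
    (h356 : g2Tri (E 3) (E 5) (E 6) = g2Tri (E' 3) (E' 5) (E' 6))
    (h456 : g2Tri (E 4) (E 5) (E 6) = g2Tri (E' 4) (E' 5) (E' 6)) (a b c : Fin 7) :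
    g2Tri (E a) (E b) (E c) = g2Tri (E' a) (E' b) (E' c) := by
  have key : ∀ a b c : Fin 7, a < b → b < c →
      g2Tri (E a) (E b) (E c) = g2Tri (E' a) (E' b) (E' c) := by
    intro a b c hab hbc
    fin_cases a <;> fin_cases b <;> first | (exfalso; revert hab; decide) | skip
    all_goals fin_cases c <;> first | (exfalso; revert hbc; decide) | assumption
  have h1 : ∀ u v : Fin 7 → R, g2Tri u v v = 0 := fun u v => by
    rw [← g2Tri_rotate, g2Tri_self]
  have h2 : ∀ u v : Fin 7 → R, g2Tri u v u = 0 := fun u v => by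
    rw [← g2Tri_rotate, h1]
  have h3 : ∀ u v w : Fin 7 → R, g2Tri u w v = -g2Tri u v w := fun u v w => by
    rw [← g2Tri_rotate u w v, g2Tri_swap, g2Tri_rotate u v w]
  rcases lt_trichotomy a b with hab | hab | hab <;> rcases lt_trichotomy b c with hbc | hbc | hbc
  · exact key _ _ _ hab hbc
  · rw [hbc, h1, h1]
  · rcases lt_trichotomy a c with hac | rfl | hac
    · rw [h3 _ (E c), h3 _ (E' c), key _ _ _ hac hbc]
    · rw [h2, h2]
    · rw [g2Tri_rotate (E c) (E a), g2Tri_rotate (E' c) (E' a), key _ _ _ hac hab]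
  · rw [hab, g2Tri_self, g2Tri_self]
  · rw [hab, g2Tri_self, g2Tri_self]
  · rw [hab, g2Tri_self, g2Tri_self]
  · rcases lt_trichotomy a c with hac | rfl | hac
    · rw [g2Tri_swap, g2Tri_swap (E' b), key _ _ _ hab hac]
    · rw [h2, h2]
    · rw [← g2Tri_rotate (E a), ← g2Tri_rotate (E' a), key _ _ _ hbc hac]
  · rw [hbc, h1, h1]
  · rw [g2Tri_swap, g2Tri_swap (E' b), g2Tri_rotate (E c) (E b), g2Tri_rotate (E' c) (E' b),
      key _ _ _ hbc hab]

end Ring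

variable {K : Type*} [Field K]

/-- A hyperbolic basis adapted to the octonion product: `f` and `g` are bases of the eigenspaces of
`v × ·` for the eigenvalues `1` and `-1`. -/
structure IsG2Frame (f g : Fin 3 → Fin 7 → K) (v : Fin 7 → K) : Prop where
  cross_f : ∀ i, g2Cross v (f i) = f i
  cross_g : ∀ i, g2Cross v (g i) = -g i
  pair : ∀ i j, g2Bil (f i) (g j) = if i = j then 1 else 0
  norm : g2Bil v v = -1
  vol : g2Tri (f 0) (f 1) (f 2) = 2

/-- The columns of the matrix of a frame. -/
def g2FrameCol (f g : Fin 3 → Fin 7 → K) (v : Fin 7 → K) : Fin 7 → Fin 7 → K :=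
  ![f 0, -g 2, g 1, v, f 1, f 2, g 0]

/-- The matrix of a frame. -/
def g2FrameMatrix (f g : Fin 3 → Fin 7 → K) (v : Fin 7 → K) : Matrix (Fin 7) (Fin 7) K :=
  (Matrix.of (g2FrameCol f g v))ᵀ

theorem g2Bil_eq_zero_of_cross (h2 : (2 : K) ≠ 0) {c : K} (hc : c ≠ 0) {v a b : Fin 7 → K}
    (ha : g2Cross v a = c • a) (hb : g2Cross v b = c • b) : g2Bil a b = 0 := by
  have h1 : c * g2Bil a b = g2Tri v a b := by rw [← g2Bil_smul_left, ← ha, g2Bil_cross]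
  have h3 : c * g2Bil b a = g2Tri v b a := by rw [← g2Bil_smul_left, ← hb, g2Bil_cross]
  have h4 : g2Tri v b a = -g2Tri v a b := by
    rw [← g2Tri_rotate v b a, g2Tri_swap, g2Tri_rotate v a b]
  rw [g2Bil_comm b a, h4, ← h1] at h3
  have : 2 * (c * g2Bil a b) = 0 := by linear_combination h3
  simpa [h2, hc] using this

theorem g2Bil_eq_zero_of_cross_self {c : K} (hc : c ≠ 0) {v a : Fin 7 → K}
    (ha : g2Cross v a = c • a) : g2Bil v a = 0 := by
  have h1 : c * g2Bil a v = g2Tri v a v := by rw [← g2Bil_smul_left, ← ha, g2Bil_cross]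
  rw [← g2Tri_rotate, ← g2Tri_rotate, g2Tri_self, g2Bil_comm] at h1
  simpa [hc] using h1

theorem g2Cross_cross_of_eigen (h2 : (2 : K) ≠ 0) {c : K} (hc : c ≠ 0) {v a b : Fin 7 → K}
    (ha : g2Cross v a = c • a) (hb : g2Cross v b = c • b) :
    g2Cross v (g2Cross a b) = (-c) • g2Cross a b := by
  have h := g2Cross_cross_add v a b
  rw [hb, g2Cross_smul, g2Bil_comm b v, g2Bil_eq_zero_of_cross_self hc hb,
    g2Bil_eq_zero_of_cross h2 hc hb ha, g2Bil_eq_zero_of_cross_self hc ha, mul_zero, zero_smul,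
    zero_smul, zero_smul, add_zero, sub_zero] at h
  rw [neg_smul, eq_neg_iff_add_eq_zero, h]

namespace IsG2Frame

variable {f g : Fin 3 → Fin 7 → K} {v : Fin 7 → K} (h : IsG2Frame f g v)
include h

theorem cross_f' (i : Fin 3) : g2Cross v (f i) = (1 : K) • f i := by rw [one_smul, h.cross_f]

theorem cross_g' (i : Fin 3) : g2Cross v (g i) = (-1 : K) • g i := by rw [neg_one_smul, h.cross_g]

theorem bil_ff (h2 : (2 : K) ≠ 0) (i j : Fin 3) : g2Bil (f i) (f j) = 0 :=
  g2Bil_eq_zero_of_cross h2 one_ne_zero (h.cross_f' i) (h.cross_f' j)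

theorem bil_gg (h2 : (2 : K) ≠ 0) (i j : Fin 3) : g2Bil (g i) (g j) = 0 :=
  g2Bil_eq_zero_of_cross h2 (neg_ne_zero.2 one_ne_zero) (h.cross_g' i) (h.cross_g' j)

theorem bil_vf (i : Fin 3) : g2Bil v (f i) = 0 :=
  g2Bil_eq_zero_of_cross_self one_ne_zero (h.cross_f' i)

theorem bil_vg (i : Fin 3) : g2Bil v (g i) = 0 :=
  g2Bil_eq_zero_of_cross_self (neg_ne_zero.2 one_ne_zero) (h.cross_g' i)

theorem bil_col (h2 : (2 : K) ≠ 0) (a b : Fin 7) :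
    g2Bil (g2FrameCol f g v a) (g2FrameCol f g v b) = g2Bil (Pi.single a 1) (Pi.single b 1) := by
  have hn : ∀ x y : Fin 7 → K, g2Bil (-x) y = -g2Bil x y := fun x y => by
    rw [← neg_one_smul K x, g2Bil_smul_left, neg_one_mul]
  have hn' : ∀ x y : Fin 7 → K, g2Bil x (-y) = -g2Bil x y := fun x y => by
    rw [g2Bil_comm, hn, g2Bil_comm]
  have hfv := fun i => (g2Bil_comm (f i) v).trans (h.bil_vf i)
  have hgv := fun i => (g2Bil_comm (g i) v).trans (h.bil_vg i)
  have hgf := fun i j => (g2Bil_comm (g i) (f j)).trans (h.pair j i)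
  fin_cases a <;> fin_cases b <;>
  · simp only [g2FrameCol, cons_val, Fin.mk_one, Fin.zero_eta, Fin.reduceFinMk, hn, hn',
      h.bil_ff h2, h.bil_gg h2, h.bil_vf, h.bil_vg, hfv, hgv, hgf, h.pair, h.norm]
    simp [g2Bil]

end IsG2Frame

end G2Frame

section G2Frame

open Matrix

section Ring

variable {R : Type*} [CommRing R]

theorem tensorForm_soOdd_three (v : Fin 2 → Fin 7 → R) :
    tensorForm (soOddTensor 3) R v = g2Bil (v 0) (v 1) := by
  rw [tensorForm_two]
  have h : ∀ i j : Fin 7, gramMatrix (soOddTensor 3) R i j =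
      if (i : ℕ) + j = 6 then (-1) ^ (j : ℕ) else 0 := soOddGram_apply R 3
  change ∑ i : Fin 7, v 0 i * ∑ j : Fin 7, gramMatrix (soOddTensor 3) R i j * v 1 j = _
  simp only [h, Fin.sum_univ_seven]
  simp [g2Bil]
  ring

theorem preserves_soOdd_three_iff (A : Matrix (Fin 7) (Fin 7) R) :
    Preserves (soOddTensor 3) A ↔ ∀ u v, g2Bil (A *ᵥ u) (A *ᵥ v) = g2Bil u v := by
  rw [preserves_iff]
  simp only [tensorForm_soOdd_three]
  exact ⟨fun h u v => h ![u, v], fun h v => h _ _⟩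

theorem preserves_g2_iff (A : Matrix (Fin 7) (Fin 7) R) :
    Preserves g2Tensor A ↔ ∀ u v w, g2Tri (A *ᵥ u) (A *ᵥ v) (A *ᵥ w) = g2Tri u v w := by
  rw [preserves_iff]
  simp only [tensorForm_g2]
  exact ⟨fun h u v w => h ![u, v, w], fun h v => h _ _ _⟩

theorem preserves_g2_of_col {A : Matrix (Fin 7) (Fin 7) R}
    (h : ∀ a b c, g2Tri (A.col a) (A.col b) (A.col c) =
      g2Tri (Pi.single a 1) (Pi.single b 1) (Pi.single c 1)) : Preserves g2Tensor A := by
  intro s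
  rw [tensorForm_g2, h, ← tensorForm_single, tensorForm_g2]

theorem preserves_soOdd_three_of_col {A : Matrix (Fin 7) (Fin 7) R}
    (h : ∀ a b, g2Bil (A.col a) (A.col b) = g2Bil (Pi.single a 1) (Pi.single b 1)) :
    Preserves (soOddTensor 3) A := by
  intro s
  rw [tensorForm_soOdd_three]
  refine (h _ _).trans ?_
  have := tensorForm_single (soOddTensor 3) R s
  rw [tensorForm_soOdd_three] at this
  exact this

/-- The alternating matrix with first row `(0, ξ)` and remaining block `Ω`. -/
def borderMatrix (ξ : Fin 7 → R) (Ω : Matrix (Fin 7) (Fin 7) R) :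
    Matrix (Fin (2 * 4)) (Fin (2 * 4)) R :=
  Matrix.of (Fin.cons (Fin.cons 0 ξ) fun i : Fin 7 => Fin.cons (-ξ i) (Ω i) :
    Fin 8 → Fin 8 → R)

theorem map_borderMatrix (A : Matrix (Fin 7) (Fin 7) R) (ξ : Fin 7 → R)
    (Ω : Matrix (Fin 7) (Fin 7) R) (hΩ : Ωᵀ = -Ω) (hΩ0 : ∀ i, Ω i i = 0) :
    pfaffian 4 (borderMatrix (Aᵀ *ᵥ ξ) (Aᵀ * Ω * A)) = A.det * pfaffian 4 (borderMatrix ξ Ω) := by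
  set C : Matrix (Fin 8) (Fin 8) R :=
    Matrix.of (Fin.cons (Fin.cons 1 0) fun i : Fin 7 => Fin.cons 0 (A i)) with hC
  have hdet : C.det = A.det := by
    rw [det_succ_row_zero, Fin.sum_univ_succ, Finset.sum_eq_zero (fun i _ => ?_)]
    · have : C.submatrix Fin.succ (Fin.succAbove 0) = A := by
        refine Matrix.ext fun i j => ?_
        simp [C]
      rw [this]
      simp [C]
    · simp [C]
  rw [← hdet, ← pfaffian_transpose_mul_mul (n := 4) (borderMatrix ξ Ω) C]
  · congr 1
    have key : ∀ (i j : Fin 8), borderMatrix (Aᵀ *ᵥ ξ) (Aᵀ * Ω * A) i j =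
        ((Cᵀ * borderMatrix ξ Ω : Matrix (Fin 8) (Fin 8) R) * C) i j := by
      intro i j
      refine Fin.cases ?_ (fun i => ?_) i <;> refine Fin.cases ?_ (fun j => ?_) j
      · simp [borderMatrix, C, mul_apply, Fin.sum_univ_succ (n := 7)]
      · simp [borderMatrix, C, mul_apply, Fin.sum_univ_succ (n := 7), mulVec, dotProduct, mul_comm]
      · simp [borderMatrix, C, mul_apply, Fin.sum_univ_succ (n := 7), mulVec, dotProduct]
      · simp [borderMatrix, C, mul_apply, Fin.sum_univ_succ (n := 7), mulVec, dotProduct]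
    exact Matrix.ext key
  · refine Matrix.ext fun i j => ?_
    change borderMatrix ξ Ω j i = - borderMatrix ξ Ω i j
    refine Fin.cases ?_ (fun i => ?_) i <;> refine Fin.cases ?_ (fun j => ?_) j
    · simp [borderMatrix]
    · simp [borderMatrix]
    · simp [borderMatrix]
    · have := congrFun (congrFun hΩ i) j
      simpa [borderMatrix] using this
  · refine Fin.cases ?_ fun i => ?_
    · simp [borderMatrix]
    · simpa [borderMatrix] using hΩ0 i

/-- The matrix of `T(u, ·, ·)`. -/
def g2Contract (u : Fin 7 → R) : Matrix (Fin 7) (Fin 7) R :=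
  Matrix.of fun i j => g2Tri u (Pi.single i 1) (Pi.single j 1)

theorem g2Tri_add_right (u v w w' : Fin 7 → R) :
    g2Tri u v (w + w') = g2Tri u v w + g2Tri u v w' := by
  simp only [← g2Bil_cross]
  exact map_add (g2BilForm R _) w w'

theorem g2Tri_smul_right (c : R) (u v w : Fin 7 → R) : g2Tri u v (c • w) = c * g2Tri u v w := by
  simp only [← g2Bil_cross]
  exact map_smul (g2BilForm R _) c w

theorem g2Tri_swap_right (u v w : Fin 7 → R) : g2Tri u w v = -g2Tri u v w := by
  rw [← g2Tri_rotate u w v, g2Tri_swap, g2Tri_rotate u v w]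

theorem g2Tri_self_right (u v : Fin 7 → R) : g2Tri u v v = 0 := by
  rw [← g2Tri_rotate, g2Tri_self]

theorem g2Tri_self_outer (u v : Fin 7 → R) : g2Tri u v u = 0 := by
  rw [← g2Tri_rotate, g2Tri_self_right]

/-- `T(u, ·, ·)` as a bilinear form. -/
def g2TriForm (u : Fin 7 → R) : LinearMap.BilinForm R (Fin 7 → R) :=
  LinearMap.mk₂ R (g2Tri u)
    (fun v v' w => by rw [g2Tri_swap_right, g2Tri_add_right, g2Tri_swap_right u w v,
      g2Tri_swap_right u w v', neg_add])
    (fun c v w => by rw [g2Tri_swap_right, g2Tri_smul_right, g2Tri_swap_right u w v, smul_eq_mul,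
      mul_neg])
    (g2Tri_add_right u) (fun c v w => g2Tri_smul_right c u v w)

theorem g2Contract_map (A : Matrix (Fin 7) (Fin 7) R) (u : Fin 7 → R) (i j : Fin 7) :
    (Aᵀ * g2Contract u * A) i j = g2Tri u (A.col i) (A.col j) := by
  have h : g2Contract u = LinearMap.toMatrix₂' R (g2TriForm u) := by
    refine Matrix.ext fun i j => ?_
    rw [LinearMap.toMatrix₂'_apply]
    rfl
  rw [h, ← col_gram_col]
  have := Matrix.toLinearMap₂'_apply' (LinearMap.toMatrix₂' R (g2TriForm u)) (A.col i) (A.col j)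
  rw [Matrix.toLinearMap₂'_toMatrix'] at this
  exact this.symm

theorem det_mul_g2Bil (A : Matrix (Fin 7) (Fin 7) R) (ξ u : Fin 7 → R) :
    pfaffian 4 (borderMatrix (Aᵀ *ᵥ ξ) (Matrix.of fun i j =>
      g2Tri (A *ᵥ u) (A.col i) (A.col j))) =
      -(A.det * (g2Bil (A *ᵥ u) (A *ᵥ u) * ∑ i, (Aᵀ *ᵥ ξ) i * u i)) := by
  have h1 := pfaffian_g2Border ξ (A *ᵥ u)
  have h2 := map_borderMatrix A ξ (g2Contract (A *ᵥ u))
    (Matrix.ext fun i j => g2Tri_swap_right _ _ _)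
    (fun i => by rw [g2Contract, of_apply, ← g2Tri_rotate, g2Tri_self])
  have h3 : Aᵀ * g2Contract (A *ᵥ u) * A =
      Matrix.of fun i j => g2Tri (A *ᵥ u) (A.col i) (A.col j) :=
    Matrix.ext fun i j => g2Contract_map A _ i j
  have h4 : ∑ i, ξ i * (A *ᵥ u) i = ∑ i, (Aᵀ *ᵥ ξ) i * u i := by
    change ξ ⬝ᵥ A *ᵥ u = (Aᵀ *ᵥ ξ) ⬝ᵥ u
    rw [mulVec_transpose, dotProduct_mulVec]
  rw [← h3, h2, ← h4, ← mul_neg, ← h1]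
  rfl

end Ring

section Field

variable {K : Type*} [Field K]

theorem g2Bil_of_preserves {A : Matrix (Fin 7) (Fin 7) K} (hA : A.det ≠ 0)
    (h : Preserves g2Tensor A) (u : Fin 7 → K) :
    A.det * g2Bil (A *ᵥ u) (A *ᵥ u) = g2Bil u u := by
  rw [preserves_g2_iff] at h
  by_cases hu : u = 0
  · simp [hu, g2Bil]
  · obtain ⟨i, hi⟩ := Function.ne_iff.1 hu
    have hA' : IsUnit Aᵀ.det := by rw [det_transpose]; exact hA.isUnit
    have h1 := det_mul_g2Bil A ((Aᵀ)⁻¹ *ᵥ Pi.single i 1) u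
    rw [mulVec_mulVec, mul_nonsing_inv _ hA', one_mulVec] at h1
    have h3 : (Matrix.of fun a b => g2Tri (A *ᵥ u) (A.col a) (A.col b)) =
        Matrix.of fun a b => g2Tri u (Pi.single a 1) (Pi.single b 1) := by
      refine Matrix.ext fun a b => ?_
      rw [of_apply, of_apply, ← mulVec_single_one, ← mulVec_single_one, h]
    have h2 := pfaffian_g2Border (Pi.single i 1) u
    rw [h3] at h1
    have h4 : ∑ j, (Pi.single i 1 : Fin 7 → K) j * u j = u i := by
      rw [Finset.sum_eq_single i] <;> simp +contextual
    rw [h4] at h1 h2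
    have h5 := h1.symm.trans h2
    refine mul_right_cancel₀ hi ?_
    linear_combination -h5

/-- Preserving `T` means preserving `B` up to the determinant. -/
theorem g2Bil_polar_of_preserves (h2 : (2 : K) ≠ 0) {A : Matrix (Fin 7) (Fin 7) K} (hA : A.det ≠ 0)
    (h : Preserves g2Tensor A) (u v : Fin 7 → K) :
    A.det * g2Bil (A *ᵥ u) (A *ᵥ v) = g2Bil u v := by
  have h1 := g2Bil_of_preserves hA h (u + v)
  have hp : ∀ x y : Fin 7 → K, g2Bil (x + y) (x + y) = g2Bil x x + g2Bil y y + 2 * g2Bil x y :=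
    fun x y => by
      rw [g2Bil_add_left, g2Bil_comm x (x + y), g2Bil_comm y (x + y), g2Bil_add_left,
        g2Bil_add_left, g2Bil_comm y x]
      ring
  rw [mulVec_add, hp, hp] at h1
  refine mul_left_cancel₀ h2 ?_
  linear_combination h1 - g2Bil_of_preserves hA h u - g2Bil_of_preserves hA h v

theorem g2Gram_of_preserves (h2 : (2 : K) ≠ 0) {A : Matrix (Fin 7) (Fin 7) K} (hA : A.det ≠ 0)
    (h : Preserves g2Tensor A) :
    A.det • (Aᵀ * gramMatrix (soOddTensor 3) K * A) = gramMatrix (soOddTensor 3) K := by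
  refine Matrix.ext fun i j => ?_
  have h1 := g2Bil_polar_of_preserves h2 hA h (Pi.single i 1) (Pi.single j 1)
  have h3 : ∀ u v : Fin 7 → K, g2Bil u v = u ⬝ᵥ gramMatrix (soOddTensor 3) K *ᵥ v := fun u v => by
    have := tensorForm_soOdd_three (R := K) ![u, v]
    rw [tensorForm_two] at this
    exact this.symm
  rw [mulVec_single_one, mulVec_single_one, h3, col_gram_col, h3] at h1
  rw [Matrix.smul_apply, smul_eq_mul]
  refine h1.trans ?_
  simp

theorem det_pow_of_preserves_g2 (h2 : (2 : K) ≠ 0) {A : Matrix (Fin 7) (Fin 7) K} (hA : A.det ≠ 0)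
    (h : Preserves g2Tensor A) : A.det ^ 9 = 1 := by
  have h1 := congrArg det (g2Gram_of_preserves h2 hA h)
  rw [det_smul, det_mul, det_mul, det_transpose, det_soOddGram] at h1
  simp only [Fintype.card_fin, mul_one] at h1
  rw [← h1]
  ring

theorem det_eq_one_of_preserves_g2 (h2 : (2 : K) ≠ 0) {A : Matrix (Fin 7) (Fin 7) K}
    (hA : A.det ≠ 0) (h : Preserves g2Tensor A) (hB : Preserves (soOddTensor 3) A) :
    A.det = 1 := by
  have h1 := g2Bil_polar_of_preserves h2 hA h (Pi.single 0 1) (Pi.single 6 1)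
  rw [(preserves_soOdd_three_iff A).1 hB] at h1
  simpa [g2Bil, Pi.single_apply] using h1

namespace IsG2Frame

variable {f g : Fin 3 → Fin 7 → K} {v : Fin 7 → K} (h : IsG2Frame f g v)
include h

theorem preserves_soOdd (h2 : (2 : K) ≠ 0) : Preserves (soOddTensor 3) (g2FrameMatrix f g v) :=
  preserves_soOdd_three_of_col (h.bil_col h2)

theorem det_ne_zero (h2 : (2 : K) ≠ 0) : (g2FrameMatrix f g v).det ≠ 0 := by
  have h1 := congrArg det ((preserves_two_iff _ _).1 (h.preserves_soOdd h2))
  rw [det_mul, det_mul, det_soOddGram] at h1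
  intro h0
  rw [h0, mul_zero] at h1
  exact zero_ne_one h1

theorem eq_of_bil (h2 : (2 : K) ≠ 0) {x y : Fin 7 → K} (hf : ∀ i, g2Bil x (f i) = g2Bil y (f i))
    (hg : ∀ i, g2Bil x (g i) = g2Bil y (g i)) (hv : g2Bil x v = g2Bil y v) : x = y := by
  rw [← sub_eq_zero]
  have hsub : ∀ w, g2Bil (x - y) w = g2Bil x w - g2Bil y w := fun w => by
    rw [sub_eq_add_neg, ← neg_one_smul K y, g2Bil_add_left, g2Bil_smul_left]
    ring
  have hcol : ∀ a, g2Bil (x - y) (g2FrameCol f g v a) = 0 := by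
    intro a
    fin_cases a <;> simp [g2FrameCol, hsub, hf, hg, hv, ← g2BilForm_apply]
    simp [g2BilForm_apply, hg]
  set M := g2FrameMatrix f g v
  have hM : IsUnit M.det := (h.det_ne_zero h2).isUnit
  have hall : ∀ w, g2Bil (x - y) (M *ᵥ w) = 0 := by
    intro w
    have : M *ᵥ w = ∑ a, w a • g2FrameCol f g v a := by
      rw [mulVec_eq_sum]
      simp only [op_smul_eq_smul]
      rfl
    rw [this, ← g2BilForm_apply, map_sum]
    refine Finset.sum_eq_zero fun a _ => ?_
    rw [map_smul, g2BilForm_apply, hcol, smul_zero]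
  refine exists_g2Bil_ne_zero fun i => ?_
  have := hall (M⁻¹ *ᵥ Pi.single i 1)
  rwa [mulVec_mulVec, mul_nonsing_inv _ hM, one_mulVec] at this

theorem cross_ff (h2 : (2 : K) ≠ 0) (i j : Fin 3) :
    g2Cross v (g2Cross (f i) (f j)) = (-1 : K) • g2Cross (f i) (f j) :=
  g2Cross_cross_of_eigen h2 one_ne_zero (h.cross_f' i) (h.cross_f' j)

theorem cross_gg (h2 : (2 : K) ≠ 0) (i j : Fin 3) :
    g2Cross v (g2Cross (g i) (g j)) = (1 : K) • g2Cross (g i) (g j) := by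
  have := g2Cross_cross_of_eigen h2 (neg_ne_zero.2 one_ne_zero) (h.cross_g' i) (h.cross_g' j)
  rwa [neg_neg] at this

theorem tri_ffg (h2 : (2 : K) ≠ 0) (i j l : Fin 3) : g2Tri (f i) (f j) (g l) = 0 := by
  rw [← g2Bil_cross]
  exact g2Bil_eq_zero_of_cross h2 (neg_ne_zero.2 one_ne_zero) (h.cross_ff h2 i j) (h.cross_g' l)

theorem tri_ggf (h2 : (2 : K) ≠ 0) (i j l : Fin 3) : g2Tri (g i) (g j) (f l) = 0 := by
  rw [← g2Bil_cross]
  exact g2Bil_eq_zero_of_cross h2 one_ne_zero (h.cross_gg h2 i j) (h.cross_f' l)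

theorem tri_vff (h2 : (2 : K) ≠ 0) (i j : Fin 3) : g2Tri v (f i) (f j) = 0 := by
  rw [← g2Bil_cross, h.cross_f, h.bil_ff h2]

theorem tri_vgg (h2 : (2 : K) ≠ 0) (i j : Fin 3) : g2Tri v (g i) (g j) = 0 := by
  rw [← g2Bil_cross, h.cross_g, ← neg_one_smul K, g2Bil_smul_left, h.bil_gg h2, mul_zero]

theorem tri_vfg (i j : Fin 3) : g2Tri v (f i) (g j) = if i = j then 1 else 0 := by
  rw [← g2Bil_cross, h.cross_f, h.pair]

theorem cross_f01 (h2 : (2 : K) ≠ 0) : g2Cross (f 0) (f 1) = (2 : K) • g 2 := by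
  refine h.eq_of_bil h2 (fun i => ?_) (fun i => ?_) ?_
  · rw [g2Bil_cross, g2Bil_smul_left, g2Bil_comm, h.pair]
    fin_cases i
    · simp [g2Tri_self_outer]
    · simp [g2Tri_self_right]
    · simpa using h.vol
  · rw [g2Bil_cross, h.tri_ffg h2, g2Bil_smul_left, h.bil_gg h2, mul_zero]
  · rw [g2Bil_cross, g2Tri_rotate, h.tri_vff h2,
      g2Bil_smul_left, g2Bil_comm, h.bil_vg, mul_zero]

theorem cross_fg (h2 : (2 : K) ≠ 0) {i j : Fin 3} (hij : i ≠ j) : g2Cross (f i) (g j) = 0 := by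
  have h0 : ∀ w : Fin 7 → K, g2Bil 0 w = 0 := fun w => by simp [g2Bil]
  refine h.eq_of_bil h2 (fun l => ?_) (fun l => ?_) ?_
  · rw [h0, g2Bil_cross, g2Tri_swap_right, h.tri_ffg h2, neg_zero]
  · rw [h0, g2Bil_cross, ← g2Tri_rotate, h.tri_ggf h2]
  · rw [h0, g2Bil_cross, g2Tri_rotate, h.tri_vfg, if_neg hij]

theorem vol_g (h2 : (2 : K) ≠ 0) : g2Tri (g 0) (g 1) (g 2) = 1 := by
  have h1 := g2Cross_cross_add (f 0) (g 0) (g 1)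
  rw [h.cross_fg h2 (by decide : (0 : Fin 3) ≠ 1), g2Bil_comm, h.pair, if_neg (by decide), h.bil_gg h2, h.pair,
    if_pos rfl] at h1
  have h3 : g2Bil (g2Cross (f 0) (g2Cross (g 0) (g 1))) (f 1) = -2 := by
    have h4 : g2Cross (g 0) (0 : Fin 7 → K) = 0 := map_zero (g2Ad (g 0))
    rw [h4, add_zero, zero_smul, zero_smul, zero_add, zero_sub, mul_one, ← neg_smul] at h1
    rw [h1, g2Bil_smul_left, g2Bil_comm, h.pair, if_pos rfl, mul_one]
  rw [g2Bil_cross, g2Tri_swap_right, ← g2Bil_cross, h.cross_f01 h2, g2Bil_smul_left, g2Bil_comm,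
    g2Bil_cross] at h3
  refine mul_left_cancel₀ h2 ?_
  linear_combination -h3

theorem preserves_g2 (h2 : (2 : K) ≠ 0) : Preserves g2Tensor (g2FrameMatrix f g v) := by
  have hn : ∀ x y z : Fin 7 → K, g2Tri x y (-z) = -g2Tri x y z := fun x y z => by
    rw [← neg_one_smul K z, g2Tri_smul_right, neg_one_mul]
  have hn1 : ∀ x y z : Fin 7 → K, g2Tri (-x) y z = -g2Tri x y z := fun x y z => by
    rw [← g2Tri_rotate, hn, g2Tri_rotate x y z]
  have hn2 : ∀ x y z : Fin 7 → K, g2Tri x (-y) z = -g2Tri x y z := fun x y z => by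
    rw [g2Tri_swap_right, hn, g2Tri_swap_right, neg_neg]
  have t1 := fun i j l => (g2Tri_rotate (f l) (f i) (g j)).trans (h.tri_ffg h2 l i j)
  have t2 := fun i j l => (g2Tri_rotate (g i) (f j) (f l)).symm.trans (h.tri_ffg h2 j l i)
  have t3 := fun i j l => (g2Tri_rotate (g l) (g i) (f j)).trans (h.tri_ggf h2 l i j)
  have t4 := fun i j l => (g2Tri_rotate (f i) (g j) (g l)).symm.trans (h.tri_ggf h2 j l i)
  have t5 := fun x y : Fin 7 → K => g2Tri_rotate v x y
  have t6 := fun x y : Fin 7 → K => g2Tri_swap v x y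
  have t7 : ∀ i j, g2Tri v (g i) (f j) = -if j = i then 1 else 0 := fun i j => by
    rw [g2Tri_swap_right, h.tri_vfg]
  have t8 : g2Tri (g 2) (g 1) (g 0) = -1 := by
    rw [g2Tri_swap_right, g2Tri_rotate, g2Tri_rotate, h.vol_g h2]
  refine preserves_g2_of_col fun a b c => ?_
  refine g2Tri_col_ext (E := g2FrameCol f g v) (E' := fun i => Pi.single i 1) ?_ ?_ ?_ ?_ ?_ ?_ ?_
    ?_ ?_ ?_ ?_ ?_ ?_ ?_ ?_ ?_ ?_ ?_ ?_ ?_ ?_ ?_ ?_ ?_ ?_ ?_ ?_ ?_ ?_ ?_ ?_ ?_ ?_ ?_ ?_ a b c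
  all_goals
    simp only [g2FrameCol, cons_val, hn1, hn2, h.tri_ffg h2, h.tri_ggf h2, t1, t2, t3, t4, t5,
      t6, t7, t8, h.tri_vff h2, h.tri_vgg h2, h.tri_vfg, h.vol]
    simp [g2Tri, minor3]

theorem det_eq_one (h2 : (2 : K) ≠ 0) : (g2FrameMatrix f g v).det = 1 :=
  det_eq_one_of_preserves_g2 h2 (h.det_ne_zero h2) (h.preserves_g2 h2) (h.preserves_soOdd h2)

end IsG2Frame

end Field

end G2Frame

/-! ### Lattices with integral `G₂` form -/

section G2Lattice

open Matrix

variable {k : Type*} [Field k]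

theorem g2_exists_unit_det (h2 : (2 : k) ≠ 0) {A : Matrix (Fin 7) (Fin 7) (FF k)} (hA : A.det ≠ 0)
    (h : Preserves g2Tensor A) : ∃ u : (OO k)ˣ, A.det = algebraMap (OO k) (FF k) u := by
  have h1 := det_pow_of_preserves_g2 (two_ne_zero_FF h2) hA h
  obtain ⟨y, hy⟩ := (IsIntegrallyClosed.isIntegral_iff (R := OO k) (K := FF k) (x := A.det)).1
    (IsIntegral.of_pow (n := 9) (by norm_num) (by rw [h1]; exact isIntegral_one))
  have h3 : y ^ 9 = 1 := algebraMap_injective_OO (by rw [map_pow, hy, h1, map_one])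
  exact ⟨(IsUnit.of_pow_eq_one h3 (by norm_num)).unit, hy.symm⟩

theorem g2Tri_mem_of_col {A : Matrix (Fin 7) (Fin 7) (FF k)}
    (h : ∀ a b c, g2Tri (A.col a) (A.col b) (A.col c) ∈ Set.range (algebraMap (OO k) (FF k)))
    (u : Fin 7 → OO k) (b c : Fin 7) :
    g2Tri (A *ᵥ vecToFF u) (A.col b) (A.col c) ∈ Set.range (algebraMap (OO k) (FF k)) := by
  rw [← g2Tri_rotate, mulVec_eq_sum]
  change g2TriForm (A.col b) (A.col c) _ ∈ (algebraMap (OO k) (FF k)).range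
  rw [map_sum]
  refine Subring.sum_mem _ fun i _ => ?_
  rw [op_smul_eq_smul, map_smul]
  refine Subring.mul_mem _ ⟨u i, rfl⟩ ?_
  have := h i b c
  rw [← g2Tri_rotate] at this
  exact this

theorem g2Bil_mem_of_isUnit {A : Matrix (Fin 7) (Fin 7) (FF k)}
    (hA : ∃ u : (OO k)ˣ, A.det = algebraMap (OO k) (FF k) u)
    (h : ∀ a b c, g2Tri (A.col a) (A.col b) (A.col c) ∈ Set.range (algebraMap (OO k) (FF k)))
    (u : Fin 7 → OO k) (i : Fin 7) (hi : u i = 1) :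
    g2Bil (A *ᵥ vecToFF u) (A *ᵥ vecToFF u) ∈ (algebraMap (OO k) (FF k)).range := by
  obtain ⟨d, hd⟩ := hA
  have hA' : IsUnit Aᵀ.det := by
    rw [det_transpose, hd]
    exact d.isUnit.map _
  have h1 := det_mul_g2Bil A ((Aᵀ)⁻¹ *ᵥ Pi.single i 1) (vecToFF u)
  rw [mulVec_mulVec, mul_nonsing_inv _ hA', one_mulVec] at h1
  have h4 : ∑ j, (Pi.single i 1 : Fin 7 → FF k) j * vecToFF u j = 1 := by
    rw [Finset.sum_eq_single i]
    · simp [vecToFF, hi]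
    · simp +contextual
    · simp
  rw [h4, mul_one] at h1
  choose C hC using g2Tri_mem_of_col h u
  have h5 : borderMatrix (Pi.single i 1) (Matrix.of fun a b =>
      g2Tri (A *ᵥ vecToFF u) (A.col a) (A.col b)) =
      (borderMatrix (Pi.single i 1) (Matrix.of C)).map (algebraMap (OO k) (FF k)) := by
    have key : ∀ a b : Fin 8, borderMatrix (Pi.single i 1) (Matrix.of fun a b =>
        g2Tri (A *ᵥ vecToFF u) (A.col a) (A.col b)) a b =
        algebraMap (OO k) (FF k) (borderMatrix (Pi.single i 1) (Matrix.of C) a b) := by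
      intro a b
      refine Fin.cases ?_ (fun a => ?_) a <;> refine Fin.cases ?_ (fun b => ?_) b
      · simp [borderMatrix]
      · simp [borderMatrix, Pi.single_apply, apply_ite]
      · simp [borderMatrix, Pi.single_apply, apply_ite]
      · simpa [borderMatrix] using (hC a b).symm
    exact Matrix.ext key
  rw [h5, pfaffian_map, hd] at h1
  refine ⟨-(↑d⁻¹ * pfaffian 4 (borderMatrix (Pi.single i 1) (Matrix.of C))), ?_⟩
  rw [map_neg, map_mul, h1]
  have h6 : algebraMap (OO k) (FF k) ↑d⁻¹ * algebraMap (OO k) (FF k) d = 1 := by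
    rw [← map_mul, Units.inv_mul, map_one]
  linear_combination (g2Bil (A *ᵥ vecToFF u) (A *ᵥ vecToFF u)) * h6

theorem g2Bil_col_mem (h2 : (2 : k) ≠ 0) {A : Matrix (Fin 7) (Fin 7) (FF k)}
    (hA : ∃ u : (OO k)ˣ, A.det = algebraMap (OO k) (FF k) u)
    (h : ∀ a b c, g2Tri (A.col a) (A.col b) (A.col c) ∈ Set.range (algebraMap (OO k) (FF k)))
    (i j : Fin 7) : g2Bil (A.col i) (A.col j) ∈ (algebraMap (OO k) (FF k)).range := by
  have hs : ∀ i : Fin 7, vecToFF (Pi.single i (1 : OO k)) = Pi.single i 1 := fun i => by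
    funext a
    simp [vecToFF, Pi.single_apply, apply_ite]
  have hd : ∀ i, g2Bil (A.col i) (A.col i) ∈ (algebraMap (OO k) (FF k)).range := fun i => by
    have := g2Bil_mem_of_isUnit hA h (Pi.single i 1) i (by simp)
    rwa [hs, mulVec_single_one] at this
  by_cases hij : i = j
  · rw [hij]
    exact hd j
  · have h1 := g2Bil_mem_of_isUnit hA h
      ((Pi.single i 1 : Fin 7 → OO k) + (Pi.single j 1 : Fin 7 → OO k)) i (by simp [hij])
    have hadd : vecToFF ((Pi.single i 1 : Fin 7 → OO k) + (Pi.single j 1 : Fin 7 → OO k)) =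
        (Pi.single i 1 + Pi.single j 1 : Fin 7 → FF k) := by
      rw [← hs, ← hs]
      funext a
      simp [vecToFF]
    rw [hadd, mulVec_add, mulVec_single_one, mulVec_single_one, g2Bil_add_left, g2Bil_comm,
      g2Bil_comm (A.col j), g2Bil_add_left, g2Bil_add_left, g2Bil_comm (A.col j)] at h1
    obtain ⟨a, ha⟩ := h1
    obtain ⟨b, hb⟩ := hd i
    obtain ⟨c, hc⟩ := hd j
    obtain ⟨t, ht⟩ := isUnit_two_OO h2
    refine ⟨↑t⁻¹ * (a - b - c), ?_⟩
    have h6 : algebraMap (OO k) (FF k) ↑t⁻¹ * 2 = 1 := by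
      rw [← map_ofNat (algebraMap (OO k) (FF k)) 2, ← ht, ← map_mul, Units.inv_mul, map_one]
    rw [map_mul, map_sub, map_sub, ha, hb, hc]
    linear_combination (g2Bil (A.col i) (A.col j)) * h6

/-- Two hyperbolic pairs of eigenvectors extend to a frame. -/
theorem isG2Frame_of_pairs {K : Type*} [Field K] (h2 : (2 : K) ≠ 0) {v f₀ f₁ g₀ g₁ : Fin 7 → K}
    (hv : g2Bil v v = -1) (hf₀ : g2Cross v f₀ = f₀) (hf₁ : g2Cross v f₁ = f₁)
    (hg₀ : g2Cross v g₀ = -g₀) (hg₁ : g2Cross v g₁ = -g₁) (h₀₀ : g2Bil f₀ g₀ = 1)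
    (h₀₁ : g2Bil f₀ g₁ = 0) (h₁₀ : g2Bil f₁ g₀ = 0) (h₁₁ : g2Bil f₁ g₁ = 1) :
    IsG2Frame ![f₀, f₁, g2Cross g₀ g₁] ![g₀, g₁, (2⁻¹ : K) • g2Cross f₀ f₁] v := by
  have hf₀' : g2Cross v f₀ = (1 : K) • f₀ := by rw [one_smul, hf₀]
  have hf₁' : g2Cross v f₁ = (1 : K) • f₁ := by rw [one_smul, hf₁]
  have hg₀' : g2Cross v g₀ = (-1 : K) • g₀ := by rw [neg_one_smul, hg₀]
  have hg₁' : g2Cross v g₁ = (-1 : K) • g₁ := by rw [neg_one_smul, hg₁]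
  have hn : (-1 : K) ≠ 0 := neg_ne_zero.2 one_ne_zero
  have hff := g2Cross_cross_of_eigen h2 one_ne_zero hf₀' hf₁'
  have hgg := g2Cross_cross_of_eigen h2 hn hg₀' hg₁'
  rw [neg_neg] at hgg
  have hy : g2Cross f₀ g₁ = 0 := by
    have e1 := g2Cross_cross_add v f₀ g₁
    have e2 := g2Cross_cross_add v g₁ f₀
    rw [hg₁, g2Cross_neg, g2Bil_comm g₁ v, g2Bil_eq_zero_of_cross_self hn hg₁', g2Bil_comm g₁ f₀,
      h₀₁, g2Bil_eq_zero_of_cross_self one_ne_zero hf₀'] at e1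
    rw [hf₀, g2Cross_swap f₀ g₁, g2Bil_comm f₀ v, g2Bil_eq_zero_of_cross_self hn hg₁', h₀₁,
      g2Bil_eq_zero_of_cross_self one_ne_zero hf₀', g2Cross_neg] at e2
    have e3 : (2 : K) • g2Cross f₀ g₁ = 0 := by
      have := congrArg₂ (· + ·) e1 e2
      simp only [zero_smul, mul_zero, add_zero, sub_zero] at this
      rw [← neg_eq_zero, ← this]
      module
    exact (smul_eq_zero.1 e3).resolve_left h2
  have hvol : g2Tri f₀ f₁ (g2Cross g₀ g₁) = 2 := by
    have h1 := g2Cross_cross_add f₀ g₀ g₁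
    have h4 : g2Cross g₀ (0 : Fin 7 → K) = 0 := map_zero (g2Ad g₀)
    rw [hy, h4, add_zero, g2Bil_comm, h₀₁, g2Bil_eq_zero_of_cross h2 hn hg₁' hg₀', h₀₀, zero_smul,
      zero_smul, zero_add, zero_sub, mul_one, ← neg_smul] at h1
    rw [g2Tri_swap_right, ← g2Bil_cross, h1, g2Bil_smul_left, g2Bil_comm, h₁₁]
    ring
  have hsm : ∀ (x : Fin 7 → K) (c : K) (y : Fin 7 → K), g2Bil x (c • y) = c * g2Bil x y :=
    fun x c y => (map_smul (g2BilForm K x) c y)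
  constructor
  · intro i
    fin_cases i
    · exact hf₀
    · exact hf₁
    · exact hgg.trans (one_smul _ _)
  · intro i
    fin_cases i
    · exact hg₀
    · exact hg₁
    · change g2Cross v ((2⁻¹ : K) • g2Cross f₀ f₁) = -((2⁻¹ : K) • g2Cross f₀ f₁)
      rw [g2Cross_smul, hff, neg_one_smul, smul_neg]
  · intro i j
    fin_cases i <;> fin_cases j
    · simpa using h₀₀
    · simpa using h₀₁
    · change g2Bil f₀ ((2⁻¹ : K) • g2Cross f₀ f₁) = 0
      rw [hsm, g2Bil_comm, g2Bil_cross, g2Tri_self_outer, mul_zero]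
    · simpa using h₁₀
    · simpa using h₁₁
    · change g2Bil f₁ ((2⁻¹ : K) • g2Cross f₀ f₁) = 0
      rw [hsm, g2Bil_comm, g2Bil_cross, g2Tri_self_right, mul_zero]
    · change g2Bil (g2Cross g₀ g₁) g₀ = 0
      rw [g2Bil_cross, g2Tri_self_outer]
    · change g2Bil (g2Cross g₀ g₁) g₁ = 0
      rw [g2Bil_cross, g2Tri_self_right]
    · change g2Bil (g2Cross g₀ g₁) ((2⁻¹ : K) • g2Cross f₀ f₁) = 1
      rw [hsm, g2Bil_comm, g2Bil_cross, hvol, inv_mul_cancel₀ h2]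
  · exact hv
  · exact hvol

/-- The conditions on a lattice in `F⁷` under which it is spanned by a frame. -/
structure IsG2Order (L : Submodule (OO k) (Fin 7 → FF k)) : Prop where
  bil : ∀ x ∈ L, ∀ y ∈ L, g2Bil x y ∈ (algebraMap (OO k) (FF k)).range
  cross : ∀ x ∈ L, ∀ y ∈ L, g2Cross x y ∈ L

namespace IsG2Order

variable {L : Submodule (OO k) (Fin 7 → FF k)} (hL : IsG2Order L)
include hL

theorem smul_mem {c : FF k} (hc : c ∈ (algebraMap (OO k) (FF k)).range) {x : Fin 7 → FF k}
    (hx : x ∈ L) : c • x ∈ L := by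
  obtain ⟨c, rfl⟩ := hc
  rw [algebraMap_smul]
  exact L.smul_mem c hx

theorem half_mem (h2 : (2 : k) ≠ 0) : (2⁻¹ : FF k) ∈ (algebraMap (OO k) (FF k)).range := by
  obtain ⟨t, ht⟩ := isUnit_two_OO h2
  refine ⟨↑t⁻¹, ?_⟩
  rw [← map_ofNat (algebraMap (OO k) (FF k)) 2, ← ht]
  refine eq_inv_of_mul_eq_one_left ?_
  rw [← map_mul, Units.inv_mul, map_one]

theorem exists_pair_of_isUnit {w w' : Fin 7 → FF k} {c : OO k} (hc : IsUnit c) (hw' : w' ∈ L) (hww' : g2Bil w w' = algebraMap (OO k) (FF k) c) :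
    ∃ g ∈ L, g2Bil w g = 1 ∧ ∃ a : FF k, g = a • w' := by
  obtain ⟨c, rfl⟩ := hc
  refine ⟨_, hL.smul_mem ⟨↑c⁻¹, rfl⟩ hw', ?_, _, rfl⟩
  rw [g2Bil_comm, g2Bil_smul_left, g2Bil_comm, hww', ← map_mul, Units.inv_mul, map_one]

theorem exists_pair (h2 : (2 : k) ≠ 0) {v w w' : Fin 7 → FF k} (hvL : v ∈ L) (hv : g2Bil v v = -1)
    (hw : w ∈ L) (hw' : w' ∈ L) (hvw : g2Bil w v = 0) (hvw' : g2Bil w' v = 0) {c : OO k}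
    (hc : IsUnit c) (hww' : g2Bil w w' = algebraMap (OO k) (FF k) c) :
    ∃ f ∈ L, ∃ g ∈ L, g2Cross v f = f ∧ g2Cross v g = -g ∧ g2Bil f g = 1 ∧
      ∀ y, g2Bil y w = 0 → g2Bil y w' = 0 → g2Bil y (g2Cross v w) = 0 →
        g2Bil y (g2Cross v w') = 0 → g2Bil y f = 0 ∧ g2Bil y g = 0 := by
  have h2' := two_ne_zero_FF h2
  have hsq : ∀ w, g2Bil w v = 0 → g2Cross v (g2Cross v w) = w := fun w hw => by
    rw [g2Cross_cross, hw, hv, zero_smul, zero_sub, neg_one_smul, neg_neg]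
  set p : (Fin 7 → FF k) → Fin 7 → FF k := fun w => (2⁻¹ : FF k) • (w + g2Cross v w) with hp
  set m : (Fin 7 → FF k) → Fin 7 → FF k := fun w => (2⁻¹ : FF k) • (w - g2Cross v w) with hm
  have hpe : ∀ w, g2Bil w v = 0 → g2Cross v (p w) = p w := fun w hw => by
    simp only [p]
    rw [g2Cross_smul, g2Cross_add, hsq w hw, add_comm]
  have hme : ∀ w, g2Bil w v = 0 → g2Cross v (m w) = -m w := fun w hw => by
    simp only [m]
    rw [g2Cross_smul, g2Cross_sub, hsq w hw, ← smul_neg, neg_sub]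
  have hpL : ∀ w ∈ L, p w ∈ L := fun w hw =>
    hL.smul_mem (hL.half_mem h2) (L.add_mem hw (hL.cross _ hvL _ hw))
  have hmL : ∀ w ∈ L, m w ∈ L := fun w hw =>
    hL.smul_mem (hL.half_mem h2) (L.sub_mem hw (hL.cross _ hvL _ hw))
  have hpm : ∀ w, w = p w + m w := fun w => by
    simp only [p, m]
    rw [← smul_add, add_add_sub_cancel, ← two_smul (FF k), smul_smul, inv_mul_cancel₀ h2', one_smul]
  have hyp : ∀ y w, g2Bil y w = 0 → g2Bil y (g2Cross v w) = 0 →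
      g2Bil y (p w) = 0 ∧ g2Bil y (m w) = 0 := fun y w h3 h4 => by
    rw [← g2BilForm_apply] at h3 h4
    constructor
    · simp only [p]
      rw [← g2BilForm_apply, map_smul, map_add, h3, h4, add_zero, smul_zero]
    · simp only [m]
      rw [← g2BilForm_apply, map_smul, map_sub, h3, h4, sub_zero, smul_zero]
  have core : ∀ w ∈ L, ∀ w' ∈ L, g2Bil w v = 0 → g2Bil w' v = 0 → ∀ d : OO k, IsUnit d →
      g2Bil (p w) (m w') = algebraMap (OO k) (FF k) d →
      ∃ f ∈ L, ∃ g ∈ L, g2Cross v f = f ∧ g2Cross v g = -g ∧ g2Bil f g = 1 ∧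
      ∀ y, g2Bil y w = 0 → g2Bil y w' = 0 → g2Bil y (g2Cross v w) = 0 →
        g2Bil y (g2Cross v w') = 0 → g2Bil y f = 0 ∧ g2Bil y g = 0 := by
    intro w hw w' hw' hvw hvw' d hd hdd
    obtain ⟨g, hg, h3, a, rfl⟩ := hL.exists_pair_of_isUnit hd (hmL w' hw') hdd
    refine ⟨p w, hpL w hw, _, hg, hpe w hvw, ?_, h3, fun y h4 h5 h6 h7 => ⟨(hyp y w h4 h6).1, ?_⟩⟩
    · rw [g2Cross_smul, hme w' hvw', smul_neg]
    · rw [g2Bil_comm, g2Bil_smul_left, g2Bil_comm, (hyp y w' h5 h7).2, mul_zero]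
  obtain ⟨d, hd⟩ := hL.bil _ (hpL w hw) _ (hmL w' hw')
  obtain ⟨d', hd'⟩ := hL.bil _ (hpL w' hw') _ (hmL w hw)
  have hsum : c = d + d' := by
    apply algebraMap_injective_OO
    have z1 : g2Bil (p w) (p w') = 0 := g2Bil_eq_zero_of_cross h2' one_ne_zero
      ((hpe w hvw).trans (one_smul _ _).symm) ((hpe w' hvw').trans (one_smul _ _).symm)
    have z2 : g2Bil (m w) (m w') = 0 := g2Bil_eq_zero_of_cross h2' (neg_ne_zero.2 one_ne_zero)
      ((hme w hvw).trans (neg_one_smul _ _).symm) ((hme w' hvw').trans (neg_one_smul _ _).symm)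
    rw [map_add, hd, hd', ← hww']
    conv_lhs => rw [hpm w, hpm w']
    rw [g2Bil_add_left, g2Bil_comm _ (p w' + m w'), g2Bil_comm _ (p w' + m w'), g2Bil_add_left,
      g2Bil_add_left, g2Bil_comm (p w') (p w), z1, g2Bil_comm (m w') (m w), z2,
      g2Bil_comm (m w') (p w)]
    ring
  rcases IsLocalRing.isUnit_or_isUnit_of_isUnit_add (hsum ▸ hc) with h | h
  · exact core w hw w' hw' hvw hvw' d h hd.symm
  · obtain ⟨f, hf, g, hg, h3, h4, h5, h6⟩ := core w' hw' w hw hvw' hvw d' h hd'.symm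
    exact ⟨f, hf, g, hg, h3, h4, h5, fun y a b c d => h6 y b a d c⟩

end IsG2Order

end G2Lattice

section G2Lattice

open Matrix

variable {k : Type*} [Field k]

theorem g2Tri_mem_of_span {L : Submodule (OO k) (Fin 7 → FF k)} {X : Fin 7 → Fin 7 → FF k}
    (hL : L = Submodule.span (OO k) (Set.range X))
    (h : ∀ a b c, g2Tri (X a) (X b) (X c) ∈ (algebraMap (OO k) (FF k)).range) :
    ∀ x ∈ L, ∀ y ∈ L, ∀ z ∈ L, g2Tri x y z ∈ (algebraMap (OO k) (FF k)).range := by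
  have key : ∀ x y, (∀ i, g2Tri x y (X i) ∈ (algebraMap (OO k) (FF k)).range) → ∀ z ∈ L,
      g2Tri x y z ∈ (algebraMap (OO k) (FF k)).range := by
    intro x y hxy z hz
    rw [hL] at hz
    induction hz using Submodule.span_induction with
    | mem z hz =>
      obtain ⟨i, rfl⟩ := hz
      exact hxy i
    | zero =>
      rw [← zero_smul (FF k) (0 : Fin 7 → FF k), g2Tri_smul_right, zero_mul]
      exact Subring.zero_mem _
    | add u w _ _ hu hw =>
      rw [g2Tri_add_right]
      exact Subring.add_mem _ hu hw
    | smul c u _ hu =>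
      rw [← algebraMap_smul (FF k) c, g2Tri_smul_right]
      exact Subring.mul_mem _ ⟨c, rfl⟩ hu
  intro x hx y hy
  refine key x y fun i => ?_
  rw [g2Tri_rotate (X i) x y]
  refine key (X i) x (fun j => ?_) y hy
  rw [g2Tri_rotate (X j) (X i) x]
  exact key (X j) (X i) (fun l => h j i l) x hx

section Orthogonal

variable {g : Matrix (Fin 7) (Fin 7) (FF k)} (hg : g.det ≠ 0)
  (hgB : ∀ u v, g2Bil (g *ᵥ u) (g *ᵥ v) = g2Bil u v)
include hg hgB

theorem mem_span_col_iff (y : Fin 7 → FF k) :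
    y ∈ Submodule.span (OO k) (Set.range g.col) ↔
      ∀ i, g2Bil y (g.col i) ∈ (algebraMap (OO k) (FF k)).range := by
  have hcol : ∀ i, g.col i = g *ᵥ Pi.single i 1 := fun i => (mulVec_single_one _ _).symm
  constructor
  · intro hy i
    induction hy using Submodule.span_induction with
    | mem z hz =>
      obtain ⟨j, rfl⟩ := hz
      rw [hcol, hcol, hgB]
      refine ⟨g2Bil (Pi.single j 1) (Pi.single i 1), ?_⟩
      fin_cases j <;> fin_cases i <;> simp [g2Bil]
    | zero => exact ⟨0, by simp [g2Bil]⟩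
    | add u w _ _ hu hw =>
      rw [g2Bil_add_left]
      exact Subring.add_mem _ hu hw
    | smul c u _ hu =>
      rw [← algebraMap_smul (FF k) c, g2Bil_smul_left]
      exact Subring.mul_mem _ ⟨c, rfl⟩ hu
  · intro h
    set w := g⁻¹ *ᵥ y with hw
    have hy : y = g *ᵥ w := by
      rw [hw, mulVec_mulVec, mul_nonsing_inv _ hg.isUnit, one_mulVec]
    have hwi : ∀ i, w i ∈ (algebraMap (OO k) (FF k)).range := by
      intro i
      have h1 := h i.rev
      rw [hcol, hy, hgB] at h1
      fin_cases i <;> simpa [g2Bil] using h1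
    choose c hc using hwi
    rw [hy, mulVec_eq_sum]
    refine Submodule.sum_mem _ fun i _ => ?_
    rw [op_smul_eq_smul, ← hc, algebraMap_smul]
    exact Submodule.smul_mem _ _ (Submodule.subset_span ⟨i, rfl⟩)

theorem sum_g2Bil_col (a b : Fin 7 → FF k) :
    ∑ i : Fin 7, (-1) ^ (i : ℕ) * (g2Bil (g.col i) a * g2Bil b (g.col i.rev)) = g2Bil a b := by
  have hcol : ∀ i, g.col i = g *ᵥ Pi.single i 1 := fun i => (mulVec_single_one _ _).symm
  have hy : ∀ y, y = g *ᵥ (g⁻¹ *ᵥ y) := fun y => by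
    rw [mulVec_mulVec, mul_nonsing_inv _ hg.isUnit, one_mulVec]
  rw [hy a, hy b]
  simp only [hcol, hgB]
  simp [Fin.sum_univ_seven, g2Bil, Fin.rev]
  ring

theorem isG2Order_span_col
    (hT : ∀ a b c, g2Tri (g.col a) (g.col b) (g.col c) ∈ (algebraMap (OO k) (FF k)).range) :
    IsG2Order (Submodule.span (OO k) (Set.range g.col)) := by
  constructor
  · intro x hx y hy
    induction hy using Submodule.span_induction with
    | mem z hz =>
      obtain ⟨j, rfl⟩ := hz
      exact (mem_span_col_iff hg hgB x).1 hx j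
    | zero => exact ⟨0, by simp [g2Bil]⟩
    | add u w _ _ hu hw =>
      rw [g2Bil_comm, g2Bil_add_left, g2Bil_comm u, g2Bil_comm w]
      exact Subring.add_mem _ hu hw
    | smul c u _ hu =>
      rw [← algebraMap_smul (FF k) c, g2Bil_comm, g2Bil_smul_left, g2Bil_comm u]
      exact Subring.mul_mem _ ⟨c, rfl⟩ hu
  · intro x hx y hy
    rw [mem_span_col_iff hg hgB]
    intro i
    rw [g2Bil_cross]
    exact g2Tri_mem_of_span rfl hT x hx y hy _ (Submodule.subset_span ⟨i, rfl⟩)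

theorem exists_g2Frame_mem (h2 : (2 : k) ≠ 0)
    (hL : IsG2Order (Submodule.span (OO k) (Set.range g.col))) :
    ∃ f e v, IsG2Frame f e v ∧
      ∀ i, g2FrameCol f e v i ∈ Submodule.span (OO k) (Set.range g.col) := by
  have h2' := two_ne_zero_FF h2
  set L := Submodule.span (OO k) (Set.range g.col) with hLdef
  have hmem : ∀ i, g.col i ∈ L := fun i => Submodule.subset_span ⟨i, rfl⟩
  have hcol : ∀ i, g.col i = g *ᵥ Pi.single i 1 := fun i => (mulVec_single_one _ _).symm
  set v := g.col 3 with hvdef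
  have hv : g2Bil v v = -1 := by
    rw [hvdef, hcol, hgB]
    simp [g2Bil]
  obtain ⟨f₀, hf₀, g₀, hg₀, e1, e2, e3, -⟩ := hL.exists_pair h2 (hmem 3) hv (hmem 0) (hmem 6)
    (by rw [hcol, hcol, hgB]; simp [g2Bil]) (by rw [hcol, hcol, hgB]; simp [g2Bil])
    (isUnit_one) (by rw [hcol, hcol, hgB]; simp [g2Bil])
  have hvf : g2Bil v f₀ = 0 := g2Bil_eq_zero_of_cross_self one_ne_zero (e1.trans (one_smul _ _).symm)
  have hvg : g2Bil v g₀ = 0 := g2Bil_eq_zero_of_cross_self (neg_ne_zero.2 one_ne_zero)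
    (e2.trans (neg_one_smul _ _).symm)
  have hff : g2Bil f₀ f₀ = 0 := g2Bil_eq_zero_of_cross h2' one_ne_zero (e1.trans (one_smul _ _).symm)
    (e1.trans (one_smul _ _).symm)
  have hgg : g2Bil g₀ g₀ = 0 := g2Bil_eq_zero_of_cross h2' (neg_ne_zero.2 one_ne_zero)
    (e2.trans (neg_one_smul _ _).symm) (e2.trans (neg_one_smul _ _).symm)
  set N : (Fin 7 → FF k) → Fin 7 → FF k := fun x =>
    x + g2Bil x v • v - g2Bil x g₀ • f₀ - g2Bil x f₀ • g₀ with hN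
  have hNB : ∀ x y, g2Bil (N x) y =
      g2Bil x y + g2Bil x v * g2Bil v y - g2Bil x g₀ * g2Bil f₀ y - g2Bil x f₀ * g2Bil g₀ y := by
    intro x y
    simp only [N, ← g2BilForm_apply]
    simp
  have hNL : ∀ x ∈ L, N x ∈ L := fun x hx => L.sub_mem (L.sub_mem (L.add_mem hx
    (hL.smul_mem (hL.bil _ hx _ (hmem 3)) (hmem 3))) (hL.smul_mem (hL.bil _ hx _ hg₀) hf₀))
    (hL.smul_mem (hL.bil _ hx _ hf₀) hg₀)
  have hNv : ∀ x, g2Bil (N x) v = 0 := fun x => by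
    rw [hNB, hv, g2Bil_comm f₀, hvf, g2Bil_comm g₀, hvg]
    ring
  have hNf : ∀ x, g2Bil (N x) f₀ = 0 := fun x => by
    rw [hNB, hvf, hff, g2Bil_comm g₀, e3]
    ring
  have hNg : ∀ x, g2Bil (N x) g₀ = 0 := fun x => by
    rw [hNB, hvg, hgg, e3]
    ring
  have hNN : ∀ x y, g2Bil (N x) (N y) = g2Bil (N x) y := fun x y => by
    rw [g2Bil_comm, hNB, g2Bil_comm v, hNv, g2Bil_comm f₀, hNf, g2Bil_comm g₀, hNg, g2Bil_comm]
    ring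
  have htrace : ∑ i : Fin 7, (-1) ^ (i : ℕ) * g2Bil (N (g.col i)) (g.col i.rev) = (4 : FF k) := by
    have h7 : ∑ i : Fin 7, (-1) ^ (i : ℕ) * g2Bil (g.col i) (g.col i.rev) = (7 : FF k) := by
      simp only [hcol, hgB]
      simp [Fin.sum_univ_seven, g2Bil, Fin.rev]
      norm_num
    have hs := sum_g2Bil_col hg hgB
    simp only [hNB, mul_sub, mul_add, Finset.sum_sub_distrib, Finset.sum_add_distrib, hs, h7, hv]
    rw [g2Bil_comm g₀, e3]
    norm_num
  have hex : ∃ i : Fin 7, ∃ c : OO k, IsUnit c ∧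
      g2Bil (N (g.col i)) (g.col i.rev) = algebraMap (OO k) (FF k) c := by
    by_contra hcon
    push Not at hcon
    choose c hc using fun i : Fin 7 => hL.bil _ (hNL _ (hmem i)) _ (hmem i.rev)
    have h4 : (∑ i : Fin 7, (-1) ^ (i : ℕ) * c i) = (4 : OO k) := by
      apply algebraMap_injective_OO
      rw [map_sum, map_ofNat, ← htrace]
      refine Finset.sum_congr rfl fun i _ => ?_
      rw [map_mul, hc, map_pow, map_neg, map_one]
    have h5 : (4 : OO k) ∈ IsLocalRing.maximalIdeal (OO k) := by
      rw [← h4]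
      refine Ideal.sum_mem _ fun i _ => Ideal.mul_mem_left _ _ ?_
      rw [IsLocalRing.mem_maximalIdeal]
      exact fun hu => hcon i (c i) hu (hc i).symm
    rw [IsLocalRing.mem_maximalIdeal] at h5
    refine h5 ?_
    have := (isUnit_two_OO h2).mul (isUnit_two_OO h2)
    norm_num at this
    exact this
  obtain ⟨i, c, hc, hic⟩ := hex
  obtain ⟨f₁, hf₁, g₁, hg₁, d1, d2, d3, hy⟩ := hL.exists_pair h2 (hmem 3) hv (hNL _ (hmem i))
    (hNL _ (hmem i.rev)) (hNv _) (hNv _) hc (by rw [hNN, hic])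
  have hfv : ∀ w, g2Bil f₀ (N w) = 0 := fun w => by rw [g2Bil_comm, hNf]
  have hgv : ∀ w, g2Bil g₀ (N w) = 0 := fun w => by rw [g2Bil_comm, hNg]
  have hfx : ∀ w, g2Bil f₀ (g2Cross v (N w)) = 0 := fun w => by
    rw [g2Bil_comm, g2Bil_cross, g2Tri_swap_right, ← g2Bil_cross, e1, hfv, neg_zero]
  have hgx : ∀ w, g2Bil g₀ (g2Cross v (N w)) = 0 := fun w => by
    rw [g2Bil_comm, g2Bil_cross, g2Tri_swap_right, ← g2Bil_cross, e2, ← neg_one_smul (FF k) g₀,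
      g2Bil_smul_left, hgv, mul_zero, neg_zero]
  have o1 := hy f₀ (hfv _) (hfv _) (hfx _) (hfx _)
  have o2 := hy g₀ (hgv _) (hgv _) (hgx _) (hgx _)
  refine ⟨_, _, _, isG2Frame_of_pairs h2' hv e1 d1 e2 d2 e3 o1.2 (by rw [g2Bil_comm]; exact o2.1)
    d3, ?_⟩
  intro i
  fin_cases i
  · exact hf₀
  · exact L.neg_mem (hL.smul_mem (hL.half_mem h2) (hL.cross _ hf₀ _ hf₁))
  · exact hg₁
  · exact hmem 3
  · exact hf₁
  · exact hL.cross _ hg₀ _ hg₁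
  · exact hg₀

end Orthogonal

theorem g2_exists_preserving (h2 : (2 : k) ≠ 0) (A : Matrix (Fin 7) (Fin 7) (FF k))
    (hA : ∃ u : (OO k)ˣ, A.det = algebraMap (OO k) (FF k) u)
    (h : ∀ s : Fin 3 → Fin 7, tensorForm g2Tensor (FF k) (fun j => A.col (s j)) ∈
        Set.range (algebraMap (OO k) (FF k))) :
    ∃ Q : Matrix (Fin 7) (Fin 7) (OO k), IsUnit Q.det ∧
      (A * toFF Q).det = 1 ∧ Preserves g2Tensor (A * toFF Q) := by
  have hT : ∀ a b c, g2Tri (A.col a) (A.col b) (A.col c) ∈ (algebraMap (OO k) (FF k)).range := by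
    intro a b c
    have := h ![a, b, c]
    rw [tensorForm_g2] at this
    exact this
  obtain ⟨Q, hQ, hdet, hpres⟩ := soOdd_exists_preserving h2 3 A hA (fun s => by
    have := tensorForm_soOdd_three (R := FF k) (fun j => A.col (s j))
    refine Eq.subst (motive := fun x => x ∈ Set.range (algebraMap (OO k) (FF k))) this.symm ?_
    exact g2Bil_col_mem h2 hA hT _ _)
  have hB := (preserves_soOdd_three_iff _).1 hpres
  have hd : (A * toFF Q).det ≠ 0 := by
    rw [hdet]
    exact one_ne_zero
  have hcolmem : ∀ (B : Matrix (Fin 7) (Fin 7) (FF k)) (C : Matrix (Fin 7) (Fin 7) (OO k)) i,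
      (B * toFF C).col i ∈ Submodule.span (OO k) (Set.range B.col) := by
    intro B C i
    rw [← mulVec_single_one, ← mulVec_mulVec, mulVec_single_one, mulVec_eq_sum]
    refine Submodule.sum_mem _ fun j _ => ?_
    rw [op_smul_eq_smul]
    change algebraMap (OO k) (FF k) (C j i) • _ ∈ _
    rw [algebraMap_smul]
    exact Submodule.smul_mem _ _ (Submodule.subset_span ⟨j, rfl⟩)
  obtain ⟨f, e, v, hF, hmem⟩ := exists_g2Frame_mem hd hB h2 (isG2Order_span_col hd hB
    fun a b c => g2Tri_mem_of_span rfl hT _ (hcolmem A Q a) _ (hcolmem A Q b) _ (hcolmem A Q c))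
  choose c hc using fun i => (Submodule.mem_span_range_iff_exists_fun (OO k)).1 (hmem i)
  set C : Matrix (Fin 7) (Fin 7) (OO k) := Matrix.of fun i j => c j i with hC
  have hM : g2FrameMatrix f e v = A * toFF (Q * C) := by
    rw [toFF_mul, ← mul_assoc]
    refine Matrix.ext fun i j => ?_
    have h1 := congrFun (hc j) i
    change g2FrameCol f e v j i = _
    rw [← h1, mul_apply, Finset.sum_apply]
    refine Finset.sum_congr rfl fun l _ => ?_
    rw [Pi.smul_apply, Algebra.smul_def, mul_comm]
    rfl
  refine ⟨Q * C, ?_, ?_, ?_⟩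
  · have h1 := hF.det_eq_one (two_ne_zero_FF h2)
    obtain ⟨u, hu⟩ := hA
    have h3 : (Q * C).det * u = 1 := algebraMap_injective_OO (by
      rw [map_mul, ← det_toFF, ← hu, mul_comm, ← det_mul, ← hM, h1, map_one])
    exact IsUnit.of_mul_eq_one _ h3
  · rw [← hM]
    exact hF.det_eq_one (two_ne_zero_FF h2)
  · rw [← hM]
    exact hF.preserves_g2 (two_ne_zero_FF h2)

end G2Lattice

/-! ### The companion section for `G₂` -/

section G2Companion

open Matrix Module

variable {k : Type*} [Field k] (e q : OO k)

theorem g2Poly_natDegree : (oddPoly (g2Coeffs e q)).natDegree = 7 := oddPoly_natDegree _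

/-- The monomial basis of `V`. -/
def g2Monomial : Basis (Fin 7) (FF k) (G2Space e q) :=
  (monomialBasis (oddPoly_monic (g2Coeffs e q)) (g2Poly_natDegree e q)).baseChange (FF k)

theorem g2Monomial_apply (j : Fin 7) : g2Monomial e q j = g2X e q ^ (j : ℕ) := by
  rw [g2Monomial, Basis.baseChange_apply, monomialBasis_apply, g2X, ← map_pow]
  rfl

theorem g2Coord_monomial (i j : Fin 7) :
    g2Coord e q i (g2Monomial e q j) = if i = j then 1 else 0 := by
  rw [g2Monomial_apply, g2Coord_pow e q i j j.2]
  simp only [Fin.ext_iff]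

theorem g2_eq_sum (w : G2Space e q) : w = ∑ j : Fin 7, g2Coord e q j w • g2X e q ^ (j : ℕ) := by
  have h : (LinearMap.id : G2Space e q →ₗ[FF k] G2Space e q) =
      ∑ j : Fin 7, (g2Coord e q j).smulRight (g2X e q ^ (j : ℕ)) := by
    refine (g2Monomial e q).ext fun i => ?_
    simp only [LinearMap.id_apply, LinearMap.sum_apply, LinearMap.smulRight_apply,
      g2Coord_monomial]
    simp [g2Monomial_apply]
  have := congrArg (fun φ => φ w) h
  simpa using this

variable {e q} {a b : OO k}

theorem pow_seven_of_aeval {R K A : Type*} [CommRing R] [Field K] [CommRing A] [Algebra R K]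
    [Algebra K A] [Algebra R A] [IsScalarTower R K A] {c : Fin 3 → R} {x : A}
    (h : Polynomial.aeval x (oddPoly c) = 0) :
    x ^ 7 = -(algebraMap R K (c 0)) • x ^ 5 - (algebraMap R K (c 1)) • x ^ 3 -
      (algebraMap R K (c 2)) • x := by
  rw [oddPoly, evenPoly] at h
  simp only [Fin.sum_univ_three, map_mul, map_add, map_pow, Polynomial.aeval_X,
    Polynomial.aeval_C] at h
  norm_num at h
  simp only [Algebra.smul_def, map_neg, ← IsScalarTower.algebraMap_apply]
  linear_combination h

theorem mul_sum_of_pow_seven {K A : Type*} [Field K] [CommRing A] [Algebra K A] {x : A} {r s t : K}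
    (h : x ^ 7 = r • x ^ 5 - s • x ^ 3 - t • x) (c : Fin 7 → K) :
    x * ∑ j : Fin 7, c j • x ^ (j : ℕ) = ∑ j : Fin 7, (![0, c 0 - t * c 6, c 1, c 2 - s * c 6, c 3,
      c 4 + r * c 6, c 5] : Fin 7 → K) j • x ^ (j : ℕ) := by
  simp only [Fin.sum_univ_seven, Algebra.smul_def] at h ⊢
  simp
  linear_combination (algebraMap K A (c 6)) * h

theorem g2X_pow_seven (h2 : (2 : k) ≠ 0) (ha : 2 * a = e) (hb : 2 * b = q) :
    g2X e q ^ 7 = (2 * algebraMap (OO k) (FF k) a) • g2X e q ^ 5 -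
      (algebraMap (OO k) (FF k) a ^ 2) • g2X e q ^ 3 -
      (2 * algebraMap (OO k) (FF k) b) • g2X e q := by
  have h4 : (4⁻¹ : k) • e ^ 2 = a ^ 2 := by
    have : (4 : k) ≠ 0 := by
      have := mul_ne_zero h2 h2
      norm_num at this
      exact this
    rw [inv_smul_eq_iff₀ this, ← ha, mul_pow, Algebra.smul_def, map_ofNat]
    norm_num
  have h1 : toGeneric (k := k) _ (Polynomial.aeval (AdjoinRoot.root (oddPoly (g2Coeffs e q)))
      (oddPoly (g2Coeffs e q))) = 0 := by
    rw [AdjoinRoot.aeval_eq, AdjoinRoot.mk_self, map_zero]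
  rw [← Polynomial.aeval_algHom_apply] at h1
  have h5 := pow_seven_of_aeval (K := FF k) (x := g2X e q) h1
  have c0 : -algebraMap (OO k) (FF k) (g2Coeffs e q 0) = 2 * algebraMap (OO k) (FF k) a := by
    rw [← map_ofNat (algebraMap (OO k) (FF k)) 2, ← map_mul, ha, ← map_neg]
    exact congrArg _ (neg_neg e)
  have c1 : algebraMap (OO k) (FF k) (g2Coeffs e q 1) = algebraMap (OO k) (FF k) a ^ 2 := by
    rw [← map_pow, ← h4]
    rfl
  have c2 : algebraMap (OO k) (FF k) (g2Coeffs e q 2) = 2 * algebraMap (OO k) (FF k) b := by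
    rw [← map_ofNat (algebraMap (OO k) (FF k)) 2, ← map_mul, hb]
    rfl
  rw [c0, c1, c2] at h5
  exact h5

/-- The coordinates in the basis of `V` in which the form is the standard one. -/
def g2Standard (a b : OO k) : G2Space e q →ₗ[FF k] Fin 7 → FF k :=
  LinearMap.pi ![g2Coord e q 0 - algebraMap (OO k) (FF k) b • g2Coord e q 6,
    g2Coord e q 1 + algebraMap (OO k) (FF k) a • g2Coord e q 3 +
      algebraMap (OO k) (FF k) a ^ 2 • g2Coord e q 5,
    g2Coord e q 2 + algebraMap (OO k) (FF k) a • g2Coord e q 4 +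
      algebraMap (OO k) (FF k) a ^ 2 • g2Coord e q 6,
    g2Coord e q 3 + algebraMap (OO k) (FF k) a • g2Coord e q 5,
    g2Coord e q 4 + (2 * algebraMap (OO k) (FF k) a) • g2Coord e q 6,
    g2Coord e q 5, g2Coord e q 6]

/-- Multiplication by `x` in the standard coordinates. -/
def g2Companion (α β : FF k) (y : Fin 7 → FF k) : Fin 7 → FF k :=
  ![-β * y 5, y 0 + α * y 2 - β * y 6, y 1, y 2, y 3 + α * y 5, y 4, y 5]

theorem g2Tri_companion (α β : FF k) (u v w : Fin 7 → FF k) :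
    g2Tri (g2Companion α β u) v w + g2Tri u (g2Companion α β v) w +
      g2Tri u v (g2Companion α β w) = 0 := by
  simp only [g2Tri, minor3, g2Companion, cons_val]
  ring

theorem g2Coord_X_mul (h2 : (2 : k) ≠ 0) (ha : 2 * a = e) (hb : 2 * b = q) (w : G2Space e q)
    (i : Fin 7) : g2Coord e q i (g2X e q * w) =
      (![0, g2Coord e q 0 w - 2 * algebraMap (OO k) (FF k) b * g2Coord e q 6 w, g2Coord e q 1 w,
        g2Coord e q 2 w - algebraMap (OO k) (FF k) a ^ 2 * g2Coord e q 6 w, g2Coord e q 3 w,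
        g2Coord e q 4 w + 2 * algebraMap (OO k) (FF k) a * g2Coord e q 6 w, g2Coord e q 5 w] :
        Fin 7 → FF k) i := by
  have h1 := mul_sum_of_pow_seven (K := FF k) (A := G2Space e q) (x := g2X e q)
    (r := 2 * algebraMap (OO k) (FF k) a) (s := algebraMap (OO k) (FF k) a ^ 2)
    (t := 2 * algebraMap (OO k) (FF k) b) (g2X_pow_seven h2 ha hb) (fun j => g2Coord e q j w)
  rw [← g2_eq_sum e q w] at h1
  rw [h1, map_sum, Finset.sum_eq_single i]
  · rw [map_smul, g2Coord_pow e q i i i.2, if_pos rfl, smul_eq_mul, mul_one]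
    rfl
  · intro l _ hl
    rw [map_smul, g2Coord_pow e q i l l.2, if_neg fun h => hl (Fin.ext h.symm), smul_zero]
  · simp

theorem g2Standard_apply (w : G2Space e q) : g2Standard a b w =
    ![g2Coord e q 0 w - algebraMap (OO k) (FF k) b * g2Coord e q 6 w,
      g2Coord e q 1 w + algebraMap (OO k) (FF k) a * g2Coord e q 3 w +
        algebraMap (OO k) (FF k) a ^ 2 * g2Coord e q 5 w,
      g2Coord e q 2 w + algebraMap (OO k) (FF k) a * g2Coord e q 4 w +
        algebraMap (OO k) (FF k) a ^ 2 * g2Coord e q 6 w,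
      g2Coord e q 3 w + algebraMap (OO k) (FF k) a * g2Coord e q 5 w,
      g2Coord e q 4 w + 2 * algebraMap (OO k) (FF k) a * g2Coord e q 6 w,
      g2Coord e q 5 w, g2Coord e q 6 w] := by
  funext i
  fin_cases i <;> rfl

theorem g2Standard_mul (h2 : (2 : k) ≠ 0) (ha : 2 * a = e) (hb : 2 * b = q) (w : G2Space e q) :
    g2Standard a b (g2X e q * w) = g2Companion (algebraMap (OO k) (FF k) a)
      (algebraMap (OO k) (FF k) b) (g2Standard a b w) := by
  have h := g2Coord_X_mul h2 ha hb w
  rw [g2Standard_apply, g2Standard_apply, show g2Coord e q 0 (g2X e q * w) = _ from h 0,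
    show g2Coord e q 1 (g2X e q * w) = _ from h 1, show g2Coord e q 2 (g2X e q * w) = _ from h 2,
    show g2Coord e q 3 (g2X e q * w) = _ from h 3, show g2Coord e q 4 (g2X e q * w) = _ from h 4,
    show g2Coord e q 5 (g2X e q * w) = _ from h 5, show g2Coord e q 6 (g2X e q * w) = _ from h 6]
  generalize algebraMap (OO k) (FF k) a = α
  generalize algebraMap (OO k) (FF k) b = β
  generalize g2Coord e q 0 w = c0
  generalize g2Coord e q 1 w = c1
  generalize g2Coord e q 2 w = c2
  generalize g2Coord e q 3 w = c3
  generalize g2Coord e q 4 w = c4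
  generalize g2Coord e q 5 w = c5
  generalize g2Coord e q 6 w = c6
  funext i
  fin_cases i <;>
  · simp only [g2Companion, cons_val, Fin.mk_one, Fin.zero_eta, Fin.reduceFinMk]
    try ring

end G2Companion

section G2Companion

open Matrix Module

section Top

variable {K A : Type*} [Field K] [CommRing A] [Algebra K A] {x : A} {α β : K}

/-- The values of the top coefficient on `xⁿ (x³ - α x)`. -/
def g2TopCoeff (α β : K) : Fin 13 → K :=
  ![0, 0, 0, 1, 0, α, 0, α ^ 2, 0, α ^ 3 - 2 * β, 0, α ^ 4 - 6 * α * β, 0]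

theorem topCoeff_of_pow_seven (h : x ^ 7 = (2 * α) • x ^ 5 - (α ^ 2) • x ^ 3 - (2 * β) • x)
    (φ : A →ₗ[K] K) (hφ : ∀ j < 7, φ (x ^ j) = if 6 = j then 1 else 0) (n : Fin 13) :
    φ (x ^ ((n : ℕ) + 3) - α • x ^ ((n : ℕ) + 1)) = g2TopCoeff α β n := by
  have hr : ∀ n, φ (x ^ (n + 7)) =
      2 * α * φ (x ^ (n + 5)) - α ^ 2 * φ (x ^ (n + 3)) - 2 * β * φ (x ^ (n + 1)) := by
    intro n
    rw [pow_add, h, mul_sub, mul_sub, mul_smul_comm, mul_smul_comm, mul_smul_comm, ← pow_add,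
      ← pow_add, ← pow_succ, map_sub, map_sub, map_smul, map_smul, map_smul]
    rfl
  have h1 := hφ 1 (by norm_num)
  have h2 := hφ 2 (by norm_num)
  have h3 := hφ 3 (by norm_num)
  have h4 := hφ 4 (by norm_num)
  have h5 := hφ 5 (by norm_num)
  have h6 := hφ 6 (by norm_num)
  have h7 := hr 0
  have h8 := hr 1
  have h9 := hr 2
  have h10 := hr 3
  have h11 := hr 4
  have h12 := hr 5
  have h13 := hr 6
  have h14 := hr 7
  have h15 := hr 8
  simp only [Nat.reduceEqDiff, if_false, if_true] at h1 h2 h3 h4 h5 h6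
  simp only [Nat.reduceAdd, h1, h3, h5] at h7
  simp only [Nat.reduceAdd, h2, h4, h6] at h8
  simp only [Nat.reduceAdd, h7, h5, h3] at h9
  simp only [Nat.reduceAdd, h8, h6, h4] at h10
  simp only [Nat.reduceAdd, h9, h7, h5] at h11
  simp only [Nat.reduceAdd, h10, h8, h6] at h12
  simp only [Nat.reduceAdd, h11, h9, h7] at h13
  simp only [Nat.reduceAdd, h12, h10, h8] at h14
  simp only [Nat.reduceAdd, h13, h11, h9] at h15
  rw [map_sub, map_smul, smul_eq_mul]
  fin_cases n <;> simp only [g2TopCoeff, Nat.reduceAdd, h1, h2, h3, h4, h5, h6, h7, h8, h9, h10,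
    h11, h12, h13, h14, h15, cons_val, Fin.mk_one, Fin.zero_eta, Fin.reduceFinMk] <;>
    simp <;> ring

theorem topCoeff_sum (h : x ^ 7 = (2 * α) • x ^ 5 - (α ^ 2) • x ^ 3 - (2 * β) • x)
    (φ : A →ₗ[K] K) (hφ : ∀ j < 7, φ (x ^ j) = if 6 = j then 1 else 0) (c d : Fin 7 → K) :
    φ ((∑ i : Fin 7, c i • x ^ (i : ℕ)) * (∑ j : Fin 7, d j • (-x) ^ (j : ℕ)) * (x ^ 3 - α • x)) =
      ∑ i : Fin 7, ∑ j : Fin 7, c i * d j * ((-1) ^ (j : ℕ) *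
        g2TopCoeff α β ⟨i + j, by omega⟩) := by
  rw [Finset.sum_mul_sum, Finset.sum_mul, map_sum]
  refine Finset.sum_congr rfl fun i _ => ?_
  rw [Finset.sum_mul, map_sum]
  refine Finset.sum_congr rfl fun j _ => ?_
  have h1 : c i • x ^ (i : ℕ) * d j • (-x) ^ (j : ℕ) * (x ^ 3 - α • x) =
      (c i * d j * (-1) ^ (j : ℕ)) • (x ^ ((i : ℕ) + j + 3) - α • x ^ ((i : ℕ) + j + 1)) := by
    simp only [Algebra.smul_def, map_mul, map_pow, map_neg, map_one]
    rw [neg_pow x]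
    ring
  rw [h1, map_smul, topCoeff_of_pow_seven h φ hφ ⟨i + j, by omega⟩, smul_eq_mul, mul_assoc]

theorem sum_g2TopCoeff (c d : Fin 7 → K) :
    ∑ i : Fin 7, ∑ j : Fin 7, c i * d j * ((-1) ^ (j : ℕ) * g2TopCoeff α β ⟨i + j, by omega⟩) =
    (-(c 0 * d 3 - c 3 * d 0) + (c 1 * d 2 - c 2 * d 1)) +
    α * (-(c 0 * d 5 - c 5 * d 0) + (c 1 * d 4 - c 4 * d 1) - (c 2 * d 3 - c 3 * d 2)) +
    α ^ 2 * ((c 1 * d 6 - c 6 * d 1) - (c 2 * d 5 - c 5 * d 2) + (c 3 * d 4 - c 4 * d 3)) +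
    (α ^ 3 - 2 * β) * ((c 3 * d 6 - c 6 * d 3) - (c 4 * d 5 - c 5 * d 4)) +
    (α ^ 4 - 6 * α * β) * ((c 5 * d 6 - c 6 * d 5)) := by
  simp [Fin.sum_univ_seven, g2TopCoeff]
  ring

end Top

variable {k : Type*} [Field k] {e q a b : OO k}

theorem extendInvolution_g2X : extendInvolution (soOddInvolution (g2Coeffs e q)) (g2X e q) =
    -g2X e q := by
  rw [g2X, extendInvolution_toGeneric, soOddInvolution, involution_root, map_neg]

theorem half_eq (h2 : (2 : k) ≠ 0) (ha : 2 * a = e) :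
    g2E e / 2 = algebraMap (OO k) (FF k) a := by
  rw [g2E, ← ha, map_mul, map_ofNat, mul_div_cancel_left₀ _ (two_ne_zero_FF h2)]

theorem g2TrZ_eq (h2 : (2 : k) ≠ 0) (ha : 2 * a = e) (hb : 2 * b = q) (u v : G2Space e q) :
    g2TrZ e q u v = ∑ i : Fin 7, ∑ j : Fin 7, g2Coord e q i u * g2Coord e q j v *
      ((-1) ^ (j : ℕ) * g2TopCoeff (algebraMap (OO k) (FF k) a) (algebraMap (OO k) (FF k) b)
        ⟨i + j, by omega⟩) := by
  have h1 := topCoeff_sum (K := FF k) (A := G2Space e q) (x := g2X e q)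
    (α := algebraMap (OO k) (FF k) a) (β := algebraMap (OO k) (FF k) b) (g2X_pow_seven h2 ha hb)
    (g2Coord e q 6) (fun j hj => g2Coord_pow e q 6 j hj) (fun i => g2Coord e q i u)
    (fun j => g2Coord e q j v)
  rw [← h1, g2TrZ, g2Z, half_eq h2 ha]
  have hv : extendInvolution (soOddInvolution (g2Coeffs e q)) v =
      ∑ j : Fin 7, g2Coord e q j v • (-g2X e q) ^ (j : ℕ) := by
    conv_lhs => rw [g2_eq_sum e q v]
    rw [map_sum]
    refine Finset.sum_congr rfl fun j _ => ?_
    rw [map_smul, map_pow, extendInvolution_g2X]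
  rw [hv, ← g2_eq_sum e q u]

/-- The form on `V` in monomial coordinates, with `k 0` replaced by `2 * β * k 0`. -/
theorem g2Form_coordinates {K : Type*} [Field K] (α β : K) (k : Fin 3 → Fin 7 → K)
    (d₂ e₁ e₃ d₃ : Fin 3 → K) (he₃ : ∀ j, e₃ j = k j 6 - k j 0)
    (he₁ : ∀ j, e₁ j = k j 4 + 2 * α * k j 0 + α * e₃ j)
    (hd₃ : ∀ j, d₃ j = k j 3 + α * k j 5) (hd₂ : ∀ j, d₂ j = k j 2 - α ^ 2 * k j 0 + α * e₁ j)
    (k' y : Fin 3 → Fin 7 → K)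
    (hk' : ∀ j, k' j = ![2 * β * k j 0, k j 1, k j 2, k j 3, k j 4, k j 5, k j 6])
    (hy : ∀ j, y j = ![2 * β * k j 0 - β * k j 6, k j 1 + α * k j 3 + α ^ 2 * k j 5,
      k j 2 + α * k j 4 + α ^ 2 * k j 6, k j 3 + α * k j 5, k j 4 + 2 * α * k j 6, k j 5, k j 6])
    (t : Fin 3 → Fin 3 → K) (ht : ∀ m n, t m n = ∑ i : Fin 7, ∑ j : Fin 7, k' m i * k' n j *
      ((-1) ^ (j : ℕ) * g2TopCoeff α β ⟨i + j, by omega⟩)) :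
    det (of fun i j : Fin 3 => ![fun j => k j 1, d₂, e₃] i j) +
      det (of fun i j : Fin 3 => ![fun j => k j 1, fun j => k j 5, d₃] i j) +
      det (of fun i j : Fin 3 => ![e₁, d₂, d₃] i j) -
      2 * β * det (of fun i j : Fin 3 => ![e₁, fun j => k j 5, e₃] i j) +
      (k 0 0 * t 1 2 - k 1 0 * t 0 2 + k 2 0 * t 0 1) = g2Tri (y 0) (y 1) (y 2) := by
  simp only [ht, sum_g2TopCoeff, det_fin_three, of_apply, cons_val, hy, hk', hd₂, hd₃, he₁, he₃,
    g2Tri, minor3]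
  ring

theorem g2Form_eq (h2 : (2 : k) ≠ 0) (ha : 2 * a = e) (hb : 2 * b = q) (hq : q ≠ 0)
    (v : Fin 3 → G2Space e q) : g2Form e q v =
      g2Tri (g2Standard a b (v 0)) (g2Standard a b (v 1)) (g2Standard a b (v 2)) := by
  have hQ : g2Q q = 2 * algebraMap (OO k) (FF k) b := by rw [g2Q, ← hb, map_mul, map_ofNat]
  have hE : g2E e = 2 * algebraMap (OO k) (FF k) a := by rw [g2E, ← ha, map_mul, map_ofNat]
  have hE2 := half_eq h2 ha
  have hE4 : g2E e ^ 2 / 4 = algebraMap (OO k) (FF k) a ^ 2 := by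
    rw [← hE2, div_pow]
    norm_num
  have hq0 : g2Q q ≠ 0 := by
    rw [g2Q, Ne, FaithfulSMul.algebraMap_eq_zero_iff]
    exact hq
  have hε : ∀ w, g2Coord e q 0 w = 2 * algebraMap (OO k) (FF k) b * g2Eps e q w := fun w => by
    rw [g2Eps, LinearMap.smul_apply, smul_eq_mul, ← hQ, mul_inv_cancel_left₀ hq0]
  have key := g2Form_coordinates (algebraMap (OO k) (FF k) a) (algebraMap (OO k) (FF k) b)
    (fun j => ![g2Eps e q (v j), g2Coord e q 1 (v j), g2Coord e q 2 (v j), g2Coord e q 3 (v j),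
      g2Coord e q 4 (v j), g2Coord e q 5 (v j), g2Coord e q 6 (v j)])
    (fun j => g2Delta2 e q (v j)) (fun j => g2Eta1 e q (v j)) (fun j => g2Eta3 e q (v j))
    (fun j => g2Delta3 e q (v j)) (fun _ => rfl)
    (fun j => by rw [← hE, ← hE2]; rfl) (fun j => by rw [← hE2]; rfl)
    (fun j => by rw [← hE4, ← hE2]; rfl)
    (fun j i => g2Coord e q i (v j)) (fun j => g2Standard a b (v j))
    (fun j => by
      funext i
      fin_cases i
      · exact hε (v j)
      all_goals rfl)
    (fun j => by
      rw [g2Standard_apply, hε]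
      rfl) (fun m n => g2TrZ e q (v m) (v n)) (fun m n => g2TrZ_eq h2 ha hb _ _)
  rw [← key, ← hQ, g2Form]
  have hw : ∀ φ ψ χ : G2Space e q →ₗ[FF k] FF k, wedge3 φ ψ χ v = det (of fun i j : Fin 3 =>
      (![fun j => φ (v j), fun j => ψ (v j), fun j => χ (v j)] : Fin 3 → Fin 3 → FF k) i j) := by
    intro φ ψ χ
    rw [wedge3]
    congr 1
    refine Matrix.ext fun i j => ?_
    fin_cases i <;> rfl
  rw [hw, hw, hw, hw]
  rfl

end G2Companion

section G2Companion

open Matrix Module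

variable {k : Type*} [Field k]

theorem coeffFun_eq_repr {R : Type*} [CommRing R] [Nontrivial R] {f : R[X]} (hf : f.Monic) {d : ℕ}
    (hd : f.natDegree = d) (i : Fin d) (w : AdjoinRoot f) :
    coeffFun hf i w = (monomialBasis hf hd).equivFun w i := by
  have h : coeffFun hf i = LinearMap.proj i ∘ₗ (monomialBasis hf hd).equivFun.toLinearMap := by
    refine (monomialBasis hf hd).ext fun j => ?_
    rw [LinearMap.comp_apply, LinearEquiv.coe_coe, LinearMap.proj_apply, Basis.equivFun_self,
      monomialBasis_apply, coeffFun_root_pow hf i j (by rw [hd]; exact j.2)]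
    simp only [Fin.ext_iff, eq_comm]
  exact congrArg (fun φ => φ w) h

/-- The change of coordinates from the monomial basis. -/
def g2Change {R : Type*} [CommRing R] (a b : R) : (Fin 7 → R) ≃ₗ[R] Fin 7 → R where
  toFun c := ![c 0 - b * c 6, c 1 + a * c 3 + a ^ 2 * c 5, c 2 + a * c 4 + a ^ 2 * c 6,
    c 3 + a * c 5, c 4 + 2 * a * c 6, c 5, c 6]
  invFun y := ![y 0 + b * y 6, y 1 - a * y 3, y 2 - a * y 4 + a ^ 2 * y 6, y 3 - a * y 5,
    y 4 - 2 * a * y 6, y 5, y 6]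
  map_add' c d := by
    funext i
    fin_cases i <;> simp <;> ring
  map_smul' t c := by
    funext i
    fin_cases i <;> simp <;> ring
  left_inv c := by
    funext i
    fin_cases i <;> simp <;> ring
  right_inv c := by
    funext i
    fin_cases i <;> simp <;> ring

theorem g2_exists_basis {e q a b : OO k} : ∃ c : Basis (Fin 7) (OO k) (G2Alg e q),
    ∀ i, g2Standard a b (c.baseChange (FF k) i) = (Pi.single i 1 : Fin 7 → FF k) := by
  set E := (monomialBasis (oddPoly_monic (g2Coeffs e q)) (g2Poly_natDegree e q)).equivFun
  refine ⟨Basis.ofEquivFun (E.trans (g2Change a b)), fun i => ?_⟩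
  set c : Basis (Fin 7) (OO k) (G2Alg e q) := Basis.ofEquivFun (E.trans (g2Change a b)) with hc
  have h1 : c.baseChange (FF k) i = toGeneric _ (c i) := Basis.baseChange_apply ..
  have h2 : g2Change a b (E (c i)) = Pi.single i 1 := by
    have h3 : c.equivFun = E.trans (g2Change a b) := by rw [hc, Basis.equivFun_ofEquivFun]
    have h4 := c.equivFun_self i
    rw [h3] at h4
    refine (funext h4 : _ = _).trans ?_
    funext j
    simp [Pi.single_apply, eq_comm]
  have h5 : ∀ j : Fin 7, g2Coord e q j (toGeneric _ (c i)) = algebraMap (OO k) (FF k) (E (c i) j) :=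
    fun j => by
      rw [g2Coord, extendScalars_toGeneric, coeffFun_eq_repr _ (g2Poly_natDegree e q)]
  have h6 : g2Standard a b (c.baseChange (FF k) i) = vecToFF (g2Change a b (E (c i))) := by
    rw [h1, g2Standard_apply, show g2Coord e q 0 (toGeneric _ (c i)) = _ from h5 0,
      show g2Coord e q 1 (toGeneric _ (c i)) = _ from h5 1,
      show g2Coord e q 2 (toGeneric _ (c i)) = _ from h5 2,
      show g2Coord e q 3 (toGeneric _ (c i)) = _ from h5 3,
      show g2Coord e q 4 (toGeneric _ (c i)) = _ from h5 4,
      show g2Coord e q 5 (toGeneric _ (c i)) = _ from h5 5,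
      show g2Coord e q 6 (toGeneric _ (c i)) = _ from h5 6]
    generalize E (c i) = y
    funext j
    have h7 : (2 : FF k) = algebraMap (OO k) (FF k) 2 := (map_ofNat _ 2).symm
    rw [h7]
    fin_cases j <;> simp [vecToFF, g2Change]
  rw [h6, h2]
  funext j
  simp [vecToFF, Pi.single_apply, apply_ite]

theorem g2_latticeDescription (h2 : (2 : k) ≠ 0) {e q : OO k} (hq : q ≠ 0)
    (hconj : IsAlgClosed k → ∀ γ ∈ tensorLie g2Tensor (FF k),
      ∀ γ' ∈ tensorLie g2Tensor (FF k), g2Chi e q γ → g2Chi e q γ' →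
        ∃ A : Matrix _ _ (FF k), A.det ≠ 0 ∧ Preserves g2Tensor A ∧ γ' * A = A * γ) :
    LatticeDescription g2Tensor (g2Chi e q) (toGeneric (G2Alg e q)) (AdjoinRoot.root _)
      (baseLattice (G2Alg e q)) (g2Form e q) := by
  obtain ⟨t, ht⟩ := isUnit_two_OO h2
  have hhalf : ∀ x : OO k, 2 * (↑t⁻¹ * x) = x := fun x => by
    rw [← mul_assoc, ← ht, Units.mul_inv, one_mul]
  obtain ⟨a, ha⟩ : ∃ a, 2 * a = e := ⟨_, hhalf e⟩
  obtain ⟨b, hb⟩ : ∃ b, 2 * b = q := ⟨_, hhalf q⟩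
  obtain ⟨c, hc⟩ := g2_exists_basis (e := e) (q := q) (a := a) (b := b)
  have hΩ : g2Form e q = (tensorMultilinear g2Tensor (FF k)).compLinearMap
      (fun _ => g2Standard (e := e) (q := q) a b) := by
    funext v
    rw [g2Form_eq h2 ha hb hq, MultilinearMap.compLinearMap_apply, tensorMultilinear_apply,
      tensorForm_g2]
  rw [hΩ]
  refine latticeDescription_of ((tensorMultilinear g2Tensor (FF k)).compLinearMap
      (fun _ => g2Standard (e := e) (q := q) a b)) (adjoin_root_eq_top _)
    (fun A hA h => g2_exists_unit_det h2 hA h) (g2_exists_preserving h2)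
    ⟨c.baseChange (FF k), fun s => ?_, span_baseChange c, ?_⟩ ?_ ?_
    (fun v hv => baseLattice_mul_mem _ hv) hconj
  · rw [MultilinearMap.compLinearMap_apply, tensorMultilinear_apply]
    simp only [hc]
    exact tensorForm_single _ _ _
  · rw [g2Chi, toMatrix_mulLeft_baseChange, charpoly_toFF,
      charpoly_leftMulMatrix_root (oddPoly_monic _) c (by
        rw [g2Poly_natDegree, Fintype.card_fin])]
  · intro v
    have hx : ∀ w, g2Standard a b (toGeneric (G2Alg e q) (AdjoinRoot.root _) * w) =
        g2Companion (algebraMap (OO k) (FF k) a) (algebraMap (OO k) (FF k) b)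
          (g2Standard a b w) := g2Standard_mul h2 ha hb
    simp only [MultilinearMap.compLinearMap_apply, tensorMultilinear_apply, tensorForm_g2,
      Fin.sum_univ_three]
    simp [Function.update, hx, g2Tri_companion]
  · intro γ hγ
    refine trace_eq_zero_of_charpoly fun hn => ?_
    rw [hγ, Polynomial.coeff_map, oddPoly, Polynomial.coeff_X_mul (n := 5),
      evenPoly_coeff_odd _ (by norm_num), map_zero]

end G2Companion

/-! ### The Lie algebra of `G₂` -/

section G2Lie

open Matrix

section Ring

variable {R : Type*} [CommRing R]

/-- The general derivation of the cross product, in coordinates. -/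
def g2LieFun (p : Fin 14 → R) (y : Fin 7 → R) : Fin 7 → R := ![
    p 0 * y 0 + p 1 * y 1 + p 2 * y 2 + p 3 * y 3 + p 4 * y 4 + p 5 * y 5,
    p 6 * y 0 + p 7 * y 1 + p 8 * y 2 - 2 * p 2 * y 3 - p 3 * y 4 + p 5 * y 6,
    p 9 * y 0 + p 10 * y 1 + p 0 * y 2 - p 7 * y 2 + 2 * p 1 * y 3 - p 3 * y 5 - p 4 * y 6,
    2 * p 11 * y 0 - p 9 * y 1 + p 6 * y 2 + 2 * p 1 * y 4 + 2 * p 2 * y 5 + p 3 * y 6,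
    p 12 * y 0 - p 11 * y 1 + p 6 * y 3 - p 0 * y 4 + p 7 * y 4 + p 8 * y 5 - p 2 * y 6,
    p 13 * y 0 - p 11 * y 2 + p 9 * y 3 + p 10 * y 4 - p 7 * y 5 + p 1 * y 6,
    p 13 * y 1 - p 12 * y 2 + 2 * p 11 * y 3 - p 9 * y 4 + p 6 * y 5 - p 0 * y 6]

theorem g2Bil_g2LieFun (p : Fin 14 → R) (y z : Fin 7 → R) :
    g2Bil (g2LieFun p y) z = -g2Bil y (g2LieFun p z) := by
  simp only [g2Bil, g2LieFun, cons_val]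
  ring

theorem g2LieFun_cross (p : Fin 14 → R) (y z : Fin 7 → R) :
    g2LieFun p (g2Cross y z) = g2Cross (g2LieFun p y) z + g2Cross y (g2LieFun p z) := by
  funext i
  fin_cases i <;>
  · simp only [g2Cross, g2LieFun, cons_val, Pi.add_apply, Fin.mk_one, Fin.zero_eta, Fin.reduceFinMk]
    ring

theorem g2LieFun_cube (p : Fin 14 → R) : ∃ (c : R) (v : Fin 7 → R), ∀ y,
    g2LieFun p (g2LieFun p (g2LieFun p y)) = c • g2LieFun p y + g2Cross v y := by
  refine ⟨p 0 * p 0 - p 0 * p 7 + 3 * p 1 * p 6 + 3 * p 2 * p 9 + 3 * p 3 * p 11 + p 4 * p 12 + p 5 *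
    p 13 + p 7 * p 7 + p 8 * p 10,
    ![-2 * p 0 * p 1 * p 2 - p 0 * p 3 * p 7 - p 0 * p 5 * p 9 - 2 * p 1 * p 1 * p 8 + 4 * p 1 *
      p 2 * p 7 - p 1 * p 3 * p 6 - 2 * p 1 * p 5 * p 11 + 2 * p 2 * p 2 * p 10 - p 2 * p 3 * p
      9 + 2 * p 2 * p 4 * p 11 - p 3 * p 3 * p 11 + p 3 * p 7 * p 7 + p 3 * p 8 * p 10 - p 4 * p
      6 * p 7 - p 4 * p 8 * p 9 - p 5 * p 6 * p 10 + p 5 * p 7 * p 9,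
      2 * p 0 * p 0 * p 2 + 2 * p 0 * p 1 * p 8 - 2 * p 0 * p 2 * p 7 + 2 * p 0 * p 3 * p 6 - 2
      * p 0 * p 5 * p 11 - 2 * p 1 * p 2 * p 6 - 2 * p 1 * p 5 * p 12 - 2 * p 2 * p 2 * p 9 - 2
      * p 2 * p 3 * p 11 + 2 * p 2 * p 4 * p 12 - p 3 * p 3 * p 12 - p 3 * p 6 * p 7 - p 3 * p 8
      * p 9 + p 4 * p 6 * p 6 - 2 * p 4 * p 8 * p 11 + p 5 * p 6 * p 9 + 2 * p 5 * p 7 * p 11,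
      -2 * p 0 * p 1 * p 7 - 2 * p 0 * p 2 * p 10 + p 0 * p 3 * p 9 + 2 * p 1 * p 1 * p 6 + 2 *
      p 1 * p 2 * p 9 + 2 * p 1 * p 3 * p 11 - 2 * p 1 * p 5 * p 13 + 2 * p 2 * p 4 * p 13 - p 3
      * p 3 * p 13 - p 3 * p 6 * p 10 + p 3 * p 7 * p 9 + p 4 * p 6 * p 9 + 2 * p 4 * p 7 * p 11
      + p 5 * p 9 * p 9 + 2 * p 5 * p 10 * p 11,
      p 0 * p 0 * p 7 - p 0 * p 1 * p 6 + p 0 * p 3 * p 11 + p 0 * p 5 * p 13 - p 0 * p 7 * p 7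
      - p 0 * p 8 * p 10 + p 1 * p 3 * p 12 + p 1 * p 6 * p 7 + p 1 * p 8 * p 9 + p 2 * p 3 * p
      13 + p 2 * p 6 * p 10 - p 2 * p 7 * p 9 + p 4 * p 6 * p 11 + p 4 * p 7 * p 12 + p 4 * p 8
      * p 13 - p 5 * p 7 * p 13 + p 5 * p 9 * p 11 + p 5 * p 10 * p 12,
      -2 * p 0 * p 2 * p 11 + p 0 * p 6 * p 7 + p 0 * p 8 * p 9 - 2 * p 1 * p 2 * p 12 - p 1 * p
      6 * p 6 + 2 * p 1 * p 8 * p 11 - 2 * p 2 * p 2 * p 13 - p 2 * p 6 * p 9 - 2 * p 2 * p 7 *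
      p 11 - p 3 * p 6 * p 11 - p 3 * p 7 * p 12 - p 3 * p 8 * p 13 + p 5 * p 6 * p 13 - p 5 * p
      9 * p 12 + 2 * p 5 * p 11 * p 11,
      p 0 * p 0 * p 9 + 4 * p 0 * p 1 * p 11 - p 0 * p 3 * p 13 + p 0 * p 6 * p 10 - p 0 * p 7 *
      p 9 + 2 * p 1 * p 1 * p 12 + 2 * p 1 * p 2 * p 13 - p 1 * p 6 * p 9 - 2 * p 1 * p 7 * p 11
      - p 2 * p 9 * p 9 - 2 * p 2 * p 10 * p 11 + p 3 * p 7 * p 13 - p 3 * p 9 * p 11 - p 3 * p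
      10 * p 12 - p 4 * p 6 * p 13 + p 4 * p 9 * p 12 - 2 * p 4 * p 11 * p 11,
      2 * p 0 * p 2 * p 13 + p 0 * p 6 * p 9 + 2 * p 0 * p 7 * p 11 + 2 * p 1 * p 6 * p 11 + 2 *
      p 1 * p 7 * p 12 + 2 * p 1 * p 8 * p 13 - 2 * p 2 * p 7 * p 13 + 2 * p 2 * p 9 * p 11 + 2
      * p 2 * p 10 * p 12 + p 3 * p 6 * p 13 - p 3 * p 9 * p 12 + 2 * p 3 * p 11 * p 11 + p 6 *
      p 6 * p 10 - 2 * p 6 * p 7 * p 9 - 2 * p 7 * p 7 * p 11 - p 8 * p 9 * p 9 - 2 * p 8 * p 10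
      * p 11], fun y => ?_⟩
  funext i
  fin_cases i <;>
  · simp only [g2Cross, g2LieFun, cons_val, Pi.add_apply, Pi.smul_apply, smul_eq_mul, Fin.mk_one,
      Fin.zero_eta, Fin.reduceFinMk]
    ring

end Ring

variable {K : Type*} [Field K]

set_option maxHeartbeats 1600000 in
theorem exists_g2LieFun (h2 : (2 : K) ≠ 0) (h3 : (3 : K) ≠ 0) {D : Matrix (Fin 7) (Fin 7) K}
    (hD : D ∈ tensorLie g2Tensor K) : ∃ p : Fin 14 → K, ∀ y, D *ᵥ y = g2LieFun p y := by
  have h6 : (6 : K) ≠ 0 := by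
    rw [show (6 : K) = 2 * 3 by norm_num]
    exact mul_ne_zero h2 h3
  have E : ∀ i j l : Fin 7, g2Tri (D.col i) (Pi.single j 1) (Pi.single l 1) +
      g2Tri (Pi.single i 1) (D.col j) (Pi.single l 1) +
      g2Tri (Pi.single i 1) (Pi.single j 1) (D.col l) = 0 := by
    intro i j l
    have := hD.2 ![Pi.single i 1, Pi.single j 1, Pi.single l 1]
    simp only [Fin.sum_univ_three, tensorForm_g2] at this
    simpa [Function.update, mulVec_single_one] using this
  have d06 : 6 * D 0 6 = 0 := by
    linear_combination (norm := skip) 3 * E 4 5 6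
    simp only [g2Tri, minor3, col_apply, Pi.single_apply, Fin.reduceEq, if_true, if_false]
    ring
  have d13 : 6 * D 1 3 = -12 * D 0 2 := by
    linear_combination (norm := skip) 3 * E 2 4 5 - 6 * E 2 3 6 - 3 * E 0 5 6
    simp only [g2Tri, minor3, col_apply, Pi.single_apply, Fin.reduceEq, if_true, if_false]
    ring
  have d14 : 6 * D 1 4 = -6 * D 0 3 := by
    linear_combination (norm := skip) 3 * E 3 4 5 - 3 * E 2 4 6 - 3 * E 1 5 6
    simp only [g2Tri, minor3, col_apply, Pi.single_apply, Fin.reduceEq, if_true, if_false]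
    ring
  have d15 : 6 * D 1 5 = 0 := by
    linear_combination (norm := skip) -6 * E 2 5 6
    simp only [g2Tri, minor3, col_apply, Pi.single_apply, Fin.reduceEq, if_true, if_false]
    ring
  have d16 : 6 * D 1 6 = 6 * D 0 5 := by
    linear_combination (norm := skip) -6 * E 3 5 6
    simp only [g2Tri, minor3, col_apply, Pi.single_apply, Fin.reduceEq, if_true, if_false]
    ring
  have d22 : 6 * D 2 2 = -6 * D 1 1 + 6 * D 0 0 := by
    linear_combination (norm := skip) 2 * E 2 3 4 - 2 * E 1 3 5 - E 0 4 5 + 4 * E 1 2 6 + 4 * E 0 3 6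
    simp only [g2Tri, minor3, col_apply, Pi.single_apply, Fin.reduceEq, if_true, if_false]
    ring
  have d23 : 6 * D 2 3 = 12 * D 0 1 := by
    linear_combination (norm := skip) -3 * E 1 4 5 + 6 * E 1 3 6 + 3 * E 0 4 6
    simp only [g2Tri, minor3, col_apply, Pi.single_apply, Fin.reduceEq, if_true, if_false]
    ring
  have d24 : 6 * D 2 4 = 0 := by
    linear_combination (norm := skip) 6 * E 1 4 6
    simp only [g2Tri, minor3, col_apply, Pi.single_apply, Fin.reduceEq, if_true, if_false]
    ring
  have d25 : 6 * D 2 5 = -6 * D 0 3 := by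
    linear_combination (norm := skip) 3 * E 2 4 6 + 3 * E 1 5 6 + 3 * E 3 4 5
    simp only [g2Tri, minor3, col_apply, Pi.single_apply, Fin.reduceEq, if_true, if_false]
    ring
  have d26 : 6 * D 2 6 = -6 * D 0 4 := by
    linear_combination (norm := skip) 6 * E 3 4 6
    simp only [g2Tri, minor3, col_apply, Pi.single_apply, Fin.reduceEq, if_true, if_false]
    ring
  have d31 : 6 * D 3 1 = -6 * D 2 0 := by
    linear_combination (norm := skip) -6 * E 0 1 6
    simp only [g2Tri, minor3, col_apply, Pi.single_apply, Fin.reduceEq, if_true, if_false]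
    ring
  have d32 : 6 * D 3 2 = 6 * D 1 0 := by
    linear_combination (norm := skip) -6 * E 0 2 6
    simp only [g2Tri, minor3, col_apply, Pi.single_apply, Fin.reduceEq, if_true, if_false]
    ring
  have d33 : 6 * D 3 3 = 0 := by
    linear_combination (norm := skip) -2 * E 1 2 6 - 2 * E 0 3 6 + 2 * E 2 3 4 - 2 * E 1 3 5 - E 0 4 5
    simp only [g2Tri, minor3, col_apply, Pi.single_apply, Fin.reduceEq, if_true, if_false]
    ring
  have d34 : 6 * D 3 4 = 12 * D 0 1 := by
    linear_combination (norm := skip) -6 * E 1 4 5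
    simp only [g2Tri, minor3, col_apply, Pi.single_apply, Fin.reduceEq, if_true, if_false]
    ring
  have d35 : 6 * D 3 5 = 12 * D 0 2 := by
    linear_combination (norm := skip) -6 * E 2 4 5
    simp only [g2Tri, minor3, col_apply, Pi.single_apply, Fin.reduceEq, if_true, if_false]
    ring
  have d36 : 6 * D 3 6 = 6 * D 0 3 := by
    linear_combination (norm := skip) -3 * E 2 4 6 - 3 * E 3 4 5 + 3 * E 1 5 6
    simp only [g2Tri, minor3, col_apply, Pi.single_apply, Fin.reduceEq, if_true, if_false]
    ring
  have d41 : 6 * D 4 1 = -3 * D 3 0 := by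
    linear_combination (norm := skip) 3 * E 0 1 5
    simp only [g2Tri, minor3, col_apply, Pi.single_apply, Fin.reduceEq, if_true, if_false]
    ring
  have d42 : 6 * D 4 2 = 0 := by
    linear_combination (norm := skip) 3 * E 0 2 5
    simp only [g2Tri, minor3, col_apply, Pi.single_apply, Fin.reduceEq, if_true, if_false]
    ring
  have d43 : 6 * D 4 3 = 6 * D 1 0 := by
    linear_combination (norm := skip) 3 * E 1 2 5 + 3 * E 0 3 5 - 3 * E 0 2 6
    simp only [g2Tri, minor3, col_apply, Pi.single_apply, Fin.reduceEq, if_true, if_false]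
    ring
  have d44 : 6 * D 4 4 = 6 * D 1 1 - 6 * D 0 0 := by
    linear_combination (norm := skip) 4 * E 1 3 5 + 2 * E 0 4 5 - 2 * E 1 2 6 - 2 * E 0 3 6 + 2 * E 2 3 4
    simp only [g2Tri, minor3, col_apply, Pi.single_apply, Fin.reduceEq, if_true, if_false]
    ring
  have d45 : 6 * D 4 5 = 6 * D 1 2 := by
    linear_combination (norm := skip) 6 * E 2 3 5
    simp only [g2Tri, minor3, col_apply, Pi.single_apply, Fin.reduceEq, if_true, if_false]
    ring
  have d46 : 6 * D 4 6 = -6 * D 0 2 := by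
    linear_combination (norm := skip) 3 * E 2 4 5 - 3 * E 0 5 6
    simp only [g2Tri, minor3, col_apply, Pi.single_apply, Fin.reduceEq, if_true, if_false]
    ring
  have d51 : 6 * D 5 1 = 0 := by
    linear_combination (norm := skip) -3 * E 0 1 4
    simp only [g2Tri, minor3, col_apply, Pi.single_apply, Fin.reduceEq, if_true, if_false]
    ring
  have d52 : 6 * D 5 2 = -3 * D 3 0 := by
    linear_combination (norm := skip) -3 * E 0 2 4
    simp only [g2Tri, minor3, col_apply, Pi.single_apply, Fin.reduceEq, if_true, if_false]
    ring
  have d53 : 6 * D 5 3 = 6 * D 2 0 := by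
    linear_combination (norm := skip) -3 * E 1 2 4 - 3 * E 0 3 4 + 3 * E 0 1 6
    simp only [g2Tri, minor3, col_apply, Pi.single_apply, Fin.reduceEq, if_true, if_false]
    ring
  have d54 : 6 * D 5 4 = 6 * D 2 1 := by
    linear_combination (norm := skip) -6 * E 1 3 4
    simp only [g2Tri, minor3, col_apply, Pi.single_apply, Fin.reduceEq, if_true, if_false]
    ring
  have d55 : 6 * D 5 5 = -6 * D 1 1 := by
    linear_combination (norm := skip) -4 * E 1 3 5 + 2 * E 1 2 6 + 2 * E 0 3 6 - 2 * E 2 3 4 + E 0 4 5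
    simp only [g2Tri, minor3, col_apply, Pi.single_apply, Fin.reduceEq, if_true, if_false]
    ring
  have d56 : 6 * D 5 6 = 6 * D 0 1 := by
    linear_combination (norm := skip) -3 * E 1 4 5 + 3 * E 0 4 6
    simp only [g2Tri, minor3, col_apply, Pi.single_apply, Fin.reduceEq, if_true, if_false]
    ring
  have d60 : 6 * D 6 0 = 0 := by
    linear_combination (norm := skip) 6 * E 0 1 2
    simp only [g2Tri, minor3, col_apply, Pi.single_apply, Fin.reduceEq, if_true, if_false]
    ring
  have d61 : 6 * D 6 1 = 6 * D 5 0 := by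
    linear_combination (norm := skip) 6 * E 0 1 3
    simp only [g2Tri, minor3, col_apply, Pi.single_apply, Fin.reduceEq, if_true, if_false]
    ring
  have d62 : 6 * D 6 2 = -6 * D 4 0 := by
    linear_combination (norm := skip) 6 * E 0 2 3
    simp only [g2Tri, minor3, col_apply, Pi.single_apply, Fin.reduceEq, if_true, if_false]
    ring
  have d63 : 6 * D 6 3 = 6 * D 3 0 := by
    linear_combination (norm := skip) 6 * E 1 2 3 + 3 * E 0 2 4 - 3 * E 0 1 5
    simp only [g2Tri, minor3, col_apply, Pi.single_apply, Fin.reduceEq, if_true, if_false]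
    ring
  have d64 : 6 * D 6 4 = -6 * D 2 0 := by
    linear_combination (norm := skip) 6 * E 1 2 4 - 6 * E 0 1 6
    simp only [g2Tri, minor3, col_apply, Pi.single_apply, Fin.reduceEq, if_true, if_false]
    ring
  have d65 : 6 * D 6 5 = 6 * D 1 0 := by
    linear_combination (norm := skip) 6 * E 1 2 5 - 6 * E 0 2 6
    simp only [g2Tri, minor3, col_apply, Pi.single_apply, Fin.reduceEq, if_true, if_false]
    ring
  have d66 : 6 * D 6 6 = -6 * D 0 0 := by
    linear_combination (norm := skip) 2 * E 1 2 6 - 2 * E 2 3 4 + 2 * E 1 3 5 + E 0 4 5 - 4 * E 0 3 6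
    simp only [g2Tri, minor3, col_apply, Pi.single_apply, Fin.reduceEq, if_true, if_false]
    ring
  refine ⟨![D 0 0, D 0 1, D 0 2, D 0 3, D 0 4, D 0 5, D 1 0, D 1 1, D 1 2, D 2 0, D 2 1, -D 4 1,
    D 4 0, D 5 0], fun y => funext fun i => mul_left_cancel₀ h6 ?_⟩
  fin_cases i
  · simp only [mulVec, dotProduct, Fin.sum_univ_seven, g2LieFun, cons_val, Fin.mk_one,
      Fin.zero_eta, Fin.reduceFinMk]
    linear_combination y 6 * d06
  · simp only [mulVec, dotProduct, Fin.sum_univ_seven, g2LieFun, cons_val, Fin.mk_one,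
      Fin.zero_eta, Fin.reduceFinMk]
    linear_combination y 3 * d13 + y 4 * d14 + y 5 * d15 + y 6 * d16
  · simp only [mulVec, dotProduct, Fin.sum_univ_seven, g2LieFun, cons_val, Fin.mk_one,
      Fin.zero_eta, Fin.reduceFinMk]
    linear_combination y 2 * d22 + y 3 * d23 + y 4 * d24 + y 5 * d25 + y 6 * d26
  · simp only [mulVec, dotProduct, Fin.sum_univ_seven, g2LieFun, cons_val, Fin.mk_one,
      Fin.zero_eta, Fin.reduceFinMk]
    linear_combination y 1 * d31 + y 2 * d32 + y 3 * d33 + y 4 * d34 + y 5 * d35 + y 6 * d36 + 2 * y 0 * d41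
  · simp only [mulVec, dotProduct, Fin.sum_univ_seven, g2LieFun, cons_val, Fin.mk_one,
      Fin.zero_eta, Fin.reduceFinMk]
    linear_combination y 2 * d42 + y 3 * d43 + y 4 * d44 + y 5 * d45 + y 6 * d46
  · simp only [mulVec, dotProduct, Fin.sum_univ_seven, g2LieFun, cons_val, Fin.mk_one,
      Fin.zero_eta, Fin.reduceFinMk]
    linear_combination y 1 * d51 + y 2 * d52 + y 3 * d53 + y 4 * d54 + y 5 * d55 + y 6 * d56 - y 2 * d41
  · simp only [mulVec, dotProduct, Fin.sum_univ_seven, g2LieFun, cons_val, Fin.mk_one,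
      Fin.zero_eta, Fin.reduceFinMk]
    linear_combination y 0 * d60 + y 1 * d61 + y 2 * d62 + y 3 * d63 + y 4 * d64 + y 5 * d65 + y 6 * d66 + 2 * y 3 * d41

end G2Lie

/-! ### Derivations of the cross product and their axes -/

section G2Axis

open Matrix Polynomial Module

variable {K : Type*} [Field K]

/-- A derivation `D` of the cross product with `D³ = a D + v × ·` and `(D³ - a D)² = -q` on the
orthogonal complement of `v`. -/
structure IsG2Axis (D : End K (Fin 7 → K)) (v : Fin 7 → K) (a q : K) : Prop where
  skew : ∀ x y, g2Bil (D x) y = -g2Bil x (D y)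
  cross : ∀ x y, D (g2Cross x y) = g2Cross (D x) y + g2Cross x (D y)
  cube : ∀ x, D (D (D x)) = a • D x + g2Cross v x
  map_axis : D v = 0
  norm : g2Bil v v = q

theorem eq_zero_of_g2Cross (h2 : (2 : K) ≠ 0) {u : Fin 7 → K} (h : ∀ y, g2Cross u y = 0) : u = 0 := by
  have h0 := h (Pi.single 0 1)
  have h1 := congrFun (h (Pi.single 1 1)) 0
  have h3 := congrFun (h (Pi.single 2 1)) 0
  have h4 := congrFun (h (Pi.single 3 1)) 0
  have h00 := congrFun h0 0
  have h01 := congrFun h0 1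
  have h02 := congrFun h0 2
  have h03 := congrFun h0 3
  funext i
  fin_cases i <;> simp_all [g2Cross]

/-- The polynomial `x⁶ - 2 a x⁴ + a² x² + q`. -/
def g2Sextic (a q : K) : K[X] := (X ^ 3 - C a * X) ^ 2 + C q

/-- The polynomial whose value at `x²` is `g2Sextic`. -/
def g2Cubic (a q : K) : K[X] := X * (X - C a) ^ 2 + C q

theorem expand_g2Cubic (a q : K) : expand K 2 (g2Cubic a q) = g2Sextic a q := by
  simp only [g2Cubic, g2Sextic, map_add, map_mul, map_pow, map_sub, expand_X, expand_C]
  ring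

theorem g2Cubic_monic (a q : K) : (g2Cubic a q).Monic := by
  have : g2Cubic a q = X ^ 3 + (C (-2 * a) * X ^ 2 + C (a ^ 2) * X + C q) := by
    simp only [g2Cubic, map_mul, map_pow, map_neg, map_ofNat]
    ring
  rw [this]
  exact monic_X_pow_add (degree_quadratic_lt)

theorem g2Sextic_dvd {a q c μ : K} (h3 : (3 : K) ≠ 0)
    (h : g2Sextic a q ∣ (X ^ 3 - C c * X) ^ 3 + C μ * (X ^ 3 - C c * X)) : c = a ∧ μ = q := by
  obtain ⟨d, hd⟩ : ∃ d, d = a - c := ⟨_, rfl⟩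
  have hr : (X ^ 3 - C c * X) ^ 3 + C μ * (X ^ 3 - C c * X) =
      g2Sextic a q * (X ^ 3 - C a * X + 3 * C d * X) + (C (3 * d ^ 2) * X ^ 5 +
        C (d ^ 3 + μ - q - 3 * a * d ^ 2) * X ^ 3 + C (q * a - 3 * q * d - μ * c) * X) := by
    subst hd
    simp only [g2Sextic, map_mul, map_pow, map_sub, map_add, map_ofNat]
    ring
  rw [hr, dvd_add_right (dvd_mul_right _ _)] at h
  have hm : (g2Sextic a q).natDegree = 6 := by
    rw [← expand_g2Cubic, natDegree_expand]
    have : g2Cubic a q = C 1 * X ^ 3 + C (-2 * a) * X ^ 2 + C (a ^ 2) * X + C q := by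
      simp only [g2Cubic, map_mul, map_pow, map_neg, map_ofNat, map_one]
      ring
    rw [this, natDegree_cubic one_ne_zero]
  have h0 := eq_zero_of_dvd_of_natDegree_lt h (by
    rw [hm]
    refine lt_of_le_of_lt (b := 5) ?_ (by norm_num)
    compute_degree)
  have h5 : 3 * d ^ 2 = 0 := by
    simpa [-map_mul, -map_add, -map_sub, -map_pow, coeff_X, coeff_X_pow, h3] using
      congrArg (fun P => coeff P 5) h0
  have h3' : d ^ 3 + μ - q - 3 * a * d ^ 2 = 0 := by
    simpa [-map_mul, -map_add, -map_sub, -map_pow, coeff_X, coeff_X_pow] using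
      congrArg (fun P => coeff P 3) h0
  have hd0 : d = 0 := by simpa [h3] using h5
  rw [hd0] at h3' hd
  exact ⟨by linear_combination hd, by linear_combination h3'⟩

theorem exists_isG2Axis (h2 : (2 : K) ≠ 0) (h3 : (3 : K) ≠ 0) {γ : Matrix (Fin 7) (Fin 7) K}
    (hγ : γ ∈ tensorLie g2Tensor K) {a q : K} (hs : (g2Sextic a q).Separable)
    (hc : γ.charpoly = X * g2Sextic a q) : ∃ v, IsG2Axis (Matrix.toLin' γ) v a q := by
  obtain ⟨p, hp⟩ := exists_g2LieFun h2 h3 hγ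
  obtain ⟨c, v, hv⟩ := g2LieFun_cube p
  simp only [← hp] at hv
  have hskew : ∀ x y, g2Bil (γ *ᵥ x) y = -g2Bil x (γ *ᵥ y) := fun x y => by
    rw [hp, hp, g2Bil_g2LieFun]
  have hcross : ∀ x y, γ *ᵥ g2Cross x y = g2Cross (γ *ᵥ x) y + g2Cross x (γ *ᵥ y) := fun x y => by
    rw [hp, hp, hp, g2LieFun_cross]
  have hv0 : γ *ᵥ v = 0 := by
    refine eq_zero_of_g2Cross h2 fun y => ?_
    have h4 := congrArg (γ *ᵥ ·) (hv y)
    simp only [mulVec_add, mulVec_smul] at h4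
    rw [hv (γ *ᵥ y), hcross, add_right_inj] at h4
    exact right_eq_add.1 h4
  have hP : ∀ x, aeval (Matrix.toLin' γ) (X ^ 3 - C c * X) x = g2Cross v x := fun x => by
    rw [map_sub, map_mul, map_pow, aeval_X, aeval_C, LinearMap.sub_apply, pow_succ, pow_two]
    simp only [End.mul_apply, Matrix.toLin'_apply, hv, Module.algebraMap_end_apply,
      add_sub_cancel_left]
  have hQ : aeval (Matrix.toLin' γ)
      ((X ^ 3 - C c * X) ^ 3 + C (g2Bil v v) * (X ^ 3 - C c * X)) = 0 := by
    refine LinearMap.ext fun x => ?_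
    have hPP : aeval (Matrix.toLin' γ) ((X ^ 3 - C c * X) ^ 3) x =
        g2Cross v (g2Cross v (g2Cross v x)) := by
      rw [pow_succ, pow_two, map_mul, map_mul, End.mul_apply, End.mul_apply, hP, hP, hP]
    rw [map_add, LinearMap.add_apply, hPP, map_mul, End.mul_apply, hP, aeval_C, g2Cross_cross,
      g2Bil_cross, g2Tri_self_outer, zero_smul, zero_sub,
      Module.algebraMap_end_apply, neg_add_cancel, LinearMap.zero_apply]
  obtain ⟨hca, hμ⟩ := g2Sextic_dvd h3 (dvd_of_aeval_eq_zero hs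
    (by rw [Matrix.charpoly_toLin', hc]; exact dvd_mul_left _ _) hQ)
  exact ⟨v, hskew, hcross, fun x => hca ▸ hv x, hv0, hμ⟩

end G2Axis

/-! ### Axes of hyperbolic type -/

section G2Split

open Matrix Polynomial Module

variable {K : Type*} [Field K]

theorem g2Bil_cross_right (v x y : Fin 7 → K) : g2Bil x (g2Cross v y) = -g2Bil (g2Cross v x) y := by
  rw [g2Bil_comm, g2Bil_cross, g2Bil_cross, g2Tri_swap_right]

theorem g2Bil_add_right (u v w : Fin 7 → K) : g2Bil u (v + w) = g2Bil u v + g2Bil u w :=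
  map_add (g2BilForm K u) v w

theorem g2Bil_smul_right (c : K) (u v : Fin 7 → K) : g2Bil u (c • v) = c * g2Bil u v :=
  map_smul (g2BilForm K u) c v

theorem g2BilForm_nondegenerate : (g2BilForm K).Nondegenerate := by
  have h1 : ∀ x : Fin 7 → K, (∀ y, g2Bil x y = 0) → x = 0 := fun x hx =>
    exists_g2Bil_ne_zero fun i => hx _
  exact ⟨h1, fun x hx => h1 x fun y => (g2Bil_comm x y).trans (hx y)⟩

theorem exists_g2Bil_dual {n : ℕ} {f : Fin n → Fin 7 → K} (hf : LinearIndependent K f) :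
    ∃ y : Fin n → Fin 7 → K, ∀ i j, g2Bil (f i) (y j) = if i = j then 1 else 0 := by
  obtain ⟨φ, hφ⟩ := LinearMap.exists_leftInverse_of_injective (Fintype.linearCombination K f)
    (LinearMap.ker_eq_bot.2 hf.fintypeLinearCombination_injective)
  refine ⟨fun j => ((g2BilForm K).toDual g2BilForm_nondegenerate).symm (LinearMap.proj j ∘ₗ φ),
    fun i j => ?_⟩
  have h1 := LinearMap.congr_fun hφ (Pi.single i 1)
  rw [LinearMap.comp_apply, Fintype.linearCombination_apply_single, one_smul] at h1
  rw [g2Bil_comm, ← g2BilForm_apply, LinearMap.BilinForm.apply_toDual_symm_apply,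
    LinearMap.comp_apply, h1]
  simp [Pi.single_apply, eq_comm]

theorem exists_g2Bil_dual_eigen (h2 : (2 : K) ≠ 0) {n : ℕ} {f : Fin n → Fin 7 → K}
    (hf : LinearIndependent K f) {v : Fin 7 → K} (hv : g2Bil v v = -1)
    (hfv : ∀ i, g2Cross v (f i) = f i) : ∃ g : Fin n → Fin 7 → K, (∀ j, g2Cross v (g j) = -g j) ∧
      ∀ i j, g2Bil (f i) (g j) = if i = j then 1 else 0 := by
  obtain ⟨y, hy⟩ := exists_g2Bil_dual hf
  have hcc : ∀ x, g2Cross v (g2Cross v (g2Cross v x)) = g2Cross v x := fun x => by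
    rw [g2Cross_cross, g2Bil_cross, g2Tri_self_outer, hv, zero_smul, neg_one_smul, zero_sub, neg_neg]
  refine ⟨fun j => (2⁻¹ : K) • (g2Cross v (g2Cross v (y j)) - g2Cross v (y j)), fun j => ?_,
    fun i j => ?_⟩
  · rw [g2Cross_smul, g2Cross_sub, hcc, ← smul_neg, neg_sub]
  · rw [g2Bil_smul_right, sub_eq_add_neg, ← neg_one_smul K, g2Bil_add_right, g2Bil_smul_right,
      g2Bil_cross_right, g2Bil_cross_right, hfv, hfv, g2Bil_cross_right, hfv, hy]
    split_ifs
    · field_simp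
      norm_num
    · simp

theorem g2Cross_zero_left (x : Fin 7 → K) : g2Cross 0 x = 0 := by
  simpa using g2Cross_smul_left (0 : K) 0 x

theorem g2Tri_smul_left (c : K) (u v w : Fin 7 → K) : g2Tri (c • u) v w = c * g2Tri u v w := by
  rw [← g2Tri_rotate, g2Tri_smul_right, g2Tri_rotate]

theorem g2Tri_smul_mid (c : K) (u v w : Fin 7 → K) : g2Tri u (c • v) w = c * g2Tri u v w := by
  rw [g2Tri_swap_right, g2Tri_smul_right, g2Tri_swap_right u w v, mul_neg]

theorem g2Tri_add_left (u u' v w : Fin 7 → K) : g2Tri (u + u') v w = g2Tri u v w + g2Tri u' v w := by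
  rw [← g2Tri_rotate, g2Tri_add_right, g2Tri_rotate u v w, g2Tri_rotate u' v w]

theorem g2Tri_add_mid (u v v' w : Fin 7 → K) : g2Tri u (v + v') w = g2Tri u v w + g2Tri u v' w := by
  rw [g2Tri_swap_right, g2Tri_add_right, g2Tri_swap_right u w v, g2Tri_swap_right u w v', neg_add]

theorem linearIndependent_of_g2Tri {x : Fin 3 → Fin 7 → K} (hx : g2Tri (x 0) (x 1) (x 2) ≠ 0) :
    LinearIndependent K x := by
  rw [Fintype.linearIndependent_iff]
  intro c hc
  rw [Fin.sum_univ_three] at hc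
  have h0 : ∀ y z : Fin 7 → K, g2Tri 0 y z = 0 := fun y z => by
    simpa using g2Tri_smul_left (0 : K) 0 y z
  have e0 := congrArg (fun t => g2Tri t (x 1) (x 2)) hc
  have e1 := congrArg (fun t => g2Tri t (x 2) (x 0)) hc
  have e2 := congrArg (fun t => g2Tri t (x 0) (x 1)) hc
  simp only [g2Tri_add_left, g2Tri_smul_left, g2Tri_self, g2Tri_self_outer, mul_zero, add_zero,
    zero_add, h0] at e0 e1 e2
  rw [g2Tri_rotate] at e1
  rw [← g2Tri_rotate] at e2
  intro i
  fin_cases i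
  · exact (mul_eq_zero.1 e0).resolve_right hx
  · exact (mul_eq_zero.1 e1).resolve_right hx
  · exact (mul_eq_zero.1 e2).resolve_right hx

namespace IsG2Axis

variable {D : End K (Fin 7 → K)} {v : Fin 7 → K} {a q s : K} (h : IsG2Axis D v a q)
include h

theorem map_cross_axis (x : Fin 7 → K) : D (g2Cross v x) = g2Cross v (D x) := by
  rw [h.cross, h.map_axis, g2Cross_zero_left, zero_add]

theorem map_eigen {x : Fin 7 → K} (hx : g2Cross v x = s • x) : g2Cross v (D x) = s • D x := by
  rw [← h.map_cross_axis, hx, map_smul]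

theorem tri_map {x : Fin 7 → K} (hx : g2Cross v x = s • x) :
    g2Tri (D x) (D (D x)) (D (D (D x))) = s * g2Tri x (D x) (D (D x)) := by
  rw [h.cube, hx, g2Tri_add_right, g2Tri_smul_right, g2Tri_smul_right, g2Tri_self_outer, mul_zero,
    zero_add, g2Tri_rotate]

theorem exists_tri_pow {x : Fin 7 → K} (hx : g2Cross v x = s • x) (i : ℕ) :
    ∃ y, g2Cross v y = s • y ∧ g2Tri y (D y) (D (D y)) = s ^ i * g2Tri x (D x) (D (D x)) := by
  induction i with
  | zero => exact ⟨x, hx, by rw [pow_zero, one_mul]⟩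
  | succ i ih =>
    obtain ⟨y, hy, hy'⟩ := ih
    exact ⟨D y, h.map_eigen hy, by rw [h.tri_map hy, hy', pow_succ]; ring⟩

theorem exists_tri_root {x : Fin 7 → K} (hx : g2Cross v x = s • x) {r : K} (hr : r ^ 3 = a * r + s)
    (hr' : 3 * r ^ 2 - a ≠ 0) (t : K) :
    ∃ y, g2Cross v y = s • y ∧ g2Tri y (D y) (D (D y)) = t * g2Tri x (D x) (D (D x)) := by
  obtain ⟨μ, hμ⟩ : ∃ μ : K, 1 + μ * (3 * r ^ 2 - a) = t :=
    ⟨(t - 1) / (3 * r ^ 2 - a), by field_simp; ring⟩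
  have hDz : D (D (D x)) = a • D x + s • x := by rw [h.cube, hx]
  obtain ⟨z, hz⟩ : ∃ z, z = D (D x) + r • D x + (r ^ 2 - a) • x := ⟨_, rfl⟩
  have hz1 : D z = r • z := by
    rw [hz, map_add, map_add, hDz, map_smul, map_smul]
    have hs : s = r ^ 3 - a * r := by linear_combination -hr
    rw [hs]
    module
  refine ⟨x + μ • z, ?_, ?_⟩
  · have hz2 : g2Cross v z = s • z := by
      rw [hz, g2Cross_add, g2Cross_add, g2Cross_smul, g2Cross_smul, h.map_eigen (h.map_eigen hx),
        h.map_eigen hx, hx]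
      module
    rw [g2Cross_add, g2Cross_smul, hx, hz2]
    module
  · have e1 : g2Tri (D (D x)) x (D x) = g2Tri x (D x) (D (D x)) := by
      rw [← g2Tri_rotate]
    have e2 : g2Tri x z (D (D x)) = r * g2Tri x (D x) (D (D x)) := by
      rw [hz, g2Tri_add_mid, g2Tri_add_mid, g2Tri_smul_mid, g2Tri_smul_mid, g2Tri_self_right,
        g2Tri_self]
      ring
    have e3 : g2Tri x (D x) z = g2Tri x (D x) (D (D x)) := by
      rw [hz, g2Tri_add_right, g2Tri_add_right, g2Tri_smul_right, g2Tri_smul_right,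
        g2Tri_self_right, g2Tri_self_outer]
      ring
    have e4 : g2Tri z (D x) (D (D x)) = (r ^ 2 - a) * g2Tri x (D x) (D (D x)) := by
      rw [hz, g2Tri_add_left, g2Tri_add_left, g2Tri_smul_left, g2Tri_smul_left, g2Tri_self,
        g2Tri_self_outer]
      ring
    simp only [map_add, map_smul, hz1, g2Tri_add_left, g2Tri_add_mid, g2Tri_add_right,
      g2Tri_smul_left, g2Tri_smul_mid, g2Tri_smul_right, g2Tri_self, g2Tri_self_right,
      g2Tri_self_outer, e2, e3, e4]
    rw [← hμ]
    ring

/-- The eigenspace of `v × ·` contains a cyclic vector. -/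
theorem exists_tri_ne_zero (h2 : (2 : K) ≠ 0) (hs : s ≠ 0) (hq : q = -s ^ 2) {x : Fin 7 → K}
    (hx : HasAnnihilator D (X ^ 3 - C a * X - C s) x) :
    g2Cross v x = s • x ∧ g2Tri x (D x) (D (D x)) ≠ 0 := by
  have hx0 : D (D (D x)) - a • D x - s • x = 0 := by
    have := (hx _).2 dvd_rfl
    simpa [pow_succ] using this
  have hxs : g2Cross v x = s • x := by
    rw [h.cube, add_sub_cancel_left, sub_eq_zero] at hx0
    exact hx0
  have hquad : ∀ α β γ : K, α • D (D x) + β • D x + γ • x = 0 → α = 0 ∧ β = 0 ∧ γ = 0 := by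
    intro α β γ hP
    have h1 : aeval D (C α * X ^ 2 + C β * X + C γ) x = 0 := by simpa [pow_two] using hP
    have h3 := eq_zero_of_dvd_of_natDegree_lt ((hx _).1 h1) (by
      have : (X ^ 3 - C a * X - C s : K[X]).natDegree = 3 := by compute_degree!
      rw [this]
      exact Nat.lt_succ_of_le natDegree_quadratic_le)
    refine ⟨?_, ?_, ?_⟩
    · simpa [coeff_X, coeff_C] using congrArg (fun P => coeff P 2) h3
    · simpa [coeff_X, coeff_C] using congrArg (fun P => coeff P 1) h3
    · simpa [coeff_X, coeff_C] using congrArg (fun P => coeff P 0) h3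
  refine ⟨hxs, fun hT => ?_⟩
  have hv : ∀ y, g2Cross v y = s • y → g2Cross (s⁻¹ • v) y = y := fun y hy => by
    rw [g2Cross_smul_left, hy, smul_smul, inv_mul_cancel₀ hs, one_smul]
  have hvn : g2Bil (s⁻¹ • v) (s⁻¹ • v) = -1 := by
    rw [g2Bil_smul_left, g2Bil_smul_right, h.norm, hq]
    field_simp
  have hli : LinearIndependent K ![x, D x] := by
    rw [LinearIndependent.pair_iff]
    intro α β hαβ
    have := hquad 0 β α (by rw [zero_smul, zero_add, add_comm, hαβ])
    exact ⟨this.2.2, this.2.1⟩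
  have hDx := hv _ (h.map_eigen hxs)
  have hDDx := hv _ (h.map_eigen (h.map_eigen hxs))
  obtain ⟨g, hg, hfg⟩ := exists_g2Bil_dual_eigen h2 hli hvn (fun i => by
    fin_cases i
    · exact hv _ hxs
    · exact hDx)
  have hF := isG2Frame_of_pairs h2 hvn (hv _ hxs) hDx (hg 0) (hg 1) (hfg 0 0) (hfg 0 1) (hfg 1 0)
    (hfg 1 1)
  have hD2' : g2Cross (s⁻¹ • v) (D (D x)) = (1 : K) • D (D x) := by rw [one_smul, hDDx]
  have heq : D (D x) = g2Bil (D (D x)) (g 0) • x + g2Bil (D (D x)) (g 1) • D x := by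
    refine hF.eq_of_bil h2 (fun i => ?_) (fun i => ?_) ?_
    · rw [g2Bil_eq_zero_of_cross h2 one_ne_zero hD2' (hF.cross_f' i), g2Bil_add_left,
        g2Bil_smul_left, g2Bil_smul_left]
      have e0 := hF.bil_ff h2 0 i
      have e1 := hF.bil_ff h2 1 i
      simp only [cons_val] at e0 e1
      rw [e0, e1, mul_zero, mul_zero, add_zero]
    · have e0 := hF.pair 0 i
      have e1 := hF.pair 1 i
      rw [g2Bil_add_left, g2Bil_smul_left, g2Bil_smul_left]
      simp only [cons_val_zero, cons_val_one] at e0 e1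
      rw [e0, e1]
      fin_cases i
      · simp
      · simp
      · rw [g2Bil_comm]
        simp [g2Bil_smul_left, g2Bil_cross, hT]
    · have e0 := hF.bil_vf 0
      have e1 := hF.bil_vf 1
      simp only [cons_val] at e0 e1
      rw [g2Bil_add_left, g2Bil_smul_left, g2Bil_smul_left, g2Bil_comm x, g2Bil_comm (D x), e0, e1,
        g2Bil_comm, g2Bil_eq_zero_of_cross_self one_ne_zero hD2', mul_zero, mul_zero, add_zero]
  have := hquad 1 (-g2Bil (D (D x)) (g 1)) (-g2Bil (D (D x)) (g 0)) (by
    rw [one_smul]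
    nth_rw 1 [heq]
    module)
  exact one_ne_zero this.1

theorem exists_frame (h2 : (2 : K) ≠ 0) (hs : s ≠ 0) (hq : q = -s ^ 2) {x : Fin 7 → K}
    (hx : g2Cross v x = s • x) (hT : g2Tri x (D x) (D (D x)) = 2) :
    ∃ g, IsG2Frame ![x, D x, D (D x)] g (s⁻¹ • v) := by
  have hv : ∀ y, g2Cross v y = s • y → g2Cross (s⁻¹ • v) y = y := fun y hy => by
    rw [g2Cross_smul_left, hy, smul_smul, inv_mul_cancel₀ hs, one_smul]
  have hvn : g2Bil (s⁻¹ • v) (s⁻¹ • v) = -1 := by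
    rw [g2Bil_smul_left, g2Bil_smul_right, h.norm, hq]
    field_simp
  have hc : ∀ i, g2Cross (s⁻¹ • v) (![x, D x, D (D x)] i) = ![x, D x, D (D x)] i := fun i => by
    fin_cases i
    · exact hv _ hx
    · exact hv _ (h.map_eigen hx)
    · exact hv _ (h.map_eigen (h.map_eigen hx))
  obtain ⟨g, hg, hfg⟩ := exists_g2Bil_dual_eigen h2
    (linearIndependent_of_g2Tri (x := ![x, D x, D (D x)]) (by simpa [hT] using h2)) hvn hc
  exact ⟨g, hc, hg, hfg, hvn, hT⟩

end IsG2Axis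

end G2Split

section G2Split

open Matrix Polynomial Module

variable {K : Type*} [Field K]

theorem g2FrameMatrix_mulVec_single (f g : Fin 3 → Fin 7 → K) (v : Fin 7 → K) (j : Fin 7) :
    g2FrameMatrix f g v *ᵥ Pi.single j 1 = g2FrameCol f g v j := by
  rw [mulVec_single_one]
  rfl

/-- Two frames are related by an element preserving the tensor. -/
theorem IsG2Frame.exists_preserves (h2 : (2 : K) ≠ 0) {f g f' g' : Fin 3 → Fin 7 → K}
    {v v' : Fin 7 → K} (h : IsG2Frame f g v) (h' : IsG2Frame f' g' v') :
    ∃ A : Matrix (Fin 7) (Fin 7) K, A.det ≠ 0 ∧ Preserves g2Tensor A ∧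
      (∀ i, A *ᵥ f i = f' i) ∧ (∀ i, A *ᵥ g i = g' i) ∧ A *ᵥ v = v' := by
  have hu : IsUnit (g2FrameMatrix f g v).det := (h.det_ne_zero h2).isUnit
  obtain ⟨A, hA⟩ : ∃ A, A = g2FrameMatrix f' g' v' * (g2FrameMatrix f g v)⁻¹ := ⟨_, rfl⟩
  have hAM : A * g2FrameMatrix f g v = g2FrameMatrix f' g' v' := by
    rw [hA, mul_assoc, nonsing_inv_mul _ hu, mul_one]
  have hcol : ∀ j, A *ᵥ g2FrameCol f g v j = g2FrameCol f' g' v' j := fun j => by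
    rw [← g2FrameMatrix_mulVec_single, mulVec_mulVec, hAM, g2FrameMatrix_mulVec_single]
  refine ⟨A, ?_, ?_, ?_, ?_, hcol 3⟩
  · intro h0
    have := congrArg det hAM
    rw [det_mul, h0, zero_mul] at this
    exact h'.det_ne_zero h2 this.symm
  · rw [preserves_g2_iff]
    intro x y z
    have hM : ∀ x, x = g2FrameMatrix f g v *ᵥ ((g2FrameMatrix f g v)⁻¹ *ᵥ x) := fun x => by
      rw [mulVec_mulVec, mul_nonsing_inv _ hu, one_mulVec]
    conv_rhs => rw [hM x, hM y, hM z, (preserves_g2_iff _).1 (h.preserves_g2 h2)]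
    rw [hA]
    simp only [← mulVec_mulVec]
    rw [(preserves_g2_iff _).1 (h'.preserves_g2 h2)]
  · intro i
    fin_cases i
    · exact hcol 0
    · exact hcol 4
    · exact hcol 5
  · intro i
    fin_cases i
    · exact hcol 6
    · exact hcol 2
    · have := hcol 1
      change A *ᵥ (-g 2) = -g' 2 at this
      rw [mulVec_neg, neg_inj] at this
      exact this

theorem IsG2Frame.ext_of_mul (h2 : (2 : K) ≠ 0) {f g : Fin 3 → Fin 7 → K} {v : Fin 7 → K}
    (h : IsG2Frame f g v) {A B : Matrix (Fin 7) (Fin 7) K} (hf : ∀ i, A *ᵥ f i = B *ᵥ f i)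
    (hg : ∀ i, A *ᵥ g i = B *ᵥ g i) (hv : A *ᵥ v = B *ᵥ v) : A = B := by
  have hu : IsUnit (g2FrameMatrix f g v).det := (h.det_ne_zero h2).isUnit
  have hM : A * g2FrameMatrix f g v = B * g2FrameMatrix f g v := by
    refine ext_of_mulVec_single fun j => ?_
    rw [← mulVec_mulVec, ← mulVec_mulVec, g2FrameMatrix_mulVec_single]
    fin_cases j
    · exact hf 0
    · change A *ᵥ (-g 2) = B *ᵥ (-g 2)
      rw [mulVec_neg, mulVec_neg, hg]
    · exact hg 1
    · exact hv
    · exact hf 1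
    · exact hf 2
    · exact hg 0
  have := congrArg (· * (g2FrameMatrix f g v)⁻¹) hM
  simpa only [mul_assoc, mul_nonsing_inv _ hu, mul_one] using this

theorem IsG2Axis.map_frame (h2 : (2 : K) ≠ 0) {D : End K (Fin 7 → K)} {v : Fin 7 → K} {a q s : K}
    (h : IsG2Axis D v a q) {x : Fin 7 → K} (hx : g2Cross v x = s • x) {g : Fin 3 → Fin 7 → K}
    (hF : IsG2Frame ![x, D x, D (D x)] g (s⁻¹ • v)) :
    D (D (D x)) = a • D x + s • x ∧ D (g 0) = (-s) • g 2 ∧ D (g 1) = -g 0 + (-a) • g 2 ∧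
      D (g 2) = -g 1 := by
  have h3 : D (D (D x)) = a • D x + s • x := by rw [h.cube, hx]
  have hskew : ∀ i y, g2Bil (D (g i)) y = -g2Bil (D y) (g i) := fun i y => by
    rw [h.skew, g2Bil_comm]
  have h00 := fun i => hF.pair 0 i
  have h01 := fun i => hF.pair 1 i
  have h02 := fun i => hF.pair 2 i
  simp only [cons_val] at h00 h01 h02
  have hgg := hF.bil_gg h2
  have hgv := hF.bil_vg
  have hDg : ∀ i, g2Cross (s⁻¹ • v) (D (g i)) = (-1 : K) • D (g i) := fun i => by
    rw [g2Cross_smul_left, ← h.map_cross_axis, ← map_smul, ← g2Cross_smul_left, hF.cross_g, map_neg,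
      neg_one_smul]
  have hDgg : ∀ i j, g2Bil (D (g i)) (g j) = 0 := fun i j =>
    g2Bil_eq_zero_of_cross h2 (neg_ne_zero.2 one_ne_zero) (hDg i) (hF.cross_g' j)
  have hDgv : ∀ i, g2Bil (D (g i)) (s⁻¹ • v) = 0 := fun i => by
    rw [hskew, map_smul, h.map_axis, smul_zero]
    simp [g2Bil]
  have hneg : ∀ u w : Fin 7 → K, g2Bil (-u) w = -g2Bil u w := fun u w => by
    rw [← neg_one_smul K, g2Bil_smul_left, neg_one_mul]
  refine ⟨h3, ?_, ?_, ?_⟩ <;>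
  · refine hF.eq_of_bil h2 (fun j => ?_) (fun j => ?_) ?_
    · rw [hskew]
      fin_cases j <;>
        simp [h3, g2Bil_add_left, g2Bil_smul_left, hneg, h00, h01, h02, g2Bil_comm (g _) x,
          g2Bil_comm (g _) (D x), g2Bil_comm (g _) (D (D x))]
    · simp only [hDgg, g2Bil_add_left, g2Bil_smul_left, hneg, hgg, mul_zero, neg_zero, add_zero]
    · simp only [hDgv, g2Bil_add_left, g2Bil_smul_left, hneg, g2Bil_comm (g _), hgv, mul_zero,
        neg_zero, add_zero]

theorem IsG2Axis.exists_conj_of_split (h2 : (2 : K) ≠ 0) {γ γ' : Matrix (Fin 7) (Fin 7) K}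
    {v v' : Fin 7 → K} {a q s : K} (h : IsG2Axis (Matrix.toLin' γ) v a q)
    (h' : IsG2Axis (Matrix.toLin' γ') v' a q) (hs : s ≠ 0) (hq : q = -s ^ 2)
    {x x' : Fin 7 → K} (hx : g2Cross v x = s • x)
    (hT : g2Tri x (Matrix.toLin' γ x) (Matrix.toLin' γ (Matrix.toLin' γ x)) = 2)
    (hx' : g2Cross v' x' = s • x')
    (hT' : g2Tri x' (Matrix.toLin' γ' x') (Matrix.toLin' γ' (Matrix.toLin' γ' x')) = 2) :
    ∃ A : Matrix (Fin 7) (Fin 7) K, A.det ≠ 0 ∧ Preserves g2Tensor A ∧ γ' * A = A * γ := by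
  obtain ⟨g, hF⟩ := h.exists_frame h2 hs hq hx hT
  obtain ⟨g', hF'⟩ := h'.exists_frame h2 hs hq hx' hT'
  obtain ⟨A, hA, hAT, hAf, hAg, hAv⟩ := hF.exists_preserves h2 hF'
  refine ⟨A, hA, hAT, hF.ext_of_mul h2 (fun i => ?_) (fun i => ?_) ?_⟩
  all_goals rw [← mulVec_mulVec, ← mulVec_mulVec]
  · obtain ⟨e1, -⟩ := h.map_frame h2 hx hF
    obtain ⟨e2, -⟩ := h'.map_frame h2 hx' hF'
    rw [hAf]
    have a0 := hAf 0
    have a1 := hAf 1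
    have a2 := hAf 2
    simp only [cons_val, Matrix.toLin'_apply] at a0 a1 a2 e1 e2
    fin_cases i
    · simp only [Fin.zero_eta, cons_val, a1]
    · simp only [Fin.mk_one, cons_val, Matrix.toLin'_apply, a2]
    · simp only [Fin.reduceFinMk, cons_val, Matrix.toLin'_apply, e1, e2, mulVec_add, mulVec_smul, a0, a1]
  · obtain ⟨-, e1⟩ := h.map_frame h2 hx hF
    obtain ⟨-, e2⟩ := h'.map_frame h2 hx' hF'
    simp only [Matrix.toLin'_apply] at e1 e2
    rw [hAg]
    fin_cases i
    · simp only [Fin.zero_eta, e1, e2, mulVec_smul, hAg]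
    · simp only [Fin.mk_one, e1, e2, mulVec_add, mulVec_neg, mulVec_smul, hAg]
    · simp only [Fin.reduceFinMk, e1, e2, mulVec_neg, hAg]
  · have e1 := h.map_axis
    have e2 := h'.map_axis
    rw [Matrix.toLin'_apply] at e1 e2
    rw [hAv, mulVec_smul, mulVec_smul, e1, e2, smul_zero, mulVec_zero]

end G2Split

/-! ### Roots of polynomials over `F` -/

section LaurentRoots

open Polynomial

variable {k : Type*} [Field k]

theorem exists_root_of_residue {f : (OO k)[X]} (hf : f.Monic) (x₀ : k)
    (h₀ : (f.map PowerSeries.constantCoeff).eval x₀ = 0)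
    (h₁ : (f.map PowerSeries.constantCoeff).derivative.eval x₀ ≠ 0) :
    ∃ r : OO k, f.eval r = 0 ∧ PowerSeries.constantCoeff r = x₀ := by
  have he : ∀ g : (OO k)[X], PowerSeries.constantCoeff (g.eval (PowerSeries.C x₀)) =
      (g.map PowerSeries.constantCoeff).eval x₀ := fun g => by
    rw [eval_map, ← PowerSeries.constantCoeff_C x₀, eval₂_at_apply, PowerSeries.constantCoeff_C]
  have hm : ∀ y : OO k, y ∈ IsLocalRing.maximalIdeal (OO k) ↔ PowerSeries.constantCoeff y = 0 := by
    intro y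
    rw [IsLocalRing.mem_maximalIdeal, mem_nonunits_iff, PowerSeries.isUnit_iff_constantCoeff,
      isUnit_iff_ne_zero, not_not]
  obtain ⟨r, hr, hr'⟩ := HenselianLocalRing.is_henselian f hf (PowerSeries.C x₀)
    ((hm _).2 ((he f).trans h₀)) (by
      rw [PowerSeries.isUnit_iff_constantCoeff, he, ← derivative_map]
      exact h₁.isUnit)
  refine ⟨r, hr, ?_⟩
  rw [hm, map_sub, PowerSeries.constantCoeff_C, sub_eq_zero] at hr'
  exact hr'

theorem exists_cubic_root_of_residue (b c d : OO k) (x₀ : k)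
    (h₀ : x₀ ^ 3 + PowerSeries.constantCoeff b * x₀ ^ 2 + PowerSeries.constantCoeff c * x₀ +
      PowerSeries.constantCoeff d = 0)
    (h₁ : 3 * x₀ ^ 2 + 2 * PowerSeries.constantCoeff b * x₀ + PowerSeries.constantCoeff c ≠ 0) :
    ∃ r : OO k, r ^ 3 + b * r ^ 2 + c * r + d = 0 ∧ PowerSeries.constantCoeff r = x₀ := by
  obtain ⟨r, hr, hr'⟩ := exists_root_of_residue
    (f := X ^ 3 + (C b * X ^ 2 + C c * X + C d)) (monic_X_pow_add degree_quadratic_lt) x₀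
    (by simpa [add_assoc] using h₀)
    (by
      refine fun h => h₁ (h ▸ ?_)
      simp only [Polynomial.map_add, Polynomial.map_mul, Polynomial.map_pow, map_X, map_C,
        derivative_add, derivative_mul, derivative_C, derivative_X, derivative_X_pow, eval_add,
        eval_mul, eval_pow, eval_X, eval_C, eval_zero, eval_one]
      norm_num
      ring)
  exact ⟨r, by simpa [add_assoc] using hr, hr'⟩

theorem exists_sq_of_isUnit [IsAlgClosed k] (h2 : (2 : k) ≠ 0) {u : OO k} (hu : IsUnit u) :
    ∃ r : OO k, r ^ 2 = u := by
  obtain ⟨x₀, hx₀⟩ := IsAlgClosed.exists_pow_nat_eq (PowerSeries.constantCoeff u) two_pos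
  have hx : x₀ ≠ 0 := by
    rintro rfl
    exact (PowerSeries.isUnit_constantCoeff u hu).ne_zero (by rw [← hx₀, zero_pow two_ne_zero])
  obtain ⟨r, hr, -⟩ := exists_root_of_residue (f := X ^ 2 - C u)
    (monic_X_pow_sub_C _ two_ne_zero) x₀ (by simp [hx₀]) (by
      simpa [derivative_X_pow, one_add_one_eq_two] using ⟨h2, hx⟩)
  exact ⟨r, by simpa [sub_eq_zero] using hr⟩

theorem exists_cube_of_isUnit [IsAlgClosed k] (h3 : (3 : k) ≠ 0) {u : OO k} (hu : IsUnit u) :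
    ∃ r : OO k, r ^ 3 = u := by
  obtain ⟨x₀, hx₀⟩ := IsAlgClosed.exists_pow_nat_eq (PowerSeries.constantCoeff u) three_pos
  have hx : x₀ ≠ 0 := by
    rintro rfl
    exact (PowerSeries.isUnit_constantCoeff u hu).ne_zero (by rw [← hx₀, zero_pow three_ne_zero])
  obtain ⟨r, hr, -⟩ := exists_cubic_root_of_residue 0 0 (-u) x₀ (by simp [hx₀]) (by simp [h3, hx])
  exact ⟨r, by linear_combination hr⟩

theorem exists_zpow_mul (x : FF k) (hx : x ≠ 0) : ∃ (n : ℤ) (u : OO k), IsUnit u ∧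
    x = (algebraMap (OO k) (FF k) PowerSeries.X) ^ n * algebraMap (OO k) (FF k) u := by
  refine ⟨x.order, x.powerSeriesPart, ?_, ?_⟩
  · rw [PowerSeries.isUnit_iff_constantCoeff, ← PowerSeries.coeff_zero_eq_constantCoeff_apply,
      LaurentSeries.powerSeriesPart_coeff, Nat.cast_zero, add_zero, isUnit_iff_ne_zero]
    exact HahnSeries.coeff_order_eq_zero.not.2 hx
  · conv_lhs => rw [← x.single_order_mul_powerSeriesPart]
    rw [LaurentSeries.coe_algebraMap, HahnSeries.ofPowerSeries_X, RatFunc.single_zpow]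

theorem zpow_mul_cube {K : Type*} [Field K] {π : K} (hπ : π ≠ 0) (n : ℤ) (r : K) :
    π ^ n * r ^ 3 = (π ^ (n / 3) * r) ^ 3 * π ^ (n % 3) := by
  conv_lhs => rw [← Int.mul_ediv_add_emod n 3, zpow_add₀ hπ, mul_comm 3, zpow_mul]
  norm_cast
  ring

theorem cube_or_eq_of_zpow {K : Type*} [Field K] {π : K} (hπ : π ≠ 0)
    (h : ∀ x : K, x ≠ 0 → ∃ (n : ℤ) (r : K), r ≠ 0 ∧ x = π ^ n * r ^ 3) {s t : K} (hs : s ≠ 0)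
    (ht : t ≠ 0) : (∃ c, s = c ^ 3) ∨ ∃ (c : K) (i : ℕ), t = c ^ 3 * s ^ i := by
  have key : ∀ x : K, x ≠ 0 → ∃ (i : ℤ) (c : K), 0 ≤ i ∧ i < 3 ∧ c ≠ 0 ∧ x = c ^ 3 * π ^ i := by
    intro x hx
    obtain ⟨n, r, hr, rfl⟩ := h x hx
    exact ⟨n % 3, π ^ (n / 3) * r, Int.emod_nonneg _ (by norm_num),
      Int.emod_lt_of_pos _ (by norm_num), mul_ne_zero (zpow_ne_zero _ hπ) hr,
      zpow_mul_cube hπ n r⟩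
  obtain ⟨i, c, hi0, hi3, hc, rfl⟩ := key s hs
  obtain ⟨j, d, hj0, -, hd, rfl⟩ := key t ht
  lift j to ℕ using hj0
  interval_cases i
  · exact Or.inl ⟨c, by simp⟩
  · refine Or.inr ⟨d / c ^ j, j, ?_⟩
    rw [zpow_natCast, zpow_one]
    field_simp
    ring
  · refine Or.inr ⟨d / (c ^ (2 * j) * π ^ j), 2 * j, ?_⟩
    rw [zpow_natCast, zpow_ofNat]
    field_simp
    ring

theorem cube_or_eq_cube_mul_pow [IsAlgClosed k] (h3 : (3 : k) ≠ 0) {s t : FF k} (hs : s ≠ 0)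
    (ht : t ≠ 0) : (∃ c, s = c ^ 3) ∨ ∃ (c : FF k) (i : ℕ), t = c ^ 3 * s ^ i := by
  refine cube_or_eq_of_zpow (π := algebraMap (OO k) (FF k) PowerSeries.X)
    ((map_ne_zero_iff _ algebraMap_injective_OO).2 PowerSeries.X_ne_zero) (fun x hx => ?_) hs ht
  obtain ⟨n, u, hu, rfl⟩ := exists_zpow_mul x hx
  obtain ⟨r, rfl⟩ := exists_cube_of_isUnit h3 hu
  refine ⟨n, algebraMap _ _ r, ?_, by rw [map_pow]⟩
  rw [map_pow] at hx
  exact ne_zero_pow three_ne_zero (mul_ne_zero_iff.1 hx).2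

theorem integral_or_inv (x : FF k) : (∃ b : OO k, algebraMap _ _ b = x) ∨
    ∃ b : OO k, PowerSeries.constantCoeff b = 0 ∧ x * algebraMap _ _ b = 1 := by
  by_cases hx : x = 0
  · exact Or.inl ⟨0, by rw [map_zero, hx]⟩
  rcases ValuationRing.isInteger_or_isInteger (OO k) x with h | h
  · exact Or.inl h
  · obtain ⟨b, hb⟩ := h
    by_cases hb0 : PowerSeries.constantCoeff b = 0
    · exact Or.inr ⟨b, hb0, by rw [hb, mul_inv_cancel₀ hx]⟩
    · obtain ⟨u, rfl⟩ := PowerSeries.isUnit_iff_constantCoeff.2 (isUnit_iff_ne_zero.2 hb0)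
      refine Or.inl ⟨↑u⁻¹, ?_⟩
      have h1 : algebraMap (OO k) (FF k) u * algebraMap (OO k) (FF k) ↑u⁻¹ = 1 := by
        rw [← map_mul, Units.mul_inv, map_one]
      rw [hb] at h1
      rw [← mul_one x, ← h1, mul_inv_cancel_left₀ hx]

theorem exists_cubic_root_of_cube [IsAlgClosed k] (h3 : (3 : k) ≠ 0) (a : FF k)
    {c : FF k} (hc : c ≠ 0) : ∃ r : FF k, r ^ 3 = a * r + c ^ 3 := by
  suffices H : ∀ a : FF k, ∃ r : FF k, r ^ 3 = a * r + 1 by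
    obtain ⟨r, hr⟩ := H (a / c ^ 2)
    refine ⟨c * r, ?_⟩
    rw [mul_pow, hr]
    field_simp
  intro a
  rcases integral_or_inv a with ⟨b, rfl⟩ | ⟨b, hb, hab⟩
  · have hroot : ∃ x : k, x ^ 3 + 0 * x ^ 2 + -PowerSeries.constantCoeff b * x + -1 = 0 ∧
        3 * x ^ 2 + 2 * 0 * x + -PowerSeries.constantCoeff b ≠ 0 := by
      set β := PowerSeries.constantCoeff b
      obtain ⟨x, hx⟩ := IsAlgClosed.exists_root (X ^ 3 + (C 0 * X ^ 2 + C (-β) * X + C (-1)) : k[X]) (by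
        rw [degree_eq_natDegree (monic_X_pow_add degree_quadratic_lt).ne_zero]
        have : (X ^ 3 + (C 0 * X ^ 2 + C (-β) * X + C (-1)) : k[X]).natDegree = 3 := by
          compute_degree!
        rw [this]
        norm_num)
      have hx' : x ^ 3 - β * x - 1 = 0 := by
        simp [IsRoot] at hx
        linear_combination hx
      by_cases hd : 3 * x ^ 2 - β = 0
      · refine ⟨-2 * x, by linear_combination hx' - 3 * x * hd, fun h => ?_⟩
        have hx0 : 9 * x ^ 2 = 0 := by linear_combination h - hd
        have h9 : (9 : k) ≠ 0 := by
          rw [show (9 : k) = 3 * 3 by norm_num]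
          exact mul_ne_zero h3 h3
        have hx0' : x = 0 := by simpa [h9] using hx0
        rw [hx0'] at hx'
        norm_num at hx'
      · exact ⟨x, by linear_combination hx', fun h => hd (by linear_combination h)⟩
    obtain ⟨x, hx, hx'⟩ := hroot
    obtain ⟨r, hr, -⟩ := exists_cubic_root_of_residue 0 (-b) (-1) x (by simpa using hx)
      (by simpa using hx')
    refine ⟨algebraMap _ _ r, ?_⟩
    rw [← map_pow, ← map_mul, ← map_one (algebraMap (OO k) (FF k)), ← map_add]
    congr 1
    linear_combination hr
  · obtain ⟨z, hz, hz0⟩ := exists_cubic_root_of_residue 1 0 (-b ^ 3) (-1) (by simp [hb]; norm_num)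
      (by simp; norm_num)
    have hz0' : algebraMap (OO k) (FF k) z ≠ 0 := by
      refine (map_ne_zero_iff _ algebraMap_injective_OO).2 ?_
      rintro rfl
      simp at hz0
    refine ⟨algebraMap _ _ b / algebraMap _ _ z, ?_⟩
    have hz' := congrArg (algebraMap (OO k) (FF k)) hz
    simp only [map_add, map_mul, map_pow, map_one, map_neg, map_zero] at hz'
    field_simp
    linear_combination -hz' - algebraMap (OO k) (FF k) z ^ 2 * hab

end LaurentRoots

section LaurentAxes

open Polynomial Module

variable {k : Type*} [Field k]

theorem g2Sextic_split {K : Type*} [Field K] (a s : K) :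
    g2Sextic a (-s ^ 2) = (X ^ 3 - C a * X - C s) * (X ^ 3 - C a * X + C s) := by
  simp only [g2Sextic, map_neg, map_pow]
  ring

theorem IsG2Axis.exists_tri_eq_two [IsAlgClosed k] (h2 : (2 : k) ≠ 0) (h3 : (3 : k) ≠ 0)
    {D : End (FF k) (Fin 7 → FF k)} {v : Fin 7 → FF k} {a q s : FF k} (h : IsG2Axis D v a q)
    (hs : s ≠ 0) (hq : q = -s ^ 2) (hsep : (g2Sextic a q).Separable)
    (hc : D.charpoly = X * g2Sextic a q) :
    ∃ x, g2Cross v x = s • x ∧ g2Tri x (D x) (D (D x)) = 2 := by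
  have hdvd : X ^ 3 - C a * X - C s ∣ g2Sextic a q := by
    rw [hq, g2Sextic_split]
    exact dvd_mul_right _ _
  have hcub := hsep.of_dvd hdvd
  obtain ⟨x, hx⟩ := exists_hasAnnihilator hcub (hdvd.trans (hc ▸ dvd_mul_left _ _))
  obtain ⟨hxs, hT⟩ := h.exists_tri_ne_zero (two_ne_zero_FF h2) hs hq hx
  obtain ⟨t, ht⟩ : ∃ t, t * g2Tri x (D x) (D (D x)) = 2 := ⟨_, div_mul_cancel₀ _ hT⟩
  have ht0 : t ≠ 0 := by
    rintro rfl
    rw [zero_mul] at ht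
    exact two_ne_zero_FF h2 ht.symm
  rcases cube_or_eq_cube_mul_pow h3 hs ht0 with ⟨c, hc⟩ | ⟨c, i, rfl⟩
  · have hc0 : c ≠ 0 := by
      rintro rfl
      exact hs (hc.trans (zero_pow three_ne_zero))
    obtain ⟨r, hr⟩ := exists_cubic_root_of_cube h3 a hc0
    rw [← hc] at hr
    have hr' : 3 * r ^ 2 - a ≠ 0 := by
      intro hd
      obtain ⟨A, B, hAB⟩ := hcub
      have := congrArg (eval r) hAB
      simp only [eval_add, eval_mul, eval_sub, eval_pow, eval_X, eval_C, derivative_sub,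
        derivative_C_mul, derivative_X_pow, derivative_X, derivative_C, eval_zero, eval_one] at this
      norm_num at this
      rw [hd, mul_zero, add_zero, show r ^ 3 - a * r - s = 0 by rw [hr]; ring, mul_zero] at this
      exact zero_ne_one this
    obtain ⟨y, hy, hy'⟩ := h.exists_tri_root hxs hr hr' t
    exact ⟨y, hy, hy'.trans ht⟩
  · obtain ⟨y, hy, hy'⟩ := h.exists_tri_pow hxs i
    refine ⟨c • y, by rw [g2Cross_smul, hy, smul_comm], ?_⟩
    simp only [map_smul, g2Tri_smul_left, g2Tri_smul_mid, g2Tri_smul_right, hy']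
    linear_combination ht

/-- Cube roots of elements of norm one of a quadratic extension of `F`. -/
theorem exists_norm_one_cube_root [IsAlgClosed k] (h2 : (2 : k) ≠ 0) (h3 : (3 : k) ≠ 0) {q : FF k}
    (hq : ∀ s, q ≠ -s ^ 2) {α β : FF k} (h : α ^ 2 + q * β ^ 2 = 1) :
    ∃ a b : FF k, a ^ 2 + q * b ^ 2 = 1 ∧ a ^ 3 - 3 * q * a * b ^ 2 = α ∧
      3 * a ^ 2 * b - q * b ^ 3 = β := by
  by_cases hβ : β = 0
  · subst hβ
    exact ⟨α, 0, h, by linear_combination α * h, by ring⟩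
  have h2F := two_ne_zero_FF h2
  obtain ⟨A, rfl⟩ : ∃ A : OO k, algebraMap _ _ A = α := by
    rcases integral_or_inv α with hA | ⟨c, hc, hαc⟩
    · exact hA
    · exfalso
      obtain ⟨r, hr⟩ := exists_sq_of_isUnit h2 (u := 1 - c ^ 2)
        (PowerSeries.isUnit_iff_constantCoeff.2 (by simp [hc]))
      have hr' := congrArg (algebraMap (OO k) (FF k)) hr
      rw [map_pow, map_sub, map_one, map_pow] at hr'
      have hc0 : algebraMap (OO k) (FF k) c ≠ 0 := right_ne_zero_of_mul_eq_one hαc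
      refine hq (algebraMap _ _ r / (β * algebraMap _ _ c)) ?_
      rw [div_pow, hr']
      field_simp
      linear_combination (algebraMap (OO k) (FF k) c) ^ 2 * h - (α * algebraMap (OO k) (FF k) c + 1) * hαc
  have hA : PowerSeries.constantCoeff A ^ 2 = 1 := by
    by_contra hne
    obtain ⟨r, hr⟩ := exists_sq_of_isUnit h2 (u := A ^ 2 - 1)
      (PowerSeries.isUnit_iff_constantCoeff.2 (by simpa [sub_eq_zero] using hne))
    have hr' := congrArg (algebraMap (OO k) (FF k)) hr
    rw [map_pow, map_sub, map_one, map_pow] at hr'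
    refine hq (algebraMap _ _ r / β) ?_
    rw [div_pow, hr']
    field_simp
    linear_combination h
  have e2 : PowerSeries.constantCoeff (2 : OO k) = 2 := map_ofNat _ 2
  have e3 : PowerSeries.constantCoeff (3 : OO k) = 3 := map_ofNat _ 3
  obtain ⟨y, hy, hy0⟩ := exists_cubic_root_of_residue 0 (-3) (-2 * A)
    (2 * PowerSeries.constantCoeff A) (by
      simp only [map_zero, map_neg, map_mul, e2, e3]
      linear_combination 8 * PowerSeries.constantCoeff A * hA) (by
      have h9 : (9 : k) ≠ 0 := by
        rw [show (9 : k) = 3 * 3 by norm_num]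
        exact mul_ne_zero h3 h3
      refine fun h => h9 ?_
      simp only [map_zero, map_neg, e3] at h
      linear_combination h - 12 * hA)
  have hy' := congrArg (algebraMap (OO k) (FF k)) hy
  simp only [map_add, map_mul, map_pow, map_neg, map_zero, map_ofNat] at hy'
  have hy1 : algebraMap (OO k) (FF k) y ^ 2 - 1 ≠ 0 := by
    rw [← map_one (algebraMap (OO k) (FF k)), ← map_pow, ← map_sub]
    refine (map_ne_zero_iff _ algebraMap_injective_OO).2 fun h0 => h3 ?_
    have := congrArg PowerSeries.constantCoeff h0
    rw [map_sub, map_pow, map_one, map_zero, hy0] at this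
    linear_combination this - 4 * hA
  generalize algebraMap (OO k) (FF k) y = Y at *
  generalize algebraMap (OO k) (FF k) A = α at *
  have hα : α = (Y ^ 3 - 3 * Y) / 2 := by
    field_simp
    linear_combination -hy'
  have hqβ : q * β ^ 2 = (1 - (Y / 2) ^ 2) * (Y ^ 2 - 1) ^ 2 := by
    rw [hα] at h
    field_simp at h ⊢
    linear_combination h
  have hb : q * (β / (Y ^ 2 - 1)) ^ 2 = 1 - (Y / 2) ^ 2 := by
    rw [div_pow, ← mul_div_assoc, hqβ, mul_div_cancel_right₀ _ (pow_ne_zero 2 hy1)]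
  refine ⟨Y / 2, β / (Y ^ 2 - 1), by rw [hb]; ring, ?_, ?_⟩
  · rw [hα, show ∀ x y : FF k, 3 * q * x * y ^ 2 = 3 * x * (q * y ^ 2) from fun x y => by ring, hb]
    field_simp
    ring
  · rw [show ∀ x : FF k, q * x ^ 3 = q * x ^ 2 * x from fun x => by ring, hb]
    field_simp
    ring

end LaurentAxes

/-! ### Axes of elliptic type -/

section G2Orthogonal

open Matrix Module

variable {K : Type*} [Field K]

theorem linearIndependent_of_g2Bil {n : ℕ} {c : Fin n → Fin 7 → K}
    (hc : ∀ i j, i ≠ j → g2Bil (c i) (c j) = 0) (hn : ∀ i, g2Bil (c i) (c i) ≠ 0) :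
    LinearIndependent K c :=
  LinearMap.linearIndependent_of_isOrthoᵢ (B := g2BilForm K)
    (LinearMap.isOrthoᵢ_def.2 fun i j hij => hc i j hij) fun i => hn i

theorem eq_of_g2Bil_orthogonal {c : Fin 7 → Fin 7 → K} (hc : ∀ i j, i ≠ j → g2Bil (c i) (c j) = 0)
    (hn : ∀ i, g2Bil (c i) (c i) ≠ 0) {x y : Fin 7 → K} (h : ∀ i, g2Bil x (c i) = g2Bil y (c i)) :
    x = y := by
  have hspan := (linearIndependent_of_g2Bil hc hn).span_eq_top_of_card_eq_finrank' (by simp)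
  have h1 : g2BilForm K x = g2BilForm K y := LinearMap.ext_on_range hspan fun i => by
    rw [g2BilForm_apply, g2BilForm_apply, h]
  refine sub_eq_zero.1 (exists_g2Bil_ne_zero fun i => ?_)
  rw [← g2BilForm_apply, map_sub, h1, sub_self, LinearMap.zero_apply]

theorem exists_g2Bil_orthogonal (h2 : (2 : K) ≠ 0) {n : ℕ} (hn7 : n < 7) {c : Fin n → Fin 7 → K}
    (hc : ∀ i j, i ≠ j → g2Bil (c i) (c j) = 0) (hn : ∀ i, g2Bil (c i) (c i) ≠ 0) :
    ∃ x, (∀ i, g2Bil (c i) x = 0) ∧ g2Bil x x ≠ 0 := by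
  have hker : LinearMap.ker (LinearMap.pi fun i => g2BilForm K (c i)) ≠ ⊥ :=
    LinearMap.ker_ne_bot_of_finrank_lt (by simpa using hn7)
  obtain ⟨x, hx, hx0⟩ := Submodule.exists_mem_ne_zero_of_ne_bot hker
  have hx' : ∀ i, g2Bil (c i) x = 0 := fun i => congrFun hx i
  obtain ⟨j, hj⟩ : ∃ j, g2Bil x (Pi.single j 1) ≠ 0 := by
    by_contra! h
    exact hx0 (exists_g2Bil_ne_zero h)
  set y : Fin 7 → K := Pi.single j 1
  set y' := y - ∑ i, (g2Bil (c i) y / g2Bil (c i) (c i)) • c i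
  have hy' : ∀ i, g2Bil (c i) y' = 0 := fun i => by
    rw [← g2BilForm_apply, map_sub, map_sum, Finset.sum_eq_single i]
    · rw [map_smul, g2BilForm_apply, g2BilForm_apply, smul_eq_mul, div_mul_cancel₀ _ (hn i), sub_self]
    · intro l _ hl
      rw [map_smul, g2BilForm_apply, hc i l hl.symm, smul_zero]
    · simp
  have hxy : g2Bil x y' = g2Bil x y := by
    rw [← g2BilForm_apply, map_sub, map_sum, Finset.sum_eq_zero, sub_zero, g2BilForm_apply]
    intro l _
    rw [map_smul, g2BilForm_apply, g2Bil_comm x, hx', smul_zero]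
  by_cases h1 : g2Bil x x = 0
  · by_cases h3 : g2Bil y' y' = 0
    · refine ⟨x + y', fun i => by rw [g2Bil_add_right, hx', hy', add_zero], ?_⟩
      rw [g2Bil_add_right, g2Bil_add_left, g2Bil_add_left, h1, h3, g2Bil_comm y' x, hxy, zero_add,
        add_zero, ← two_mul]
      exact mul_ne_zero h2 hj
    · exact ⟨y', hy', h3⟩
  · exact ⟨x, hx', h1⟩

theorem g2Cross_self (u : Fin 7 → K) : g2Cross u u = 0 := by
  refine exists_g2Bil_ne_zero fun i => ?_
  rw [g2Bil_cross, g2Tri_self]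

theorem g2Bil_self_cross (v x : Fin 7 → K) : g2Bil v (g2Cross v x) = 0 := by
  rw [g2Bil_comm, g2Bil_cross, g2Tri_self_outer]

theorem g2Bil_cross_self (v x : Fin 7 → K) : g2Bil (g2Cross v x) x = 0 := by
  rw [g2Bil_cross, g2Tri_self_right]

theorem g2Cross_cross_of_orthogonal {v x : Fin 7 → K} (hx : g2Bil v x = 0) :
    g2Cross v (g2Cross v x) = -g2Bil v v • x := by
  rw [g2Cross_cross, g2Bil_comm, hx, zero_smul, zero_sub, neg_smul]

theorem g2Bil_cross_cross (u w : Fin 7 → K) :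
    g2Bil (g2Cross u w) (g2Cross u w) = g2Bil u u * g2Bil w w - g2Bil u w ^ 2 := by
  rw [g2Bil_cross_right, g2Cross_cross, sub_eq_add_neg, ← neg_smul, g2Bil_add_left,
    g2Bil_smul_left, g2Bil_smul_left, g2Bil_comm w u]
  ring

theorem g2Bil_cross_cross_left {v x y : Fin 7 → K} (hx : g2Bil v x = 0) :
    g2Bil (g2Cross v x) (g2Cross v y) = g2Bil v v * g2Bil x y := by
  rw [g2Bil_cross_right, g2Cross_cross_of_orthogonal hx, g2Bil_smul_left]
  ring

theorem g2Tri_cross_mid {v x y z : Fin 7 → K} (hx : g2Bil v x = 0) (hy : g2Bil v y = 0)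
    (hz : g2Bil v z = 0) : g2Tri x (g2Cross v y) z = g2Tri x y (g2Cross v z) := by
  have h := congrArg (fun t => g2Bil t z) (g2Cross_cross_add v x y)
  simp only [sub_eq_add_neg, ← neg_smul, g2Bil_add_left, g2Bil_smul_left, hx, hz, g2Bil_comm y v,
    hy] at h
  have h1 : g2Bil (g2Cross v (g2Cross x y)) z = -g2Tri x y (g2Cross v z) := by
    rw [← g2Bil_cross x y, g2Bil_cross_right, neg_neg]
  rw [h1, g2Bil_cross] at h
  linear_combination h

theorem g2Tri_cross_left {v x y z : Fin 7 → K} (hx : g2Bil v x = 0) (hy : g2Bil v y = 0)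
    (hz : g2Bil v z = 0) : g2Tri (g2Cross v x) y z = g2Tri x y (g2Cross v z) := by
  rw [← g2Tri_rotate, ← g2Tri_cross_mid hy hz hx, g2Tri_rotate x y]

section Perp

variable {v x y z : Fin 7 → K} (hx : g2Bil v x = 0) (hy : g2Bil v y = 0) (hz : g2Bil v z = 0)
include hx hy

theorem g2Tri_cross_self_outer : g2Tri x y (g2Cross v x) = 0 := by
  rw [← g2Tri_cross_mid hx hy hx, g2Tri_self_outer]

theorem g2Tri_cross_self_right : g2Tri x y (g2Cross v y) = 0 := by
  rw [← neg_eq_zero, ← g2Tri_swap, g2Tri_cross_self_outer hy hx]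

theorem g2Tri_cross_self_mid : g2Tri x (g2Cross v x) y = 0 := by
  rw [← neg_eq_zero, ← g2Tri_swap_right, g2Tri_cross_self_outer hx hy]

include hz

theorem g2Tri_cross_right_swap : g2Tri x z (g2Cross v y) = -g2Tri x y (g2Cross v z) := by
  rw [g2Tri_swap_right, g2Tri_cross_mid hx hy hz]

theorem g2Tri_cross_right_rotate : g2Tri y z (g2Cross v x) = g2Tri x y (g2Cross v z) := by
  rw [g2Tri_rotate, g2Tri_cross_left hx hy hz]

theorem g2Tri_cross_mid_right :
    g2Tri x (g2Cross v y) (g2Cross v z) = -g2Bil v v * g2Tri x y z := by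
  rw [g2Tri_cross_mid hx hy (g2Bil_self_cross v z), g2Cross_cross_of_orthogonal hz, g2Tri_smul_right]

theorem g2Tri_cross_left_right :
    g2Tri y (g2Cross v x) (g2Cross v z) = g2Bil v v * g2Tri x y z := by
  rw [g2Tri_cross_mid_right hy hx hz, g2Tri_swap, neg_mul_neg]

theorem g2Tri_cross_left_mid :
    g2Tri z (g2Cross v x) (g2Cross v y) = -g2Bil v v * g2Tri x y z := by
  rw [g2Tri_cross_mid_right hz hx hy, g2Tri_rotate z x y]

theorem g2Tri_cross_all : g2Tri (g2Cross v x) (g2Cross v y) (g2Cross v z) =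
    -g2Bil v v * g2Tri x y (g2Cross v z) := by
  rw [g2Tri_cross_mid_right (g2Bil_self_cross v x) hy hz, g2Tri_cross_left hx hy hz]

end Perp

/-- The vectors `v, u, w, p, v × u, v × w, v × p`. -/
def g2AxisCol (v u w p : Fin 7 → K) : Fin 7 → Fin 7 → K :=
  ![v, u, w, p, g2Cross v u, g2Cross v w, g2Cross v p]

theorem g2Tri_axisCol {v u w p v' u' w' p' : Fin 7 → K}
    (hu : g2Bil v u = 0) (hw : g2Bil v w = 0) (hp : g2Bil v p = 0)
    (hB : ∀ i j, g2Bil (g2AxisCol v' u' w' p' i) (g2AxisCol v' u' w' p' j) =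
      g2Bil (g2AxisCol v u w p i) (g2AxisCol v u w p j))
    (h₀ : g2Tri u' w' p' = g2Tri u w p)
    (h₁ : g2Tri u' w' (g2Cross v' p') = g2Tri u w (g2Cross v p)) (i j l : Fin 7) :
    g2Tri (g2AxisCol v' u' w' p' i) (g2AxisCol v' u' w' p' j) (g2AxisCol v' u' w' p' l) =
      g2Tri (g2AxisCol v u w p i) (g2AxisCol v u w p j) (g2AxisCol v u w p l) := by
  have hq : g2Bil v' v' = g2Bil v v := hB 0 0
  have hu' : g2Bil v' u' = 0 := (hB 0 1).trans hu
  have hw' : g2Bil v' w' = 0 := (hB 0 2).trans hw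
  have hp' : g2Bil v' p' = 0 := (hB 0 3).trans hp
  have hs := fun x : Fin 7 → K => g2Bil_self_cross v x
  have hs' := fun x : Fin 7 → K => g2Bil_self_cross v' x
  have e : ∀ m j : Fin 7,
      g2Tri (g2AxisCol v' u' w' p' 0) (g2AxisCol v' u' w' p' m) (g2AxisCol v' u' w' p' j) =
        g2Tri (g2AxisCol v u w p 0) (g2AxisCol v u w p m) (g2AxisCol v u w p j) := by
    intro m j
    change g2Tri v' _ _ = g2Tri v _ _
    rw [← g2Bil_cross, ← g2Bil_cross]
    have hc : ∀ {x x' : Fin 7 → K} (r : Fin 7), g2Bil v x = 0 → g2Bil v' x' = 0 →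
        g2AxisCol v u w p r = x → g2AxisCol v' u' w' p' r = x' →
        g2Bil (g2Cross v' (g2Cross v' x')) (g2AxisCol v' u' w' p' j) =
          g2Bil (g2Cross v (g2Cross v x)) (g2AxisCol v u w p j) := by
      rintro _ _ r h h' rfl rfl
      rw [g2Cross_cross_of_orthogonal h, g2Cross_cross_of_orthogonal h', g2Bil_smul_left,
        g2Bil_smul_left, hq, hB]
    fin_cases m
    · change g2Bil (g2Cross v' v') _ = g2Bil (g2Cross v v) _
      rw [g2Cross_self, g2Cross_self]
      simp [g2Bil]
    · exact hB 4 j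
    · exact hB 5 j
    · exact hB 6 j
    · exact hc 1 hu hu' rfl rfl
    · exact hc 2 hw hw' rfl rfl
    · exact hc 3 hp hp' rfl rfl
  refine g2Tri_col_ext (E := g2AxisCol v' u' w' p') (E' := g2AxisCol v u w p) (e 1 2) (e 1 3) (e 1 4) (e 1 5) (e 1 6) (e 2 3) (e 2 4) (e 2 5) (e 2 6)
    (e 3 4) (e 3 5) (e 3 6) (e 4 5) (e 4 6) (e 5 6) h₀ ?_ ?_ h₁ ?_ ?_ ?_ ?_ ?_ ?_ ?_ ?_ ?_ ?_ ?_ ?_ ?_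
    ?_ ?_ ?_ i j l
  · exact (g2Tri_cross_self_outer hu' hw').trans (g2Tri_cross_self_outer hu hw).symm
  · exact (g2Tri_cross_self_right hu' hw').trans (g2Tri_cross_self_right hu hw).symm
  · exact (g2Tri_cross_self_outer hu' hp').trans (g2Tri_cross_self_outer hu hp).symm
  · exact (g2Tri_cross_right_swap hu' hw' hp').trans ((congrArg _ h₁).trans
      (g2Tri_cross_right_swap hu hw hp).symm)
  · exact (g2Tri_cross_self_right hu' hp').trans (g2Tri_cross_self_right hu hp).symm
  · exact (g2Tri_cross_self_mid hu' (hs' _)).trans (g2Tri_cross_self_mid hu (hs _)).symm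
  · exact (g2Tri_cross_self_mid hu' (hs' _)).trans (g2Tri_cross_self_mid hu (hs _)).symm
  · exact (g2Tri_cross_mid_right hu' hw' hp').trans (by
      rw [hq, h₀]; exact (g2Tri_cross_mid_right hu hw hp).symm)
  · exact (g2Tri_cross_right_rotate hu' hw' hp').trans (h₁.trans
      (g2Tri_cross_right_rotate hu hw hp).symm)
  · exact (g2Tri_cross_self_outer hw' hp').trans (g2Tri_cross_self_outer hw hp).symm
  · exact (g2Tri_cross_self_right hw' hp').trans (g2Tri_cross_self_right hw hp).symm
  · exact (g2Tri_cross_self_outer hw' (hs' _)).trans (g2Tri_cross_self_outer hw (hs _)).symm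
  · exact (g2Tri_cross_left_right hu' hw' hp').trans (by
      rw [hq, h₀]; exact (g2Tri_cross_left_right hu hw hp).symm)
  · exact (g2Tri_cross_self_mid hw' (hs' _)).trans (g2Tri_cross_self_mid hw (hs _)).symm
  · exact (g2Tri_cross_left_mid hu' hw' hp').trans (by
      rw [hq, h₀]; exact (g2Tri_cross_left_mid hu hw hp).symm)
  · exact (g2Tri_cross_self_outer hp' (hs' _)).trans (g2Tri_cross_self_outer hp (hs _)).symm
  · exact (g2Tri_cross_self_outer hp' (hs' _)).trans (g2Tri_cross_self_outer hp (hs _)).symm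
  · exact (g2Tri_cross_all hu' hw' hp').trans (by
      rw [hq, h₁]; exact (g2Tri_cross_all hu hw hp).symm)

theorem g2Bil_axisCol {v u w : Fin 7 → K} (hu : g2Bil v u = 0) (hw : g2Bil v w = 0)
    (huw : g2Bil u w = 0) (hJ : g2Bil (g2Cross v u) w = 0) {i j : Fin 7} (hij : i ≠ j) :
    g2Bil (g2AxisCol v u w (g2Cross u w) i) (g2AxisCol v u w (g2Cross u w) j) = 0 := by
  have hp : g2Bil v (g2Cross u w) = 0 := by
    rw [g2Bil_comm, g2Bil_cross, ← g2Tri_rotate, ← g2Tri_rotate, ← g2Bil_cross, hJ]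
  have hup : g2Bil u (g2Cross u w) = 0 := g2Bil_self_cross u w
  have hwp : g2Bil w (g2Cross u w) = 0 := by rw [g2Bil_comm, g2Bil_cross_self]
  have a : ∀ x, g2Bil x (g2Cross v x) = 0 := fun x => by rw [g2Bil_comm, g2Bil_cross_self]
  have huJw : g2Bil u (g2Cross v w) = 0 := by rw [g2Bil_cross_right, hJ, neg_zero]
  have hwJu : g2Bil w (g2Cross v u) = 0 := by rw [g2Bil_comm, hJ]
  have hpJu : g2Bil (g2Cross u w) (g2Cross v u) = 0 := by
    rw [g2Bil_cross, g2Tri_cross_self_outer hu hw]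
  have hpJw : g2Bil (g2Cross u w) (g2Cross v w) = 0 := by
    rw [g2Bil_cross, g2Tri_cross_self_right hu hw]
  have huJp : g2Bil u (g2Cross v (g2Cross u w)) = 0 := by
    rw [g2Bil_cross_right, g2Bil_comm, hpJu, neg_zero]
  have hwJp : g2Bil w (g2Cross v (g2Cross u w)) = 0 := by
    rw [g2Bil_cross_right, g2Bil_comm, hpJw, neg_zero]
  have h45 := g2Bil_cross_cross_left (y := w) hu
  have h46 := g2Bil_cross_cross_left (y := g2Cross u w) hu
  have h56 := g2Bil_cross_cross_left (y := g2Cross u w) hw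
  rw [huw, mul_zero] at h45
  rw [hup, mul_zero] at h46
  rw [hwp, mul_zero] at h56
  have key : ∀ i j : Fin 7, i < j →
      g2Bil (g2AxisCol v u w (g2Cross u w) i) (g2AxisCol v u w (g2Cross u w) j) = 0 := by
    intro i j hlt
    fin_cases i <;> fin_cases j <;> first
      | exact absurd hlt (by decide)
      | assumption
      | exact g2Bil_self_cross v _
      | exact a _
  rcases lt_or_gt_of_ne hij with h | h
  · exact key i j h
  · rw [g2Bil_comm]
    exact key j i h

theorem g2Bil_axisCol_self {v u w : Fin 7 → K} (hu : g2Bil v u = 0) (hw : g2Bil v w = 0)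
    (huw : g2Bil u w = 0) (hJ : g2Bil (g2Cross v u) w = 0) (hv0 : g2Bil v v ≠ 0)
    (hu0 : g2Bil u u ≠ 0) (hw0 : g2Bil w w ≠ 0) (i : Fin 7) :
    g2Bil (g2AxisCol v u w (g2Cross u w) i) (g2AxisCol v u w (g2Cross u w) i) ≠ 0 := by
  have hp : g2Bil v (g2Cross u w) = 0 := by
    rw [g2Bil_comm, g2Bil_cross, ← g2Tri_rotate, ← g2Tri_rotate, ← g2Bil_cross, hJ]
  have hp0 : g2Bil (g2Cross u w) (g2Cross u w) ≠ 0 := by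
    rw [g2Bil_cross_cross, huw, zero_pow two_ne_zero, sub_zero]
    exact mul_ne_zero hu0 hw0
  have key : ∀ {x : Fin 7 → K}, g2Bil v x = 0 → g2Bil x x ≠ 0 →
      g2Bil (g2Cross v x) (g2Cross v x) ≠ 0 := fun hx hx0 => by
    rw [g2Bil_cross_cross_left hx]
    exact mul_ne_zero hv0 hx0
  fin_cases i
  exacts [hv0, hu0, hw0, hp0, key hu hu0, key hw hw0, key hp hp0]

end G2Orthogonal

section G2Nonsplit

open Matrix Module

variable {K : Type*} [Field K]

namespace IsG2Axis

variable {D D' : End K (Fin 7 → K)} {v v' : Fin 7 → K} {a q : K} (h : IsG2Axis D v a q)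
  (h' : IsG2Axis D' v' a q)
include h h'

theorem exists_isometry_map_axis (hq : q ≠ 0) {σ : End K (Fin 7 → K)}
    (hσ : ∀ x y, g2Bil (σ x) (σ y) = g2Bil x y) (hσD : ∀ x, D' (σ x) = σ (D x)) :
    ∃ σ : End K (Fin 7 → K), (∀ x y, g2Bil (σ x) (σ y) = g2Bil x y) ∧
      (∀ x, D' (σ x) = σ (D x)) ∧ σ v = v' := by
  have h0 : D' (σ v) = 0 := by rw [hσD, h.map_axis, map_zero]
  have h1 : g2Cross v' (σ v) = 0 := by
    have := h'.cube (σ v)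
    rw [h0, map_zero, map_zero, smul_zero, zero_add] at this
    exact this.symm
  obtain ⟨c, hc⟩ : ∃ c : K, σ v = c • v' := by
    have h3 := g2Cross_cross v' (σ v)
    have h4 : g2Cross v' (0 : Fin 7 → K) = 0 := map_zero (g2Ad v')
    rw [h1, h4, h'.norm, eq_comm, sub_eq_zero] at h3
    refine ⟨q⁻¹ * g2Bil (σ v) v', ?_⟩
    rw [mul_smul, h3, smul_smul, inv_mul_cancel₀ hq, one_smul]
  have hcc : c * c = 1 := by
    have h3 := hσ v v
    rw [hc, g2Bil_smul_left, g2Bil_smul_right, h.norm, h'.norm, ← mul_assoc] at h3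
    exact mul_right_cancel₀ hq (h3.trans (one_mul q).symm)
  refine ⟨c • σ, fun x y => ?_, fun x => ?_, ?_⟩
  · rw [LinearMap.smul_apply, LinearMap.smul_apply, g2Bil_smul_left, g2Bil_smul_right, hσ,
      ← mul_assoc, hcc, one_mul]
  · rw [LinearMap.smul_apply, LinearMap.smul_apply, map_smul, hσD]
  · rw [LinearMap.smul_apply, hc, smul_smul, hcc, one_smul]

theorem map_cross_of_isometry {σ : End K (Fin 7 → K)} (hσD : ∀ x, D' (σ x) = σ (D x))
    (x : Fin 7 → K) : σ (g2Cross v x) = g2Cross v' (σ x) := by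
  have h1 := congrArg σ (h.cube x)
  rw [← hσD, ← hσD, ← hσD, h'.cube, map_add, map_smul, hσD, add_right_inj] at h1
  exact h1.symm

/-- An isometry which commutes with `D` can be multiplied by an element of norm one of the
quadratic algebra generated by `v × ·`. -/
theorem exists_twist (hq : q ≠ 0) {σ : End K (Fin 7 → K)}
    (hσ : ∀ x y, g2Bil (σ x) (σ y) = g2Bil x y) (hσD : ∀ x, D' (σ x) = σ (D x)) (hσv : σ v = v')
    {α β : K} (hαβ : α ^ 2 + q * β ^ 2 = 1) :
    ∃ τ : End K (Fin 7 → K), (∀ x y, g2Bil (τ x) (τ y) = g2Bil x y) ∧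
      (∀ x, D' (τ x) = τ (D x)) ∧ τ v = v' ∧
      ∀ x, g2Bil v x = 0 → τ x = α • σ x + β • g2Cross v' (σ x) := by
  have hvx : ∀ x, g2Bil v' (σ x) = g2Bil v x := fun x => by rw [← hσv, hσ]
  refine ⟨α • σ + β • (g2Ad v' ∘ₗ σ) + (q⁻¹ * (1 - α)) • (g2BilForm K v).smulRight v',
    fun x y => ?_, fun x => ?_, ?_, fun x hx => ?_⟩
  · have e1 : g2Bil (g2Cross v' (σ x)) (g2Cross v' (σ y)) =
        q * g2Bil x y - g2Bil v x * g2Bil v y := by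
      rw [g2Bil_cross_right, g2Cross_cross, h'.norm, sub_eq_add_neg, ← neg_smul, g2Bil_add_left,
        g2Bil_smul_left, g2Bil_smul_left, hσ, g2Bil_comm (σ x), hvx, hvx]
      ring
    have e2 := g2Bil_cross_right v' (σ x) (σ y)
    have e3 : g2Bil (g2Cross v' (σ x)) v' = 0 := by rw [g2Bil_comm, g2Bil_self_cross]
    have e4 := g2Bil_self_cross v' (σ y)
    change g2Bil (α • σ x + β • g2Cross v' (σ x) + (q⁻¹ * (1 - α)) • g2Bil v x • v')
      (α • σ y + β • g2Cross v' (σ y) + (q⁻¹ * (1 - α)) • g2Bil v y • v') = g2Bil x y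
    simp only [g2Bil_add_left, g2Bil_add_right, g2Bil_smul_left, g2Bil_smul_right, e1, e2, e3, e4,
      hσ, hvx, g2Bil_comm (σ x) v', h'.norm]
    field_simp
    linear_combination (q * g2Bil x y - g2Bil v x * g2Bil v y) * hαβ
  · change D' (α • σ x + β • g2Cross v' (σ x) + (q⁻¹ * (1 - α)) • g2Bil v x • v') =
      α • σ (D x) + β • g2Cross v' (σ (D x)) + (q⁻¹ * (1 - α)) • g2Bil v (D x) • v'
    have e1 : g2Bil v (D x) = 0 := by
      rw [← neg_eq_zero, ← h.skew, h.map_axis]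
      simp [g2Bil]
    rw [map_add, map_add, map_smul, map_smul, map_smul, map_smul, h'.map_axis, h'.map_cross_axis,
      hσD, e1, smul_zero, zero_smul]
  · change α • σ v + β • g2Cross v' (σ v) + (q⁻¹ * (1 - α)) • g2Bil v v • v' = v'
    rw [hσv, g2Cross_self, h.norm, smul_zero, add_zero, smul_smul, mul_right_comm,
      inv_mul_cancel₀ hq, one_mul, ← add_smul, add_sub_cancel, one_smul]
  · change α • σ x + β • g2Cross v' (σ x) + (q⁻¹ * (1 - α)) • g2Bil v x • v' = _
    rw [hx, zero_smul, smul_zero, add_zero]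

end IsG2Axis

/-- The cubic form on triples of multiples of `x, y, z` by an element of the quadratic algebra. -/
theorem g2Tri_twist {v x y z : Fin 7 → K} (hx : g2Bil v x = 0) (hy : g2Bil v y = 0)
    (hz : g2Bil v z = 0) (α β : K) :
    g2Tri (α • x + β • g2Cross v x) (α • y + β • g2Cross v y) (α • z + β • g2Cross v z) =
      (α ^ 3 - 3 * g2Bil v v * α * β ^ 2) * g2Tri x y z +
        (3 * α ^ 2 * β - g2Bil v v * β ^ 3) * g2Tri x y (g2Cross v z) := by
  have e1 : g2Tri (g2Cross v x) y (g2Cross v z) = -g2Bil v v * g2Tri x y z := by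
    rw [g2Tri_swap, g2Tri_cross_left_right hx hy hz, neg_mul]
  have e2 : g2Tri (g2Cross v x) (g2Cross v y) z = -g2Bil v v * g2Tri x y z := by
    rw [g2Tri_rotate z, g2Tri_cross_left_mid hx hy hz]
  simp only [g2Tri_add_left, g2Tri_add_mid, g2Tri_add_right, g2Tri_smul_left, g2Tri_smul_mid,
    g2Tri_smul_right, g2Tri_cross_left hx hy hz, g2Tri_cross_mid hx hy hz, e1, e2,
    g2Tri_cross_mid_right hx hy hz, g2Tri_cross_all hx hy hz]
  ring

/-- If `u × w` goes to a multiple of the image of `u × w`, the isometry can be corrected. -/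
theorem IsG2Axis.exists_tri_isometry (h2 : (2 : K) ≠ 0) {D D' : End K (Fin 7 → K)}
    {v v' : Fin 7 → K} {a q : K} (h : IsG2Axis D v a q) (h' : IsG2Axis D' v' a q) (hq : q ≠ 0)
    (hroot : ∀ α β : K, α ^ 2 + q * β ^ 2 = 1 → ∃ a b : K, a ^ 2 + q * b ^ 2 = 1 ∧
      a ^ 3 - 3 * q * a * b ^ 2 = α ∧ 3 * a ^ 2 * b - q * b ^ 3 = β)
    {σ : End K (Fin 7 → K)} (hσ : ∀ x y, g2Bil (σ x) (σ y) = g2Bil x y)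
    (hσD : ∀ x, D' (σ x) = σ (D x)) :
    ∃ τ : End K (Fin 7 → K), (∀ x y, g2Bil (τ x) (τ y) = g2Bil x y) ∧
      (∀ x, D' (τ x) = τ (D x)) ∧ ∀ x y z, g2Tri (τ x) (τ y) (τ z) = g2Tri x y z := by
  obtain ⟨σ, hσ, hσD, hσv⟩ := h.exists_isometry_map_axis h' hq hσ hσD
  have hvv : g2Bil v v ≠ 0 := by rwa [h.norm]
  obtain ⟨u, hu, hu0⟩ := exists_g2Bil_orthogonal h2 (by norm_num : 1 < 7) (c := ![v])
    (fun i j hij => absurd (Subsingleton.elim i j) hij) (fun i => by fin_cases i; exact hvv)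
  replace hu : g2Bil v u = 0 := hu 0
  have hJu : g2Bil (g2Cross v u) (g2Cross v u) ≠ 0 := by
    rw [g2Bil_cross_cross_left hu]
    exact mul_ne_zero hvv hu0
  obtain ⟨w, hw3, hw0⟩ := exists_g2Bil_orthogonal h2 (by norm_num : 3 < 7) (c := ![v, u, g2Cross v u])
    (fun i j hij => by
      have e1 := g2Bil_self_cross v u
      have e2 := g2Bil_cross_self v u
      fin_cases i <;> fin_cases j <;> first
        | exact absurd rfl hij
        | assumption
        | exact (g2Bil_comm _ _).trans ‹_›)
    (fun i => by fin_cases i; exacts [hvv, hu0, hJu])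
  have hw : g2Bil v w = 0 := hw3 0
  have huw : g2Bil u w = 0 := hw3 1
  have hJuw : g2Bil (g2Cross v u) w = 0 := hw3 2
  set p := g2Cross u w with hpdef
  have hp : g2Bil v p = 0 := g2Bil_axisCol hu hw huw hJuw (by decide : (0 : Fin 7) ≠ 3)
  obtain ⟨N, hN⟩ : ∃ N, N = g2Bil p p := ⟨_, rfl⟩
  have hN0 : N ≠ 0 := hN ▸ g2Bil_axisCol_self hu hw huw hJuw hvv hu0 hw0 3
  have hcol : ∀ τ : End K (Fin 7 → K), (∀ x, D' (τ x) = τ (D x)) → τ v = v' → ∀ i,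
      τ (g2AxisCol v u w p i) = g2AxisCol v' (τ u) (τ w) (τ p) i := fun τ hτ hτv i => by
    have := h.map_cross_of_isometry h' hτ
    fin_cases i
    exacts [hτv, rfl, rfl, rfl, this _, this _, this _]
  have hcolB : ∀ τ : End K (Fin 7 → K), (∀ x y, g2Bil (τ x) (τ y) = g2Bil x y) →
      (∀ x, D' (τ x) = τ (D x)) → τ v = v' → ∀ i j,
      g2Bil (g2AxisCol v' (τ u) (τ w) (τ p) i) (g2AxisCol v' (τ u) (τ w) (τ p) j) =
        g2Bil (g2AxisCol v u w p i) (g2AxisCol v u w p j) := fun τ hτ hτD hτv i j => by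
    rw [← hcol τ hτD hτv, ← hcol τ hτD hτv, hτ]
  have hB := hcolB σ hσ hσD hσv
  have hu' : g2Bil v' (σ u) = 0 := (hB 0 1).trans hu
  have hw' : g2Bil v' (σ w) = 0 := (hB 0 2).trans hw
  have hp' : g2Bil v' (σ p) = 0 := (hB 0 3).trans hp
  obtain ⟨α, hα⟩ : ∃ α, g2Tri (σ u) (σ w) (σ p) = α * N :=
    ⟨_, (div_mul_cancel₀ _ hN0).symm⟩
  obtain ⟨β, hβ⟩ : ∃ β, g2Tri (σ u) (σ w) (g2Cross v' (σ p)) = β * (q * N) :=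
    ⟨_, (div_mul_cancel₀ _ (mul_ne_zero hq hN0)).symm⟩
  have hpp : g2Bil (σ p) (σ p) = N := by rw [hσ, hN]
  have hJpp : g2Bil (g2Cross v' (σ p)) (g2Cross v' (σ p)) = q * N := by
    rw [g2Bil_cross_cross_left hp', h'.norm, hpp]
  have hcross : g2Cross (σ u) (σ w) = α • σ p + β • g2Cross v' (σ p) := by
    refine eq_of_g2Bil_orthogonal (c := g2AxisCol v' (σ u) (σ w) (σ p))
      (fun i j hij => (hB i j).trans (g2Bil_axisCol hu hw huw hJuw hij))
      (fun i => (hB i i).trans_ne (g2Bil_axisCol_self hu hw huw hJuw hvv hu0 hw0 i)) fun i => ?_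
    have e3 : ∀ i, 3 ≠ i → g2Bil (σ p) (g2AxisCol v' (σ u) (σ w) (σ p) i) = 0 := fun i hi =>
      (hB 3 i).trans (g2Bil_axisCol hu hw huw hJuw hi)
    have e6 : ∀ i, 6 ≠ i → g2Bil (g2Cross v' (σ p)) (g2AxisCol v' (σ u) (σ w) (σ p) i) = 0 :=
      fun i hi => (hB 6 i).trans (g2Bil_axisCol hu hw huw hJuw hi)
    rw [g2Bil_cross, g2Bil_add_left, g2Bil_smul_left, g2Bil_smul_left]
    by_cases hi3 : 3 = i
    · subst hi3
      rw [e6 3 (by decide), mul_zero, add_zero]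
      exact hα.trans (by rw [← hpp]; rfl)
    by_cases hi6 : 6 = i
    · subst hi6
      rw [e3 6 (by decide), mul_zero, zero_add]
      exact hβ.trans (by rw [← hJpp]; rfl)
    rw [e3 i hi3, e6 i hi6, mul_zero, mul_zero, add_zero]
    fin_cases i
    · change g2Tri (σ u) (σ w) v' = 0
      rw [← g2Tri_rotate, ← g2Tri_rotate, ← g2Bil_cross]
      exact (hB 4 2).trans hJuw
    · exact g2Tri_self_outer _ _
    · exact g2Tri_self_right _ _
    · exact absurd rfl hi3
    · exact g2Tri_cross_self_outer hu' hw'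
    · exact g2Tri_cross_self_right hu' hw'
    · exact absurd rfl hi6
  have hαβ : α ^ 2 + q * β ^ 2 = 1 := by
    have e1 : g2Bil (g2Cross (σ u) (σ w)) (g2Cross (σ u) (σ w)) = N := by
      rw [g2Bil_cross_cross, hσ, hσ, hσ, hN, hpdef, g2Bil_cross_cross]
    have e2 : g2Bil (g2Cross v' (σ p)) (σ p) = 0 := g2Bil_cross_self _ _
    rw [hcross, g2Bil_add_left, g2Bil_add_right, g2Bil_add_right] at e1
    simp only [g2Bil_smul_left, g2Bil_smul_right, hpp, hJpp, e2, g2Bil_comm (σ p) (g2Cross v' (σ p))]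
      at e1
    refine mul_right_cancel₀ hN0 ?_
    linear_combination e1
  obtain ⟨b, c, hbc, hbα, hcβ⟩ := hroot α β hαβ
  obtain ⟨τ, hτ, hτD, hτv, hτσ⟩ := h.exists_twist h' hq hσ hσD hσv hbc
  refine ⟨τ, hτ, hτD, ?_⟩
  have htri : ∀ i j l, g2Tri (g2AxisCol v' (τ u) (τ w) (τ p) i) (g2AxisCol v' (τ u) (τ w) (τ p) j)
      (g2AxisCol v' (τ u) (τ w) (τ p) l) = g2Tri (g2AxisCol v u w p i) (g2AxisCol v u w p j)
        (g2AxisCol v u w p l) := by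
    refine g2Tri_axisCol hu hw hp (hcolB τ hτ hτD hτv) ?_ ?_
    · have : g2Tri u w p = N := by rw [← g2Bil_cross, hN]
      rw [hτσ u hu, hτσ w hw, hτσ p hp, g2Tri_twist hu' hw' hp', h'.norm, hα, hβ, this, hbα, hcβ]
      linear_combination N * hαβ
    · have e1 : g2Tri u w (g2Cross v p) = 0 := by
        rw [← g2Bil_cross, ← hpdef, g2Bil_comm, g2Bil_cross_self]
      have e2 : g2Cross v' (b • σ p + c • g2Cross v' (σ p)) =
          b • g2Cross v' (σ p) + c • g2Cross v' (g2Cross v' (σ p)) := by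
        rw [g2Cross_add, g2Cross_smul, g2Cross_smul]
      rw [e1, hτσ u hu, hτσ w hw, hτσ p hp, e2,
        g2Tri_twist hu' hw' (g2Bil_self_cross v' _), g2Cross_cross_of_orthogonal hp',
        g2Tri_smul_right, h'.norm, hα, hβ, hbα, hcβ]
      ring
  have hli : LinearIndependent K (g2AxisCol v u w p) := linearIndependent_of_g2Bil
    (fun i j => g2Bil_axisCol hu hw huw hJuw) (g2Bil_axisCol_self hu hw huw hJuw hvv hu0 hw0)
  have hT : (tensorMultilinear g2Tensor K).compLinearMap (fun _ => τ) =
      tensorMultilinear g2Tensor K := by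
    refine Basis.ext_multilinear
      (fun _ => basisOfLinearIndependentOfCardEqFinrank hli (by simp)) fun s => ?_
    simp only [MultilinearMap.compLinearMap_apply, tensorMultilinear_apply, tensorForm_g2,
      coe_basisOfLinearIndependentOfCardEqFinrank, hcol τ hτD hτv, htri]
  intro x y z
  have := congrArg (fun f => f ![x, y, z]) hT
  simp only [MultilinearMap.compLinearMap_apply, tensorMultilinear_apply, tensorForm_g2] at this
  exact this

theorem exists_preserves_of_tri_isometry {γ γ' : Matrix (Fin 7) (Fin 7) K}
    (h : ∃ τ : End K (Fin 7 → K), (∀ x y, g2Bil (τ x) (τ y) = g2Bil x y) ∧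
      (∀ x, Matrix.toLin' γ' (τ x) = τ (Matrix.toLin' γ x)) ∧
      ∀ x y z, g2Tri (τ x) (τ y) (τ z) = g2Tri x y z) :
    ∃ A : Matrix (Fin 7) (Fin 7) K, A.det ≠ 0 ∧ Preserves g2Tensor A ∧ γ' * A = A * γ := by
  obtain ⟨τ, h1, h2, h3⟩ := h
  refine ⟨LinearMap.toMatrix' τ, ?_, ?_, ?_⟩
  · rw [← isUnit_iff_ne_zero, ← Matrix.isUnit_iff_isUnit_det, ← Matrix.mulVec_injective_iff_isUnit]
    intro x y hxy
    simp only [LinearMap.toMatrix'_mulVec] at hxy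
    refine sub_eq_zero.1 (exists_g2Bil_ne_zero fun i => ?_)
    rw [← h1, map_sub, hxy, sub_self]
    simp [g2Bil]
  · rw [preserves_g2_iff]
    simpa only [LinearMap.toMatrix'_mulVec] using h3
  · apply Matrix.toLin'.injective
    rw [Matrix.toLin'_mul, Matrix.toLin'_mul, Matrix.toLin'_toMatrix']
    exact LinearMap.ext h2

end G2Nonsplit

section G2Description

open Polynomial Matrix Module

variable {k : Type*} [Field k]

theorem three_ne_zero_FF (h3 : (3 : k) ≠ 0) : (3 : FF k) ≠ 0 := by
  have h := isUnit_natCast_OO (k := k) (n := 3) (by exact_mod_cast h3)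
  have := (h.map (algebraMap (OO k) (FF k))).ne_zero
  rwa [map_natCast, Nat.cast_ofNat] at this

/-- Over `F`, elements of the Lie algebra of `G₂` with the same regular semisimple characteristic
polynomial are conjugate. -/
theorem g2_exists_conj [IsAlgClosed k] (h2 : (2 : k) ≠ 0) (h3 : (3 : k) ≠ 0) {a q : FF k}
    (hq : q ≠ 0) (hsep : (X * g2Cubic a q).Separable) {γ γ' : Matrix (Fin 7) (Fin 7) (FF k)}
    (hγ : γ ∈ tensorLie g2Tensor (FF k)) (hγ' : γ' ∈ tensorLie g2Tensor (FF k))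
    (hc : γ.charpoly = X * g2Sextic a q) (hc' : γ'.charpoly = X * g2Sextic a q) :
    ∃ A : Matrix (Fin 7) (Fin 7) (FF k), A.det ≠ 0 ∧ Preserves g2Tensor A ∧ γ' * A = A * γ := by
  have h2F := two_ne_zero_FF h2
  have h3F := three_ne_zero_FF h3
  have hs := separable_expand_two h2F hsep
  rw [expand_g2Cubic] at hs
  obtain ⟨v, hv⟩ := exists_isG2Axis h2F h3F hγ hs hc
  obtain ⟨v', hv'⟩ := exists_isG2Axis h2F h3F hγ' hs hc'
  by_cases hsq : ∃ s, q = -s ^ 2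
  · obtain ⟨s, hs'⟩ := hsq
    have hs0 : s ≠ 0 := by
      rintro rfl
      exact hq (by rw [hs']; ring)
    obtain ⟨x, hx, hT⟩ := hv.exists_tri_eq_two h2 h3 hs0 hs' hs
      (by rw [Matrix.charpoly_toLin', hc])
    obtain ⟨x', hx', hT'⟩ := hv'.exists_tri_eq_two h2 h3 hs0 hs' hs
      (by rw [Matrix.charpoly_toLin', hc'])
    exact hv.exists_conj_of_split h2F hv' hs0 hs' hx hT hx' hT'
  · push Not at hsq
    have hp : SkewPair (g2BilForm (FF k)) (Matrix.toLin' γ') (Matrix.toLin' γ) (g2Cubic a q) 1 :=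
      { two_ne_zero := h2F
        nondeg := g2BilForm_nondegenerate
        sign := ⟨1, one_ne_zero, fun x y => by
          rw [g2BilForm_apply, g2BilForm_apply, g2Bil_comm, one_mul]⟩
        skew := hv'.skew
        skew' := hv.skew
        monic := g2Cubic_monic a q
        separable := hsep
        charpoly := by rw [Matrix.charpoly_toLin', hc', expand_g2Cubic, pow_one]
        charpoly' := by rw [Matrix.charpoly_toLin', hc, expand_g2Cubic, pow_one] }
    obtain ⟨σ, hσ, hσD⟩ := hp.exists_isometry_of_symm (by norm_num) ⟨fun x y => g2Bil_comm _ _⟩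
      fun c => exists_dvd_sq_sub h2 c hsep
    exact exists_preserves_of_tri_isometry
      (hv.exists_tri_isometry h2F hv' hq (fun α β => exists_norm_one_cube_root h2 h3 hsq) hσ hσD)

theorem g2Regular.soOddRegular {e q : OO k} (h : g2Regular e q) : soOddRegular (g2Coeffs e q) := by
  obtain ⟨t, h0, h1, ht, ht0⟩ := h
  refine ⟨t, h1, fun i j hij => ⟨ht i j hij, fun hs => ?_⟩, ht0⟩
  fin_cases i <;> fin_cases j <;> simp only [Fin.mk_one, Fin.zero_eta, Fin.reduceFinMk] at hij hs
  · exact hij rfl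
  · exact ht0 2 (by linear_combination h0 - hs)
  · exact ht0 1 (by linear_combination h0 - hs)
  · exact ht0 2 (by linear_combination h0 - hs)
  · exact hij rfl
  · exact ht0 0 (by linear_combination h0 - hs)
  · exact ht0 1 (by linear_combination h0 - hs)
  · exact ht0 0 (by linear_combination h0 - hs)
  · exact hij rfl

theorem polyFF_halfPoly_g2Coeffs (h2 : (2 : k) ≠ 0) {e q a : OO k} (ha : 2 * a = e) :
    polyFF (halfPoly (g2Coeffs e q)) =
      g2Cubic (algebraMap (OO k) (FF k) a) (algebraMap (OO k) (FF k) q) := by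
  have h4 : (4⁻¹ : k) • e ^ 2 = a ^ 2 := by
    have h4 : (4 : k) ≠ 0 := by
      rw [show (4 : k) = 2 * 2 by norm_num]
      exact mul_ne_zero h2 h2
    have : e ^ 2 = (4 : k) • a ^ 2 := by
      rw [← ha, mul_pow, PowerSeries.smul_eq_C_mul, map_ofNat]
      norm_num
    rw [this, smul_smul, inv_mul_cancel₀ h4, one_smul]
  have h : halfPoly (g2Coeffs e q) = X * (X - C a) ^ 2 + C q := by
    rw [halfPoly, Fin.sum_univ_three, g2Coeffs, h4, ← ha]
    simp [show (C (2 : OO k) : (OO k)[X]) = 2 from map_ofNat C 2]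
    ring
  rw [h, g2Cubic]
  simp

theorem g2_latticeDescription_of_regular (h2 : (2 : k) ≠ 0) (h3 : (3 : k) ≠ 0) (e q : OO k)
    (h : g2Regular e q) :
    LatticeDescription g2Tensor (g2Chi e q) (toGeneric (G2Alg e q)) (AdjoinRoot.root _)
      (baseLattice (G2Alg e q)) (g2Form e q) := by
  obtain ⟨t, ht⟩ := isUnit_two_OO h2
  obtain ⟨a, ha⟩ : ∃ a, 2 * a = e := ⟨↑t⁻¹ * e, by rw [← mul_assoc, ← ht, Units.mul_inv, one_mul]⟩
  have hsep := h.soOddRegular.separable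
  have hcub := polyFF_halfPoly_g2Coeffs h2 (q := q) ha
  rw [hcub] at hsep
  have hq : algebraMap (OO k) (FF k) q ≠ 0 := by
    intro h0
    obtain ⟨A, B, hAB⟩ := hsep.isCoprime
    have := congrArg (eval 0) hAB
    simp [g2Cubic, h0] at this
  have hc : polyFF (oddPoly (g2Coeffs e q)) =
      X * g2Sextic (algebraMap (OO k) (FF k) a) (algebraMap (OO k) (FF k) q) := by
    rw [← expand_g2Cubic, ← hcub, polyFF_expand, expand_halfPoly, oddPoly, polyFF,
      Polynomial.map_mul, Polynomial.map_X]
  refine g2_latticeDescription h2 (fun h0 => hq (by rw [h0, map_zero])) fun _ γ hγ γ' hγ' h1 h1' =>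
    g2_exists_conj h2 h3 hq hsep hγ hγ' (h1.trans hc) (h1'.trans hc)

end G2Description

end Springer

end

theorem mainTheorem6 {k : Type*} [Field k] (h2 : (2 : k) ≠ 0) :
    (∀ (n : ℕ) (a : Fin n → Springer.OO k), Springer.spRegular a →
      Springer.LatticeDescription (Springer.spTensor n) (Springer.spChi a)
        (Springer.toGeneric (Springer.SpAlg a)) (AdjoinRoot.root _)
        (Springer.baseLattice (Springer.SpAlg a)) (Springer.spForm a)) ∧
    (∀ (n : ℕ) (a : Fin n → Springer.OO k), Springer.soOddRegular a →
      Springer.LatticeDescription (Springer.soOddTensor n) (Springer.soOddChi a)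
        (Springer.toGeneric (Springer.SOOddAlg a)) (AdjoinRoot.root _)
        (Springer.baseLattice (Springer.SOOddAlg a)) (Springer.soOddForm a)) ∧
    (∀ (m : ℕ) (a : Fin m → Springer.OO k) (p : Springer.OO k), Springer.soEvenRegular a p →
      Springer.LatticeDescription (Springer.soEvenTensor m) (Springer.soEvenChi a p)
        ((Springer.toGeneric (Springer.SOEvenNormAlg a p)).comp (Springer.soEvenToNorm a p))
        (AdjoinRoot.root _)
        (Springer.baseLattice (Springer.SOEvenNormAlg a p)) (Springer.soEvenForm a p)) ∧
    ((3 : k) ≠ 0 → ∀ e q : Springer.OO k, Springer.g2Regular e q →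
      Springer.LatticeDescription Springer.g2Tensor (Springer.g2Chi e q)
        (Springer.toGeneric (Springer.G2Alg e q)) (AdjoinRoot.root _)
        (Springer.baseLattice (Springer.G2Alg e q)) (Springer.g2Form e q)) := by
  exact ⟨fun _ => Springer.sp_latticeDescription_of_regular h2,
    fun _ => Springer.soOdd_latticeDescription_of_regular h2,
    fun _ => Springer.soEven_latticeDescription_of_regular h2, fun h3 => Springer.g2_latticeDescription_of_regular h2 h3⟩
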